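/- **Theorem 3.6.** Let $m\ge 0$ and consider the Schwarzschild spacetime (Minkowski spacetime if $m=0$) in the region $r>2m$, with metric $$g_{\rm Sch}=-\Big(1-\frac{2m}{r}\Big)dt^2+\Big(1-\frac{2m}{r}\Big)^{-1}dr^2+r^2\sigma ,$$ where $\sigma$ is the standard metric of the unit sphere $\mathbb S^2$. Put $r_*=r+2m\log\left|\frac r{2m}-1\right|$ ($r_*=r$ if $m=0$), $s=1/r$ and $\bar v=t-r_*$. Let $s_0>0$ with $2ms_0\le 1$, and let $P=P(\mathbf y,s)$ be a function on $\mathbb S^2\times[0,s_0)$ which is smooth up to $s=0$. Let $\Sigma$ be the surface $\bar v=-P(\mathbf y,s)$, $\mathbf y\in\mathbb S^2$, $0<s<s_0$; that is, the graph $t=u$ with $u=r_*-P$. Suppose that 1. $\Sigma$ is spacelike and its mean curvature (one third of the trace of the second fundamental form) with respect to the future directed unit normal is constant and equal to $1$; 2. $P(\cdot,0)$ is a linear combination of the first four eigenfunctions of the Laplacian of $(\mathbb S^2,\sigma)$, i.e. $P(\cdot,0)=f_0+f_1$ with smooth $f_0,f_1$ such that $\Delta f_0=0$ and $\Delta f_1=-2f_1$.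 Then $\Sigma$ with its induced metric is asymptotically hyperbolic in the sense of Chruściel–Herzlich, that is: a neighbourhood of the end $s\to0$ of $\Sigma$ is diffeomorphic, with infinity corresponding to infinity, to $\{\rho>R\}$ for some $R>0$ in hyperbolic space $\mathbb H^3$ with metric $\mathfrak b=d\rho^2+\sinh^2\!\rho\,\sigma$, such that the transported metric $g$ satisfies the following. * There is $\tau>\frac32$ such that for every smooth orthonormal frame $f_1,f_2$ on a geodesic ball of radius $2$ in $\mathbb S^2$, with $\varepsilon_0=\partial_\rho$, $\varepsilon_\alpha=\frac1{\sinh\rho}f_\alpha$ ($\alpha=1,2$) and $g_{ij}=g(\varepsilon_i,\varepsilon_j)$, one has for all $0\le i,j,k,l\le 2$, as $\rho\to\infty$ and uniformly over the concentric geodesic ball of radius $1$, $$|g_{ij}-\delta_{ij}|=O(e^{-\tau\rho}),\qquad |\varepsilon_k(g_{ij})|=O(e^{-\tau\rho}),\qquad |\varepsilon_k(\varepsilon_l(g_{ij}))|=O(e^{-\tau\rho}).$$ * The scalar curvature $\mathcal S$ of $g$ satisfies $\mathcal S+6\in L^1(e^\rho\,dv_{\mathfrak b})$ near infinity, where $dv_{\mathfrak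 b}$ is the volume element of $\mathfrak b$. -/

import Mathlib

open scoped ContDiff Manifold Matrix InnerProductSpace

noncomputable section

namespace SchwarzschildCMC

/-- Coordinate space `ℝⁿ`. -/
abbrev E (n : ℕ) := EuclideanSpace ℝ (Fin n)

/-- The standard unit sphere `𝕊²` in `ℝ³`, with Mathlib's smooth structure. -/
abbrev S2 := Metric.sphere (0 : E 3) 1

/-! ### Semi-Riemannian geometry in a coordinate chart -/

/-- The partial derivative `∂_i f`. -/
def partialD {n : ℕ} (i : Fin n) (f : E n → ℝ) (x : E n) : ℝ :=
  fderiv ℝ f x (EuclideanSpace.single i 1)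

/-- Christoffel symbols `Γ^k_{ij}` of the Levi-Civita connection of the metric `g_{ij}`. -/
def christoffel {n : ℕ} (g : E n → Matrix (Fin n) (Fin n) ℝ) (k i j : Fin n) (x : E n) : ℝ :=
  (1 / 2) * ∑ l, (g x)⁻¹ k l *
    (partialD i (fun y => g y j l) x + partialD j (fun y => g y i l) x
      - partialD l (fun y => g y i j) x)

/-- Ricci tensor
`R_{ij} = ∂_k Γ^k_{ij} - ∂_j Γ^k_{ik} + Γ^k_{kl} Γ^l_{ij} - Γ^k_{jl} Γ^l_{ik}`. -/
def ricci {n : ℕ} (g : E n → Matrix (Fin n) (Fin n) ℝ) (i j : Fin n) (x : E n) : ℝ :=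
  ∑ k, (partialD k (christoffel g k i j) x - partialD j (christoffel g k i k) x
    + ∑ l, (christoffel g k k l x * christoffel g l i j x
      - christoffel g k j l x * christoffel g l i k x))

/-- Scalar curvature `g^{ij} R_{ij}`. -/
def scalarCurvature {n : ℕ} (g : E n → Matrix (Fin n) (Fin n) ℝ) (x : E n) : ℝ :=
  ∑ i, ∑ j, (g x)⁻¹ i j * ricci g i j x

/-- The metric induced on a parametrized hypersurface `X` by the ambient metric `g`. -/
def inducedMetric {n : ℕ} (g : E (n + 1) → Matrix (Fin (n + 1)) (Fin (n + 1)) ℝ)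
    (X : E n → E (n + 1)) (x : E n) : Matrix (Fin n) (Fin n) ℝ :=
  Matrix.of fun i j => ∑ a, ∑ b, g (X x) a b *
    partialD i (fun y => X y a) x * partialD j (fun y => X y b) x

/-- The second fundamental form of a parametrized hypersurface `X` with unit normal field `N`,
`A(∂_i, ∂_j) = g(∇_{∂_i} N, ∂_j) = - g(N, ∇_{∂_i} ∂_j)`. -/
def secondFundamentalForm {n : ℕ} (g : E (n + 1) → Matrix (Fin (n + 1)) (Fin (n + 1)) ℝ)
    (X N : E n → E (n + 1)) (x : E n) : Matrix (Fin n) (Fin n) ℝ :=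
  Matrix.of fun i j => -∑ a, ∑ b, g (X x) a b * N x a *
    (partialD i (partialD j (fun y => X y b)) x
      + ∑ c, ∑ d, christoffel g b c d (X x) *
          partialD i (fun y => X y c) x * partialD j (fun y => X y d) x)

/-- The mean curvature, normalized as `1 / n` times the trace of the second fundamental form. -/
def meanCurvature {n : ℕ} (g : E (n + 1) → Matrix (Fin (n + 1)) (Fin (n + 1)) ℝ)
    (X N : E n → E (n + 1)) (x : E n) : ℝ :=
  (1 / (n : ℝ)) * ∑ i, ∑ j, (inducedMetric g X x)⁻¹ i j * secondFundamentalForm g X N x i j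

/-! ### The Schwarzschild spacetime and spacelike graphs near future null infinity -/

/-- The spatial part `x` of a spacetime point `(t, x)`; the coordinate with index `0` is `t`. -/
def spatial (p : E 4) : E 3 := !₂[p 1, p 2, p 3]

/-- The covector `dt`. -/
def dt (a : Fin 4) : ℝ := if a = 0 then 1 else 0

/-- The covector `dr` at `p = (t, x)`, where `r = |x|`. -/
def dr (p : E 4) (a : Fin 4) : ℝ := if a = 0 then 0 else p a / ‖spatial p‖

/-- The Schwarzschild metric `-h dt² + h⁻¹ dr² + r² σ`, `h = 1 - 2m/r`, in the coordinates
`(t, x)`, where `r² σ = |dx|² - dr²` (to be used in the region `r > 2m`). -/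
def schwarzschild (m : ℝ) (p : E 4) : Matrix (Fin 4) (Fin 4) ℝ :=
  Matrix.of fun a b =>
    -(1 - 2 * m / ‖spatial p‖) * (dt a * dt b)
      + (1 - 2 * m / ‖spatial p‖)⁻¹ * (dr p a * dr p b)
      + ((if a = b then 1 else 0) - dt a * dt b - dr p a * dr p b)

/-- The tortoise coordinate `r_* = r + 2m log |r/(2m) - 1|`; it equals `r` for `m = 0`. -/
def tortoise (m r : ℝ) : ℝ := r + 2 * m * Real.log |r / (2 * m) - 1|

/-- The direction `x / |x| ∈ 𝕊²` of `x ≠ 0` (an arbitrary point for `x = 0`). -/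
def direction (x : E 3) : S2 :=
  if h : x = 0 then ⟨EuclideanSpace.single 0 1, by simp⟩
  else ⟨‖x‖⁻¹ • x, by simp [norm_smul, h]⟩

/-- The function `u = r_* - P`, where `P = P(y, s)` with `y = x / |x|` and `s = 1 / r`. Thus
`t = u` is the surface `v̄ = -P`, with the retarded null coordinate `v̄ = t - r_*`. -/
def heightFunction (m : ℝ) (P : S2 × ℝ → ℝ) (x : E 3) : ℝ :=
  tortoise m ‖x‖ - P (direction x, ‖x‖⁻¹)

/-- The parametrization `x ↦ (u(x), x)` of the graph `t = u(x)`. -/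
def graphMap (u : E 3 → ℝ) (x : E 3) : E 4 := !₂[u x, x 0, x 1, x 2]

/-- The components of the covector `dF`, `F = u - t`, along the graph of `u`. -/
def graphCovector (u : E 3 → ℝ) (x : E 3) (b : Fin 4) : ℝ :=
  partialD b (fun p : E 4 => u (spatial p) - p 0) (graphMap u x)

/-- The future directed unit normal of a spacelike graph `t = u(x)`: the vector
`L^{-1/2} ∇F`, where `F = u - t` and `L = -⟨∇F, ∇F⟩`. -/
def futureUnitNormal (g : E 4 → Matrix (Fin 4) (Fin 4) ℝ) (u : E 3 → ℝ) (x : E 3) : E 4 :=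
  WithLp.toLp 2 fun a =>
    (Real.sqrt (-∑ c, ∑ d, (g (graphMap u x))⁻¹ c d * graphCovector u x c * graphCovector u x d))⁻¹
      * ∑ b, (g (graphMap u x))⁻¹ a b * graphCovector u x b

/-- The metric of the surface `t = r_* - P`, in the coordinates `x`. -/
def surfaceMetric (m : ℝ) (P : S2 × ℝ → ℝ) : E 3 → Matrix (Fin 3) (Fin 3) ℝ :=
  inducedMetric (schwarzschild m) (graphMap (heightFunction m P))

/-- The mean curvature of the surface `t = r_* - P` with respect to the future directed unit
normal. -/
def surfaceMeanCurvature (m : ℝ) (P : S2 × ℝ → ℝ) : E 3 → ℝ :=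
  meanCurvature (schwarzschild m) (graphMap (heightFunction m P))
    (futureUnitNormal (schwarzschild m) (heightFunction m P))

/-! ### The Laplacian of the sphere -/

/-- The Laplace-Beltrami operator of `𝕊²`: the Euclidean Laplacian of the extension which is
homogeneous of degree zero, restricted to `𝕊²`. -/
def sphereLaplacian (f : S2 → ℝ) (y : S2) : ℝ :=
  Laplacian.laplacian (fun x : E 3 => f (direction x)) (y : E 3)

/-- `f` is smooth with `-Δ f = lam f` on `𝕊²` (the zero function is allowed). -/
def InSphereEigenspace (lam : ℝ) (f : S2 → ℝ) : Prop :=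
  ContMDiff (𝓡 2) 𝓘(ℝ, ℝ) ∞ f ∧ ∀ y, -sphereLaplacian f y = lam * f y

/-- `f` is a linear combination of the first four eigenfunctions of the Laplacian of `𝕊²`. The
eigenvalues of `-Δ` are `ℓ (ℓ + 1)` with multiplicity `2 ℓ + 1`, so the first four eigenfunctions
span the sum of the eigenspaces of `0` (dimension one) and of `2` (dimension three). -/
def IsCombFirstFourEigenfunctions (f : S2 → ℝ) : Prop :=
  ∃ f₀ f₁ : S2 → ℝ, InSphereEigenspace 0 f₀ ∧ InSphereEigenspace 2 f₁ ∧ ∀ y, f y = f₀ y + f₁ y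

/-! ### Asymptotically hyperbolic metrics -/

/-- The open geodesic ball of radius `a` in `𝕊²` (geodesic distance is the angle). -/
def geodesicBall (p : S2) (a : ℝ) : Set S2 :=
  {y | InnerProductGeometry.angle (y : E 3) (p : E 3) < a}

/-- `f₁, f₂` is a smooth orthonormal frame of `T𝕊²` on `U`; tangent vectors of `𝕊²` at `y` are
the vectors of `ℝ³` orthogonal to `y`. -/
structure IsOrthonormalFrameOn (f : Fin 2 → S2 → E 3) (U : Set S2) : Prop where
  smooth : ∀ α, ContMDiffOn (𝓡 2) 𝓘(ℝ, E 3) ∞ (f α) U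
  tangent : ∀ α, ∀ y ∈ U, ⟪f α y, (y : E 3)⟫_ℝ = 0
  orthonormal : ∀ y ∈ U, Orthonormal ℝ (fun α => f α y)

/-- The frame `ε₀ = ∂_ρ`, `ε_α = (sinh ρ)⁻¹ f_α` of hyperbolic space
`ℍ³ = (ℝ³, dρ² + sinh² ρ σ)`, in the coordinates `z = ρ y`, `y ∈ 𝕊²`. A tangent vector `w` of
`𝕊²` at `y` is the vector `ρ w` at the point `ρ y`. -/
def hyperbolicFrame (f : Fin 2 → S2 → E 3) : Fin 3 → E 3 → E 3 :=
  Fin.cons (fun z => (direction z : E 3))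
    (fun α z => (‖z‖ / Real.sinh ‖z‖) • f α (direction z))

/-- The derivative `V(φ)` of a function along a vector field. -/
def alongField (V : E 3 → E 3) (φ : E 3 → ℝ) (z : E 3) : ℝ := fderiv ℝ φ z (V z)

/-- The value `(Φ^* G)(v, w)` at `z` of the pulled back metric. -/
def pullbackForm (G : E 3 → Matrix (Fin 3) (Fin 3) ℝ) (Φ : E 3 → E 3) (z v w : E 3) : ℝ :=
  ∑ i, ∑ j, G (Φ z) i j * (fderiv ℝ Φ z v) i * (fderiv ℝ Φ z w) j

/-- The density `(sinh ρ / ρ)²` of the volume measure `sinh² ρ dρ dσ` of `ℍ³` with respect to the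
Lebesgue measure `ρ² dρ dσ` in the coordinates `z = ρ y`. -/
def hyperbolicDensity (z : E 3) : ℝ := (Real.sinh ‖z‖ / ‖z‖) ^ 2

/-- The Riemannian metric `G` on the exterior region `Ω` of `ℝ³` is asymptotically hyperbolic
in the sense of Chruściel and Herzlich: some neighbourhood of infinity of `Ω` is
diffeomorphic to the complement `{ρ > R}` of a closed ball in `ℍ³` in such a way that

* with `g` the transported metric, and uniformly on the geodesic balls of radius one when the
  frame is smooth and orthonormal on the concentric ball of radius two, the components
  `g_{ij} = g(ε_i, ε_j)` satisfy `g_{ij} - δ_{ij}`, `ε_k(g_{ij})`, `ε_k(ε_l(g_{ij})) = O(e^{-τρ})`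
  for some `τ > 3/2`;
* `𝒮 + 6` is integrable near infinity with respect to `e^ρ` times the hyperbolic volume, where
  `𝒮` is the scalar curvature. -/
def IsAsymptoticallyHyperbolic (Ω : Set (E 3)) (G : E 3 → Matrix (Fin 3) (Fin 3) ℝ) : Prop :=
  (∀ i j, ContDiffOn ℝ ∞ (fun x => G x i j) Ω) ∧ (∀ x ∈ Ω, (G x).PosDef) ∧
  ∃ (R : ℝ) (Φ : OpenPartialHomeomorph (E 3) (E 3)),
    0 < R ∧ Φ.source = {z | R < ‖z‖} ∧ Φ.target ⊆ Ω ∧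
    ContDiffOn ℝ ∞ Φ Φ.source ∧ ContDiffOn ℝ ∞ Φ.symm Φ.target ∧
    Filter.Tendsto Φ (Bornology.cobounded (E 3)) (Bornology.cobounded (E 3)) ∧
    (∀ᶠ x in Bornology.cobounded (E 3), x ∈ Φ.target) ∧
    (∃ τ : ℝ, 3 / 2 < τ ∧
      ∀ (p : S2) (f : Fin 2 → S2 → E 3), IsOrthonormalFrameOn f (geodesicBall p 2) →
        ∃ C R₁ : ℝ, ∀ z : E 3, R₁ < ‖z‖ → direction z ∈ geodesicBall p 1 →
          ∀ i j k l : Fin 3,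
            let ε := hyperbolicFrame f
            let gij : E 3 → ℝ := fun w => pullbackForm G Φ w (ε i w) (ε j w)
            |gij z - (if i = j then 1 else 0)| ≤ C * Real.exp (-τ * ‖z‖) ∧
            |alongField (ε k) gij z| ≤ C * Real.exp (-τ * ‖z‖) ∧
            |alongField (ε k) (alongField (ε l) gij) z| ≤ C * Real.exp (-τ * ‖z‖)) ∧
    MeasureTheory.IntegrableOn
      (fun z => (scalarCurvature G (Φ z) + 6) * Real.exp ‖z‖ * hyperbolicDensity z)
      {z | R < ‖z‖} MeasureTheory.volume

end SchwarzschildCMC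

end

open SchwarzschildCMC

/-!
The retarded time `v̄ = t - r_*` turns the Schwarzschild metric into Kerr-Schild form: with
`τ = v̄ + r` it is `-dτ² + |dx|² + (2m/r) (dτ - dr)²`, and the surface is the graph of `W = r - Q`,
where `Q x = P (x / |x|, 1 / |x|)`. Its induced metric is
`δ_{ij} - ∂_i W ∂_j W + (2m/r) ∂_i Q ∂_j Q`, and its unit normal has the spatial part `L^{-1/2} n`,
with `L = 1 - |∇W|² + (2m/r) (∂_r Q)²` and `n = ∇W + (2m/r) (∂_r Q) ∇r`. The mean curvature is one
if and only if `div (L^{-1/2} n) = 3`.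

The comparison surfaces are the unit hyperboloids `W = √(1 + |x - ξ|²)` of Minkowski space, which
have the induced metric of hyperbolic space. As eigenfunctions of the sphere with eigenvalues `0`
and `2` are restrictions of affine functions (`exists_affine_of_isComb`), the boundary values of `P`
are those of a hyperboloid up to a constant `c`, so that
`Q = r - √(1 + |x - ξ|²) + c + D` with `D = O(1/r)`. Functions of `x / |x|` and `s = 1 / r` which are
smooth up to `s = 0` are symbols, that is, each derivative gains one order of decay (`IsSymbol`), and
`D` has an expansion `D = q₁ / r + q₂ / r² + O(r⁻³)` with coefficients on the sphere.

The heart of the argument is `IsComparison.isSymbol_three`: `q₁ = q₂ = 0`. The leading term of the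
mean curvature equation is `q₁ (1 - 2 q₁)² = 0`, so that `q₁` is the constant `0` or `1/2`. The root
`1/2` is spurious. It belongs to `L = O(r⁻³)`, for which the vector field `L^{-1/2} n` grows faster
than linearly in the radial direction; this contradicts the divergence theorem, the divergence
being `3`. Once `q₁ = 0`, the next term of the equation is linear and gives `q₂ = 0`.

With `D = O(r⁻³)` the second fundamental form is close to umbilic. The Gauss equation in the Ricci
flat Schwarzschild spacetime expresses `𝒮 + 6` as a quadratic expression in the deviation, which
gives `𝒮 + 6 = O(r⁻⁴)` (`IsComparison.exists_scalarCurvature_bound`). In the coordinates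
`x = ξ + sinh ρ y` the frame of hyperbolic space becomes a frame with symbol components, in which the
induced metric is `δ_{ij}` plus a symbol of order `-2` (`IsComparison.isSymbol_frameMetric`). As `r`
is comparable to `exp ρ`, this is the decay of the metric with `τ = 2`, and `𝒮 + 6 = O(exp (-4 ρ))`
is integrable with respect to `exp ρ` times the volume, which grows like `exp (2 ρ)`.
-/

namespace SchwarzschildCMC

open Set Filter Topology

/-! ### Symbol classes near infinity -/

/-- `φ` is a symbol of order `-k` on `U`: it is smooth on `U`, and its derivatives of order `n` are
`O(|x| ^ (-k - n))` there. -/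
def IsSymbol (U : Set (E 3)) (k : ℤ) (φ : E 3 → ℝ) : Prop :=
  ContDiffOn ℝ ∞ φ U ∧
    ∀ n : ℕ, ∃ C, ∀ x ∈ U, ‖iteratedFDeriv ℝ n φ x‖ ≤ C * ‖x‖ ^ (-(k + n))

/-- The sets on which symbols are considered: open sets outside of the unit ball. -/
def IsExterior (U : Set (E 3)) : Prop := IsOpen U ∧ ∀ x ∈ U, 1 ≤ ‖x‖

theorem IsExterior.norm_pos {U : Set (E 3)} (hU : IsExterior U) {x : E 3} (hx : x ∈ U) :
    0 < ‖x‖ := zero_lt_one.trans_le (hU.2 x hx)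

theorem IsExterior.ne_zero {U : Set (E 3)} (hU : IsExterior U) {x : E 3} (hx : x ∈ U) :
    x ≠ 0 := norm_pos_iff.1 (hU.norm_pos hx)

theorem isExterior_norm_gt {R : ℝ} (hR : 1 ≤ R) : IsExterior {x : E 3 | R < ‖x‖} :=
  ⟨isOpen_lt continuous_const continuous_norm, fun _ hx => hR.trans (le_of_lt hx)⟩

namespace IsSymbol

variable {U V : Set (E 3)} {k l : ℤ} {φ ψ : E 3 → ℝ}

theorem contDiffAt (h : IsSymbol U k φ) (hU : IsExterior U) {x : E 3} (hx : x ∈ U) :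
    ContDiffAt ℝ ∞ φ x := h.1.contDiffAt (hU.1.mem_nhds hx)

theorem differentiableAt (h : IsSymbol U k φ) (hU : IsExterior U) {x : E 3} (hx : x ∈ U) :
    DifferentiableAt ℝ φ x := (h.contDiffAt hU hx).differentiableAt (by simp)

theorem congr (h : IsSymbol U k φ) (hU : IsExterior U) (he : ∀ x ∈ U, ψ x = φ x) :
    IsSymbol U k ψ := by
  refine ⟨h.1.congr he, fun n => ?_⟩
  obtain ⟨C, hC⟩ := h.2 n
  refine ⟨C, fun x hx => ?_⟩
  have : ψ =ᶠ[𝓝 x] φ := Filter.eventuallyEq_of_mem (hU.1.mem_nhds hx) he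
  rw [(this.iteratedFDeriv ℝ n).eq_of_nhds]
  exact hC x hx

theorem bound_pos (h : IsSymbol U k φ) (hU : IsExterior U) (n : ℕ) :
    ∃ C, 0 < C ∧ ∀ x ∈ U, ‖iteratedFDeriv ℝ n φ x‖ ≤ C * ‖x‖ ^ (-(k + n)) := by
  obtain ⟨C, hC⟩ := h.2 n
  refine ⟨max C 1, by positivity, fun x hx => (hC x hx).trans ?_⟩
  have := hU.norm_pos hx
  gcongr
  exact le_max_left _ _

theorem bound (h : IsSymbol U k φ) (hU : IsExterior U) :
    ∃ C, 0 < C ∧ ∀ x ∈ U, |φ x| ≤ C * ‖x‖ ^ (-k) := by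
  obtain ⟨C, hC0, hC⟩ := h.bound_pos hU 0
  exact ⟨C, hC0, fun x hx => by simpa using hC x hx⟩

theorem of_le (h : IsSymbol U k φ) (hU : IsExterior U) (hl : l ≤ k) : IsSymbol U l φ := by
  refine ⟨h.1, fun n => ?_⟩
  obtain ⟨C, hC0, hC⟩ := h.bound_pos hU n
  refine ⟨C, fun x hx => (hC x hx).trans ?_⟩
  have := hU.2 x hx
  gcongr

theorem const (U : Set (E 3)) (c : ℝ) : IsSymbol U 0 (fun _ => c) := by
  refine ⟨contDiffOn_const, fun n => ?_⟩
  rcases n with _ | n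
  · exact ⟨|c|, fun x _ => by simp⟩
  · refine ⟨0, fun x _ => ?_⟩
    rw [iteratedFDeriv_const_of_ne (by simp)]
    simp

theorem add (hφ : IsSymbol U k φ) (hψ : IsSymbol U k ψ) (hU : IsExterior U) :
    IsSymbol U k (fun x => φ x + ψ x) := by
  refine ⟨hφ.1.add hψ.1, fun n => ?_⟩
  obtain ⟨C, hC⟩ := hφ.2 n
  obtain ⟨D, hD⟩ := hψ.2 n
  refine ⟨C + D, fun x hx => ?_⟩
  have h1 : ContDiffAt ℝ n φ x := (hφ.contDiffAt hU hx).of_le (mod_cast le_top)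
  have h2 : ContDiffAt ℝ n ψ x := (hψ.contDiffAt hU hx).of_le (mod_cast le_top)
  have := iteratedFDeriv_add_apply h1 h2
  have h3 : (fun x => φ x + ψ x) = φ + ψ := rfl
  rw [h3, this, add_mul]
  exact (norm_add_le _ _).trans (add_le_add (hC x hx) (hD x hx))

theorem mul (hφ : IsSymbol U k φ) (hψ : IsSymbol U l ψ) (hU : IsExterior U) :
    IsSymbol U (k + l) (fun x => φ x * ψ x) := by
  refine ⟨hφ.1.mul hψ.1, fun n => ?_⟩
  choose C hC0 hC using hφ.bound_pos hU
  choose D hD0 hD using hψ.bound_pos hU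
  refine ⟨∑ i ∈ Finset.range (n + 1), (n.choose i : ℝ) * C i * D (n - i), fun x hx => ?_⟩
  have h := norm_iteratedFDerivWithin_mul_le hφ.1 hψ.1 hU.1.uniqueDiffOn hx (n := n)
    (by exact_mod_cast le_top)
  rw [iteratedFDerivWithin_of_isOpen n hU.1 hx] at h
  refine h.trans ?_
  rw [Finset.sum_mul]
  refine Finset.sum_le_sum fun i hi => ?_
  rw [iteratedFDerivWithin_of_isOpen i hU.1 hx, iteratedFDerivWithin_of_isOpen (n - i) hU.1 hx]
  have hxp := hU.norm_pos hx
  have hin : i ≤ n := Nat.lt_succ_iff.1 (Finset.mem_range.1 hi)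
  have e : ‖x‖ ^ (-(k + l + n)) = ‖x‖ ^ (-(k + i)) * ‖x‖ ^ (-(l + (n - i : ℕ))) := by
    rw [← zpow_add₀ hxp.ne']
    congr 1
    push_cast [hin]
    ring
  rw [e]
  calc _ ≤ (n.choose i : ℝ) * (C i * ‖x‖ ^ (-(k + i)))
        * (D (n - i) * ‖x‖ ^ (-(l + (n - i : ℕ)))) := by
        gcongr
        · exact mul_nonneg (Nat.cast_nonneg _) (by have := hC0 i; positivity)
        · exact hC i x hx
        · exact hD (n - i) x hx
    _ = _ := by ring

theorem const_mul (hφ : IsSymbol U k φ) (hU : IsExterior U) (c : ℝ) :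
    IsSymbol U k (fun x => c * φ x) := by
  simpa using (const U c).mul hφ hU

theorem neg (hφ : IsSymbol U k φ) (hU : IsExterior U) : IsSymbol U k (fun x => -φ x) := by
  simpa using hφ.const_mul hU (-1)

theorem sub (hφ : IsSymbol U k φ) (hψ : IsSymbol U k ψ) (hU : IsExterior U) :
    IsSymbol U k (fun x => φ x - ψ x) := by
  simpa [sub_eq_add_neg] using hφ.add (hψ.neg hU) hU

theorem sum {ι : Type*} {s : Finset ι} {φ : ι → E 3 → ℝ} (hU : IsExterior U)
    (h : ∀ i ∈ s, IsSymbol U k (φ i)) : IsSymbol U k (fun x => ∑ i ∈ s, φ i x) := by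
  classical
  induction s using Finset.induction_on with
  | empty =>
    simp only [Finset.sum_empty]
    refine ⟨contDiffOn_const, fun n => ⟨0, fun x _ => ?_⟩⟩
    have : iteratedFDeriv ℝ n (fun _ : E 3 => (0 : ℝ)) = 0 := iteratedFDeriv_fun_zero
    rw [this]; simp
  | insert a s ha ih =>
    simp only [Finset.sum_insert ha]
    exact (h a (Finset.mem_insert_self _ _)).add
      (ih fun i hi => h i (Finset.mem_insert_of_mem hi)) hU

theorem partialD (hφ : IsSymbol U k φ) (hU : IsExterior U) (i : Fin 3) :
    IsSymbol U (k + 1) (partialD i φ) := by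
  have h1 : ContDiffOn ℝ ∞ (fderiv ℝ φ) U :=
    hφ.1.fderiv_of_isOpen hU.1 (by simp)
  refine ⟨h1.clm_apply contDiffOn_const, fun n => ?_⟩
  obtain ⟨C, hC⟩ := hφ.2 (n + 1)
  refine ⟨C, fun x hx => ?_⟩
  have h2 : ContDiffAt ℝ n (fderiv ℝ φ) x :=
    (h1.contDiffAt (hU.1.mem_nhds hx)).of_le (mod_cast le_top)
  have h3 := norm_iteratedFDeriv_clm_apply_const (c := (EuclideanSpace.single i 1 : E 3)) h2
    (n := n) le_rfl
  have h4 : ‖(EuclideanSpace.single i 1 : E 3)‖ = 1 := by simp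
  rw [h4, one_mul, norm_iteratedFDeriv_fderiv] at h3
  refine h3.trans ((hC x hx).trans_eq ?_)
  congr 2
  push_cast
  ring

end IsSymbol

/-- Symbol estimates by scaling: if after rescaling by `‖X‖` the function near `X` is given by a
function smooth on an open set `O` near a point in a fixed compact subset of `O`, then it is a
symbol. -/
theorem isSymbol_of_scaling {U : Set (E 3)} (hU : IsExterior U) {k : ℤ} {φ : E 3 → ℝ}
    {G : E 3 × ℝ → ℝ} {O K : Set (E 3 × ℝ)} (hO : IsOpen O) (hG : ContDiffOn ℝ ∞ G O)
    (hK : IsCompact K) (hKO : K ⊆ O)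
    (hmem : ∀ X ∈ U, (‖X‖⁻¹ • X, √(‖X‖⁻¹)) ∈ K)
    (heq : ∀ X ∈ U, ∀ᶠ X' in 𝓝 X, φ X' = ‖X‖ ^ (-k) * G (‖X‖⁻¹ • X', √(‖X‖⁻¹))) :
    IsSymbol U k φ := by
  -- the affine map which rescales by `‖X‖`
  let A : E 3 → E 3 →L[ℝ] E 3 × ℝ := fun X => ‖X‖⁻¹ • ContinuousLinearMap.inl ℝ (E 3) ℝ
  let b : E 3 → E 3 × ℝ := fun X => (0, √(‖X‖⁻¹))
  have hA : ∀ X X', A X X' + b X = (‖X‖⁻¹ • X', √(‖X‖⁻¹)) := by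
    intro X X'; simp [A, b]
  have hAn : ∀ X, ‖A X‖ ≤ ‖X‖⁻¹ := by
    intro X
    refine (norm_smul_le (‖X‖⁻¹) (ContinuousLinearMap.inl ℝ (E 3) ℝ)).trans ?_
    rw [norm_inv, norm_norm]
    exact mul_le_of_le_one_right (by positivity) (ContinuousLinearMap.norm_inl_le_one ℝ _ _)
  have key : ∀ X ∈ U, ContDiffAt ℝ ∞ φ X ∧ ∀ n : ℕ, ‖iteratedFDeriv ℝ n φ X‖ ≤
      ‖iteratedFDeriv ℝ n G (‖X‖⁻¹ • X, √(‖X‖⁻¹))‖ * ‖X‖ ^ (-(k + n)) := by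
    intro X hX
    have hXp := hU.norm_pos hX
    let G1 : E 3 × ℝ → ℝ := fun p => G (p + b X)
    let O1 : Set (E 3 × ℝ) := (fun p => p + b X) ⁻¹' O
    have hO1 : IsOpen O1 := hO.preimage (by fun_prop)
    have hG1 : ContDiffOn ℝ ∞ G1 O1 := hG.comp (by fun_prop) (fun p hp => hp)
    have hXO : A X X ∈ O1 := by
      change A X X + b X ∈ O
      rw [hA]; exact hKO (hmem X hX)
    have hpre : IsOpen (A X ⁻¹' O1) := hO1.preimage (A X).continuous
    have he : φ =ᶠ[𝓝 X] (‖X‖ ^ (-k)) • (G1 ∘ A X) := by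
      filter_upwards [heq X hX] with X' h'
      simp only [h', Pi.smul_apply, Function.comp, G1, hA, smul_eq_mul]
    have hcd : ContDiffAt ℝ ∞ (G1 ∘ A X) X :=
      (hG1.contDiffAt (hO1.mem_nhds hXO)).comp X (A X).contDiff.contDiffAt
    refine ⟨(hcd.const_smul (‖X‖ ^ (-k))).congr_of_eventuallyEq he, fun n => ?_⟩
    rw [(he.iteratedFDeriv ℝ n).eq_of_nhds,
      iteratedFDeriv_const_smul_apply (hcd.of_le (mod_cast le_top)), norm_smul]
    have h1 := (A X).iteratedFDerivWithin_comp_right hG1 hO1.uniqueDiffOn hpre.uniqueDiffOn hXO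
      (i := n) (by exact_mod_cast le_top)
    rw [iteratedFDerivWithin_of_isOpen n hpre hXO, iteratedFDerivWithin_of_isOpen n hO1 hXO] at h1
    rw [h1]
    have h2 : iteratedFDeriv ℝ n G1 (A X X) = iteratedFDeriv ℝ n G (‖X‖⁻¹ • X, √(‖X‖⁻¹)) := by
      rw [← hA X X]
      exact iteratedFDeriv_comp_add_right n (b X) (A X X)
    have h3 := ContinuousMultilinearMap.norm_compContinuousLinearMap_le
      (iteratedFDeriv ℝ n G1 (A X X)) (fun _ : Fin n => A X)
    rw [Finset.prod_const, Finset.card_univ, Fintype.card_fin] at h3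
    have h4 : ‖A X‖ ^ n ≤ ‖X‖⁻¹ ^ n := pow_le_pow_left₀ (norm_nonneg _) (hAn X) n
    rw [← h2]
    have e : ‖X‖ ^ (-(k + n)) = ‖X‖ ^ (-k) * ‖X‖⁻¹ ^ n := by
      rw [neg_add, zpow_add₀ hXp.ne', zpow_neg _ (n : ℤ), zpow_natCast, inv_pow]
    have e2 : ‖‖X‖ ^ (-k)‖ = ‖X‖ ^ (-k) := by
      rw [Real.norm_of_nonneg]; positivity
    rw [e, e2]
    calc _ ≤ ‖X‖ ^ (-k) * (‖iteratedFDeriv ℝ n G1 (A X X)‖ * ‖X‖⁻¹ ^ n) := by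
          gcongr
          exact h3.trans (by gcongr)
      _ = _ := by ring
  refine ⟨fun X hX => (key X hX).1.contDiffWithinAt, fun n => ?_⟩
  have hcont : ContinuousOn (fun p => ‖iteratedFDeriv ℝ n G p‖) K := by
    have h1 : ContinuousOn (iteratedFDerivWithin ℝ n G O) O :=
      hG.continuousOn_iteratedFDerivWithin (by exact_mod_cast le_top) hO.uniqueDiffOn
    refine ((h1.congr fun p hp => ?_).mono hKO).norm
    exact (iteratedFDerivWithin_of_isOpen n hO hp).symm
  obtain ⟨C, hC⟩ := hK.bddAbove_image hcont
  refine ⟨C, fun X hX => ((key X hX).2 n).trans ?_⟩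
  have := hU.norm_pos hX
  gcongr
  exact hC ⟨_, hmem X hX, rfl⟩

/-- The compact set of rescaled points. -/
theorem isCompact_sphere_prod_Icc :
    IsCompact (Metric.sphere (0 : E 3) 1 ×ˢ Icc (0 : ℝ) 1) :=
  (isCompact_sphere 0 1).prod isCompact_Icc

theorem IsExterior.rescaled_mem {U : Set (E 3)} (hU : IsExterior U) {X : E 3} (hX : X ∈ U) :
    (‖X‖⁻¹ • X, √(‖X‖⁻¹)) ∈ Metric.sphere (0 : E 3) 1 ×ˢ Icc (0 : ℝ) 1 := by
  have h := hU.norm_pos hX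
  refine ⟨by simp [norm_smul, h.ne'], Real.sqrt_nonneg _, ?_⟩
  rw [← Real.sqrt_one]
  exact Real.sqrt_le_sqrt (inv_le_one_of_one_le₀ (hU.2 X hX))

theorem isOpen_fst_ne_zero : IsOpen {p : E 3 × ℝ | p.1 ≠ 0} :=
  isOpen_ne.preimage continuous_fst

theorem contDiffOn_inv_norm_fst :
    ContDiffOn ℝ ∞ (fun p : E 3 × ℝ => ‖p.1‖⁻¹) {p | p.1 ≠ 0} :=
  ContDiffOn.inv (contDiffOn_fst.norm ℝ fun _ hp => hp) fun _ hp => norm_ne_zero_iff.2 hp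

/-- A function `F(x / |x|, |x| ^ (-1/2))` with `F` smooth is a symbol of order zero. -/
theorem isSymbol_of_smooth {U : Set (E 3)} (hU : IsExterior U) {F : E 3 × ℝ → ℝ}
    (hF : ContDiffOn ℝ ∞ F {p | p.1 ≠ 0}) {φ : E 3 → ℝ}
    (hφ : ∀ x ∈ U, φ x = F (‖x‖⁻¹ • x, √(‖x‖⁻¹))) : IsSymbol U 0 φ := by
  refine isSymbol_of_scaling hU (K := Metric.sphere (0 : E 3) 1 ×ˢ Icc (0 : ℝ) 1)
    (G := fun p => F (‖p.1‖⁻¹ • p.1, p.2 * √(‖p.1‖⁻¹))) isOpen_fst_ne_zero ?_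
    isCompact_sphere_prod_Icc ?_ (fun X hX => hU.rescaled_mem hX) ?_
  · have h1 := contDiffOn_inv_norm_fst
    have h2 : ContDiffOn ℝ ∞ (fun p : E 3 × ℝ => √(‖p.1‖⁻¹)) {p | p.1 ≠ 0} :=
      h1.sqrt fun p hp => inv_ne_zero (norm_ne_zero_iff.2 hp)
    refine hF.comp ((h1.smul contDiffOn_fst).prodMk (contDiffOn_snd.mul h2)) ?_
    intro p hp
    exact smul_ne_zero (inv_ne_zero (norm_ne_zero_iff.2 hp)) hp
  · rintro p ⟨hp, -⟩ h
    simp [h] at hp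
  · intro X hX
    have h0 := hU.norm_pos hX
    filter_upwards [hU.1.mem_nhds hX] with X' hX'
    have h0' := hU.norm_pos hX'
    have e1 : ‖‖X‖⁻¹ • X'‖⁻¹ = ‖X‖ * ‖X'‖⁻¹ := by
      rw [norm_smul, norm_inv, norm_norm, mul_inv, inv_inv]
    rw [hφ X' hX', e1, smul_smul, Real.sqrt_mul h0.le, ← mul_assoc,
      ← Real.sqrt_mul (inv_nonneg.2 h0.le), inv_mul_cancel₀ h0.ne', mul_right_comm,
      mul_inv_cancel₀ h0.ne']
    simp

theorem isSymbol_inv_norm {U : Set (E 3)} (hU : IsExterior U) : IsSymbol U 1 (fun x => ‖x‖⁻¹) := by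
  refine isSymbol_of_scaling hU isOpen_fst_ne_zero contDiffOn_inv_norm_fst
    isCompact_sphere_prod_Icc ?_ (fun X hX => hU.rescaled_mem hX) ?_
  · rintro p ⟨hp, -⟩ h
    simp [h] at hp
  · intro X hX
    have h0 := hU.norm_pos hX
    refine Eventually.of_forall fun X' => ?_
    rw [norm_smul, norm_inv, norm_norm, mul_inv, inv_inv, zpow_neg_one, ← mul_assoc,
      inv_mul_cancel₀ h0.ne', one_mul]

theorem isSymbol_norm {U : Set (E 3)} (hU : IsExterior U) : IsSymbol U (-1) (fun x => ‖x‖) := by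
  refine isSymbol_of_scaling hU (G := fun p => ‖p.1‖) isOpen_fst_ne_zero
    (contDiffOn_fst.norm ℝ fun _ hp => hp)
    isCompact_sphere_prod_Icc ?_ (fun X hX => hU.rescaled_mem hX) ?_
  · rintro p ⟨hp, -⟩ h
    simp [h] at hp
  · intro X hX
    have h0 := hU.norm_pos hX
    refine Eventually.of_forall fun X' => ?_
    rw [norm_smul, norm_inv, norm_norm, neg_neg, zpow_one, ← mul_assoc,
      mul_inv_cancel₀ h0.ne', one_mul]

theorem isSymbol_coord {U : Set (E 3)} (hU : IsExterior U) (i : Fin 3) :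
    IsSymbol U (-1) (fun x => x i) := by
  refine isSymbol_of_scaling hU (G := fun p => p.1 i) isOpen_fst_ne_zero
    (by fun_prop) isCompact_sphere_prod_Icc ?_ (fun X hX => hU.rescaled_mem hX) ?_
  · rintro p ⟨hp, -⟩ h
    simp [h] at hp
  · intro X hX
    have h0 := hU.norm_pos hX
    refine Eventually.of_forall fun X' => ?_
    simp only [neg_neg, zpow_one, PiLp.smul_apply, smul_eq_mul]
    rw [← mul_assoc, mul_inv_cancel₀ h0.ne', one_mul]

/-- Symbol classes are invariant under translations. -/
theorem IsSymbol.translate {U V : Set (E 3)} {k : ℤ} {φ : E 3 → ℝ} (h : IsSymbol U k φ)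
    (hU : IsExterior U) (hV : IsExterior V) (ξ : E 3) (hVU : ∀ x ∈ V, x + ξ ∈ U)
    (hξ : ∀ x ∈ V, 2 * ‖ξ‖ ≤ ‖x‖) : IsSymbol V k (fun x => φ (x + ξ)) := by
  refine ⟨h.1.comp (by fun_prop) hVU, fun n => ?_⟩
  obtain ⟨C, hC0, hC⟩ := h.bound_pos hU n
  refine ⟨C * 2 ^ |k + n|, fun x hx => ?_⟩
  rw [iteratedFDeriv_comp_add_right]
  refine (hC _ (hVU x hx)).trans ?_
  rw [mul_assoc]
  gcongr
  have hx0 := hV.norm_pos hx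
  have hy0 := hU.norm_pos (hVU x hx)
  have h1 : ‖x‖ ≤ 2 * ‖x + ξ‖ := by
    have := norm_sub_le (x + ξ) ξ
    rw [add_sub_cancel_right] at this
    linarith [hξ x hx]
  have h2 : ‖x + ξ‖ ≤ 2 * ‖x‖ := by
    have := norm_add_le x ξ
    linarith [hξ x hx, norm_nonneg ξ]
  generalize k + (n : ℤ) = j
  rcases le_total 0 j with hj | hj
  · lift j to ℕ using hj
    rw [Nat.abs_cast, zpow_natCast, zpow_neg, zpow_neg, zpow_natCast, zpow_natCast,
      ← div_eq_mul_inv, inv_eq_one_div, div_le_div_iff₀ (by positivity) (by positivity), one_mul,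
      ← mul_pow]
    exact pow_le_pow_left₀ hx0.le h1 j
  · obtain ⟨j, rfl⟩ := Int.exists_eq_neg_ofNat hj
    rw [abs_neg, Nat.abs_cast, zpow_natCast, neg_neg, zpow_natCast, zpow_natCast, ← mul_pow]
    exact pow_le_pow_left₀ hy0.le h2 j

end SchwarzschildCMC

namespace SchwarzschildCMC

open Set Filter Topology

/-! ### Functions on the sphere and Taylor expansions at infinity -/

theorem direction_coe {x : E 3} (hx : x ≠ 0) : (direction x : E 3) = ‖x‖⁻¹ • x := by
  simp [direction, hx]

theorem direction_smul {c : ℝ} (hc : 0 < c) (x : E 3) : direction (c • x) = direction x := by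
  by_cases hx : x = 0
  · simp [hx]
  · apply Subtype.ext
    rw [direction_coe hx, direction_coe (smul_ne_zero hc.ne' hx), norm_smul, smul_smul,
      Real.norm_of_nonneg hc.le]
    congr 1
    field_simp

theorem direction_coe_sphere (y : S2) : direction (y : E 3) = y := by
  have h1 : ‖(y : E 3)‖ = 1 := by simp
  have h0 : (y : E 3) ≠ 0 := by
    intro h; simp [h] at h1
  apply Subtype.ext
  rw [direction_coe h0, h1]; simp

theorem contMDiffOn_direction : ContMDiffOn 𝓘(ℝ, E 3) (𝓡 2) ∞ direction {x : E 3 | x ≠ 0} := by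
  let O : TopologicalSpace.Opens (E 3) := ⟨{x : E 3 | x ≠ 0}, isOpen_ne⟩
  have : Fact (Module.finrank ℝ (E 3) = 2 + 1) := ⟨by simp⟩
  have hsm : ContMDiff 𝓘(ℝ, E 3) 𝓘(ℝ, E 3) ∞ (fun x : O => ‖(x : E 3)‖⁻¹ • (x : E 3)) := by
    intro x
    have : ContMDiffAt 𝓘(ℝ, E 3) 𝓘(ℝ, E 3) ∞ (fun x : E 3 => ‖x‖⁻¹ • x) (x : E 3) := by
      rw [contMDiffAt_iff_contDiffAt]
      have hx : (x : E 3) ≠ 0 := x.2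
      exact ((contDiffAt_id.norm ℝ hx).inv (norm_ne_zero_iff.2 hx)).smul contDiffAt_id
    exact contMDiffAt_subtype_iff.2 this
  have h2 := hsm.codRestrict_sphere (n := 2) (fun x => by
    have hx : (x : E 3) ≠ 0 := x.2
    simp [norm_smul, hx])
  intro x hx
  refine ContMDiffAt.contMDiffWithinAt ?_
  refine (contMDiffAt_subtype_iff (U := O) (x := ⟨x, hx⟩)).1 ?_
  refine (h2 ⟨x, hx⟩).congr_of_eventuallyEq (Eventually.of_forall fun y => ?_)
  apply Subtype.ext
  simp [direction_coe y.2, Set.codRestrict]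

theorem contDiffOn_comp_direction {F : Type*} [NormedAddCommGroup F] [NormedSpace ℝ F]
    {f : S2 → F} {U : Set S2} (hf : ContMDiffOn (𝓡 2) 𝓘(ℝ, F) ∞ f U) :
    ContDiffOn ℝ ∞ (fun x => f (direction x)) ({x | x ≠ 0} ∩ direction ⁻¹' U) :=
  contMDiffOn_iff_contDiffOn.1
    (hf.comp (contMDiffOn_direction.mono inter_subset_left) fun _ hx => hx.2)

theorem contDiffOn_comp_direction_of_contMDiff {F : Type*} [NormedAddCommGroup F]
    [NormedSpace ℝ F] {f : S2 → F} (hf : ContMDiff (𝓡 2) 𝓘(ℝ, F) ∞ f) :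
    ContDiffOn ℝ ∞ (fun x => f (direction x)) {x | x ≠ 0} := by
  simpa using contDiffOn_comp_direction (U := univ) hf.contMDiffOn

/-- A function on `𝕊² × [0, s₀)` which is smooth up to the boundary, as a function of a direction
and of `σ = √s`: the boundary disappears, at the price of evenness in `σ`. Near `σ = 0` the
function is prolonged smoothly to all `σ`. -/
theorem exists_smooth_extension {P : S2 × ℝ → ℝ} {s₀ : ℝ} (hs₀ : 0 < s₀)
    (hP : ContMDiffOn ((𝓡 2).prod 𝓘(ℝ, ℝ)) 𝓘(ℝ, ℝ) ∞ P (Set.univ ×ˢ Set.Ico 0 s₀)) :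
    ∃ F : E 3 × ℝ → ℝ, ContDiffOn ℝ ∞ F {p | p.1 ≠ 0} ∧ (∀ x σ, F (x, -σ) = F (x, σ)) ∧
      ∃ δ > 0, ∀ x σ, |σ| < δ → F (x, σ) = P (direction x, σ ^ 2) := by
  have hq : 0 < √s₀ := Real.sqrt_pos.2 hs₀
  let χ : ContDiffBump (0 : ℝ) := ⟨√s₀ / 4, √s₀ / 2, by positivity, by linarith⟩
  refine ⟨fun p => χ p.2 * P (direction p.1, p.2 ^ 2), ?_, ?_, √s₀ / 4, by positivity, ?_⟩
  · intro p hp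
    by_cases hpσ : |p.2| < √s₀
    · -- the region in which `P` is smooth
      have h1 : ContMDiffOn 𝓘(ℝ, E 3 × ℝ) ((𝓡 2).prod 𝓘(ℝ, ℝ)) ∞
          (fun p : E 3 × ℝ => (direction p.1, p.2 ^ 2)) {p | p.1 ≠ 0 ∧ |p.2| < √s₀} := by
        refine ContMDiffOn.prodMk ?_ ?_
        · exact contMDiffOn_direction.comp
            (contMDiffOn_iff_contDiffOn.2 contDiffOn_fst) (fun p hp => hp.1)
        · exact contMDiffOn_iff_contDiffOn.2 (contDiffOn_snd.pow 2)
      have h2 := hP.comp h1 (by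
        rintro p ⟨-, hp⟩
        refine ⟨mem_univ _, sq_nonneg _, ?_⟩
        change p.2 ^ 2 < s₀
        rw [← sq_abs]
        calc |p.2| ^ 2 < √s₀ ^ 2 := by gcongr
          _ = s₀ := Real.sq_sqrt hs₀.le)
      have ho : IsOpen {p : E 3 × ℝ | p.1 ≠ 0 ∧ |p.2| < √s₀} :=
        isOpen_fst_ne_zero.inter (isOpen_lt continuous_snd.abs continuous_const)
      have h3 := (contMDiffOn_iff_contDiffOn.1 h2).contDiffAt (ho.mem_nhds ⟨hp, hpσ⟩)
      exact ((χ.contDiffAt.comp p contDiffAt_snd).mul h3).contDiffWithinAt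
    · have h1 : (fun p : E 3 × ℝ => χ p.2 * P (direction p.1, p.2 ^ 2)) =ᶠ[𝓝 p] fun _ => 0 := by
        have : ∀ᶠ p' : E 3 × ℝ in 𝓝 p, √s₀ / 2 < |p'.2| :=
          (isOpen_lt continuous_const continuous_snd.abs).mem_nhds (by
            change √s₀ / 2 < |p.2|
            linarith [not_lt.1 hpσ])
        filter_upwards [this] with p' hp'
        rw [χ.zero_of_le_dist (by simpa [Real.dist_eq] using hp'.le), zero_mul]
      exact (contDiffAt_const.congr_of_eventuallyEq h1).contDiffWithinAt
  · intro x σ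
    simp only [neg_sq]
    rw [χ.neg]
  · intro x σ hσ
    simp only
    rw [χ.one_of_mem_closedBall (by simpa [Real.dist_eq] using hσ.le), one_mul]

/-- Hadamard's lemma with parameters. -/
theorem exists_hadamard {F : E 3 × ℝ → ℝ} (hF : ContDiffOn ℝ ∞ F {p | p.1 ≠ 0}) :
    ∃ F₁ : E 3 × ℝ → ℝ, ContDiffOn ℝ ∞ F₁ {p | p.1 ≠ 0} ∧
      ∀ x σ, x ≠ 0 → F (x, σ) = F (x, 0) + σ * F₁ (x, σ) := by
  let D : E 3 × ℝ → ℝ := fun p => fderiv ℝ F p (0, 1)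
  have hD : ContDiffOn ℝ ∞ D {p | p.1 ≠ 0} :=
    (hF.fderiv_of_isOpen isOpen_fst_ne_zero (by simp)).clm_apply contDiffOn_const
  let ρ : ContDiffBump (0 : ℝ) := ⟨2, 3, by norm_num, by norm_num⟩
  let g : E 3 × ℝ → ℝ → ℝ := fun p u => ρ u * D (p.1, -u * p.2)
  let f : ℝ → ℝ := (Icc (0 : ℝ) 1).indicator 1
  have hf : MeasureTheory.LocallyIntegrable f MeasureTheory.volume :=
    ((MeasureTheory.integrable_indicator_iff measurableSet_Icc).2
      (MeasureTheory.integrableOn_const (by simp))).locallyIntegrable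
  have hconv := MeasureTheory.contDiffOn_convolution_right_with_param_comp (μ := MeasureTheory.volume)
    (n := (⊤ : ℕ∞)) (ContinuousLinearMap.mul ℝ ℝ) (s := {p : E 3 × ℝ | p.1 ≠ 0})
    (v := fun _ => (0 : ℝ)) contDiffOn_const (f := f) (g := g) (k := Metric.closedBall 0 3)
    isOpen_fst_ne_zero (isCompact_closedBall _ _) (by
      intro p u _ hu
      simp only [g]
      rw [ρ.zero_of_le_dist (by
        rw [Metric.mem_closedBall, not_le] at hu
        exact hu.le), zero_mul]) hf (by
      refine ContDiffOn.mul (ρ.contDiff.comp contDiff_snd).contDiffOn ?_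
      refine hD.comp (t := {p : E 3 × ℝ | p.1 ≠ 0}) ?_ ?_
      · fun_prop
      · rintro ⟨p, u⟩ ⟨hp, -⟩
        exact hp)
  refine ⟨_, hconv, fun x σ hx => ?_⟩
  have e1 : MeasureTheory.convolution f (g (x, σ)) (ContinuousLinearMap.mul ℝ ℝ)
      MeasureTheory.volume 0 = ∫ t in (0 : ℝ)..1, D (x, t * σ) := by
    rw [MeasureTheory.convolution, intervalIntegral.integral_of_le zero_le_one,
      ← MeasureTheory.integral_Icc_eq_integral_Ioc,
      ← MeasureTheory.integral_indicator measurableSet_Icc]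
    refine MeasureTheory.integral_congr_ae (Eventually.of_forall fun t => ?_)
    by_cases ht : t ∈ Icc (0 : ℝ) 1
    · have h1 : ρ (-t) = 1 := ρ.one_of_mem_closedBall (by
        have := ht.1
        have := ht.2
        simp only [Metric.mem_closedBall, Real.dist_eq]
        rw [abs_le]; constructor <;> simp [ρ] <;> linarith)
      simp only [f, g, indicator_of_mem ht, ContinuousLinearMap.mul_apply', Pi.one_apply,
        zero_sub, h1, one_mul, neg_neg]
    · simp only [f, indicator_of_notMem ht, ContinuousLinearMap.mul_apply', zero_mul]
  have hline : ∀ t : ℝ, HasDerivAt (fun t : ℝ => F (x, t * σ)) (σ * D (x, t * σ)) t := by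
    intro t
    have h1 : HasFDerivAt F (fderiv ℝ F (x, t * σ)) (x, t * σ) :=
      ((hF.contDiffAt (isOpen_fst_ne_zero.mem_nhds hx)).differentiableAt (by simp)).hasFDerivAt
    have h2 : HasDerivAt (fun t : ℝ => ((x, t * σ) : E 3 × ℝ)) ((0, σ) : E 3 × ℝ) t := by
      have := (hasDerivAt_const t x).prodMk ((hasDerivAt_id t).mul_const σ)
      simpa using this
    have h3 := h1.comp_hasDerivAt t h2
    have h4 : ((0, σ) : E 3 × ℝ) = σ • ((0, 1) : E 3 × ℝ) := by simp
    rw [h4, map_smul] at h3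
    exact h3
  have hcont : Continuous fun t : ℝ => D (x, t * σ) := by
    refine hD.continuousOn.comp_continuous (by fun_prop) fun t => hx
  have ftc := intervalIntegral.integral_eq_sub_of_hasDerivAt (a := 0) (b := 1)
    (fun t _ => hline t) ((continuous_const.mul hcont).intervalIntegrable _ _)
  simp only [one_mul, zero_mul] at ftc
  rw [intervalIntegral.integral_const_mul] at ftc
  rw [e1, ftc]
  ring

/-- Hadamard's lemma for functions which are even in the last variable. -/
theorem exists_hadamard_even {F : E 3 × ℝ → ℝ} (hF : ContDiffOn ℝ ∞ F {p | p.1 ≠ 0})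
    (heven : ∀ x σ, x ≠ 0 → F (x, -σ) = F (x, σ)) :
    ∃ F₂ : E 3 × ℝ → ℝ, ContDiffOn ℝ ∞ F₂ {p | p.1 ≠ 0} ∧
      (∀ x σ, x ≠ 0 → F₂ (x, -σ) = F₂ (x, σ)) ∧
      ∀ x σ, x ≠ 0 → F (x, σ) = F (x, 0) + σ ^ 2 * F₂ (x, σ) := by
  obtain ⟨F₁, hF₁, h1⟩ := exists_hadamard hF
  obtain ⟨F₂, hF₂, h2⟩ := exists_hadamard hF₁
  -- `F₁` is odd, hence vanishes at `σ = 0`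
  have hodd : ∀ x σ, x ≠ 0 → σ ≠ 0 → F₁ (x, -σ) = -F₁ (x, σ) := by
    intro x σ hx hσ
    have e1 := h1 x σ hx
    have e2 := h1 x (-σ) hx
    rw [heven x σ hx, e1] at e2
    have : σ * (F₁ (x, -σ) + F₁ (x, σ)) = 0 := by linarith
    rcases mul_eq_zero.1 this with h | h
    · exact absurd h hσ
    · linarith
  have hzero : ∀ x, x ≠ 0 → F₁ (x, 0) = 0 := by
    intro x hx
    have hc : Continuous fun σ : ℝ => F₁ (x, σ) :=
      hF₁.continuousOn.comp_continuous (by fun_prop) fun t => hx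
    have l1 : Tendsto (fun σ : ℝ => F₁ (x, -σ) + F₁ (x, σ)) (𝓝[≠] 0) (𝓝 (F₁ (x, 0) + F₁ (x, 0))) := by
      have : Continuous fun σ : ℝ => F₁ (x, -σ) + F₁ (x, σ) := (hc.comp continuous_neg).add hc
      have := (this.tendsto 0).mono_left (nhdsWithin_le_nhds (s := {0}ᶜ))
      simpa using this
    have l2 : Tendsto (fun σ : ℝ => F₁ (x, -σ) + F₁ (x, σ)) (𝓝[≠] 0) (𝓝 0) := by
      refine tendsto_const_nhds.congr' ?_
      filter_upwards [self_mem_nhdsWithin] with σ hσ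
      rw [hodd x σ hx hσ]; ring
    have := tendsto_nhds_unique l1 l2
    linarith
  refine ⟨F₂, hF₂, ?_, ?_⟩
  · intro x σ hx
    rcases eq_or_ne σ 0 with rfl | hσ
    · simp
    · have e1 := h2 x σ hx
      have e2 := h2 x (-σ) hx
      rw [hodd x σ hx hσ, e1, hzero x hx] at e2
      have : σ * (F₂ (x, -σ) - F₂ (x, σ)) = 0 := by linarith
      rcases mul_eq_zero.1 this with h | h
      · exact absurd h hσ
      · linarith
  · intro x σ hx
    rw [h1 x σ hx, h2 x σ hx, hzero x hx]
    ring

/-- The value at `σ = 0`, as a function on `ℝ³` which is homogeneous of degree zero. -/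
noncomputable def leading (F : E 3 × ℝ → ℝ) (x : E 3) : ℝ := F (‖x‖⁻¹ • x, 0)

theorem contDiffOn_leading {F : E 3 × ℝ → ℝ} (hF : ContDiffOn ℝ ∞ F {p | p.1 ≠ 0}) :
    ContDiffOn ℝ ∞ (leading F) {x | x ≠ 0} := by
  refine hF.comp (t := {p : E 3 × ℝ | p.1 ≠ 0}) (ContDiffOn.prodMk
    (ContDiffOn.smul (ContDiffOn.inv (contDiff_id.contDiffOn.norm ℝ fun x (hx : x ≠ 0) => hx)
      fun x (hx : x ≠ 0) => norm_ne_zero_iff.2 hx) contDiffOn_id) contDiffOn_const) ?_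
  intro x hx
  exact smul_ne_zero (inv_ne_zero (norm_ne_zero_iff.2 hx)) hx

theorem leading_smul (F : E 3 × ℝ → ℝ) {c : ℝ} (hc : 0 < c) (x : E 3) :
    leading F (c • x) = leading F x := by
  have : ‖c • x‖⁻¹ • c • x = ‖x‖⁻¹ • x := by
    rw [norm_smul, smul_smul, Real.norm_of_nonneg hc.le]
    congr 1
    field_simp
  rw [leading, leading, this]

theorem isSymbol_leading {U : Set (E 3)} (hU : IsExterior U) {F : E 3 × ℝ → ℝ}
    (hF : ContDiffOn ℝ ∞ F {p | p.1 ≠ 0}) : IsSymbol U 0 (leading F) := by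
  refine isSymbol_of_smooth hU (F := fun p => F (p.1, 0)) ?_ fun x _ => rfl
  exact hF.comp (t := {p : E 3 × ℝ | p.1 ≠ 0}) (by fun_prop) fun p hp => hp

/-- One step of the Taylor expansion at infinity, for even functions. -/
theorem exists_expansion {F : E 3 × ℝ → ℝ} (hF : ContDiffOn ℝ ∞ F {p | p.1 ≠ 0})
    (heven : ∀ x σ, x ≠ 0 → F (x, -σ) = F (x, σ)) :
    ∃ F₂ : E 3 × ℝ → ℝ, ContDiffOn ℝ ∞ F₂ {p | p.1 ≠ 0} ∧
      (∀ x σ, x ≠ 0 → F₂ (x, -σ) = F₂ (x, σ)) ∧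
      ∀ x : E 3, x ≠ 0 → F (‖x‖⁻¹ • x, √(‖x‖⁻¹)) =
        leading F x + ‖x‖⁻¹ * F₂ (‖x‖⁻¹ • x, √(‖x‖⁻¹)) := by
  obtain ⟨F₂, hF₂, he₂, h⟩ := exists_hadamard_even hF heven
  refine ⟨F₂, hF₂, he₂, fun x hx => ?_⟩
  rw [h _ _ (smul_ne_zero (inv_ne_zero (norm_ne_zero_iff.2 hx)) hx), leading,
    Real.sq_sqrt (by positivity)]

end SchwarzschildCMC

namespace SchwarzschildCMC

open Set Filter Topology

/-! ### Rules for partial derivatives -/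

section PartialD

variable {n : ℕ} {f g : E n → ℝ} {x : E n}

theorem partialD_congr (h : f =ᶠ[𝓝 x] g) (i : Fin n) : partialD i f x = partialD i g x := by
  rw [partialD, partialD, h.fderiv_eq]

theorem partialD_congr_of_mem {U : Set (E n)} (hU : IsOpen U) (h : ∀ y ∈ U, f y = g y)
    (hx : x ∈ U) (i : Fin n) : partialD i f x = partialD i g x :=
  partialD_congr (eventuallyEq_of_mem (hU.mem_nhds hx) h) i

theorem HasFDerivAt.partialD_eq {f' : E n →L[ℝ] ℝ} (h : HasFDerivAt f f' x) (i : Fin n) :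
    partialD i f x = f' (EuclideanSpace.single i 1) := by rw [partialD, h.fderiv]

@[simp] theorem partialD_const (c : ℝ) (i : Fin n) : partialD i (fun _ : E n => c) x = 0 := by
  simp [partialD]

theorem partialD_add (hf : DifferentiableAt ℝ f x) (hg : DifferentiableAt ℝ g x) (i : Fin n) :
    partialD i (fun y => f y + g y) x = partialD i f x + partialD i g x := by
  simp [partialD, fderiv_fun_add hf hg]

theorem partialD_sub (hf : DifferentiableAt ℝ f x) (hg : DifferentiableAt ℝ g x) (i : Fin n) :
    partialD i (fun y => f y - g y) x = partialD i f x - partialD i g x := by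
  simp [partialD, fderiv_fun_sub hf hg]

theorem partialD_neg (f : E n → ℝ) (x : E n) (i : Fin n) :
    partialD i (fun y => -f y) x = -partialD i f x := by
  simp [partialD, fderiv_fun_neg]

theorem partialD_mul (hf : DifferentiableAt ℝ f x) (hg : DifferentiableAt ℝ g x) (i : Fin n) :
    partialD i (fun y => f y * g y) x = partialD i f x * g x + f x * partialD i g x := by
  simp [partialD, fderiv_fun_mul hf hg]; ring

theorem partialD_const_mul (hf : DifferentiableAt ℝ f x) (c : ℝ) (i : Fin n) :
    partialD i (fun y => c * f y) x = c * partialD i f x := by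
  simp [partialD, fderiv_const_mul hf]

theorem partialD_sum {ι : Type*} {s : Finset ι} {f : ι → E n → ℝ}
    (hf : ∀ a ∈ s, DifferentiableAt ℝ (f a) x) (i : Fin n) :
    partialD i (fun y => ∑ a ∈ s, f a y) x = ∑ a ∈ s, partialD i (f a) x := by
  simp [partialD, fderiv_fun_sum hf]

theorem partialD_comp {u : ℝ → ℝ} {u' : ℝ} (hu : HasDerivAt u u' (f x))
    (hf : DifferentiableAt ℝ f x) (i : Fin n) :
    partialD i (fun y => u (f y)) x = u' * partialD i f x := by
  have := hu.comp_hasFDerivAt x hf.hasFDerivAt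
  rw [HasFDerivAt.partialD_eq (f := fun y => u (f y)) this]
  simp [partialD]

theorem partialD_coord (i j : Fin n) (x : E n) :
    partialD i (fun y : E n => y j) x = if i = j then 1 else 0 := by
  have h : HasFDerivAt (fun y : E n => y j) (EuclideanSpace.proj (𝕜 := ℝ) j : E n →L[ℝ] ℝ) x :=
    (EuclideanSpace.proj (𝕜 := ℝ) j : E n →L[ℝ] ℝ).hasFDerivAt
  rw [HasFDerivAt.partialD_eq h]
  simp [eq_comm]

theorem fderiv_apply_eq_sum (f : E n → ℝ) (x v : E n) :
    fderiv ℝ f x v = ∑ i, v i * partialD i f x := by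
  conv_lhs => rw [← (EuclideanSpace.basisFun (Fin n) ℝ).sum_repr v]
  simp [partialD]

theorem contDiffAt_partialD (hf : ContDiffAt ℝ ∞ f x) (i : Fin n) :
    ContDiffAt ℝ ∞ (partialD i f) x :=
  (hf.fderiv_right (m := ∞) (by simp)).clm_apply contDiffAt_const

theorem contDiffOn_partialD {U : Set (E n)} (hU : IsOpen U) (hf : ContDiffOn ℝ ∞ f U)
    (i : Fin n) : ContDiffOn ℝ ∞ (partialD i f) U :=
  fun _ hx => (contDiffAt_partialD (hf.contDiffAt (hU.mem_nhds hx)) i).contDiffWithinAt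

theorem ContDiffAt.dAt {F : Type*} [NormedAddCommGroup F] [NormedSpace ℝ F] {f : E n → F}
    (hf : ContDiffAt ℝ ∞ f x) : DifferentiableAt ℝ f x := hf.differentiableAt (by simp)

theorem partialD_comm (hf : ContDiffAt ℝ ∞ f x) (i j : Fin n) :
    partialD i (partialD j f) x = partialD j (partialD i f) x := by
  have h := hf.isSymmSndFDerivAt (by
    rw [minSmoothness_of_isRCLikeNormedField]
    exact WithTop.coe_le_coe.2 le_top)
  have hd : DifferentiableAt ℝ (fderiv ℝ f) x :=
    (hf.fderiv_right (m := ∞) (by simp)).differentiableAt (by simp)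
  have key : ∀ i j : Fin n, partialD i (partialD j f) x =
      fderiv ℝ (fderiv ℝ f) x (EuclideanSpace.single i 1) (EuclideanSpace.single j 1) := by
    intro i j
    have h1 : HasFDerivAt (fun y => fderiv ℝ f y (EuclideanSpace.single j 1))
        ((fderiv ℝ (fderiv ℝ f) x).flip (EuclideanSpace.single j 1)) x := by
      have := hd.hasFDerivAt.clm_apply
        (hasFDerivAt_const (EuclideanSpace.single j (1 : ℝ) : E n) x)
      simpa using this
    rw [show partialD j f = fun y => fderiv ℝ f y (EuclideanSpace.single j 1) from rfl,
      HasFDerivAt.partialD_eq h1]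
    simp
  rw [key, key, h.eq]

/-- The partial derivatives of a function which is homogeneous under one dilation. -/
theorem partialD_smul_of_homogeneous {U : Set (E n)} (hU : IsOpen U) {c a : ℝ} (hc : c ≠ 0)
    (h : ∀ y ∈ U, f (c • y) = a * f y) (hx : x ∈ U) (hf : DifferentiableAt ℝ f x)
    (hf' : DifferentiableAt ℝ f (c • x)) (i : Fin n) :
    partialD i f (c • x) = a / c * partialD i f x := by
  have h1 : HasFDerivAt (fun y => f (c • y))
      ((fderiv ℝ f (c • x)).comp (c • ContinuousLinearMap.id ℝ (E n))) x :=
    hf'.hasFDerivAt.comp x ((c • ContinuousLinearMap.id ℝ (E n)).hasFDerivAt)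
  have h2 := partialD_congr_of_mem hU h hx i
  rw [HasFDerivAt.partialD_eq h1, partialD_const_mul hf] at h2
  simp only [ContinuousLinearMap.comp_apply, smul_apply,
    ContinuousLinearMap.id_apply, map_smul, smul_eq_mul] at h2
  rw [div_mul_eq_mul_div, eq_div_iff hc, mul_comm]
  exact h2

end PartialD

theorem differentiableAt_norm {x : E 3} (hx : x ≠ 0) : DifferentiableAt ℝ (fun y : E 3 => ‖y‖) x :=
  (contDiffAt_norm ℝ hx (n := 1)).differentiableAt one_ne_zero

theorem partialD_norm {x : E 3} (hx : x ≠ 0) (i : Fin 3) :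
    partialD i (fun y : E 3 => ‖y‖) x = x i * ‖x‖⁻¹ := by
  have h0 : ‖x‖ ≠ 0 := norm_ne_zero_iff.2 hx
  have hd := differentiableAt_norm hx
  have h1 := partialD_mul hd hd i
  have h2 : (fun y : E 3 => ‖y‖ * ‖y‖) = fun y => ∑ j, y j * y j := by
    ext y
    rw [← sq, EuclideanSpace.norm_sq_eq]
    simp [sq]
  rw [h2, partialD_sum (fun j _ => by fun_prop)] at h1
  have h3 : ∀ j, partialD i (fun y : E 3 => y j * y j) x = if i = j then 2 * x j else 0 := by
    intro j
    rw [partialD_mul (by fun_prop) (by fun_prop), partialD_coord]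
    split_ifs <;> ring
  simp only [h3, Finset.sum_ite_eq, Finset.mem_univ, if_true] at h1
  field_simp
  linarith

theorem sum_sq_eq (x : E 3) : ∑ i, x i * x i = ‖x‖ ^ 2 := by
  rw [EuclideanSpace.norm_sq_eq]; simp [sq]

theorem contDiffOn_norm_E3 : ContDiffOn ℝ ∞ (fun x : E 3 => ‖x‖) {x | x ≠ 0} :=
  fun _ hx => (contDiffAt_norm ℝ hx).contDiffWithinAt

theorem isOpen_ne_zero : IsOpen {x : E 3 | x ≠ 0} := isOpen_ne

/-! ### The first two eigenspaces of the sphere -/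

/-- The divergence theorem for compactly supported functions. -/
theorem integral_partialD_eq_zero {f : E 3 → ℝ} (hf : ContDiff ℝ 1 f) (hs : HasCompactSupport f)
    (i : Fin 3) : ∫ x, partialD i f x = 0 := by
  have hd : Continuous (partialD i f) :=
    (hf.continuous_fderiv one_ne_zero).clm_apply continuous_const
  have hs' : HasCompactSupport (partialD i f) := by
    refine (hs.fderiv (𝕜 := ℝ)).comp_left
      (g := fun A : E 3 →L[ℝ] ℝ => A (EuclideanSpace.single i 1)) (by simp)
  have := integral_mul_fderiv_eq_neg_fderiv_mul_of_integrable (𝕜 := ℝ) (f := fun _ : E 3 => (1 : ℝ))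
    (g := f) (v := EuclideanSpace.single i 1) (μ := MeasureTheory.volume)
    (by simp) (by
      simp only [one_mul]
      exact hd.integrable_of_hasCompactSupport hs')
    (by
      simp only [one_mul]
      exact hf.continuous.integrable_of_hasCompactSupport hs)
    (fun x _ => by fun_prop) (fun x _ => hf.differentiable one_ne_zero x)
  simpa [partialD] using this

theorem euler_of_homogeneous {f : E 3 → ℝ} {x : E 3} (k : ℕ) (hx : x ≠ 0)
    (hf : DifferentiableAt ℝ f x) (h : ∀ c : ℝ, 0 < c → ∀ y, y ≠ 0 → f (c • y) = c ^ k * f y) :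
    ∑ i, x i * partialD i f x = k * f x := by
  rw [← fderiv_apply_eq_sum]
  have h1 : HasDerivAt (fun c : ℝ => f (c • x)) (fderiv ℝ f x x) 1 := by
    have h2 : HasDerivAt (fun c : ℝ => c • x) x 1 := by
      simpa using (hasDerivAt_id (1 : ℝ)).smul_const x
    have h3 : HasFDerivAt f (fderiv ℝ f x) ((1 : ℝ) • x) := by simpa using hf.hasFDerivAt
    exact h3.comp_hasDerivAt (1 : ℝ) h2
  have h4 : HasDerivAt (fun c : ℝ => c ^ k * f x) (k * f x) 1 := by
    simpa using (hasDerivAt_pow k (1 : ℝ)).mul_const (f x)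
  refine h1.unique (h4.congr_of_eventuallyEq ?_)
  filter_upwards [lt_mem_nhds (zero_lt_one (α := ℝ))] with c hc
  exact h c hc x hx

/-- The gradient of a harmonic function on `ℝ³ ∖ 0` which is homogeneous of degree zero vanishes:
integrate `div (χ w ∇w) = χ |∇w|²` for a radial cutoff `χ`. -/
theorem partialD_eq_zero_of_harmonic {w : E 3 → ℝ} (hw : ContDiffOn ℝ ∞ w {x | x ≠ 0})
    (hhom : ∀ c : ℝ, 0 < c → ∀ y, y ≠ 0 → w (c • y) = w y)
    (hharm : ∀ x, x ≠ 0 → ∑ i, partialD i (partialD i w) x = 0) {x : E 3} (hx : x ≠ 0)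
    (i : Fin 3) : partialD i w x = 0 := by
  have hw' : ∀ y : E 3, y ≠ 0 → ContDiffAt ℝ ∞ w y := fun y hy =>
    hw.contDiffAt (isOpen_ne_zero.mem_nhds hy)
  have hr : 0 < ‖x‖ ^ 2 := by positivity
  let b : ContDiffBump (‖x‖ ^ 2) := ⟨‖x‖ ^ 2 / 4, ‖x‖ ^ 2 / 2, by positivity, by linarith⟩
  let χ : E 3 → ℝ := fun y => b (‖y‖ ^ 2)
  have hχ : ContDiff ℝ ∞ χ := b.contDiff.comp (contDiff_norm_sq ℝ)
  have hχ0 : ∀ y : E 3, ‖y‖ ^ 2 < ‖x‖ ^ 2 / 2 → χ y = 0 := by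
    intro y hy
    refine b.zero_of_le_dist ?_
    rw [Real.dist_eq, abs_sub_comm, abs_of_nonneg (by linarith)]
    change ‖x‖ ^ 2 / 2 ≤ _
    linarith
  have hχs : ∀ y : E 3, 2 * ‖x‖ ^ 2 < ‖y‖ ^ 2 → χ y = 0 := by
    intro y hy
    refine b.zero_of_le_dist ?_
    rw [Real.dist_eq, abs_of_nonneg (by linarith)]
    change ‖x‖ ^ 2 / 2 ≤ _
    linarith
  -- multiplication by the cutoff removes the singularity at the origin
  have hcut : ∀ v : E 3 → ℝ, ContDiffOn ℝ ∞ v {x | x ≠ 0} → ContDiff ℝ ∞ fun y => χ y * v y := by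
    intro v hv
    rw [contDiff_iff_contDiffAt]
    intro y
    by_cases hy : y = 0
    · have : (fun y => χ y * v y) =ᶠ[𝓝 y] fun _ => 0 := by
        have h1 : ∀ᶠ y' : E 3 in 𝓝 y, ‖y'‖ ^ 2 < ‖x‖ ^ 2 / 2 :=
          (isOpen_lt (by fun_prop) continuous_const).mem_nhds (by
            change ‖y‖ ^ 2 < _
            rw [hy]; simpa using hr)
        filter_upwards [h1] with y' hy'
        rw [hχ0 y' hy', zero_mul]
      exact contDiffAt_const.congr_of_eventuallyEq this
    · exact hχ.contDiffAt.mul (hv.contDiffAt (isOpen_ne_zero.mem_nhds hy))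
  have hsupp : ∀ v : E 3 → ℝ, HasCompactSupport fun y => χ y * v y := by
    intro v
    refine HasCompactSupport.intro (isCompact_closedBall (0 : E 3) (2 * ‖x‖)) fun y hy => ?_
    rw [mem_closedBall_zero_iff, not_le] at hy
    rw [hχs y, zero_mul]
    have := pow_lt_pow_left₀ hy (by positivity) two_ne_zero
    nlinarith
  have hV : ∀ j, ContDiffOn ℝ ∞ (fun y => w y * partialD j w y) {x | x ≠ 0} := fun j =>
    hw.mul (contDiffOn_partialD isOpen_ne_zero hw j)
  have hdiv : ∀ y, ∑ j, partialD j (fun y => χ y * (w y * partialD j w y)) y =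
      χ y * ∑ j, partialD j w y ^ 2 := by
    intro y
    by_cases hy : y = 0
    · have h0 : χ y = 0 := hχ0 y (by rw [hy]; simpa using hr)
      have : ∀ᶠ y' : E 3 in 𝓝 y, χ y' = 0 := by
        have h1 : ∀ᶠ y' : E 3 in 𝓝 y, ‖y'‖ ^ 2 < ‖x‖ ^ 2 / 2 :=
          (isOpen_lt (by fun_prop) continuous_const).mem_nhds (by
            change ‖y‖ ^ 2 < _
            rw [hy]; simpa using hr)
        filter_upwards [h1] with y' hy' using hχ0 y' hy'
      rw [h0, zero_mul]
      refine Finset.sum_eq_zero fun j _ => ?_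
      rw [partialD_congr (g := fun _ => 0) (by filter_upwards [this] with y' hy'; simp [hy'])]
      simp
    · have hwy := hw' y hy
      have hpχ : ∀ j, partialD j χ y = deriv b (‖y‖ ^ 2) * (2 * y j) := by
        intro j
        have h1 : HasDerivAt b (deriv b (‖y‖ ^ 2)) (‖y‖ ^ 2) :=
          (b.contDiff (n := 1)).differentiable one_ne_zero |>.differentiableAt.hasDerivAt
        have hn := differentiableAt_norm hy
        rw [show χ = fun y => b (‖y‖ ^ 2) from rfl,
          partialD_comp (f := fun y : E 3 => ‖y‖ ^ 2) h1 (hn.pow 2)]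
        congr 1
        have : (fun y : E 3 => ‖y‖ ^ 2) = fun y => ‖y‖ * ‖y‖ := by ext; ring
        rw [this, partialD_mul hn hn, partialD_norm hy]
        have := norm_ne_zero_iff.2 hy
        field_simp
        ring
      have he : ∑ j, y j * partialD j w y = 0 := by
        simpa using euler_of_homogeneous 0 hy (ContDiffAt.dAt hwy) (by simpa using hhom)
      have hterm : ∀ j, partialD j (fun y => χ y * (w y * partialD j w y)) y =
          2 * deriv b (‖y‖ ^ 2) * w y * (y j * partialD j w y) + χ y * partialD j w y ^ 2
            + χ y * w y * partialD j (partialD j w) y := by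
        intro j
        have h1 : DifferentiableAt ℝ χ y := ContDiffAt.dAt hχ.contDiffAt
        have h2 := ContDiffAt.dAt hwy
        have h3 := ContDiffAt.dAt (contDiffAt_partialD hwy j)
        rw [partialD_mul h1 (h2.fun_mul h3), partialD_mul h2 h3, hpχ j]
        ring
      simp only [hterm, Finset.sum_add_distrib, ← Finset.mul_sum]
      rw [he, hharm y hy]
      ring
  have hint : ∫ y, χ y * ∑ j, partialD j w y ^ 2 = 0 := by
    simp_rw [← hdiv]
    rw [MeasureTheory.integral_finsetSum]
    · refine Finset.sum_eq_zero fun j _ => integral_partialD_eq_zero ?_ (hsupp _) j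
      exact (hcut _ (hV j)).of_le (by simp)
    · intro j _
      have h1 : ContDiff ℝ 1 fun y => χ y * (w y * partialD j w y) :=
        (hcut _ (hV j)).of_le (by simp)
      refine Continuous.integrable_of_hasCompactSupport
        ((h1.continuous_fderiv one_ne_zero).clm_apply continuous_const) ?_
      exact ((hsupp _).fderiv (𝕜 := ℝ)).comp_left
        (g := fun A : E 3 →L[ℝ] ℝ => A (EuclideanSpace.single j 1)) (by simp)
  have hc : Continuous fun y => χ y * ∑ j, partialD j w y ^ 2 :=
    (hcut _ (ContDiffOn.sum fun j _ =>
      (contDiffOn_partialD isOpen_ne_zero hw j).pow 2)).continuous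
  have hnn : ∀ y, 0 ≤ χ y * ∑ j, partialD j w y ^ 2 := fun y =>
    mul_nonneg b.nonneg (Finset.sum_nonneg fun j _ => sq_nonneg _)
  have hz := (MeasureTheory.integral_eq_zero_iff_of_nonneg hnn
    (hc.integrable_of_hasCompactSupport (hsupp _))).1 hint
  have hz' := congrFun ((hc.ae_eq_iff_eq MeasureTheory.volume continuous_const).1 hz) x
  have hb1 : χ x = 1 := b.one_of_mem_closedBall (Metric.mem_closedBall_self b.rIn_pos.le)
  simp only [hb1, one_mul] at hz'
  have := (Finset.sum_eq_zero_iff_of_nonneg fun j _ => sq_nonneg (partialD j w x)).1 hz' i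
    (Finset.mem_univ i)
  exact pow_eq_zero_iff two_ne_zero |>.1 this

theorem exists_const_of_harmonic {w : E 3 → ℝ} (hw : ContDiffOn ℝ ∞ w {x | x ≠ 0})
    (hhom : ∀ c : ℝ, 0 < c → ∀ y, y ≠ 0 → w (c • y) = w y)
    (hharm : ∀ x, x ≠ 0 → ∑ i, partialD i (partialD i w) x = 0) :
    ∃ c, ∀ x, x ≠ 0 → w x = c := by
  have hconn : IsPreconnected {x : E 3 | x ≠ 0} :=
    (isConnected_compl_singleton_of_one_lt_rank (by
      rw [← Module.finrank_eq_rank, finrank_euclideanSpace_fin]; norm_num) 0).isPreconnected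
  refine isOpen_ne_zero.exists_is_const_of_fderiv_eq_zero hconn (hw.differentiableOn (by simp)) ?_
  intro x hx
  ext v
  rw [fderiv_apply_eq_sum]
  simp [partialD_eq_zero_of_harmonic hw hhom hharm hx]

theorem laplacian_eq_sum {f : E 3 → ℝ} {x : E 3} (hf : ContDiffAt ℝ ∞ f x) :
    Laplacian.laplacian f x = ∑ i, partialD i (partialD i f) x := by
  have := congrFun (InnerProductSpace.laplacian_eq_iteratedFDeriv_orthonormalBasis f
    (EuclideanSpace.basisFun (Fin 3) ℝ)) x
  rw [this]
  refine Finset.sum_congr rfl fun i _ => ?_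
  rw [iteratedFDeriv_two_apply]
  have hd : DifferentiableAt ℝ (fderiv ℝ f) x :=
    (hf.fderiv_right (m := ∞) (by simp)).differentiableAt (by simp)
  have h1 : HasFDerivAt (fun y => fderiv ℝ f y (EuclideanSpace.single i 1))
      ((fderiv ℝ (fderiv ℝ f) x).flip (EuclideanSpace.single i 1)) x := by
    have := hd.hasFDerivAt.clm_apply
      (hasFDerivAt_const (EuclideanSpace.single i (1 : ℝ) : E 3) x)
    simpa using this
  rw [show partialD i f = fun y => fderiv ℝ f y (EuclideanSpace.single i 1) from rfl,
    HasFDerivAt.partialD_eq h1]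
  simp

/-- The degree zero extension of an eigenfunction. -/
theorem sum_partialD_eigenfunction {lam : ℝ} {f : S2 → ℝ} (hf : InSphereEigenspace lam f)
    {x : E 3} (hx : x ≠ 0) :
    ∑ i, partialD i (partialD i fun z => f (direction z)) x =
      -lam * f (direction x) * (‖x‖⁻¹) ^ 2 := by
  set F : E 3 → ℝ := fun z => f (direction z) with hFdef
  have hF : ContDiffOn ℝ ∞ F {x | x ≠ 0} := contDiffOn_comp_direction_of_contMDiff hf.1
  have hF' : ∀ y : E 3, y ≠ 0 → ContDiffAt ℝ ∞ F y := fun y hy =>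
    hF.contDiffAt (isOpen_ne_zero.mem_nhds hy)
  have hr : 0 < ‖x‖ := norm_pos_iff.2 hx
  have hx' : ‖x‖⁻¹ • x ≠ 0 := smul_ne_zero (inv_ne_zero hr.ne') hx
  have hne : ∀ y : E 3, y ≠ 0 → ‖x‖⁻¹ • y ≠ 0 := fun y hy =>
    smul_ne_zero (inv_ne_zero hr.ne') hy
  have h1 : ∀ i, ∀ y ∈ {y : E 3 | y ≠ 0},
      partialD i F (‖x‖⁻¹ • y) = ‖x‖ * partialD i F y := by
    intro i y hy
    rw [partialD_smul_of_homogeneous isOpen_ne_zero (a := 1) (inv_ne_zero hr.ne') ?_ hy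
      (ContDiffAt.dAt (hF' y hy)) (ContDiffAt.dAt (hF' _ (hne y hy)))]
    · simp
    · intro z _
      rw [one_mul, hFdef]
      simp only
      rw [direction_smul (inv_pos.2 hr)]
  have h2 : ∀ i, partialD i (partialD i F) (‖x‖⁻¹ • x) = ‖x‖ ^ 2 * partialD i (partialD i F) x := by
    intro i
    rw [partialD_smul_of_homogeneous isOpen_ne_zero (inv_ne_zero hr.ne') (h1 i) hx
      (ContDiffAt.dAt (contDiffAt_partialD (hF' x hx) i))
      (ContDiffAt.dAt (contDiffAt_partialD (hF' _ hx') i))]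
    field_simp
  have h3 := hf.2 (direction x)
  rw [sphereLaplacian, direction_coe hx, laplacian_eq_sum (hF' _ hx')] at h3
  simp only [h2, ← Finset.mul_sum] at h3
  field_simp
  linarith

theorem sum_partialD_partialD_norm {x : E 3} (hx : x ≠ 0) :
    ∑ i, partialD i (partialD i fun y : E 3 => ‖y‖) x = 2 * ‖x‖⁻¹ := by
  have h0 : ‖x‖ ≠ 0 := norm_ne_zero_iff.2 hx
  have hd := differentiableAt_norm hx
  have h1 : ∀ i, partialD i (partialD i fun y : E 3 => ‖y‖) x =
      ‖x‖⁻¹ - x i * x i * (‖x‖⁻¹) ^ 3 := by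
    intro i
    rw [partialD_congr_of_mem isOpen_ne_zero (g := fun y : E 3 => y i * ‖y‖⁻¹)
      (fun y hy => partialD_norm hy i) hx,
      partialD_mul (f := fun y : E 3 => y i) (g := fun y => ‖y‖⁻¹) (by fun_prop) (hd.fun_inv h0),
      partialD_coord,
      partialD_comp (f := fun y : E 3 => ‖y‖) (hasDerivAt_inv h0) hd, partialD_norm hx]
    simp only [if_true]
    field_simp
    ring
  simp only [h1, Finset.sum_sub_distrib, ← Finset.sum_mul]
  rw [sum_sq_eq]
  simp only [Finset.sum_const, Finset.card_univ, Fintype.card_fin]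
  rw [nsmul_eq_mul]
  field_simp
  norm_num

/-- Eigenfunctions with eigenvalue `2` are restrictions of linear functions: their extensions of
degree one are harmonic, hence have harmonic derivatives of degree zero. -/
theorem eigenfunction_two_eq_linear {f : S2 → ℝ} (hf : InSphereEigenspace 2 f) :
    ∃ ξ : E 3, ∀ y : S2, f y = ∑ i, ξ i * (y : E 3) i := by
  set F : E 3 → ℝ := fun z => f (direction z) with hFdef
  have hF : ContDiffOn ℝ ∞ F {x | x ≠ 0} := contDiffOn_comp_direction_of_contMDiff hf.1
  set G : E 3 → ℝ := fun z => ‖z‖ * F z with hGdef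
  have hG : ContDiffOn ℝ ∞ G {x | x ≠ 0} := contDiffOn_norm_E3.mul hF
  have at0 : ∀ {h : E 3 → ℝ}, ContDiffOn ℝ ∞ h {x | x ≠ 0} → ∀ {y : E 3}, y ≠ 0 →
      ContDiffAt ℝ ∞ h y := fun hh y hy => hh.contDiffAt (isOpen_ne_zero.mem_nhds hy)
  have hharm : ∀ x, x ≠ 0 → ∑ i, partialD i (partialD i G) x = 0 := by
    intro x hx
    have h0 : ‖x‖ ≠ 0 := norm_ne_zero_iff.2 hx
    have h1 : ∀ i, ∀ y ∈ {y : E 3 | y ≠ 0}, partialD i G y =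
        partialD i (fun y : E 3 => ‖y‖) y * F y + ‖y‖ * partialD i F y := fun i y hy =>
      partialD_mul (differentiableAt_norm hy) (ContDiffAt.dAt (at0 hF hy)) i
    have hN := contDiffOn_norm_E3
    have h2 : ∀ i, partialD i (partialD i G) x =
        partialD i (partialD i fun y : E 3 => ‖y‖) x * F x
        + 2 * ‖x‖⁻¹ * (x i * partialD i F x) + ‖x‖ * partialD i (partialD i F) x := by
      intro i
      have d1 := ContDiffAt.dAt (contDiffAt_partialD (at0 hN hx) i)
      have d2 := ContDiffAt.dAt (contDiffAt_partialD (at0 hF hx) i)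
      have d3 := differentiableAt_norm hx
      have d4 := ContDiffAt.dAt (at0 hF hx)
      rw [partialD_congr_of_mem isOpen_ne_zero (h1 i) hx, partialD_add (d1.fun_mul d4) (d3.fun_mul d2),
        partialD_mul d1 d4, partialD_mul d3 d2, partialD_norm hx]
      ring
    have he : ∑ j, x j * partialD j F x = 0 := by
      simpa using euler_of_homogeneous 0 hx (ContDiffAt.dAt (at0 hF hx)) (by
        intro c hc y _
        simp [hFdef, direction_smul hc])
    simp only [h2, Finset.sum_add_distrib, ← Finset.mul_sum, ← Finset.sum_mul]
    rw [he, sum_partialD_partialD_norm hx, sum_partialD_eigenfunction hf hx]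
    field_simp
    ring
  have hGhom : ∀ c : ℝ, 0 < c → ∀ y, y ≠ 0 → G (c • y) = c ^ 1 * G y := by
    intro c hc y _
    simp only [hGdef, hFdef, direction_smul hc, norm_smul, Real.norm_of_nonneg hc.le]
    ring
  have hderiv : ∀ i, ∃ a, ∀ x, x ≠ 0 → partialD i G x = a := by
    intro i
    refine exists_const_of_harmonic (contDiffOn_partialD isOpen_ne_zero hG i) ?_ ?_
    · intro c hc y hy
      rw [partialD_smul_of_homogeneous isOpen_ne_zero hc.ne' (fun z hz => hGhom c hc z hz) hy
        (ContDiffAt.dAt (at0 hG hy)) (ContDiffAt.dAt (at0 hG (smul_ne_zero hc.ne' hy)))]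
      field_simp
    · intro x hx
      have h1 : ∀ j, partialD j (partialD j (partialD i G)) x =
          partialD i (partialD j (partialD j G)) x := by
        intro j
        rw [partialD_congr_of_mem isOpen_ne_zero
          (fun y hy => partialD_comm (at0 hG hy) j i) hx]
        exact partialD_comm (contDiffAt_partialD (at0 hG hx) j) j i
      simp only [h1]
      rw [← partialD_sum (fun j _ => ContDiffAt.dAt (contDiffAt_partialD
        (contDiffAt_partialD (at0 hG hx) j) j)),
        partialD_congr_of_mem isOpen_ne_zero (g := fun _ => 0) hharm hx]
      simp
  choose ξ hξ using hderiv
  refine ⟨WithLp.toLp 2 ξ, fun y => ?_⟩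
  have hy1 : ‖(y : E 3)‖ = 1 := by simp
  have hy0 : (y : E 3) ≠ 0 := by
    intro h; simp [h] at hy1
  have h1 := euler_of_homogeneous 1 hy0 (ContDiffAt.dAt (at0 hG hy0)) hGhom
  simp only [hξ _ _ hy0] at h1
  simp only [hGdef, hFdef, hy1, direction_coe_sphere, Nat.cast_one, one_mul] at h1
  rw [← h1]
  exact Finset.sum_congr rfl fun i _ => mul_comm _ _

theorem exists_affine_of_isComb {f : S2 → ℝ} (hf : IsCombFirstFourEigenfunctions f) :
    ∃ (c : ℝ) (ξ : E 3), ∀ y : S2, f y = c + ∑ i, ξ i * (y : E 3) i := by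
  obtain ⟨f₀, f₁, h₀, h₁, h⟩ := hf
  obtain ⟨ξ, hξ⟩ := eigenfunction_two_eq_linear h₁
  obtain ⟨c, hc⟩ := exists_const_of_harmonic (contDiffOn_comp_direction_of_contMDiff h₀.1)
    (fun c hc y _ => by rw [direction_smul hc]) (fun x hx => by
      rw [sum_partialD_eigenfunction h₀ hx]; simp)
  refine ⟨c, ξ, fun y => ?_⟩
  have hy0 : (y : E 3) ≠ 0 := by
    intro h0
    have hy1 : ‖(y : E 3)‖ = 1 := by simp
    simp [h0] at hy1
  have := hc y hy0
  rw [direction_coe_sphere] at this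
  rw [h y, this, hξ y]

end SchwarzschildCMC

namespace SchwarzschildCMC

open Set Filter Topology

/-! ### The Gauss equation in coordinates -/

section MatrixCalculus

variable {n : ℕ} {α β κ : Type*}

/-- The entrywise partial derivative of a matrix valued function. -/
noncomputable def pdM (i : Fin n) (M : E n → Matrix α β ℝ) (x : E n) : Matrix α β ℝ :=
  Matrix.of fun a b => partialD i (fun y => M y a b) x

/-- Entrywise smoothness of a matrix valued function at a point. -/
def SmoothM (M : E n → Matrix α β ℝ) (x : E n) : Prop :=
  ∀ a b, ContDiffAt ℝ ∞ (fun y => M y a b) x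

variable {x : E n} {i j : Fin n}

theorem pdM_apply (M : E n → Matrix α β ℝ) (a : α) (b : β) :
    pdM i M x a b = partialD i (fun y => M y a b) x := rfl

theorem SmoothM.pdM {M : E n → Matrix α β ℝ} (h : SmoothM M x) (i : Fin n) :
    SmoothM (pdM i M) x := fun a b => contDiffAt_partialD (h a b) i

theorem SmoothM.add {M N : E n → Matrix α β ℝ} (hM : SmoothM M x) (hN : SmoothM N x) :
    SmoothM (fun y => M y + N y) x := fun a b => (hM a b).add (hN a b)

theorem SmoothM.sub {M N : E n → Matrix α β ℝ} (hM : SmoothM M x) (hN : SmoothM N x) :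
    SmoothM (fun y => M y - N y) x := fun a b => (hM a b).sub (hN a b)

theorem SmoothM.transpose {M : E n → Matrix α β ℝ} (hM : SmoothM M x) :
    SmoothM (fun y => (M y)ᵀ) x := fun a b => hM b a

theorem SmoothM.mul [Fintype β] {M : E n → Matrix α β ℝ} {N : E n → Matrix β κ ℝ} (hM : SmoothM M x)
    (hN : SmoothM N x) : SmoothM (fun y => M y * N y) x := fun a c => by
  simp only [Matrix.mul_apply]
  exact ContDiffAt.sum fun b _ => (hM a b).mul (hN b c)

theorem pdM_congr {M N : E n → Matrix α β ℝ} (h : M =ᶠ[𝓝 x] N) : pdM i M x = pdM i N x := by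
  ext a b
  exact partialD_congr (by filter_upwards [h] with y hy; rw [hy]) i

theorem pdM_add {M N : E n → Matrix α β ℝ} (hM : SmoothM M x) (hN : SmoothM N x) :
    pdM i (fun y => M y + N y) x = pdM i M x + pdM i N x := by
  ext a b
  exact partialD_add (ContDiffAt.dAt (hM a b)) (ContDiffAt.dAt (hN a b)) i

theorem pdM_sub {M N : E n → Matrix α β ℝ} (hM : SmoothM M x) (hN : SmoothM N x) :
    pdM i (fun y => M y - N y) x = pdM i M x - pdM i N x := by
  ext a b
  exact partialD_sub (ContDiffAt.dAt (hM a b)) (ContDiffAt.dAt (hN a b)) i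

theorem pdM_mul [Fintype β] {M : E n → Matrix α β ℝ} {N : E n → Matrix β κ ℝ} (hM : SmoothM M x)
    (hN : SmoothM N x) :
    pdM i (fun y => M y * N y) x = pdM i M x * N x + M x * pdM i N x := by
  ext a c
  simp only [pdM_apply, Matrix.mul_apply, Matrix.add_apply]
  rw [partialD_sum fun b _ => (ContDiffAt.dAt (hM a b)).fun_mul (ContDiffAt.dAt (hN b c)),
    ← Finset.sum_add_distrib]
  exact Finset.sum_congr rfl fun b _ =>
    partialD_mul (ContDiffAt.dAt (hM a b)) (ContDiffAt.dAt (hN b c)) i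

theorem pdM_transpose (M : E n → Matrix α β ℝ) : pdM i (fun y => (M y)ᵀ) x = (pdM i M x)ᵀ := rfl

theorem pdM_comm {M : E n → Matrix α β ℝ} (hM : SmoothM M x) :
    pdM i (pdM j M) x = pdM j (pdM i M) x := by
  ext a b
  exact partialD_comm (hM a b) i j

theorem SmoothM.inv {m : ℕ} {M : E n → Matrix (Fin m) (Fin m) ℝ} (hM : SmoothM M x)
    (hdet : IsUnit (M x).det) : SmoothM (fun y => (M y)⁻¹) x := by
  have hdetc : ∀ {N : E n → Matrix (Fin m) (Fin m) ℝ}, SmoothM N x →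
      ContDiffAt ℝ ∞ (fun y => (N y).det) x := by
    intro N hN
    simp only [Matrix.det_apply]
    exact ContDiffAt.sum fun σ _ => (contDiffAt_prod fun i _ => hN _ _).const_smul _
  intro a b
  simp only [Matrix.inv_def, Matrix.smul_apply, Ring.inverse_eq_inv', smul_eq_mul]
  refine ((hdetc hM).inv hdet.ne_zero).mul ?_
  simp only [Matrix.adjugate_apply]
  refine hdetc fun c d => ?_
  by_cases h : c = b
  · subst h
    simp only [Matrix.updateRow_self]
    exact contDiffAt_const
  · simp only [Matrix.updateRow_ne h]
    exact hM c d

end MatrixCalculus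

section Connection

variable {n : ℕ} {g : E n → Matrix (Fin n) (Fin n) ℝ} {O : Set (E n)} {x : E n}

/-- A smooth semi-Riemannian metric on an open set of coordinate space. -/
structure IsMetricOn (g : E n → Matrix (Fin n) (Fin n) ℝ) (O : Set (E n)) : Prop where
  isOpen : IsOpen O
  smooth : ∀ x ∈ O, SmoothM g x
  symm : ∀ x ∈ O, (g x)ᵀ = g x
  det : ∀ x ∈ O, IsUnit (g x).det

/-- The connection matrices `(Γ_i)^a_b = Γ^a_{ib}`. -/
noncomputable def conn (g : E n → Matrix (Fin n) (Fin n) ℝ) (i : Fin n) (x : E n) :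
    Matrix (Fin n) (Fin n) ℝ :=
  Matrix.of fun a b => christoffel g a i b x

/-- The curvature matrices `(R_{cd})^a_b = R^a_{bcd}`. -/
noncomputable def curv (g : E n → Matrix (Fin n) (Fin n) ℝ) (c d : Fin n) (x : E n) :
    Matrix (Fin n) (Fin n) ℝ :=
  pdM c (conn g d) x - pdM d (conn g c) x + (conn g c x * conn g d x - conn g d x * conn g c x)

theorem IsMetricOn.apply_comm (h : IsMetricOn g O) (hx : x ∈ O) (a b : Fin n) :
    g x a b = g x b a := by
  conv_lhs => rw [← h.symm x hx]
  rfl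

theorem IsMetricOn.partialD_comm (h : IsMetricOn g O) (hx : x ∈ O) (i a b : Fin n) :
    partialD i (fun y => g y a b) x = partialD i (fun y => g y b a) x :=
  partialD_congr_of_mem h.isOpen (fun _ hy => h.apply_comm hy a b) hx i

theorem IsMetricOn.christoffel_comm (h : IsMetricOn g O) (hx : x ∈ O) (k i j : Fin n) :
    christoffel g k i j x = christoffel g k j i x := by
  simp only [christoffel]
  congr 1
  refine Finset.sum_congr rfl fun l _ => ?_
  rw [h.partialD_comm hx l i j]
  ring

theorem IsMetricOn.smooth_conn (h : IsMetricOn g O) (hx : x ∈ O) (i : Fin n) :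
    SmoothM (conn g i) x := fun a b => by
  have hd : ∀ i a b, ContDiffAt ℝ ∞ (partialD i fun y => g y a b) x := fun i a b =>
    contDiffAt_partialD (h.smooth x hx a b) i
  have hi := (h.smooth x hx).inv (h.det x hx)
  exact contDiffAt_const.mul (ContDiffAt.sum fun l _ => (hi a l).mul
    (((hd _ _ _).add (hd _ _ _)).sub (hd _ _ _)))

/-- The Christoffel symbols of the first kind. -/
theorem IsMetricOn.lower_christoffel (h : IsMetricOn g O) (hx : x ∈ O) (a i j : Fin n) :
    ∑ k, g x a k * christoffel g k i j x = (1 / 2) * (partialD i (fun y => g y j a) x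
      + partialD j (fun y => g y i a) x - partialD a (fun y => g y i j) x) := by
  have h1 : g x * (g x)⁻¹ = 1 := Matrix.mul_nonsing_inv _ (h.det x hx)
  simp only [christoffel, Finset.mul_sum]
  rw [Finset.sum_comm]
  have h2 : ∀ l, ∑ k, g x a k * (g x)⁻¹ k l = if a = l then 1 else 0 := fun l => by
    rw [← Matrix.mul_apply, h1, Matrix.one_apply]
  calc _ = ∑ l, (∑ k, g x a k * (g x)⁻¹ k l) * ((1 / 2) * (partialD i (fun y => g y j l) x
      + partialD j (fun y => g y i l) x - partialD l (fun y => g y i j) x)) := by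
        refine Finset.sum_congr rfl fun l _ => ?_
        rw [Finset.sum_mul]
        exact Finset.sum_congr rfl fun k _ => by ring
    _ = _ := by simp [h2]

/-- The Levi-Civita connection is metric. -/
theorem IsMetricOn.pdM_eq (h : IsMetricOn g O) (hx : x ∈ O) (c : Fin n) :
    pdM c g x = (conn g c x)ᵀ * g x + g x * conn g c x := by
  ext a b
  have h1 := h.lower_christoffel hx a c b
  have h2 := h.lower_christoffel hx b c a
  have h3 : ((conn g c x)ᵀ * g x) a b = ∑ k, g x b k * christoffel g k c a x := by
    rw [Matrix.mul_apply]
    refine Finset.sum_congr rfl fun k _ => ?_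
    rw [h.apply_comm hx b k, mul_comm]
    rfl
  have h4 : (g x * conn g c x) a b = ∑ k, g x a k * christoffel g k c b x := rfl
  rw [Matrix.add_apply, h3, h4, h1, h2, pdM_apply, h.partialD_comm hx c b a,
    h.partialD_comm hx a c b, h.partialD_comm hx a b c]
  rw [h.partialD_comm hx a c b, h.partialD_comm hx b c a]
  ring

theorem curv_antisymm (g : E n → Matrix (Fin n) (Fin n) ℝ) (c d : Fin n) (x : E n) :
    curv g c d x = -curv g d c x := by
  simp only [curv]; abel

/-- The curvature is skew with respect to the metric. -/
theorem IsMetricOn.curv_skew (h : IsMetricOn g O) (hx : x ∈ O) (c d : Fin n) :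
    (curv g c d x)ᵀ * g x = -(g x * curv g c d x) := by
  have hev : ∀ d, pdM d g =ᶠ[𝓝 x] fun y => (conn g d y)ᵀ * g y + g y * conn g d y := fun d =>
    eventuallyEq_of_mem (h.isOpen.mem_nhds hx) fun y hy => h.pdM_eq hy d
  have hs := h.smooth x hx
  have hC := fun d => h.smooth_conn hx d
  have key : ∀ c d, pdM c (pdM d g) x = (pdM c (conn g d) x)ᵀ * g x
      + (conn g d x)ᵀ * ((conn g c x)ᵀ * g x + g x * conn g c x)
      + (((conn g c x)ᵀ * g x + g x * conn g c x) * conn g d x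
        + g x * pdM c (conn g d) x) := by
    intro c d
    rw [pdM_congr (hev d), pdM_add ((hC d).transpose.mul hs) (hs.mul (hC d)),
      pdM_mul (hC d).transpose hs, pdM_mul hs (hC d), h.pdM_eq hx c, pdM_transpose]
  have h1 := key c d
  rw [pdM_comm hs, key d c] at h1
  rw [← sub_eq_zero] at h1 ⊢
  simp only [curv, Matrix.transpose_add, Matrix.transpose_sub, Matrix.transpose_mul]
  rw [← neg_eq_zero, ← h1]
  noncomm_ring

theorem IsMetricOn.ricci_eq (h : IsMetricOn g O) (hx : x ∈ O) (i j : Fin n) :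
    ricci g i j x = ∑ k, curv g k j x k i := by
  refine Finset.sum_congr rfl fun k _ => ?_
  simp only [curv, Matrix.add_apply, Matrix.sub_apply, Matrix.mul_apply, pdM_apply, conn,
    Matrix.of_apply]
  rw [partialD_congr_of_mem h.isOpen (fun y hy => h.christoffel_comm hy k i j) hx k,
    partialD_congr_of_mem h.isOpen (fun y hy => h.christoffel_comm hy k i k) hx j,
    Finset.sum_sub_distrib]
  congr 1
  congr 1
  · exact Finset.sum_congr rfl fun l _ => by rw [h.christoffel_comm hx l i j]
  · exact Finset.sum_congr rfl fun l _ => by rw [h.christoffel_comm hx l i k]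

end Connection

section Immersion

variable {n : ℕ} {g : E (n + 1) → Matrix (Fin (n + 1)) (Fin (n + 1)) ℝ} {O : Set (E (n + 1))}
  {X : E n → E (n + 1)} {U : Set (E n)} {x : E n}

/-- The Jacobian matrix of a map. -/
noncomputable def jac (X : E n → E (n + 1)) (x : E n) : Matrix (Fin (n + 1)) (Fin n) ℝ :=
  Matrix.of fun a i => partialD i (fun y => X y a) x

/-- The connection matrices pulled back by a map. -/
noncomputable def pullConn (g : E (n + 1) → Matrix (Fin (n + 1)) (Fin (n + 1)) ℝ)
    (X : E n → E (n + 1)) (i : Fin n) (x : E n) : Matrix (Fin (n + 1)) (Fin (n + 1)) ℝ :=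
  ∑ c, jac X x c i • conn g c (X x)

/-- A smooth map from an open set into the domain of a metric. -/
structure IsMapInto (X : E n → E (n + 1)) (U : Set (E n)) (O : Set (E (n + 1))) : Prop where
  isOpen : IsOpen U
  smooth : ∀ x ∈ U, ∀ a, ContDiffAt ℝ ∞ (fun y => X y a) x
  mapsTo : ∀ x ∈ U, X x ∈ O

theorem inducedMetric_eq (g : E (n + 1) → Matrix (Fin (n + 1)) (Fin (n + 1)) ℝ)
    (X : E n → E (n + 1)) (x : E n) :
    inducedMetric g X x = (jac X x)ᵀ * g (X x) * jac X x := by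
  ext i j
  simp only [inducedMetric, Matrix.of_apply, Matrix.mul_apply, Matrix.transpose_apply, jac,
    Finset.sum_mul]
  rw [Finset.sum_comm]
  exact Finset.sum_congr rfl fun a _ => Finset.sum_congr rfl fun b _ => by ring

theorem IsMapInto.contDiffAt (h : IsMapInto X U O) (hx : x ∈ U) : ContDiffAt ℝ ∞ X x :=
  contDiffAt_euclidean.2 fun a => h.smooth x hx a

theorem IsMapInto.smooth_jac (h : IsMapInto X U O) (hx : x ∈ U) : SmoothM (jac X) x :=
  fun a i => contDiffAt_partialD (h.smooth x hx a) i

/-- The chain rule for partial derivatives. -/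
theorem IsMapInto.chain (h : IsMapInto X U O) (hx : x ∈ U) {f : E (n + 1) → ℝ}
    (hf : ContDiffAt ℝ ∞ f (X x)) (i : Fin n) :
    partialD i (fun y => f (X y)) x = ∑ c, jac X x c i * partialD c f (X x) := by
  have h1 := (ContDiffAt.dAt hf).hasFDerivAt.comp x (ContDiffAt.dAt (h.contDiffAt hx)).hasFDerivAt
  rw [HasFDerivAt.partialD_eq (f := fun y => f (X y)) h1, ContinuousLinearMap.comp_apply,
    fderiv_apply_eq_sum]
  refine Finset.sum_congr rfl fun c _ => ?_
  congr 1
  have h2 : HasFDerivAt (fun y => X y c) ((EuclideanSpace.proj (𝕜 := ℝ) c).comp (fderiv ℝ X x)) x :=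
    (EuclideanSpace.proj (𝕜 := ℝ) c : E (n + 1) →L[ℝ] ℝ).hasFDerivAt.comp x
      (ContDiffAt.dAt (h.contDiffAt hx)).hasFDerivAt
  rw [jac, Matrix.of_apply, HasFDerivAt.partialD_eq h2]
  rfl

theorem IsMapInto.smooth_comp (h : IsMapInto X U O) (hx : x ∈ U) {α β : Type*}
    {M : E (n + 1) → Matrix α β ℝ} (hM : SmoothM M (X x)) : SmoothM (fun y => M (X y)) x :=
  fun a b => (hM a b).comp x (h.contDiffAt hx)

theorem IsMapInto.pdM_comp (h : IsMapInto X U O) (hx : x ∈ U) {α β : Type*}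
    {M : E (n + 1) → Matrix α β ℝ} (hM : SmoothM M (X x)) (i : Fin n) :
    pdM i (fun y => M (X y)) x = ∑ c, jac X x c i • pdM c M (X x) := by
  ext a b
  rw [pdM_apply, h.chain hx (hM a b), Matrix.sum_apply]
  rfl

theorem IsMapInto.pdM_metric (h : IsMapInto X U O) (hg : IsMetricOn g O) (hx : x ∈ U)
    (i : Fin n) : pdM i (fun y => g (X y)) x =
      (pullConn g X i x)ᵀ * g (X x) + g (X x) * pullConn g X i x := by
  rw [h.pdM_comp hx (hg.smooth _ (h.mapsTo x hx))]
  simp only [hg.pdM_eq (h.mapsTo x hx), smul_add, Finset.sum_add_distrib, pullConn,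
    Matrix.transpose_sum, Matrix.transpose_smul, Matrix.sum_mul, Matrix.mul_sum, Matrix.smul_mul,
    Matrix.mul_smul]

theorem IsMapInto.smooth_pullConn (h : IsMapInto X U O) (hg : IsMetricOn g O) (hx : x ∈ U)
    (i : Fin n) : SmoothM (pullConn g X i) x := fun a b => by
  have : (fun y => pullConn g X i y a b) = fun y => ∑ c, jac X y c i * conn g c (X y) a b := by
    ext y; simp [pullConn, Matrix.sum_apply]
  rw [this]
  exact ContDiffAt.sum fun c _ => (h.smooth_jac hx c i).mul
    (h.smooth_comp hx (hg.smooth_conn (h.mapsTo x hx) c) a b)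

theorem IsMapInto.pdM_pullConn (h : IsMapInto X U O) (hg : IsMetricOn g O) (hx : x ∈ U)
    (i j : Fin n) : pdM i (pullConn g X j) x =
      ∑ c, partialD i (partialD j fun y => X y c) x • conn g c (X x)
      + ∑ d, ∑ c, (jac X x c i * jac X x d j) • pdM c (conn g d) (X x) := by
  ext a b
  have : (fun y => pullConn g X j y a b) = fun y => ∑ c, jac X y c j * conn g c (X y) a b := by
    ext y; simp [pullConn, Matrix.sum_apply]
  have hc := fun c => h.smooth_comp hx (hg.smooth_conn (h.mapsTo x hx) c) a b
  rw [pdM_apply, this, partialD_sum fun c _ => (ContDiffAt.dAt (h.smooth_jac hx c j)).fun_mul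
    (ContDiffAt.dAt (hc c)), Matrix.add_apply, Matrix.sum_apply, Matrix.sum_apply,
    ← Finset.sum_add_distrib]
  refine Finset.sum_congr rfl fun c _ => ?_
  rw [partialD_mul (ContDiffAt.dAt (h.smooth_jac hx c j)) (ContDiffAt.dAt (hc c)),
    h.chain hx (hg.smooth_conn (h.mapsTo x hx) c a b), Matrix.sum_apply, Finset.mul_sum]
  congr 1
  refine Finset.sum_congr rfl fun d _ => ?_
  simp only [Matrix.smul_apply, smul_eq_mul, pdM_apply]
  ring

/-- The curvature of the pulled back connection is the pulled back curvature. -/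
theorem IsMapInto.pull_curv (h : IsMapInto X U O) (hg : IsMetricOn g O) (hx : x ∈ U)
    (i j : Fin n) :
    pdM i (pullConn g X j) x - pdM j (pullConn g X i) x
      + (pullConn g X i x * pullConn g X j x - pullConn g X j x * pullConn g X i x) =
      ∑ c, ∑ d, (jac X x c i * jac X x d j) • curv g c d (X x) := by
  rw [h.pdM_pullConn hg hx, h.pdM_pullConn hg hx]
  have h1 : ∀ c, partialD i (partialD j fun y => X y c) x = partialD j (partialD i fun y => X y c) x :=
    fun c => SchwarzschildCMC.partialD_comm (h.smooth x hx c) i j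
  have h2 : ∀ i j, pullConn g X i x * pullConn g X j x =
      ∑ c, ∑ d, (jac X x c i * jac X x d j) • (conn g c (X x) * conn g d (X x)) := by
    intro i j
    simp only [pullConn, Finset.sum_mul_sum, smul_mul_smul_comm]
  have h3 : ∑ d, ∑ c, (jac X x c i * jac X x d j) • pdM c (conn g d) (X x) =
      ∑ c, ∑ d, (jac X x c i * jac X x d j) • pdM c (conn g d) (X x) := Finset.sum_comm
  have h4 : ∑ d, ∑ c, (jac X x c j * jac X x d i) • pdM c (conn g d) (X x) =
      ∑ c, ∑ d, (jac X x c i * jac X x d j) • pdM d (conn g c) (X x) :=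
    Finset.sum_congr rfl fun c _ => Finset.sum_congr rfl fun d _ => by rw [mul_comm]
  have h5 : ∑ c, ∑ d, (jac X x c j * jac X x d i) • (conn g c (X x) * conn g d (X x)) =
      ∑ c, ∑ d, (jac X x c i * jac X x d j) • (conn g d (X x) * conn g c (X x)) := by
    rw [Finset.sum_comm]
    exact Finset.sum_congr rfl fun c _ => Finset.sum_congr rfl fun d _ => by rw [mul_comm]
  simp only [h1, h2]
  rw [h3, h4, h5]
  simp only [curv, smul_add, smul_sub, Finset.sum_add_distrib, Finset.sum_sub_distrib]
  abel

/-- The part of `∇_{∂_i} ∂_j` which is not tangential, in matrix form. -/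
noncomputable def normalPart (g : E (n + 1) → Matrix (Fin (n + 1)) (Fin (n + 1)) ℝ)
    (X : E n → E (n + 1)) (i : Fin n) (x : E n) : Matrix (Fin (n + 1)) (Fin n) ℝ :=
  pdM i (jac X) x + pullConn g X i x * jac X x - jac X x * conn (inducedMetric g X) i x

/-- The symmetry of the covariant derivatives `∇_{∂_i} ∂_j`. -/
theorem IsMapInto.cov_comm (h : IsMapInto X U O) (hg : IsMetricOn g O) (hx : x ∈ U)
    (i j : Fin n) (a : Fin (n + 1)) :
    (pdM i (jac X) x + pullConn g X i x * jac X x) a j =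
      (pdM j (jac X) x + pullConn g X j x * jac X x) a i := by
  have h1 : pdM i (jac X) x a j = pdM j (jac X) x a i :=
    SchwarzschildCMC.partialD_comm (h.smooth x hx a) i j
  have h2 : ∀ i j, (pullConn g X i x * jac X x) a j =
      ∑ b, ∑ c, jac X x c i * jac X x b j * christoffel g a c b (X x) := by
    intro i j
    rw [Matrix.mul_apply]
    refine Finset.sum_congr rfl fun b _ => ?_
    rw [pullConn, Matrix.sum_apply, Finset.sum_mul]
    refine Finset.sum_congr rfl fun c _ => ?_
    simp only [Matrix.smul_apply, smul_eq_mul, conn, Matrix.of_apply]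
    ring
  rw [Matrix.add_apply, Matrix.add_apply, h1, h2, h2, Finset.sum_comm]
  congr 1
  refine Finset.sum_congr rfl fun b _ => Finset.sum_congr rfl fun c _ => ?_
  rw [hg.christoffel_comm (h.mapsTo x hx) a b c]
  ring

theorem IsMapInto.isMetricOn (h : IsMapInto X U O) (hg : IsMetricOn g O)
    (hdet : ∀ x ∈ U, IsUnit (inducedMetric g X x).det) : IsMetricOn (inducedMetric g X) U where
  isOpen := h.isOpen
  smooth x hx := by
    have h1 : inducedMetric g X = fun x => (jac X x)ᵀ * g (X x) * jac X x :=
      funext fun x => inducedMetric_eq g X x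
    rw [h1]
    exact ((h.smooth_jac hx).transpose.mul (h.smooth_comp hx (hg.smooth _ (h.mapsTo x hx)))).mul
      (h.smooth_jac hx)
  symm x hx := by
    rw [inducedMetric_eq, Matrix.transpose_mul, Matrix.transpose_mul, Matrix.transpose_transpose,
      hg.symm _ (h.mapsTo x hx), Matrix.mul_assoc]
  det := hdet

theorem IsMapInto.pdM_induced (h : IsMapInto X U O) (hg : IsMetricOn g O) (hx : x ∈ U)
    (i : Fin n) : pdM i (inducedMetric g X) x =
      (pdM i (jac X) x + pullConn g X i x * jac X x)ᵀ * g (X x) * jac X x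
      + (jac X x)ᵀ * g (X x) * (pdM i (jac X) x + pullConn g X i x * jac X x) := by
  have h1 : inducedMetric g X = fun x => (jac X x)ᵀ * g (X x) * jac X x :=
    funext fun x => inducedMetric_eq g X x
  have s1 := h.smooth_jac hx
  have s2 := h.smooth_comp hx (hg.smooth _ (h.mapsTo x hx))
  rw [h1, pdM_mul (s1.transpose.mul s2) s1, pdM_mul s1.transpose s2, h.pdM_metric hg hx,
    pdM_transpose]
  simp only [Matrix.transpose_add, Matrix.transpose_mul, Matrix.add_mul, Matrix.mul_add,
    Matrix.mul_assoc]
  abel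

/-- The Gauss formula: `normalPart` is orthogonal to the hypersurface. -/
theorem IsMapInto.normalPart_orthogonal (h : IsMapInto X U O) (hg : IsMetricOn g O)
    (hdet : ∀ x ∈ U, IsUnit (inducedMetric g X x).det) (hx : x ∈ U) (i : Fin n) :
    (jac X x)ᵀ * g (X x) * normalPart g X i x = 0 := by
  have hm := h.isMetricOn hg hdet
  set C : Fin n → Matrix (Fin n) (Fin n) ℝ := fun i =>
    (jac X x)ᵀ * g (X x) * (pdM i (jac X) x + pullConn g X i x * jac X x) with hC
  have hsym : ∀ i j l, C i l j = C j l i := by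
    intro i j l
    simp only [hC]
    rw [Matrix.mul_apply, Matrix.mul_apply]
    exact Finset.sum_congr rfl fun a _ => by rw [h.cov_comm hg hx i j a]
  have hpd : ∀ i, pdM i (inducedMetric g X) x = (C i)ᵀ + C i := by
    intro i
    rw [h.pdM_induced hg hx]
    congr 1
    simp only [hC]
    rw [Matrix.transpose_mul, Matrix.transpose_mul, Matrix.transpose_transpose,
      hg.symm _ (h.mapsTo x hx), Matrix.mul_assoc]
  have hpd' : ∀ i a b, partialD i (fun y => inducedMetric g X y a b) x = C i b a + C i a b :=
    fun i a b => by rw [← pdM_apply, hpd]; rfl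
  have key : inducedMetric g X x * conn (inducedMetric g X) i x = C i := by
    ext l j
    have h1 := hm.lower_christoffel hx l i j
    rw [hpd', hpd', hpd'] at h1
    rw [Matrix.mul_apply]
    refine h1.trans ?_
    rw [hsym i j l, hsym j l i, hsym i l j]
    ring
  rw [normalPart, Matrix.mul_sub, ← Matrix.mul_assoc, ← inducedMetric_eq, key, sub_self]

/-- The Gauss equation. -/
theorem IsMapInto.gauss (h : IsMapInto X U O) (hg : IsMetricOn g O)
    (hdet : ∀ x ∈ U, IsUnit (inducedMetric g X x).det) (hx : x ∈ U) (i j : Fin n) :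
    inducedMetric g X x * curv (inducedMetric g X) i j x =
      (jac X x)ᵀ * g (X x) * (∑ c, ∑ d, (jac X x c i * jac X x d j) • curv g c d (X x)) * jac X x
      + (normalPart g X i x)ᵀ * g (X x) * normalPart g X j x
      - (normalPart g X j x)ᵀ * g (X x) * normalPart g X i x := by
  have hm := h.isMetricOn hg hdet
  have sF := h.smooth_jac hx
  have sG := h.smooth_comp hx (hg.smooth _ (h.mapsTo x hx))
  have sΩ := fun i => h.smooth_pullConn hg hx i
  have sω := fun i => hm.smooth_conn hx i
  have sZ : ∀ i, SmoothM (normalPart g X i) x := fun i =>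
    ((sF.pdM i).add ((sΩ i).mul sF)).sub (sF.mul (sω i))
  have hF : ∀ i, pdM i (jac X) = fun y => jac X y * conn (inducedMetric g X) i y
      + normalPart g X i y - pullConn g X i y * jac X y := by
    intro i
    funext y
    rw [normalPart]
    abel
  -- the second derivatives of the immersion commute
  have key : ∀ i j, pdM i (pdM j (jac X)) x =
      (pdM i (jac X) x * conn (inducedMetric g X) j x
        + jac X x * pdM i (conn (inducedMetric g X) j) x) + pdM i (normalPart g X j) x
      - (pdM i (pullConn g X j) x * jac X x + pullConn g X j x * pdM i (jac X) x) := by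
    intro i j
    conv_lhs => rw [hF j]
    rw [pdM_sub ((sF.mul (sω j)).add (sZ j)) ((sΩ j).mul sF), pdM_add (sF.mul (sω j)) (sZ j),
      pdM_mul sF (sω j), pdM_mul (sΩ j) sF]
  have hcomm := pdM_comm (i := i) (j := j) sF
  rw [key i j, key j i] at hcomm
  -- differentiate the orthogonality of the normal part
  have horth : ∀ i j, (pdM i (jac X) x + pullConn g X i x * jac X x)ᵀ * g (X x) * normalPart g X j x
      + (jac X x)ᵀ * g (X x) * (pdM i (normalPart g X j) x
        + pullConn g X i x * normalPart g X j x) = 0 := by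
    intro i j
    have h1 : pdM i (fun y => (jac X y)ᵀ * g (X y) * normalPart g X j y) x = 0 := by
      rw [pdM_congr (N := fun _ => 0) (eventuallyEq_of_mem (h.isOpen.mem_nhds hx) fun y hy =>
        h.normalPart_orthogonal hg hdet hy j)]
      ext a b
      simp [pdM_apply]
    rw [pdM_mul (sF.transpose.mul sG) (sZ j), pdM_mul sF.transpose sG, h.pdM_metric hg hx,
      pdM_transpose] at h1
    rw [← h1]
    simp only [Matrix.transpose_add, Matrix.transpose_mul, Matrix.add_mul, Matrix.mul_add,
      Matrix.mul_assoc]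
    abel
  have horth' : ∀ i j, (jac X x)ᵀ * g (X x) * (pdM i (normalPart g X j) x
        + pullConn g X i x * normalPart g X j x) =
      -((normalPart g X i x)ᵀ * g (X x) * normalPart g X j x) := by
    intro i j
    have h1 := horth i j
    have h2 : pdM i (jac X) x + pullConn g X i x * jac X x =
        jac X x * conn (inducedMetric g X) i x + normalPart g X i x := by
      rw [normalPart]; abel
    have h3 := h.normalPart_orthogonal hg hdet hx j
    rw [h2, Matrix.transpose_add, Matrix.transpose_mul, Matrix.add_mul, Matrix.add_mul,
      Matrix.mul_assoc (conn (inducedMetric g X) i x)ᵀ, Matrix.mul_assoc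
      (conn (inducedMetric g X) i x)ᵀ, h3, Matrix.mul_zero, zero_add] at h1
    exact (eq_neg_of_add_eq_zero_right h1)
  have horthi := h.normalPart_orthogonal hg hdet hx
  have e1 := horth' i j
  have e2 := horth' j i
  rw [← h.pull_curv hg hx, inducedMetric_eq, curv]
  have h4 : ∀ i, pdM i (jac X) x = jac X x * conn (inducedMetric g X) i x
      + normalPart g X i x - pullConn g X i x * jac X x := fun i => congrFun (hF i) x
  rw [h4 i, h4 j] at hcomm
  have h5 := congrArg (fun M => (jac X x)ᵀ * g (X x) * M) (sub_eq_zero.2 hcomm)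
  rw [← sub_eq_zero, ← Matrix.mul_zero ((jac X x)ᵀ * g (X x)), ← h5]
  have e3 : (jac X x)ᵀ * g (X x) * normalPart g X i x * conn (inducedMetric g X) j x = 0 := by
    rw [horthi i, Matrix.zero_mul]
  have e4 : (jac X x)ᵀ * g (X x) * normalPart g X j x * conn (inducedMetric g X) i x = 0 := by
    rw [horthi j, Matrix.zero_mul]
  have e5 : (normalPart g X i x)ᵀ * g (X x) * normalPart g X j x =
    -((jac X x)ᵀ * g (X x) * (pdM i (normalPart g X j) x
        + pullConn g X i x * normalPart g X j x)) := by rw [e1, neg_neg]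
  have e6 : (normalPart g X j x)ᵀ * g (X x) * normalPart g X i x =
    -((jac X x)ᵀ * g (X x) * (pdM j (normalPart g X i) x
        + pullConn g X j x * normalPart g X i x)) := by rw [e2, neg_neg]
  rw [e5, e6, ← sub_eq_zero, ← sub_eq_zero.2 (e4.trans e3.symm)]
  simp only [Matrix.add_mul, Matrix.mul_add, Matrix.mul_sub, Matrix.sub_mul,
    Matrix.mul_assoc]
  abel

end Immersion

end SchwarzschildCMC

namespace SchwarzschildCMC

open Set Filter Topology

section GaussTrace

variable {n : ℕ} {g : E (n + 1) → Matrix (Fin (n + 1)) (Fin (n + 1)) ℝ} {O : Set (E (n + 1))}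
  {X : E n → E (n + 1)} {U : Set (E n)} {x : E n}

/-- The tangent vectors together with a timelike unit normal span the tangent space: the identity
is the sum of the projections. -/
theorem tangent_normal_decomposition {F : Matrix (Fin (n + 1)) (Fin n) ℝ}
    {G : Matrix (Fin (n + 1)) (Fin (n + 1)) ℝ} {N : Fin (n + 1) → ℝ}
    (hdet : IsUnit (Fᵀ * G * F).det) (h1 : Fᵀ *ᵥ (G *ᵥ N) = 0) (h2 : N ⬝ᵥ (G *ᵥ N) = -1) :
    F * (Fᵀ * G * F)⁻¹ * Fᵀ * G - Matrix.vecMulVec N (G *ᵥ N) = 1 := by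
  set w := G *ᵥ N with hw
  let M : Matrix (Fin (n + 1)) (Fin n ⊕ Unit) ℝ := Matrix.fromCols F (Matrix.replicateCol Unit N)
  let B : Matrix (Fin n ⊕ Unit) (Fin (n + 1)) ℝ :=
    Matrix.fromRows ((Fᵀ * G * F)⁻¹ * Fᵀ * G) (-Matrix.replicateRow Unit w)
  have hBM : B * M = 1 := by
    rw [Matrix.fromRows_mul_fromCols, ← Matrix.fromBlocks_one]
    congr 1
    · rw [Matrix.mul_assoc, Matrix.mul_assoc, ← Matrix.mul_assoc Fᵀ, Matrix.nonsing_inv_mul _ hdet]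
    · rw [← Matrix.replicateCol_mulVec, ← Matrix.mulVec_mulVec, ← hw, ← Matrix.mulVec_mulVec, h1,
        Matrix.mulVec_zero]
      rfl
    · rw [Matrix.neg_mul, ← Matrix.replicateRow_vecMul, ← Matrix.mulVec_transpose, h1]
      ext; simp
    · ext
      simp only [Matrix.neg_apply, Matrix.mul_apply, Matrix.replicateRow_apply,
        Matrix.replicateCol_apply, Matrix.one_apply_eq]
      simp only [neg_mul, Finset.sum_neg_distrib]
      rw [neg_eq_iff_eq_neg, ← h2]
      exact Finset.sum_congr rfl fun _ _ => mul_comm _ _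
  have hMB : M * B = 1 := (Matrix.mul_eq_one_comm_of_card_eq _ _ _ (by simp)).1 hBM
  rw [Matrix.fromCols_mul_fromRows, Matrix.mul_neg] at hMB
  rw [← hMB, sub_eq_add_neg]
  congr 1
  · simp only [Matrix.mul_assoc]
  · ext a b; simp [Matrix.vecMulVec_apply, Matrix.mul_apply]

theorem secondFundamentalForm_eq (hg : IsMetricOn g O) (hX : IsMapInto X U O) (hx : x ∈ U)
    (N : E n → E (n + 1)) (i j : Fin n) :
    secondFundamentalForm g X N x i j = -((g (X x) *ᵥ N x) ᵥ*
      (pdM i (jac X) x + pullConn g X i x * jac X x)) j := by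
  have h2 : ∀ b, (pdM i (jac X) x + pullConn g X i x * jac X x) b j =
      partialD i (partialD j fun y => X y b) x + ∑ c, ∑ d, christoffel g b c d (X x) *
          partialD i (fun y => X y c) x * partialD j (fun y => X y d) x := by
    intro b
    rw [Matrix.add_apply]
    congr 1
    rw [Matrix.mul_apply, Finset.sum_comm]
    refine Finset.sum_congr rfl fun d _ => ?_
    rw [pullConn, Matrix.sum_apply, Finset.sum_mul]
    refine Finset.sum_congr rfl fun c _ => ?_
    simp only [Matrix.smul_apply, smul_eq_mul, conn, Matrix.of_apply, jac]
    ring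
  simp only [secondFundamentalForm, Matrix.of_apply, Matrix.vecMul, dotProduct, h2, Matrix.mulVec]
  rw [Finset.sum_comm]
  simp only [Finset.sum_mul]
  congr 1
  refine Finset.sum_congr rfl fun b _ => Finset.sum_congr rfl fun a _ => ?_
  rw [hg.apply_comm (hX.mapsTo x hx) a b]

theorem sum_contract {m k : ℕ} (F : Matrix (Fin m) (Fin k) ℝ) (A B M : Matrix (Fin k) (Fin k) ℝ)
    (c d : Fin m) : (F * A * M * B * Fᵀ) c d =
      ∑ i, ∑ j, ∑ p, ∑ q, B i j * A p q * (F c p * F d j) * M q i := by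
  have h1 : (F * A * M * B * Fᵀ) c d = ∑ j, ∑ i, ∑ q, ∑ p,
      B i j * A p q * (F c p * F d j) * M q i := by
    simp only [Matrix.mul_apply, Finset.sum_mul, Matrix.transpose_apply]
    refine Finset.sum_congr rfl fun j _ => Finset.sum_congr rfl fun i _ =>
      Finset.sum_congr rfl fun q _ => Finset.sum_congr rfl fun p _ => by ring
  rw [h1, Finset.sum_comm]
  exact Finset.sum_congr rfl fun i _ => Finset.sum_congr rfl fun j _ => Finset.sum_comm

/-- The twice contracted Gauss equation for a spacelike hypersurface of a Ricci flat spacetime. -/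
theorem IsMapInto.scalarCurvature_eq (hX : IsMapInto X U O) (hg : IsMetricOn g O)
    (hdet : ∀ x ∈ U, IsUnit (inducedMetric g X x).det) (hx : x ∈ U)
    (hric : ∀ i j, ricci g i j (X x) = 0) (N : E n → E (n + 1))
    (h1 : (jac X x)ᵀ *ᵥ (g (X x) *ᵥ N x) = 0) (h2 : (N x).ofLp ⬝ᵥ (g (X x) *ᵥ N x) = -1) :
    scalarCurvature (inducedMetric g X) x =
      (∑ i, ∑ j, ∑ k, ∑ l, (inducedMetric g X x)⁻¹ i j * (inducedMetric g X x)⁻¹ k l *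
        secondFundamentalForm g X N x j l * secondFundamentalForm g X N x k i)
      - (∑ i, ∑ j, (inducedMetric g X x)⁻¹ i j * secondFundamentalForm g X N x i j) ^ 2 := by
  have hm := hX.isMetricOn hg hdet
  set F := jac X x with hF
  set G := g (X x) with hGdef
  set A := secondFundamentalForm g X N x with hA
  set v : Fin (n + 1) → ℝ := (N x).ofLp with hv
  set w := G *ᵥ v with hw
  have hGs : Gᵀ = G := hg.symm _ (hX.mapsTo x hx)
  have hGdet : IsUnit G.det := hg.det _ (hX.mapsTo x hx)
  have hγ : inducedMetric g X x = Fᵀ * G * F := inducedMetric_eq g X x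
  set H := (inducedMetric g X x)⁻¹ with hH
  have hdec : F * H * Fᵀ * G - Matrix.vecMulVec v w = 1 := by
    rw [hH, hγ]
    exact tangent_normal_decomposition (hγ ▸ hdet x hx) h1 h2
  have hwF : w ᵥ* F = 0 := by rw [← Matrix.mulVec_transpose]; exact h1
  -- the normal part is the second fundamental form times the normal
  have hZ : ∀ i, normalPart g X i x = Matrix.vecMulVec v (A i) := by
    intro i
    have e1 : w ᵥ* normalPart g X i x = -A i := by
      ext j
      rw [normalPart, Matrix.vecMul_sub, ← hF, ← Matrix.vecMul_vecMul, hwF, Matrix.zero_vecMul,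
        sub_zero, hA, Pi.neg_apply, secondFundamentalForm_eq hg hX hx, neg_neg]
    have horth : Fᵀ * G * normalPart g X i x = 0 := hX.normalPart_orthogonal hg hdet hx i
    have e2 := congrArg (fun M => M * normalPart g X i x) hdec
    simp only [Matrix.sub_mul, Matrix.one_mul] at e2
    rw [← e2, Matrix.vecMulVec_mul, e1, Matrix.mul_assoc (F * H), Matrix.mul_assoc (F * H),
      horth, Matrix.mul_zero, zero_sub, Matrix.vecMulVec_neg, neg_neg]
  set R : Fin (n + 1) → Fin (n + 1) → Matrix (Fin (n + 1)) (Fin (n + 1)) ℝ :=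
    fun c d => curv g c d (X x) with hR
  have hZZ : ∀ i j, (normalPart g X i x)ᵀ * G * normalPart g X j x =
      -Matrix.vecMulVec (A i) (A j) := by
    intro i j
    rw [hZ, hZ, Matrix.transpose_vecMulVec, Matrix.mul_assoc, Matrix.mul_vecMulVec,
      Matrix.vecMulVec_mul_vecMulVec, ← hw, h2]
    simp
  have hgauss : ∀ i j l k, (inducedMetric g X x * curv (inducedMetric g X) i j x) l k =
      (∑ c, ∑ d, F c i * F d j * (Fᵀ * G * R c d * F) l k) - A i l * A j k + A j l * A i k := by
    intro i j l k
    rw [hX.gauss hg hdet hx, hZZ, hZZ]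
    simp only [Matrix.sub_apply, Matrix.add_apply, Matrix.neg_apply, Matrix.vecMulVec_apply,
      Matrix.mul_sum, Matrix.sum_mul, Matrix.sum_apply, Matrix.mul_smul, Matrix.smul_mul,
      Matrix.smul_apply, smul_eq_mul, hR, hF, hGdef]
    ring
  have hricγ : ∀ i j, ricci (inducedMetric g X) i j x = ∑ k, ∑ l, H k l *
      (inducedMetric g X x * curv (inducedMetric g X) k j x) l i := by
    intro i j
    rw [hm.ricci_eq hx]
    refine Finset.sum_congr rfl fun k _ => ?_
    rw [← Matrix.mul_apply, ← Matrix.mul_assoc, Matrix.nonsing_inv_mul _ (hdet x hx),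
      Matrix.one_mul]
  -- the ambient curvature does not contribute
  have hRic : ∀ b d, ∑ c, R c d c b = 0 := fun b d => by
    rw [← hric b d, hg.ricci_eq (hX.mapsTo x hx)]
  have hQ : F * H * Fᵀ = G⁻¹ + Matrix.vecMulVec v v := by
    have e := congrArg (fun M => M * G⁻¹) hdec
    simp only [Matrix.sub_mul, Matrix.one_mul] at e
    rw [Matrix.mul_assoc (F * H * Fᵀ), Matrix.mul_nonsing_inv _ hGdet, Matrix.mul_one,
      Matrix.vecMulVec_mul, hw, ← Matrix.vecMul_transpose, hGs, Matrix.vecMul_vecMul,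
      Matrix.mul_nonsing_inv _ hGdet, Matrix.vecMul_one] at e
    rw [← e]; abel
  have hQG : F * H * Fᵀ * G = 1 + Matrix.vecMulVec v w := by rw [← hdec]; abel
  have hT : ∑ c, ∑ d, (F * H * (Fᵀ * G * R c d * F) * H * Fᵀ) c d = 0 := by
    have e1 : ∀ c d, F * H * (Fᵀ * G * R c d * F) * H * Fᵀ =
        R c d * G⁻¹ + Matrix.vecMulVec (R c d *ᵥ v) v
          + (Matrix.vecMulVec v (w ᵥ* R c d ᵥ* G⁻¹) + Matrix.vecMulVec v (w ᵥ* R c d) *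
            Matrix.vecMulVec v v) := by
      intro c d
      have : F * H * (Fᵀ * G * R c d * F) * H * Fᵀ =
          (F * H * Fᵀ * G) * R c d * (F * H * Fᵀ) := by simp only [Matrix.mul_assoc]
      rw [this, hQG, hQ, Matrix.add_mul, Matrix.one_mul, Matrix.add_mul, Matrix.mul_add,
        Matrix.mul_add, Matrix.mul_vecMulVec, Matrix.vecMulVec_mul, Matrix.vecMulVec_mul]
    have t1 : ∑ c, ∑ d, (R c d * G⁻¹) c d = 0 := by
      rw [Finset.sum_comm]
      refine Finset.sum_eq_zero fun d _ => ?_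
      simp only [Matrix.mul_apply]
      rw [Finset.sum_comm]
      refine Finset.sum_eq_zero fun b _ => ?_
      rw [← Finset.sum_mul, hRic, zero_mul]
    have t2 : ∀ d, ∑ c, (R c d *ᵥ v) c = 0 := by
      intro d
      simp only [Matrix.mulVec, dotProduct]
      rw [Finset.sum_comm]
      refine Finset.sum_eq_zero fun b _ => ?_
      rw [← Finset.sum_mul, hRic, zero_mul]
    have hskew : ∀ c d, w ᵥ* R c d = -((R c d *ᵥ v) ᵥ* G) := by
      intro c d
      have e := hg.curv_skew (hX.mapsTo x hx) c d
      rw [hw, ← Matrix.vecMul_transpose, hGs, Matrix.vecMul_vecMul, ← Matrix.vecMul_transpose,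
        Matrix.vecMul_vecMul]
      change v ᵥ* (g (X x) * curv g c d (X x)) = -(v ᵥ* ((curv g c d (X x))ᵀ * g (X x)))
      rw [e, Matrix.vecMul_neg, neg_neg]
    have t3 : ∀ c, ∑ d, (w ᵥ* R c d ᵥ* G⁻¹) d = 0 := by
      intro c
      have : ∀ d, w ᵥ* R c d ᵥ* G⁻¹ = R d c *ᵥ v := by
        intro d
        rw [hskew, Matrix.neg_vecMul, Matrix.vecMul_vecMul, Matrix.mul_nonsing_inv _ hGdet,
          Matrix.vecMul_one, hR]
        simp only
        rw [curv_antisymm, Matrix.neg_mulVec, neg_neg]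
      simp only [this, t2]
    have t4 : ∀ c d, (w ᵥ* R c d) ⬝ᵥ v = 0 := by
      intro c d
      have e1 : (w ᵥ* R c d) ⬝ᵥ v = w ⬝ᵥ (R c d *ᵥ v) := (Matrix.dotProduct_mulVec _ _ _).symm
      have e2 : (w ᵥ* R c d) ⬝ᵥ v = -((R c d *ᵥ v) ⬝ᵥ w) := by
        rw [hskew, neg_dotProduct, ← Matrix.dotProduct_mulVec]
      rw [dotProduct_comm (R c d *ᵥ v)] at e2
      linarith
    simp only [e1, Matrix.add_apply, Finset.sum_add_distrib, t1, zero_add]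
    simp only [Matrix.vecMulVec_mul_vecMulVec, t4, zero_smul, Matrix.vecMulVec_apply,
      Pi.zero_apply, mul_zero]
    rw [Finset.sum_comm]
    simp only [← Finset.sum_mul, t2, zero_mul, ← Finset.mul_sum, t3, mul_zero,
      Finset.sum_const_zero, add_zero]
  have hT' : ∑ i, ∑ j, ∑ k, ∑ l, H i j * H k l *
      (∑ c, ∑ d, F c k * F d j * (Fᵀ * G * R c d * F) l i) = 0 := by
    rw [← hT]
    simp only [sum_contract, Finset.mul_sum]
    simp only [Finset.sum_comm (s := (Finset.univ : Finset (Fin n)))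
      (t := (Finset.univ : Finset (Fin (n + 1))))]
    refine Finset.sum_congr rfl fun c _ => Finset.sum_congr rfl fun d _ =>
      Finset.sum_congr rfl fun i _ => Finset.sum_congr rfl fun j _ =>
      Finset.sum_congr rfl fun k _ => Finset.sum_congr rfl fun l _ => by ring
  have hHs : ∀ i j, H i j = H j i := by
    intro i j
    have : Hᵀ = H := by rw [hH, Matrix.transpose_nonsing_inv, hm.symm x hx]
    conv_lhs => rw [← this]
    rfl
  have hAs : ∀ i j, A i j = A j i := by
    intro i j
    rw [hA, secondFundamentalForm_eq hg hX hx, secondFundamentalForm_eq hg hX hx]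
    simp only [Matrix.vecMul, dotProduct, hX.cov_comm hg hx i j]
  have hS : scalarCurvature (inducedMetric g X) x = ∑ i, ∑ j, ∑ k, ∑ l, (H i j * H k l *
      (∑ c, ∑ d, F c k * F d j * (Fᵀ * G * R c d * F) l i)
      - (H k l * A k l) * (H i j * A i j) + H i j * H k l * A j l * A k i) := by
    rw [scalarCurvature]
    refine Finset.sum_congr rfl fun i _ => Finset.sum_congr rfl fun j _ => ?_
    rw [hricγ, Finset.mul_sum]
    refine Finset.sum_congr rfl fun k _ => ?_
    rw [Finset.mul_sum]
    refine Finset.sum_congr rfl fun l _ => ?_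
    rw [hgauss, hAs j i]
    ring
  rw [hS]
  simp only [Finset.sum_add_distrib, Finset.sum_sub_distrib]
  rw [hT']
  simp only [← Finset.sum_mul, ← Finset.mul_sum]
  ring

end GaussTrace

end SchwarzschildCMC

namespace SchwarzschildCMC

open Set Filter Topology

/-! ### The Schwarzschild metric is Ricci flat -/

/-- The region `r > 2m`, `r > 0`. -/
def outerRegion (m : ℝ) : Set (E 4) := {p | 2 * m < ‖spatial p‖ ∧ 0 < ‖spatial p‖}

theorem contDiff_spatial : ContDiff ℝ ∞ spatial := by
  rw [contDiff_euclidean]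
  intro i
  fin_cases i <;> simp [spatial] <;> fun_prop

theorem isOpen_outerRegion (m : ℝ) : IsOpen (outerRegion m) :=
  (isOpen_lt continuous_const contDiff_spatial.continuous.norm).inter
    (isOpen_lt continuous_const contDiff_spatial.continuous.norm)

theorem norm_spatial_sq (p : E 4) : ‖spatial p‖ ^ 2 = p 1 ^ 2 + p 2 ^ 2 + p 3 ^ 2 := by
  rw [EuclideanSpace.norm_sq_eq, Fin.sum_univ_three]
  simp [spatial]

/-- The metric `Π = r² σ`. -/
noncomputable def angular (p : E 4) (a b : Fin 4) : ℝ :=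
  (if a = b then 1 else 0) - dt a * dt b - dr p a * dr p b

theorem angular_comm (p : E 4) (a b : Fin 4) : angular p a b = angular p b a := by
  simp only [angular, eq_comm (a := a)]; ring

section Contractions

variable {p : E 4}

theorem sum_dt_mul (f : Fin 4 → ℝ) : ∑ a, dt a * f a = f 0 := by
  simp [dt]

theorem dr_zero (p : E 4) : dr p 0 = 0 := by simp [dr]

theorem sum_dt_dt : ∑ a, dt a * dt a = 1 := by simp [dt]

theorem sum_dt_dr (p : E 4) : ∑ a, dt a * dr p a = 0 := by rw [sum_dt_mul, dr_zero]

theorem sum_dr_dr (hp : 0 < ‖spatial p‖) : ∑ a, dr p a * dr p a = 1 := by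
  have := norm_spatial_sq p
  simp only [Fin.sum_univ_four, dr]
  simp only [if_true, Fin.reduceEq, if_false]
  field_simp
  linarith

theorem sum_dt_angular (p : E 4) (b : Fin 4) : ∑ a, dt a * angular p a b = 0 := by
  rw [sum_dt_mul, angular, dr_zero]
  simp [dt, eq_comm]

theorem sum_dr_angular (hp : 0 < ‖spatial p‖) (b : Fin 4) :
    ∑ a, dr p a * angular p a b = 0 := by
  have h1 : ∀ a, dr p a * angular p a b = (if a = b then dr p a else 0)
      - (dt a * dr p a) * dt b - (dr p a * dr p a) * dr p b := by
    intro a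
    simp only [angular]
    split_ifs <;> ring
  simp only [h1, Finset.sum_sub_distrib, ← Finset.sum_mul, sum_dt_dr, sum_dr_dr hp]
  simp

theorem sum_angular_self (hp : 0 < ‖spatial p‖) : ∑ a, angular p a a = 2 := by
  simp only [angular, if_true, Finset.sum_sub_distrib, sum_dt_dt, sum_dr_dr hp]
  simp
  norm_num

end Contractions

section Derivatives

variable {p : E 4}

theorem differentiableAt_norm_spatial (hp : 0 < ‖spatial p‖) :
    ContDiffAt ℝ ∞ (fun p : E 4 => ‖spatial p‖) p :=
  (contDiffAt_norm ℝ (norm_pos_iff.1 hp)).comp p contDiff_spatial.contDiffAt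

theorem partialD_norm_spatial (hp : 0 < ‖spatial p‖) (c : Fin 4) :
    partialD c (fun p : E 4 => ‖spatial p‖) p = dr p c := by
  have hd := ContDiffAt.dAt (differentiableAt_norm_spatial hp)
  have h1 := partialD_mul hd hd c
  have h2 : (fun p : E 4 => ‖spatial p‖ * ‖spatial p‖) =
      fun p => p 1 * p 1 + p 2 * p 2 + p 3 * p 3 := by
    ext p
    rw [← sq, norm_spatial_sq]; ring
  rw [h2, partialD_add (by fun_prop) (by fun_prop), partialD_add (by fun_prop) (by fun_prop),
    partialD_mul (by fun_prop) (by fun_prop), partialD_mul (by fun_prop) (by fun_prop),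
    partialD_mul (by fun_prop) (by fun_prop)] at h1
  simp only [partialD_coord] at h1
  rw [dr]
  split_ifs with hc
  · subst hc
    simp only [Fin.reduceEq, if_false, zero_mul, mul_zero, add_zero] at h1
    have h3 : partialD 0 (fun p : E 4 => ‖spatial p‖) p * ‖spatial p‖ = 0 := by linarith
    exact (mul_eq_zero.1 h3).resolve_right hp.ne'
  · rw [eq_div_iff hp.ne']
    fin_cases c <;> simp at h1 hc ⊢ <;> linarith

theorem contDiffAt_dr (hp : 0 < ‖spatial p‖) (a : Fin 4) : ContDiffAt ℝ ∞ (fun p => dr p a) p := by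
  by_cases ha : a = 0
  · simp only [dr, ha, if_true]
    exact contDiffAt_const
  · simp only [dr, ha, if_false]
    exact ContDiffAt.div (by fun_prop) (differentiableAt_norm_spatial hp) hp.ne'

theorem isOpen_norm_spatial_pos : IsOpen {p : E 4 | 0 < ‖spatial p‖} :=
  isOpen_lt continuous_const contDiff_spatial.continuous.norm

theorem partialD_dr (hp : 0 < ‖spatial p‖) (c a : Fin 4) :
    partialD c (fun p => dr p a) p = angular p c a / ‖spatial p‖ := by
  have hd := ContDiffAt.dAt (differentiableAt_norm_spatial hp)
  by_cases ha : a = 0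
  · subst ha
    simp only [dr_zero, partialD_const, angular, mul_zero, sub_zero]
    simp only [dt]
    split_ifs <;> simp
  · have h1 := partialD_mul (ContDiffAt.dAt (contDiffAt_dr hp a)) hd c
    have h2 : ∀ q ∈ {p : E 4 | 0 < ‖spatial p‖}, dr q a * ‖spatial q‖ = q a := by
      intro q (hq : 0 < ‖spatial q‖)
      simp only [dr, ha, if_false]
      field_simp
    rw [partialD_congr_of_mem isOpen_norm_spatial_pos h2 hp, partialD_coord,
      partialD_norm_spatial hp] at h1
    rw [eq_div_iff hp.ne', angular]
    simp only [dt, ha, if_false]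
    linarith

theorem partialD_angular (hp : 0 < ‖spatial p‖) (c a b : Fin 4) :
    partialD c (fun p => angular p a b) p =
      -(angular p c a * dr p b + dr p a * angular p c b) / ‖spatial p‖ := by
  have h1 := ContDiffAt.dAt (contDiffAt_dr hp a)
  have h2 := ContDiffAt.dAt (contDiffAt_dr hp b)
  simp only [angular]
  rw [partialD_sub (f := fun _ => (if a = b then (1 : ℝ) else 0) - dt a * dt b)
    (by fun_prop) (h1.fun_mul h2), partialD_mul h1 h2, partialD_const, partialD_dr hp,
    partialD_dr hp]
  simp only [angular]
  ring

theorem contDiffAt_angular (hp : 0 < ‖spatial p‖) (a b : Fin 4) :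
    ContDiffAt ℝ ∞ (fun p => angular p a b) p :=
  contDiffAt_const.sub ((contDiffAt_dr hp a).mul (contDiffAt_dr hp b))

/-- The derivative of a static, spherically symmetric expression. -/
theorem partialD_radial (hp : 0 < ‖spatial p‖) {u : ℝ → ℝ} {u' : ℝ}
    (hu : HasDerivAt u u' ‖spatial p‖) (c : Fin 4) :
    partialD c (fun p : E 4 => u ‖spatial p‖) p = u' * dr p c := by
  rw [partialD_comp (f := fun p : E 4 => ‖spatial p‖) hu (ContDiffAt.dAt (differentiableAt_norm_spatial hp)),
    partialD_norm_spatial hp]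

theorem differentiableAt_radial (hp : 0 < ‖spatial p‖) {u : ℝ → ℝ} {u' : ℝ}
    (hu : HasDerivAt u u' ‖spatial p‖) :
    DifferentiableAt ℝ (fun p : E 4 => u ‖spatial p‖) p :=
  hu.differentiableAt.comp p (ContDiffAt.dAt (differentiableAt_norm_spatial hp))

end Derivatives

/-- The inverse Schwarzschild metric. -/
noncomputable def schwarzschildInv (m : ℝ) (p : E 4) : Matrix (Fin 4) (Fin 4) ℝ :=
  Matrix.of fun a b => -(1 - 2 * m / ‖spatial p‖)⁻¹ * (dt a * dt b)
    + (1 - 2 * m / ‖spatial p‖) * (dr p a * dr p b) + angular p a b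

variable {m : ℝ} {p : E 4}

theorem lapse_pos (hp : p ∈ outerRegion m) : 0 < 1 - 2 * m / ‖spatial p‖ := by
  rw [sub_pos, div_lt_one hp.2]; exact hp.1

theorem schwarzschild_apply (m : ℝ) (p : E 4) (a b : Fin 4) : schwarzschild m p a b =
    -(1 - 2 * m / ‖spatial p‖) * (dt a * dt b)
      + (1 - 2 * m / ‖spatial p‖)⁻¹ * (dr p a * dr p b) + angular p a b := rfl

theorem sum_schwarzschildInv_dt (m : ℝ) (p : E 4) (a : Fin 4) :
    ∑ b, schwarzschildInv m p a b * dt b = -(1 - 2 * m / ‖spatial p‖)⁻¹ * dt a := by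
  have h1 : ∀ b, schwarzschildInv m p a b * dt b =
      -(1 - 2 * m / ‖spatial p‖)⁻¹ * dt a * (dt b * dt b)
      + (1 - 2 * m / ‖spatial p‖) * dr p a * (dt b * dr p b) + dt b * angular p b a := by
    intro b
    simp only [schwarzschildInv, Matrix.of_apply, angular_comm p b a]
    ring
  simp only [h1, Finset.sum_add_distrib, ← Finset.mul_sum, sum_dt_dt, sum_dt_dr, sum_dt_angular]
  ring

theorem sum_schwarzschildInv_dr (hp : p ∈ outerRegion m) (a : Fin 4) :
    ∑ b, schwarzschildInv m p a b * dr p b = (1 - 2 * m / ‖spatial p‖) * dr p a := by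
  have h1 : ∀ b, schwarzschildInv m p a b * dr p b =
      -(1 - 2 * m / ‖spatial p‖)⁻¹ * dt a * (dt b * dr p b)
      + (1 - 2 * m / ‖spatial p‖) * dr p a * (dr p b * dr p b) + dr p b * angular p b a := by
    intro b
    simp only [schwarzschildInv, Matrix.of_apply, angular_comm p b a]
    ring
  simp only [h1, Finset.sum_add_distrib, ← Finset.mul_sum, sum_dr_dr hp.2, sum_dt_dr,
    sum_dr_angular hp.2]
  ring

theorem schwarzschildInv_mul (hp : p ∈ outerRegion m) :
    schwarzschildInv m p * schwarzschild m p = 1 := by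
  ext a c
  rw [Matrix.mul_apply, Matrix.one_apply]
  have hh := (lapse_pos hp).ne'
  have h1 : ∀ b, schwarzschildInv m p a b * schwarzschild m p b c =
      -(1 - 2 * m / ‖spatial p‖) * dt c * (schwarzschildInv m p a b * dt b)
      + (1 - 2 * m / ‖spatial p‖)⁻¹ * dr p c * (schwarzschildInv m p a b * dr p b)
      + ((if b = c then schwarzschildInv m p a b else 0)
        - dt c * (schwarzschildInv m p a b * dt b)
        - dr p c * (schwarzschildInv m p a b * dr p b)) := by
    intro b
    rw [schwarzschild_apply, angular]
    split_ifs <;> ring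
  simp only [h1, Finset.sum_add_distrib, Finset.sum_sub_distrib, ← Finset.mul_sum,
    sum_schwarzschildInv_dt m p, sum_schwarzschildInv_dr hp, Finset.sum_ite_eq', Finset.mem_univ,
    if_true]
  simp only [schwarzschildInv, Matrix.of_apply, angular]
  field_simp
  ring

theorem schwarzschild_inv (hp : p ∈ outerRegion m) :
    (schwarzschild m p)⁻¹ = schwarzschildInv m p :=
  Matrix.inv_eq_left_inv (schwarzschildInv_mul hp)

theorem isMetricOn_schwarzschild (m : ℝ) : IsMetricOn (schwarzschild m) (outerRegion m) where
  isOpen := isOpen_outerRegion m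
  smooth p hp a b := by
    simp only [schwarzschild_apply]
    have h1 : ContDiffAt ℝ ∞ (fun p : E 4 => 1 - 2 * m / ‖spatial p‖) p :=
      contDiffAt_const.sub (contDiffAt_const.div (differentiableAt_norm_spatial hp.2) hp.2.ne')
    exact ((h1.neg.mul contDiffAt_const).add ((h1.inv (lapse_pos hp).ne').mul
      ((contDiffAt_dr hp.2 a).mul (contDiffAt_dr hp.2 b)))).add (contDiffAt_angular hp.2 a b)
  symm p _ := by
    ext a b
    rw [Matrix.transpose_apply, schwarzschild_apply, schwarzschild_apply, angular_comm p b a]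
    ring
  det p hp := Matrix.isUnit_det_of_left_inverse (schwarzschildInv_mul hp)

/-- The coefficient of `dt_k` in `Γ^k_{ij}`. -/
noncomputable def chrTime (m : ℝ) (i j : Fin 4) (p : E 4) : ℝ :=
  m / (‖spatial p‖ * (‖spatial p‖ - 2 * m)) * (dr p i * dt j + dr p j * dt i)

/-- The coefficient of `dr_k` in `Γ^k_{ij}`. -/
noncomputable def chrRadial (m : ℝ) (i j : Fin 4) (p : E 4) : ℝ :=
  m * (‖spatial p‖ - 2 * m) / ‖spatial p‖ ^ 3 * (dt i * dt j)
    + (-(m / (‖spatial p‖ * (‖spatial p‖ - 2 * m)))) * (dr p i * dr p j)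
    + 2 * m / ‖spatial p‖ ^ 2 * angular p i j

theorem christoffel_schwarzschild (hp : p ∈ outerRegion m) (k i j : Fin 4) :
    christoffel (schwarzschild m) k i j p = dt k * chrTime m i j p + dr p k * chrRadial m i j p := by
  have hr := hp.2
  have hr' : 0 < ‖spatial p‖ - 2 * m := sub_pos.2 hp.1
  have hh := (lapse_pos hp).ne'
  have hu : HasDerivAt (fun r : ℝ => 1 - 2 * m / r) (2 * m / ‖spatial p‖ ^ 2) ‖spatial p‖ := by
    have := ((hasDerivAt_inv hr.ne').const_mul (2 * m)).const_sub 1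
    refine this.congr_deriv ?_
    ring
  have hv := hu.inv hh
  have hpd : ∀ c a b, partialD c (fun q => schwarzschild m q a b) p =
      -(2 * m / ‖spatial p‖ ^ 2) * dr p c * (dt a * dt b)
      + (-(2 * m / ‖spatial p‖ ^ 2) / (1 - 2 * m / ‖spatial p‖) ^ 2) * dr p c * (dr p a * dr p b)
      + ((1 - 2 * m / ‖spatial p‖)⁻¹ - 1) / ‖spatial p‖ *
        (angular p c a * dr p b + angular p c b * dr p a) := by
    intro c a b
    simp only [schwarzschild_apply]
    have d1 := differentiableAt_radial hr hu
    have d2 := differentiableAt_radial hr hv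
    have e1 := partialD_radial hr hu c
    have e2 := partialD_radial hr hv c
    have d3 := ContDiffAt.dAt (contDiffAt_dr hr a)
    have d4 := ContDiffAt.dAt (contDiffAt_dr hr b)
    have d5 := ContDiffAt.dAt (contDiffAt_angular hr a b)
    simp only [Pi.inv_apply] at d2 e2
    rw [partialD_add ((d1.fun_neg.fun_mul (differentiableAt_const _)).fun_add
      (d2.fun_mul (d3.fun_mul d4))) d5, partialD_add (d1.fun_neg.fun_mul (differentiableAt_const _))
      (d2.fun_mul (d3.fun_mul d4)), partialD_mul d1.fun_neg (differentiableAt_const _),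
      partialD_neg, e1, partialD_mul d2 (d3.fun_mul d4), e2, partialD_mul d3 d4, partialD_dr hr,
      partialD_dr hr, partialD_angular hr, partialD_const]
    ring
  have hS : ∀ l, partialD i (fun q => schwarzschild m q j l) p
      + partialD j (fun q => schwarzschild m q i l) p - partialD l (fun q => schwarzschild m q i j) p
      = -(2 * m / ‖spatial p‖ ^ 2) * (dr p i * dt j + dr p j * dt i) * dt l
      + (2 * m / ‖spatial p‖ ^ 2 * (dt i * dt j)
        + (-(2 * m / ‖spatial p‖ ^ 2) / (1 - 2 * m / ‖spatial p‖) ^ 2) * (dr p i * dr p j)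
        + 2 * (((1 - 2 * m / ‖spatial p‖)⁻¹ - 1) / ‖spatial p‖) * angular p i j) * dr p l := by
    intro l
    rw [hpd, hpd, hpd, angular_comm p l i, angular_comm p l j, angular_comm p j i]
    ring
  have hs : ∀ l, (schwarzschild m p)⁻¹ k l * (partialD i (fun q => schwarzschild m q j l) p
      + partialD j (fun q => schwarzschild m q i l) p
      - partialD l (fun q => schwarzschild m q i j) p) =
      -(2 * m / ‖spatial p‖ ^ 2) * (dr p i * dt j + dr p j * dt i) *
        (schwarzschildInv m p k l * dt l)
      + (2 * m / ‖spatial p‖ ^ 2 * (dt i * dt j)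
        + (-(2 * m / ‖spatial p‖ ^ 2) / (1 - 2 * m / ‖spatial p‖) ^ 2) * (dr p i * dr p j)
        + 2 * (((1 - 2 * m / ‖spatial p‖)⁻¹ - 1) / ‖spatial p‖) * angular p i j) *
        (schwarzschildInv m p k l * dr p l) := by
    intro l
    rw [hS, schwarzschild_inv hp]
    ring
  simp only [christoffel, hs, Finset.sum_add_distrib, ← Finset.mul_sum,
    sum_schwarzschildInv_dt m p, sum_schwarzschildInv_dr hp]
  have e : 1 - 2 * m / ‖spatial p‖ = (‖spatial p‖ - 2 * m) / ‖spatial p‖ := by field_simp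
  rw [e, chrTime, chrRadial]
  field_simp
  ring

theorem hasDerivAt_chrTime_coeff (hp : p ∈ outerRegion m) : HasDerivAt (fun r : ℝ => m / (r * (r - 2 * m)))
    (-(m * (2 * ‖spatial p‖ - 2 * m)) / (‖spatial p‖ * (‖spatial p‖ - 2 * m)) ^ 2)
    ‖spatial p‖ := by
  have hr' : 0 < ‖spatial p‖ - 2 * m := sub_pos.2 hp.1
  have h1 : HasDerivAt (fun r : ℝ => r * (r - 2 * m)) (2 * ‖spatial p‖ - 2 * m) ‖spatial p‖ := by
    refine ((hasDerivAt_id ‖spatial p‖).mul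
      ((hasDerivAt_id ‖spatial p‖).sub_const (2 * m))).congr_deriv ?_
    simp only [id]; ring
  refine ((hasDerivAt_const _ m).div h1 (mul_pos hp.2 hr').ne').congr_deriv ?_
  ring

theorem hasDerivAt_chrRadial_coeff (hp : p ∈ outerRegion m) : HasDerivAt (fun r : ℝ => m * (r - 2 * m) / r ^ 3)
    (m * (6 * m - 2 * ‖spatial p‖) / ‖spatial p‖ ^ 4) ‖spatial p‖ := by
  have h1 : HasDerivAt (fun r : ℝ => m * (r - 2 * m)) m ‖spatial p‖ := by
    simpa using ((hasDerivAt_id ‖spatial p‖).sub_const (2 * m)).const_mul m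
  refine (h1.div (hasDerivAt_pow 3 _) (pow_pos hp.2 3).ne').congr_deriv ?_
  have := hp.2.ne'
  field_simp
  push_cast
  ring

theorem hasDerivAt_chrAngular_coeff (hp : p ∈ outerRegion m) : HasDerivAt (fun r : ℝ => 2 * m / r ^ 2)
    (-(4 * m) / ‖spatial p‖ ^ 3) ‖spatial p‖ := by
  refine ((hasDerivAt_const _ (2 * m)).div (hasDerivAt_pow 2 _) (pow_pos hp.2 2).ne').congr_deriv ?_
  have := hp.2.ne'
  field_simp
  push_cast
  ring

theorem partialD_chrTime (hp : p ∈ outerRegion m) (c i j : Fin 4) : DifferentiableAt ℝ (chrTime m i j) p ∧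
    partialD c (chrTime m i j) p =
    -(m * (2 * ‖spatial p‖ - 2 * m)) / (‖spatial p‖ * (‖spatial p‖ - 2 * m)) ^ 2 *
      (dr p i * dt j + dr p j * dt i) * dr p c
    + m / (‖spatial p‖ * (‖spatial p‖ - 2 * m)) / ‖spatial p‖ *
      (dt j * angular p c i + dt i * angular p c j) := by
  have hr := hp.2
  have hu := hasDerivAt_chrTime_coeff hp
  have d1 := differentiableAt_radial hr hu
  have e1 := partialD_radial hr hu c
  have d3 := ContDiffAt.dAt (contDiffAt_dr hr i)
  have d4 := ContDiffAt.dAt (contDiffAt_dr hr j)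
  have d5 := d3.fun_mul (differentiableAt_const (dt j))
  have d6 := d4.fun_mul (differentiableAt_const (dt i))
  refine ⟨d1.fun_mul (d5.fun_add d6), ?_⟩
  rw [show chrTime m i j = fun p => m / (‖spatial p‖ * (‖spatial p‖ - 2 * m)) *
    (dr p i * dt j + dr p j * dt i) from rfl, partialD_mul d1 (d5.fun_add d6), e1,
    partialD_add d5 d6, partialD_mul d3 (differentiableAt_const _),
    partialD_mul d4 (differentiableAt_const _), partialD_dr hr, partialD_dr hr, partialD_const,
    partialD_const]
  ring

theorem partialD_chrRadial (hp : p ∈ outerRegion m) (c i j : Fin 4) : DifferentiableAt ℝ (chrRadial m i j) p ∧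
    partialD c (chrRadial m i j) p =
    (m * (6 * m - 2 * ‖spatial p‖) / ‖spatial p‖ ^ 4 * (dt i * dt j)
      + (m * (2 * ‖spatial p‖ - 2 * m)) / (‖spatial p‖ * (‖spatial p‖ - 2 * m)) ^ 2 *
        (dr p i * dr p j)
      + -(4 * m) / ‖spatial p‖ ^ 3 * angular p i j) * dr p c
    + (-(m / (‖spatial p‖ * (‖spatial p‖ - 2 * m))) - 2 * m / ‖spatial p‖ ^ 2) / ‖spatial p‖ *
      (dr p j * angular p c i + dr p i * angular p c j) := by
  have hr := hp.2
  have hu := hasDerivAt_chrTime_coeff hp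
  have hv := hasDerivAt_chrRadial_coeff hp
  have hw := hasDerivAt_chrAngular_coeff hp
  have d1 := (differentiableAt_radial hr hu).fun_neg
  have e1 := partialD_radial hr hu c
  have d2 := differentiableAt_radial hr hv
  have e2 := partialD_radial hr hv c
  have d7 := differentiableAt_radial hr hw
  have e7 := partialD_radial hr hw c
  have d3 := ContDiffAt.dAt (contDiffAt_dr hr i)
  have d4 := ContDiffAt.dAt (contDiffAt_dr hr j)
  have d5 := ContDiffAt.dAt (contDiffAt_angular hr i j)
  have f1 := d2.fun_mul (differentiableAt_const (dt i * dt j))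
  have f2 := d1.fun_mul (d3.fun_mul d4)
  have f3 := d7.fun_mul d5
  refine ⟨(f1.fun_add f2).fun_add f3, ?_⟩
  rw [show chrRadial m i j = fun p => m * (‖spatial p‖ - 2 * m) / ‖spatial p‖ ^ 3 * (dt i * dt j)
    + (-(m / (‖spatial p‖ * (‖spatial p‖ - 2 * m)))) * (dr p i * dr p j)
    + 2 * m / ‖spatial p‖ ^ 2 * angular p i j from rfl, partialD_add (f1.fun_add f2) f3,
    partialD_add f1 f2, partialD_mul d2 (differentiableAt_const _), partialD_mul d1 (d3.fun_mul d4),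
    partialD_mul d7 d5, partialD_mul d3 d4, partialD_neg, e1, e2, e7, partialD_dr hr,
    partialD_dr hr, partialD_angular hr, partialD_const]
  ring

theorem sum_chrTime_dt (m : ℝ) (p : E 4) (i : Fin 4) : ∑ k, chrTime m i k p * dt k =
    m / (‖spatial p‖ * (‖spatial p‖ - 2 * m)) * dr p i := by
  have h1 : ∀ k, chrTime m i k p * dt k = m / (‖spatial p‖ * (‖spatial p‖ - 2 * m)) * dr p i *
      (dt k * dt k) + m / (‖spatial p‖ * (‖spatial p‖ - 2 * m)) * dt i * (dt k * dr p k) := by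
    intro k; rw [chrTime]; ring
  simp only [h1, Finset.sum_add_distrib, ← Finset.mul_sum, sum_dt_dt, sum_dt_dr]
  ring

theorem sum_chrTime_dr (hp : p ∈ outerRegion m) (i : Fin 4) : ∑ k, chrTime m i k p * dr p k =
    m / (‖spatial p‖ * (‖spatial p‖ - 2 * m)) * dt i := by
  have h1 : ∀ k, chrTime m i k p * dr p k = m / (‖spatial p‖ * (‖spatial p‖ - 2 * m)) * dr p i *
      (dt k * dr p k) + m / (‖spatial p‖ * (‖spatial p‖ - 2 * m)) * dt i * (dr p k * dr p k) := by
    intro k; rw [chrTime]; ring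
  simp only [h1, Finset.sum_add_distrib, ← Finset.mul_sum, sum_dr_dr hp.2, sum_dt_dr]
  ring

theorem sum_chrRadial_dt (m : ℝ) (p : E 4) (i : Fin 4) : ∑ k, chrRadial m i k p * dt k =
    m * (‖spatial p‖ - 2 * m) / ‖spatial p‖ ^ 3 * dt i := by
  have h1 : ∀ k, chrRadial m i k p * dt k =
      m * (‖spatial p‖ - 2 * m) / ‖spatial p‖ ^ 3 * dt i * (dt k * dt k)
      + (-(m / (‖spatial p‖ * (‖spatial p‖ - 2 * m)))) * dr p i * (dt k * dr p k)
      + 2 * m / ‖spatial p‖ ^ 2 * (dt k * angular p k i) := by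
    intro k; rw [chrRadial, angular_comm p k i]; ring
  simp only [h1, Finset.sum_add_distrib, ← Finset.mul_sum, sum_dt_dt, sum_dt_dr, sum_dt_angular]
  ring

theorem sum_chrRadial_dr (hp : p ∈ outerRegion m) (i : Fin 4) : ∑ k, chrRadial m i k p * dr p k =
    -(m / (‖spatial p‖ * (‖spatial p‖ - 2 * m))) * dr p i := by
  have h1 : ∀ k, chrRadial m i k p * dr p k =
      m * (‖spatial p‖ - 2 * m) / ‖spatial p‖ ^ 3 * dt i * (dt k * dr p k)
      + (-(m / (‖spatial p‖ * (‖spatial p‖ - 2 * m)))) * dr p i * (dr p k * dr p k)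
      + 2 * m / ‖spatial p‖ ^ 2 * (dr p k * angular p k i) := by
    intro k; rw [chrRadial, angular_comm p k i]; ring
  simp only [h1, Finset.sum_add_distrib, ← Finset.mul_sum, sum_dr_dr hp.2, sum_dt_dr,
    sum_dr_angular hp.2]
  ring

/-- The Christoffel symbols are trace free, as the determinant of the metric is constant. -/
theorem sum_christoffel_schwarzschild (hp : p ∈ outerRegion m) (i : Fin 4) :
    ∑ k, christoffel (schwarzschild m) k k i p = 0 := by
  have h1 : ∀ k, christoffel (schwarzschild m) k k i p =
      chrTime m i k p * dt k + chrRadial m i k p * dr p k := by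
    intro k
    rw [(isMetricOn_schwarzschild m).christoffel_comm hp, christoffel_schwarzschild hp]; ring
  simp only [h1, Finset.sum_add_distrib, sum_chrTime_dt m p, sum_chrRadial_dr hp]
  ring

theorem ricci_schwarzschild (hp : p ∈ outerRegion m) (i j : Fin 4) : ricci (schwarzschild m) i j p = 0 := by
  have hr := hp.2
  have hO := isOpen_outerRegion m
  have hcomm := fun q (hq : q ∈ outerRegion m) => (isMetricOn_schwarzschild m).christoffel_comm hq
  have hd1 : ∀ k i j, DifferentiableAt ℝ (christoffel (schwarzschild m) k i j) p := fun k i j =>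
    ContDiffAt.dAt ((isMetricOn_schwarzschild m).smooth_conn hp i k j)
  -- the trace term
  have h1 : ∑ k, partialD j (christoffel (schwarzschild m) k i k) p = 0 := by
    rw [← partialD_sum fun k _ => hd1 k i k, partialD_congr_of_mem hO (g := fun _ => 0) _ hp]
    · simp
    · intro q hq
      rw [← sum_christoffel_schwarzschild hq i]
      exact Finset.sum_congr rfl fun k _ => hcomm q hq k i k
  have h2 : ∑ k, ∑ l, christoffel (schwarzschild m) k k l p * christoffel (schwarzschild m) l i j p
      = 0 := by
    rw [Finset.sum_comm]
    simp only [← Finset.sum_mul, sum_christoffel_schwarzschild hp, zero_mul, Finset.sum_const_zero]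
  -- the divergence
  have h3 : ∑ k, partialD k (christoffel (schwarzschild m) k i j) p =
      2 / ‖spatial p‖ * chrRadial m i j p
      + (m * (6 * m - 2 * ‖spatial p‖) / ‖spatial p‖ ^ 4 * (dt i * dt j)
      + (m * (2 * ‖spatial p‖ - 2 * m)) / (‖spatial p‖ * (‖spatial p‖ - 2 * m)) ^ 2 *
        (dr p i * dr p j)
      + -(4 * m) / ‖spatial p‖ ^ 3 * angular p i j) := by
    have e1 : ∀ k, partialD k (christoffel (schwarzschild m) k i j) p =
        dt k * partialD k (chrTime m i j) p + angular p k k * (chrRadial m i j p / ‖spatial p‖)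
          + dr p k * partialD k (chrRadial m i j) p := by
      intro k
      obtain ⟨d1, -⟩ := partialD_chrTime hp k i j
      obtain ⟨d2, -⟩ := partialD_chrRadial hp k i j
      have d3 := ContDiffAt.dAt (contDiffAt_dr hr k)
      rw [partialD_congr_of_mem hO (fun q hq => christoffel_schwarzschild hq k i j) hp,
        partialD_add (d1.const_mul _) (d3.fun_mul d2), partialD_const_mul d1, partialD_mul d3 d2,
        partialD_dr hr]
      ring
    have e2 : ∑ k, dt k * partialD k (chrTime m i j) p = 0 := by
      rw [sum_dt_mul, (partialD_chrTime hp 0 i j).2, dr_zero]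
      have := sum_dt_angular p i
      have := sum_dt_angular p j
      simp only [sum_dt_mul] at *
      simp [*]
    have e3 : ∀ k, dr p k * partialD k (chrRadial m i j) p =
        (m * (6 * m - 2 * ‖spatial p‖) / ‖spatial p‖ ^ 4 * (dt i * dt j)
      + (m * (2 * ‖spatial p‖ - 2 * m)) / (‖spatial p‖ * (‖spatial p‖ - 2 * m)) ^ 2 *
        (dr p i * dr p j)
      + -(4 * m) / ‖spatial p‖ ^ 3 * angular p i j) * (dr p k * dr p k)
      + (-(m / (‖spatial p‖ * (‖spatial p‖ - 2 * m))) - 2 * m / ‖spatial p‖ ^ 2) / ‖spatial p‖ *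
        dr p j * (dr p k * angular p k i)
      + (-(m / (‖spatial p‖ * (‖spatial p‖ - 2 * m))) - 2 * m / ‖spatial p‖ ^ 2) / ‖spatial p‖ *
        dr p i * (dr p k * angular p k j) := by
      intro k
      rw [(partialD_chrRadial hp k i j).2]
      ring
    simp only [e1, Finset.sum_add_distrib, e2, ← Finset.sum_mul, sum_angular_self hr]
    simp only [e3, Finset.sum_add_distrib, ← Finset.mul_sum, sum_dr_dr hr, sum_dr_angular hr]
    ring
  -- the quadratic term
  have h4 : ∑ k, ∑ l, christoffel (schwarzschild m) k j l p * christoffel (schwarzschild m) l i k p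
      = 2 * (m / (‖spatial p‖ * (‖spatial p‖ - 2 * m))) ^ 2 * (dr p i * dr p j)
        + 2 * (m / (‖spatial p‖ * (‖spatial p‖ - 2 * m)))
          * (m * (‖spatial p‖ - 2 * m) / ‖spatial p‖ ^ 3) * (dt i * dt j) := by
    have e1 : ∀ k l, christoffel (schwarzschild m) k j l p * christoffel (schwarzschild m) l i k p =
        (chrTime m i k p * dt k) * (chrTime m j l p * dt l)
        + (chrRadial m i k p * dt k) * (chrTime m j l p * dr p l)
        + (chrTime m i k p * dr p k) * (chrRadial m j l p * dt l)
        + (chrRadial m i k p * dr p k) * (chrRadial m j l p * dr p l) := by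
      intro k l
      rw [christoffel_schwarzschild hp, christoffel_schwarzschild hp]
      ring
    simp only [e1, Finset.sum_add_distrib, ← Finset.mul_sum, ← Finset.sum_mul, sum_chrTime_dt m p,
      sum_chrTime_dr hp, sum_chrRadial_dt m p, sum_chrRadial_dr hp]
    ring
  have h5 : ricci (schwarzschild m) i j p =
      ∑ k, partialD k (christoffel (schwarzschild m) k i j) p
      - ∑ k, partialD j (christoffel (schwarzschild m) k i k) p
      + (∑ k, ∑ l, christoffel (schwarzschild m) k k l p * christoffel (schwarzschild m) l i j p
      - ∑ k, ∑ l, christoffel (schwarzschild m) k j l p *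
          christoffel (schwarzschild m) l i k p) := by
    simp only [ricci, Finset.sum_add_distrib, Finset.sum_sub_distrib]
  have hr' : 0 < ‖spatial p‖ - 2 * m := sub_pos.2 hp.1
  rw [h5, h1, h2, h3, h4, chrRadial]
  field_simp
  ring

end SchwarzschildCMC

namespace SchwarzschildCMC

open Set Filter Topology

/-! ### Geometry of the graph `t = r_* - Q` -/

/-- The components `y_i = x_i / |x|`. -/
noncomputable def unitv (i : Fin 3) (x : E 3) : ℝ := x i * ‖x‖⁻¹

/-- The radial derivative. -/
noncomputable def radialD (Q : E 3 → ℝ) (x : E 3) : ℝ := ∑ i, unitv i x * partialD i Q x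

/-- The gradient of `W = r - Q`. In Kerr-Schild coordinates the surface is the graph of `W`. -/
noncomputable def gradW (Q : E 3 → ℝ) (i : Fin 3) (x : E 3) : ℝ := unitv i x - partialD i Q x

/-- `L = 1 - |∇W|² + (2m/r) (∂_r Q)²`, the function `-⟨∇F, ∇F⟩` for `F = u - t`. -/
noncomputable def gramL (m : ℝ) (Q : E 3 → ℝ) (x : E 3) : ℝ :=
  1 - ∑ i, gradW Q i x ^ 2 + 2 * m * ‖x‖⁻¹ * radialD Q x ^ 2

/-- The spatial part of the normal vector `∇F`. -/
noncomputable def normalV (m : ℝ) (Q : E 3 → ℝ) (i : Fin 3) (x : E 3) : ℝ :=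
  gradW Q i x + 2 * m * ‖x‖⁻¹ * radialD Q x * unitv i x

/-- The induced metric. -/
noncomputable def gramG (m : ℝ) (Q : E 3 → ℝ) (x : E 3) (i j : Fin 3) : ℝ :=
  (if i = j then 1 else 0) - gradW Q i x * gradW Q j x
    + 2 * m * ‖x‖⁻¹ * (partialD i Q x * partialD j Q x)

/-- The second fundamental form, multiplied by `√L`. -/
noncomputable def hessB (m : ℝ) (Q : E 3 → ℝ) (x : E 3) (i j : Fin 3) : ℝ :=
  ((if i = j then 1 else 0) - unitv i x * unitv j x) * ‖x‖⁻¹ * (1 + 2 * m * ‖x‖⁻¹ * radialD Q x)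
    - partialD i (partialD j Q) x
    - m * ‖x‖⁻¹ ^ 2 * (partialD i Q x * partialD j Q x
        * (1 - (1 - 2 * m * ‖x‖⁻¹) * radialD Q x)
      + radialD Q x * (unitv i x * partialD j Q x + unitv j x * partialD i Q x))

theorem sum_unitv_sq {x : E 3} (hx : x ≠ 0) : ∑ i, unitv i x * unitv i x = 1 := by
  have h0 : ‖x‖ ≠ 0 := norm_ne_zero_iff.2 hx
  have h1 : ∀ i, unitv i x * unitv i x = x i * x i * (‖x‖⁻¹) ^ 2 := fun i => by
    rw [unitv]; ring
  simp only [h1, ← Finset.sum_mul, sum_sq_eq]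
  field_simp

theorem contDiffAt_inv_norm {x : E 3} (hx : x ≠ 0) : ContDiffAt ℝ ∞ (fun y : E 3 => ‖y‖⁻¹) x :=
  (contDiffAt_norm ℝ hx).inv (norm_ne_zero_iff.2 hx)

theorem contDiffAt_unitv {x : E 3} (hx : x ≠ 0) (i : Fin 3) : ContDiffAt ℝ ∞ (unitv i) x :=
  ContDiffAt.mul (f := fun y : E 3 => y i) (by fun_prop) (contDiffAt_inv_norm hx)

theorem partialD_inv_norm {x : E 3} (hx : x ≠ 0) (i : Fin 3) :
    partialD i (fun y : E 3 => ‖y‖⁻¹) x = -unitv i x * ‖x‖⁻¹ ^ 2 := by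
  have h0 : ‖x‖ ≠ 0 := norm_ne_zero_iff.2 hx
  rw [partialD_comp (f := fun y : E 3 => ‖y‖) (hasDerivAt_inv h0) (differentiableAt_norm hx),
    partialD_norm hx, unitv]
  field_simp

theorem partialD_unitv {x : E 3} (hx : x ≠ 0) (i j : Fin 3) :
    partialD i (unitv j) x = ((if i = j then 1 else 0) - unitv i x * unitv j x) * ‖x‖⁻¹ := by
  rw [show unitv j = fun y : E 3 => y j * ‖y‖⁻¹ from rfl,
    partialD_mul (f := fun y : E 3 => y j) (by fun_prop) (ContDiffAt.dAt (contDiffAt_inv_norm hx)),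
    partialD_coord, partialD_inv_norm hx]
  simp only [unitv]
  ring

section Graph

variable {m : ℝ} {Q : E 3 → ℝ} {U : Set (E 3)} {x : E 3}

/-- The assumptions under which the geometry of the graph is computed. -/
structure IsGraphDomain (m : ℝ) (Q : E 3 → ℝ) (U : Set (E 3)) : Prop where
  nonneg : 0 ≤ m
  isOpen : IsOpen U
  outer : ∀ x ∈ U, 2 * m < ‖x‖
  smooth : ContDiffOn ℝ ∞ Q U

theorem IsGraphDomain.norm_pos (h : IsGraphDomain m Q U) (hx : x ∈ U) : 0 < ‖x‖ :=
  lt_of_le_of_lt (by linarith [h.nonneg]) (h.outer x hx)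

theorem IsGraphDomain.ne_zero (h : IsGraphDomain m Q U) (hx : x ∈ U) : x ≠ 0 :=
  norm_pos_iff.1 (h.norm_pos hx)

theorem IsGraphDomain.contDiffAt (h : IsGraphDomain m Q U) (hx : x ∈ U) : ContDiffAt ℝ ∞ Q x :=
  h.smooth.contDiffAt (h.isOpen.mem_nhds hx)

/-- The function of which the surface is the graph in Schwarzschild coordinates. -/
noncomputable def heightOf (m : ℝ) (Q : E 3 → ℝ) (x : E 3) : ℝ := tortoise m ‖x‖ - Q x

theorem hasDerivAt_tortoise {r : ℝ} (hm : 0 ≤ m) (hr : 2 * m < r) :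
    HasDerivAt (tortoise m) (1 - 2 * m / r)⁻¹ r := by
  have hr0 : 0 < r := lt_of_le_of_lt (by linarith) hr
  rcases hm.eq_or_lt with rfl | hm
  · have : tortoise 0 = id := by ext r; simp [tortoise]
    rw [this]
    simpa using hasDerivAt_id r
  · have h1 : HasDerivAt (fun r : ℝ => r / (2 * m) - 1) (1 / (2 * m)) r :=
      ((hasDerivAt_id r).div_const _).sub_const 1
    have h2 : 0 < r / (2 * m) - 1 := by
      rw [sub_pos, one_lt_div (by positivity)]; exact hr
    have h3 := (hasDerivAt_id r).add ((h1.log h2.ne').const_mul (2 * m))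
    have h4 : tortoise m = id + fun r => 2 * m * Real.log (r / (2 * m) - 1) := by
      ext r; simp [tortoise, Real.log_abs]
    rw [h4]
    refine h3.congr_deriv ?_
    have h5 : 0 < r - 2 * m := by linarith
    have e1 : r / (2 * m) - 1 = (r - 2 * m) / (2 * m) := by field_simp
    have e2 : 1 - 2 * m / r = (r - 2 * m) / r := by field_simp
    rw [e1, e2]
    field_simp
    ring

theorem contDiffAt_tortoise {r : ℝ} (hm : 0 ≤ m) (hr : 2 * m < r) :
    ContDiffAt ℝ ∞ (tortoise m) r := by
  rcases hm.eq_or_lt with rfl | hm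
  · have : tortoise 0 = id := by ext r; simp [tortoise]
    rw [this]
    exact contDiffAt_id
  · have h2 : 0 < r / (2 * m) - 1 := by
      rw [sub_pos, one_lt_div (by positivity)]; exact hr
    have h4 : tortoise m = fun r => r + 2 * m * Real.log (r / (2 * m) - 1) := by
      ext r; simp [tortoise, Real.log_abs]
    rw [h4]
    exact contDiffAt_id.add (contDiffAt_const.mul
      (((contDiffAt_id.div_const _).sub contDiffAt_const).log h2.ne'))

theorem IsGraphDomain.contDiffAt_height (h : IsGraphDomain m Q U) (hx : x ∈ U) :
    ContDiffAt ℝ ∞ (heightOf m Q) x :=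
  ((contDiffAt_tortoise h.nonneg (h.outer x hx)).comp x
    (contDiffAt_norm ℝ (h.ne_zero hx))).sub (h.contDiffAt hx)

theorem IsGraphDomain.partialD_height (h : IsGraphDomain m Q U) (hx : x ∈ U) (i : Fin 3) :
    partialD i (heightOf m Q) x = (1 - 2 * m / ‖x‖)⁻¹ * unitv i x - partialD i Q x := by
  have hn := differentiableAt_norm (h.ne_zero hx)
  have ht := hasDerivAt_tortoise h.nonneg (h.outer x hx)
  rw [show heightOf m Q = fun x => tortoise m ‖x‖ - Q x from rfl,
    partialD_sub (f := fun x : E 3 => tortoise m ‖x‖) (ht.differentiableAt.comp x hn)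
      (ContDiffAt.dAt (h.contDiffAt hx)), partialD_comp (f := fun y : E 3 => ‖y‖) ht hn,
    partialD_norm (h.ne_zero hx)]
  rfl

theorem spatial_graphMap (u : E 3 → ℝ) (x : E 3) : spatial (graphMap u x) = x := by
  ext i
  fin_cases i <;> simp [spatial, graphMap]

theorem dr_graphMap_succ (u : E 3 → ℝ) (x : E 3) (k : Fin 3) :
    dr (graphMap u x) k.succ = unitv k x := by
  rw [dr, if_neg (Fin.succ_ne_zero k), spatial_graphMap, unitv, div_eq_mul_inv]
  fin_cases k <;> simp [graphMap]

theorem graphMap_succ (u : E 3 → ℝ) (x : E 3) (k : Fin 3) : graphMap u x k.succ = x k := by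
  fin_cases k <;> simp [graphMap]

theorem partialD_graphMap_succ (u : E 3 → ℝ) (i k : Fin 3) (x : E 3) :
    partialD i (fun y => graphMap u y k.succ) x = if i = k then 1 else 0 := by
  simp only [graphMap_succ]
  exact partialD_coord i k x

theorem IsGraphDomain.isMapInto (h : IsGraphDomain m Q U) :
    IsMapInto (graphMap (heightOf m Q)) U (outerRegion m) where
  isOpen := h.isOpen
  smooth x hx a := by
    refine Fin.cases ?_ (fun k => ?_) a
    · exact h.contDiffAt_height hx
    · simp only [graphMap_succ]; fun_prop
  mapsTo x hx := by
    rw [outerRegion]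
    change _ ∧ _
    rw [spatial_graphMap]
    exact ⟨h.outer x hx, h.norm_pos hx⟩

theorem sum_schwarzschild_mul (p : E 4) (v w : Fin 4 → ℝ) :
    ∑ a, ∑ b, schwarzschild m p a b * v a * w b =
      -(1 - 2 * m / ‖spatial p‖) * (v 0 * w 0)
      + (1 - 2 * m / ‖spatial p‖)⁻¹ * ((∑ a, dr p a * v a) * ∑ a, dr p a * w a)
      + (∑ a, v a * w a - v 0 * w 0 - (∑ a, dr p a * v a) * ∑ a, dr p a * w a) := by
  simp only [schwarzschild_apply, angular, Fin.sum_univ_four, dt]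
  simp
  ring

theorem sum_schwarzschildInv_mul (p : E 4) (v w : Fin 4 → ℝ) :
    ∑ a, ∑ b, schwarzschildInv m p a b * v a * w b =
      -(1 - 2 * m / ‖spatial p‖)⁻¹ * (v 0 * w 0)
      + (1 - 2 * m / ‖spatial p‖) * ((∑ a, dr p a * v a) * ∑ a, dr p a * w a)
      + (∑ a, v a * w a - v 0 * w 0 - (∑ a, dr p a * v a) * ∑ a, dr p a * w a) := by
  simp only [schwarzschildInv, Matrix.of_apply, angular, Fin.sum_univ_four, dt]
  simp
  ring

/-- The coordinate vector `∂_i` of the graph, as a spacetime vector. -/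
noncomputable def graphTangent (m : ℝ) (Q : E 3 → ℝ) (x : E 3) (i : Fin 3) (a : Fin 4) : ℝ :=
  partialD i (fun y => graphMap (heightOf m Q) y a) x

theorem graphTangent_zero (i : Fin 3) :
    graphTangent m Q x i 0 = partialD i (heightOf m Q) x := rfl

theorem graphTangent_succ (i k : Fin 3) :
    graphTangent m Q x i k.succ = if i = k then 1 else 0 := partialD_graphMap_succ _ i k x

theorem sum_dr_graphTangent (i : Fin 3) :
    ∑ a, dr (graphMap (heightOf m Q) x) a * graphTangent m Q x i a = unitv i x := by
  rw [Fin.sum_univ_succ, dr_zero]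
  simp only [dr_graphMap_succ, graphTangent_succ]
  simp

theorem sum_graphTangent_mul (v : Fin 4 → ℝ) (i : Fin 3) :
    ∑ a, v a * graphTangent m Q x i a = v 0 * partialD i (heightOf m Q) x + v i.succ := by
  rw [Fin.sum_univ_succ, graphTangent_zero]
  simp [graphTangent_succ]

theorem sum_graphTangent_graphTangent (i j : Fin 3) :
    ∑ a, graphTangent m Q x i a * graphTangent m Q x j a =
      partialD i (heightOf m Q) x * partialD j (heightOf m Q) x + if i = j then 1 else 0 := by
  rw [sum_graphTangent_mul, graphTangent_zero, graphTangent_succ]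

theorem IsGraphDomain.inducedMetric_eq (h : IsGraphDomain m Q U) (hx : x ∈ U) (i j : Fin 3) :
    inducedMetric (schwarzschild m) (graphMap (heightOf m Q)) x i j = gramG m Q x i j := by
  have hx0 := h.norm_pos hx
  have hlt := h.outer x hx
  have hne : ‖x‖ - 2 * m ≠ 0 := by linarith
  have h1 := sum_schwarzschild_mul (m := m) (graphMap (heightOf m Q) x) (graphTangent m Q x i)
    (graphTangent m Q x j)
  rw [sum_dr_graphTangent, sum_dr_graphTangent, sum_graphTangent_graphTangent, graphTangent_zero,
    graphTangent_zero, spatial_graphMap, h.partialD_height hx, h.partialD_height hx] at h1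
  change ∑ a, ∑ b, _ * graphTangent m Q x i a * graphTangent m Q x j b = _
  rw [h1, gramG, gradW, gradW]
  have e : 1 - 2 * m / ‖x‖ = (‖x‖ - 2 * m) / ‖x‖ := by field_simp
  rw [e]
  field_simp
  ring

/-- The spatial projection as a continuous linear map. -/
noncomputable def spatialL : E 4 →L[ℝ] E 3 :=
  LinearMap.toContinuousLinearMap
    { toFun := spatial
      map_add' := fun p q => by ext i; fin_cases i <;> simp [spatial]
      map_smul' := fun c q => by ext i; fin_cases i <;> simp [spatial] }

theorem spatialL_single_succ (k : Fin 3) :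
    spatialL (EuclideanSpace.single k.succ 1) = EuclideanSpace.single k 1 := by
  change spatial _ = _
  ext i
  fin_cases k <;> fin_cases i <;> simp [spatial]

theorem spatialL_single_zero : spatialL (EuclideanSpace.single 0 1) = 0 := by
  change spatial _ = _
  ext i
  fin_cases i <;> simp [spatial]

theorem graphCovector_eq {u : E 3 → ℝ} (hu : DifferentiableAt ℝ u x) (b : Fin 4) :
    graphCovector u x b = fderiv ℝ u x (spatialL (EuclideanSpace.single b 1))
      - if b = 0 then 1 else 0 := by
  have h1 : HasFDerivAt (fun p : E 4 => u (spatial p)) ((fderiv ℝ u x).comp spatialL)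
      (graphMap u x) := by
    refine HasFDerivAt.comp (f := spatial) _ ?_ spatialL.hasFDerivAt
    change HasFDerivAt u _ (spatial (graphMap u x))
    rw [spatial_graphMap]
    exact hu.hasFDerivAt
  rw [graphCovector, partialD_sub h1.differentiableAt (by fun_prop), HasFDerivAt.partialD_eq h1, partialD_coord]
  rfl

theorem graphCovector_zero {u : E 3 → ℝ} (hu : DifferentiableAt ℝ u x) :
    graphCovector u x 0 = -1 := by
  rw [graphCovector_eq hu, spatialL_single_zero]; simp

theorem graphCovector_succ {u : E 3 → ℝ} (hu : DifferentiableAt ℝ u x) (k : Fin 3) :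
    graphCovector u x k.succ = partialD k u x := by
  rw [graphCovector_eq hu, spatialL_single_succ]; simp [partialD]

theorem IsGraphDomain.gramL_eq (h : IsGraphDomain m Q U) (hx : x ∈ U) :
    gramL m Q x = 2 * radialD Q x - (∑ i, partialD i Q x * partialD i Q x)
      + 2 * m * ‖x‖⁻¹ * radialD Q x ^ 2 := by
  have h1 := sum_unitv_sq (h.ne_zero hx)
  simp only [gramL, gradW, radialD, Fin.sum_univ_three] at h1 ⊢
  linear_combination -h1

theorem IsGraphDomain.sum_dr_covector (h : IsGraphDomain m Q U) (hx : x ∈ U) :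
    ∑ a, dr (graphMap (heightOf m Q) x) a * graphCovector (heightOf m Q) x a =
      (1 - 2 * m / ‖x‖)⁻¹ - radialD Q x := by
  have hu := ContDiffAt.dAt (h.contDiffAt_height hx)
  rw [Fin.sum_univ_succ, dr_zero, zero_mul, zero_add]
  simp only [graphCovector_succ hu, dr_graphMap_succ, h.partialD_height hx, mul_sub,
    Finset.sum_sub_distrib]
  rw [radialD]
  congr 1
  have h1 := sum_unitv_sq (h.ne_zero hx)
  simp only [Fin.sum_univ_three] at h1 ⊢
  linear_combination (1 - 2 * m / ‖x‖)⁻¹ * h1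

theorem IsGraphDomain.norm_covector (h : IsGraphDomain m Q U) (hx : x ∈ U) :
    -∑ c, ∑ d, (schwarzschild m (graphMap (heightOf m Q) x))⁻¹ c d
      * graphCovector (heightOf m Q) x c * graphCovector (heightOf m Q) x d = gramL m Q x := by
  have hu := ContDiffAt.dAt (h.contDiffAt_height hx)
  have hx0 := h.norm_pos hx
  have hne : ‖x‖ - 2 * m ≠ 0 := by linarith [h.outer x hx]
  rw [schwarzschild_inv (h.isMapInto.mapsTo x hx), sum_schwarzschildInv_mul, h.sum_dr_covector hx,
    spatial_graphMap, h.gramL_eq hx, Fin.sum_univ_succ (n := 3), graphCovector_zero hu]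
  simp only [graphCovector_succ hu, h.partialD_height hx]
  have h1 := sum_unitv_sq (h.ne_zero hx)
  have h2 : ∑ i, ((1 - 2 * m / ‖x‖)⁻¹ * unitv i x - partialD i Q x) *
      ((1 - 2 * m / ‖x‖)⁻¹ * unitv i x - partialD i Q x) =
      (1 - 2 * m / ‖x‖)⁻¹ ^ 2 - 2 * (1 - 2 * m / ‖x‖)⁻¹ * radialD Q x
        + ∑ i, partialD i Q x * partialD i Q x := by
    simp only [radialD, Fin.sum_univ_three] at h1 ⊢
    linear_combination (1 - 2 * m / ‖x‖)⁻¹ ^ 2 * h1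
  rw [h2]
  have e : 1 - 2 * m / ‖x‖ = (‖x‖ - 2 * m) / ‖x‖ := by field_simp
  rw [e]
  field_simp
  ring

theorem IsGraphDomain.lower_normal (h : IsGraphDomain m Q U) (hx : x ∈ U) :
    schwarzschild m (graphMap (heightOf m Q) x) *ᵥ
      (futureUnitNormal (schwarzschild m) (heightOf m Q) x).ofLp =
      fun b => (Real.sqrt (gramL m Q x))⁻¹ * graphCovector (heightOf m Q) x b := by
  have h1 : (futureUnitNormal (schwarzschild m) (heightOf m Q) x).ofLp =
      (Real.sqrt (gramL m Q x))⁻¹ • ((schwarzschild m (graphMap (heightOf m Q) x))⁻¹ *ᵥ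
        graphCovector (heightOf m Q) x) := by
    ext a
    simp only [futureUnitNormal, h.norm_covector hx]
    rfl
  have hdet := (isMetricOn_schwarzschild m).det _ (h.isMapInto.mapsTo x hx)
  rw [h1, Matrix.mulVec_smul, Matrix.mulVec_mulVec, Matrix.mul_nonsing_inv _ hdet,
    Matrix.one_mulVec]
  rfl

theorem IsGraphDomain.normal_orthogonal (h : IsGraphDomain m Q U) (hx : x ∈ U) :
    (jac (graphMap (heightOf m Q)) x)ᵀ *ᵥ (schwarzschild m (graphMap (heightOf m Q) x) *ᵥ
      (futureUnitNormal (schwarzschild m) (heightOf m Q) x).ofLp) = 0 := by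
  have hu := ContDiffAt.dAt (h.contDiffAt_height hx)
  rw [h.lower_normal hx]
  ext i
  simp only [Matrix.mulVec, dotProduct, Matrix.transpose_apply, Pi.zero_apply]
  change ∑ a, graphTangent m Q x i a * ((Real.sqrt (gramL m Q x))⁻¹ *
    graphCovector (heightOf m Q) x a) = 0
  have h1 : ∀ a, graphTangent m Q x i a *
      ((Real.sqrt (gramL m Q x))⁻¹ * graphCovector (heightOf m Q) x a) =
      (Real.sqrt (gramL m Q x))⁻¹ * (graphCovector (heightOf m Q) x a * graphTangent m Q x i a) :=
    fun a => by ring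
  simp only [h1, ← Finset.mul_sum]
  rw [sum_graphTangent_mul, graphCovector_zero hu, graphCovector_succ hu]
  simp

theorem IsGraphDomain.normal_unit (h : IsGraphDomain m Q U) (hx : x ∈ U) (hL : 0 < gramL m Q x) :
    (futureUnitNormal (schwarzschild m) (heightOf m Q) x).ofLp ⬝ᵥ
      (schwarzschild m (graphMap (heightOf m Q) x) *ᵥ
      (futureUnitNormal (schwarzschild m) (heightOf m Q) x).ofLp) = -1 := by
  rw [h.lower_normal hx]
  simp only [dotProduct, futureUnitNormal, h.norm_covector hx]
  have h1 : ∀ a, (Real.sqrt (gramL m Q x))⁻¹ *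
      (∑ b, (schwarzschild m (graphMap (heightOf m Q) x))⁻¹ a b
        * graphCovector (heightOf m Q) x b) *
      ((Real.sqrt (gramL m Q x))⁻¹ * graphCovector (heightOf m Q) x a) =
      (Real.sqrt (gramL m Q x))⁻¹ ^ 2 * ∑ b, (schwarzschild m (graphMap (heightOf m Q) x))⁻¹ a b
        * graphCovector (heightOf m Q) x a * graphCovector (heightOf m Q) x b := by
    intro a
    simp only [Finset.mul_sum, Finset.sum_mul]
    exact Finset.sum_congr rfl fun b _ => by ring
  simp only [h1, ← Finset.mul_sum]
  rw [← neg_neg (∑ a, _), h.norm_covector hx, inv_pow, Real.sq_sqrt hL.le]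
  field_simp

end Graph

end SchwarzschildCMC

namespace SchwarzschildCMC

open Set Filter Topology

/-! ### The second fundamental form of the graph -/

section Graph

variable {m : ℝ} {Q : E 3 → ℝ} {U : Set (E 3)} {x : E 3}

theorem hasDerivAt_inv_lapse {r : ℝ} (hm : 0 ≤ m) (hr : 2 * m < r) :
    HasDerivAt (fun r : ℝ => (1 - 2 * m / r)⁻¹) (-(2 * m) / (r - 2 * m) ^ 2) r := by
  have hr0 : 0 < r := by linarith
  have hne : r - 2 * m ≠ 0 := by linarith
  have e : 1 - 2 * m / r = (r - 2 * m) / r := by field_simp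
  have hu : HasDerivAt (fun r : ℝ => 1 - 2 * m / r) (2 * m / r ^ 2) r := by
    have := ((hasDerivAt_inv hr0.ne').const_mul (2 * m)).const_sub 1
    refine this.congr_deriv ?_
    ring
  refine (hu.inv (by rw [e]; positivity)).congr_deriv ?_
  rw [e]
  field_simp

theorem IsGraphDomain.hessian_height (h : IsGraphDomain m Q U) (hx : x ∈ U) (i j : Fin 3) :
    partialD i (partialD j (heightOf m Q)) x =
      -(2 * m) / (‖x‖ - 2 * m) ^ 2 * (unitv i x * unitv j x)
      + (1 - 2 * m / ‖x‖)⁻¹ * (((if i = j then 1 else 0) - unitv i x * unitv j x) * ‖x‖⁻¹)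
      - partialD i (partialD j Q) x := by
  rw [partialD_congr_of_mem h.isOpen (fun y hy => h.partialD_height hy j) hx]
  have h0 := h.ne_zero hx
  have hn := differentiableAt_norm h0
  have ht := hasDerivAt_inv_lapse h.nonneg (h.outer x hx)
  have h1 : DifferentiableAt ℝ (fun y : E 3 => (1 - 2 * m / ‖y‖)⁻¹) x :=
    ht.differentiableAt.comp x hn
  have h2 := ContDiffAt.dAt (contDiffAt_unitv h0 j)
  have h3 := ContDiffAt.dAt (contDiffAt_partialD (h.contDiffAt hx) j)
  rw [partialD_sub (h1.fun_mul h2) h3, partialD_mul h1 h2,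
    partialD_comp (f := fun y : E 3 => ‖y‖) ht hn, partialD_norm h0, partialD_unitv h0]
  simp only [unitv]
  ring

theorem sum_chrTime (i j : Fin 3) :
    ∑ c, ∑ d, chrTime m c d (graphMap (heightOf m Q) x) * graphTangent m Q x i c
        * graphTangent m Q x j d =
      m / (‖x‖ * (‖x‖ - 2 * m)) * (unitv i x * partialD j (heightOf m Q) x
        + unitv j x * partialD i (heightOf m Q) x) := by
  rw [← sum_dr_graphTangent (m := m) (Q := Q) (x := x) i,
    ← sum_dr_graphTangent (m := m) (Q := Q) (x := x) j, ← graphTangent_zero, ← graphTangent_zero]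
  simp only [chrTime, spatial_graphMap, Fin.sum_univ_four, dt]
  simp
  ring

theorem sum_chrRadial (i j : Fin 3) :
    ∑ c, ∑ d, chrRadial m c d (graphMap (heightOf m Q) x) * graphTangent m Q x i c
        * graphTangent m Q x j d =
      m * (‖x‖ - 2 * m) / ‖x‖ ^ 3 * (partialD i (heightOf m Q) x * partialD j (heightOf m Q) x)
      - m / (‖x‖ * (‖x‖ - 2 * m)) * (unitv i x * unitv j x)
      + 2 * m / ‖x‖ ^ 2 * ((if i = j then 1 else 0) - unitv i x * unitv j x) := by
  have h1 : (if i = j then (1 : ℝ) else 0) = ∑ a, graphTangent m Q x i a * graphTangent m Q x j a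
      - partialD i (heightOf m Q) x * partialD j (heightOf m Q) x := by
    rw [sum_graphTangent_graphTangent]; ring
  rw [h1, ← sum_dr_graphTangent (m := m) (Q := Q) (x := x) i,
    ← sum_dr_graphTangent (m := m) (Q := Q) (x := x) j, ← graphTangent_zero, ← graphTangent_zero]
  simp only [chrRadial, angular, spatial_graphMap, Fin.sum_univ_four, dt]
  simp
  ring

theorem IsGraphDomain.secondFundamentalForm_eq (h : IsGraphDomain m Q U) (hx : x ∈ U)
    (i j : Fin 3) :
    secondFundamentalForm (schwarzschild m) (graphMap (heightOf m Q))
      (futureUnitNormal (schwarzschild m) (heightOf m Q)) x i j =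
      (Real.sqrt (gramL m Q x))⁻¹ * hessB m Q x i j := by
  have hu := ContDiffAt.dAt (h.contDiffAt_height hx)
  have hp := h.isMapInto.mapsTo x hx
  have hx0 := h.norm_pos hx
  have hne : ‖x‖ - 2 * m ≠ 0 := by linarith [h.outer x hx]
  have hl : ∀ b, ∑ a, schwarzschild m (graphMap (heightOf m Q) x) a b *
      (futureUnitNormal (schwarzschild m) (heightOf m Q) x) a =
      (Real.sqrt (gramL m Q x))⁻¹ * graphCovector (heightOf m Q) x b := by
    intro b
    have := congrFun (h.lower_normal hx) b
    rw [← this, Matrix.mulVec, dotProduct]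
    exact Finset.sum_congr rfl fun a _ => by rw [(isMetricOn_schwarzschild m).apply_comm hp]
  have hG : ∀ b, ∑ c, ∑ d, christoffel (schwarzschild m) b c d (graphMap (heightOf m Q) x) *
      graphTangent m Q x i c * graphTangent m Q x j d =
      dt b * (m / (‖x‖ * (‖x‖ - 2 * m)) * (unitv i x * partialD j (heightOf m Q) x
        + unitv j x * partialD i (heightOf m Q) x)) + dr (graphMap (heightOf m Q) x) b *
      (m * (‖x‖ - 2 * m) / ‖x‖ ^ 3 * (partialD i (heightOf m Q) x * partialD j (heightOf m Q) x)
      - m / (‖x‖ * (‖x‖ - 2 * m)) * (unitv i x * unitv j x)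
      + 2 * m / ‖x‖ ^ 2 * ((if i = j then 1 else 0) - unitv i x * unitv j x)) := by
    intro b
    rw [← sum_chrTime (Q := Q), ← sum_chrRadial (Q := Q)]
    simp only [Finset.mul_sum, ← Finset.sum_add_distrib]
    refine Finset.sum_congr rfl fun c _ => Finset.sum_congr rfl fun d _ => ?_
    rw [christoffel_schwarzschild hp]
    ring
  have hH : ∀ b, partialD i (partialD j (fun y => graphMap (heightOf m Q) y b)) x =
      dt b * partialD i (partialD j (heightOf m Q)) x := by
    intro b
    refine Fin.cases ?_ (fun k => ?_) b
    · simp only [dt, if_true, one_mul]; rfl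
    · have : partialD j (fun y => graphMap (heightOf m Q) y k.succ) =
          fun _ => if j = k then 1 else 0 := by
        ext y; exact partialD_graphMap_succ _ j k y
      rw [this, partialD_const]
      simp [dt]
  have h1 : secondFundamentalForm (schwarzschild m) (graphMap (heightOf m Q))
      (futureUnitNormal (schwarzschild m) (heightOf m Q)) x i j =
      -∑ b, (Real.sqrt (gramL m Q x))⁻¹ * graphCovector (heightOf m Q) x b *
        (partialD i (partialD j (fun y => graphMap (heightOf m Q) y b)) x +
        ∑ c, ∑ d, christoffel (schwarzschild m) b c d (graphMap (heightOf m Q) x) *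
          graphTangent m Q x i c * graphTangent m Q x j d) := by
    simp only [secondFundamentalForm, Matrix.of_apply, ← hl, Finset.sum_mul]
    rw [Finset.sum_comm]
    rfl
  set T := m / (‖x‖ * (‖x‖ - 2 * m)) * (unitv i x * partialD j (heightOf m Q) x
        + unitv j x * partialD i (heightOf m Q) x) with hT
  set S := (m * (‖x‖ - 2 * m) / ‖x‖ ^ 3 *
      (partialD i (heightOf m Q) x * partialD j (heightOf m Q) x)
      - m / (‖x‖ * (‖x‖ - 2 * m)) * (unitv i x * unitv j x)
      + 2 * m / ‖x‖ ^ 2 * ((if i = j then 1 else 0) - unitv i x * unitv j x)) with hS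
  have h2 : ∀ b, (Real.sqrt (gramL m Q x))⁻¹ * graphCovector (heightOf m Q) x b *
        (partialD i (partialD j (fun y => graphMap (heightOf m Q) y b)) x +
        ∑ c, ∑ d, christoffel (schwarzschild m) b c d (graphMap (heightOf m Q) x) *
          graphTangent m Q x i c * graphTangent m Q x j d) =
      (Real.sqrt (gramL m Q x))⁻¹ * (partialD i (partialD j (heightOf m Q)) x + T) *
        (dt b * graphCovector (heightOf m Q) x b) +
      (Real.sqrt (gramL m Q x))⁻¹ * S *
        (dr (graphMap (heightOf m Q) x) b * graphCovector (heightOf m Q) x b) := by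
    intro b
    rw [hG, hH]
    ring
  rw [h1]
  simp only [h2, Finset.sum_add_distrib, ← Finset.mul_sum]
  rw [h.sum_dr_covector hx, sum_dt_mul, graphCovector_zero hu, hT, hS, h.hessian_height hx,
    h.partialD_height hx, h.partialD_height hx, hessB]
  have e : 1 - 2 * m / ‖x‖ = (‖x‖ - 2 * m) / ‖x‖ := by field_simp
  rw [e]
  generalize radialD Q x = a
  generalize unitv i x = y1
  generalize unitv j x = y2
  generalize partialD i Q x = q1
  generalize partialD j Q x = q2
  generalize partialD i (partialD j Q) x = K
  generalize (if i = j then (1 : ℝ) else 0) = dl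
  generalize (Real.sqrt (gramL m Q x))⁻¹ = z
  field_simp
  ring

end Graph

/-! ### Algebra of the induced metric -/

section Algebra

variable {y q : Fin 3 → ℝ} {μ : ℝ}

/-- The algebraic form of the inverse of the induced metric. -/
theorem gram_mul_inverse (hy : ∑ i, y i * y i = 1) {a b L : ℝ} (ha : ∑ i, y i * q i = a)
    (hb : ∑ i, q i * q i = b) (hL : L = 2 * a - b + μ * a ^ 2) (hL0 : L ≠ 0) (i k : Fin 3) :
    ∑ j, ((if i = j then 1 else 0) - (y i - q i) * (y j - q j) + μ * (q i * q j)) *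
      ((if j = k then 1 else 0) - μ * (y j * y k)
        + ((1 + μ * a) * y j - q j) * ((1 + μ * a) * y k - q k) / L) = if i = k then 1 else 0 := by
  have h1 : ∀ (v : Fin 3 → ℝ), ∑ j, ((if i = j then 1 else 0) - (y i - q i) * (y j - q j)
      + μ * (q i * q j)) * v j = v i - (y i - q i) * (∑ j, y j * v j - ∑ j, q j * v j)
        + μ * q i * ∑ j, q j * v j := by
    intro v
    have : ∀ j, ((if i = j then 1 else 0) - (y i - q i) * (y j - q j) + μ * (q i * q j)) * v j =
        (if i = j then v j else 0) - (y i - q i) * (y j * v j - q j * v j)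
        + μ * q i * (q j * v j) := by
      intro j; split_ifs <;> ring
    simp only [this, Finset.sum_add_distrib, Finset.sum_sub_distrib, ← Finset.mul_sum]
    simp
  rw [h1]
  have h2 : ∀ (v : Fin 3 → ℝ), ∑ j, v j * ((if j = k then 1 else 0) - μ * (y j * y k)
        + ((1 + μ * a) * y j - q j) * ((1 + μ * a) * y k - q k) / L) =
      v k - μ * y k * (∑ j, y j * v j) + ((1 + μ * a) * (∑ j, y j * v j) - ∑ j, q j * v j) *
        (((1 + μ * a) * y k - q k) / L) := by
    intro v
    have : ∀ j, v j * ((if j = k then 1 else 0) - μ * (y j * y k)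
        + ((1 + μ * a) * y j - q j) * ((1 + μ * a) * y k - q k) / L) =
        (if j = k then v j else 0) - μ * y k * (y j * v j)
        + ((1 + μ * a) * (y j * v j) - q j * v j) * (((1 + μ * a) * y k - q k) / L) := by
      intro j; split_ifs <;> ring
    simp only [this, Finset.sum_add_distrib, Finset.sum_sub_distrib, ← Finset.mul_sum,
      ← Finset.sum_mul]
    simp
  have ha' : ∑ i, q i * y i = a := by rw [← ha]; exact Finset.sum_congr rfl fun i _ => mul_comm _ _
  rw [h2, h2, hy, ha, ha', hb]
  field_simp
  subst hL
  split_ifs <;> ring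

/-- If `L ≤ 0` then the metric is not positive on the vector `n`. -/
theorem gram_normal_normal (hy : ∑ i, y i * y i = 1) {a b L : ℝ} (ha : ∑ i, y i * q i = a)
    (hb : ∑ i, q i * q i = b) (hL : L = 2 * a - b + μ * a ^ 2) :
    ∑ i, ∑ j, ((if i = j then 1 else 0) - (y i - q i) * (y j - q j) + μ * (q i * q j)) *
      ((1 + μ * a) * y i - q i) * ((1 + μ * a) * y j - q j) = L * (1 - (1 - μ) * L) := by
  subst hL ha hb
  simp only [Fin.sum_univ_three] at hy ⊢
  simp
  have h0 : y 0 * y 0 = 1 - y 1 * y 1 - y 2 * y 2 := by linarith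
  grind

end Algebra

end SchwarzschildCMC

namespace SchwarzschildCMC

open Set Filter Topology

section Algebra

variable {y q : Fin 3 → ℝ} {μ : ℝ}

theorem form_hess_algebra (y q v : Fin 3 → ℝ) (K : Fin 3 → Fin 3 → ℝ) (μ s c a : ℝ) :
    ∑ i, ∑ j, (((if i = j then 1 else 0) - y i * y j) * s * c - K i j
      - μ / 2 * s * (q i * q j * (1 - (1 - μ) * a) + a * (y i * q j + y j * q i))) * (v i * v j) =
    (∑ i, v i * v i - (∑ i, y i * v i) ^ 2) * s * c - ∑ i, ∑ j, K i j * (v i * v j)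
      - μ / 2 * s * ((∑ i, q i * v i) ^ 2 * (1 - (1 - μ) * a)
        + 2 * a * (∑ i, y i * v i) * (∑ i, q i * v i)) := by
  simp only [Fin.sum_univ_three]
  simp
  ring

theorem mean_curvature_algebra (hy : ∑ i, y i * y i = 1) (K : Fin 3 → Fin 3 → ℝ)
    (hK : ∀ i j, K i j = K j i) (s : ℝ) {a b L c : ℝ}
    (ha : ∑ i, y i * q i = a) (hb : ∑ i, q i * q i = b) (hL : L = 2 * a - b + μ * a ^ 2)
    (hc : c = 1 + μ * a) {B : Fin 3 → Fin 3 → ℝ} (hB : ∀ i j, B i j =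
      ((if i = j then 1 else 0) - y i * y j) * s * c - K i j
      - μ / 2 * s * (q i * q j * (1 - (1 - μ) * a) + a * (y i * q j + y j * q i)))
    {n da dL : Fin 3 → ℝ} (hn : ∀ i, n i = c * y i - q i)
    (hda : ∀ i, da i = s * (q i - a * y i) + ∑ k, y k * K i k)
    (hdL : ∀ i, dL i = 2 * da i - 2 * ∑ k, q k * K i k - μ * s * y i * a ^ 2 + 2 * μ * a * da i) :
    L * (∑ i, B i i - μ * ∑ i, ∑ j, B i j * (y i * y j)) + ∑ i, ∑ j, B i j * (n i * n j) =
      L * ∑ i, ((-(μ * s * y i * a) + μ * da i) * y i + c * ((1 - y i * y i) * s) - K i i)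
        - 1 / 2 * ∑ i, n i * dL i := by
  obtain ⟨k0, h0⟩ : ∃ k, k = ∑ i, K i i := ⟨_, rfl⟩
  obtain ⟨k1, h1⟩ : ∃ k, k = ∑ i, ∑ j, K i j * (y i * y j) := ⟨_, rfl⟩
  obtain ⟨k2, h2⟩ : ∃ k, k = ∑ i, ∑ j, K i j * (y i * q j) := ⟨_, rfl⟩
  obtain ⟨k3, h3⟩ : ∃ k, k = ∑ i, ∑ j, K i j * (q i * q j) := ⟨_, rfl⟩
  have ha' : ∑ i, q i * y i = a := by rw [← ha]; exact Finset.sum_congr rfl fun i _ => mul_comm _ _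
  have h2' : ∑ i, ∑ j, K i j * (q i * y j) = k2 := by
    rw [h2, Finset.sum_comm]
    exact Finset.sum_congr rfl fun i _ => Finset.sum_congr rfl fun j _ => by rw [hK]; ring
  have tB : ∑ i, B i i = 2 * s * c - k0 - μ / 2 * s * (b * (1 - (1 - μ) * a) + 2 * a ^ 2) := by
    have e : ∀ i, B i i = s * c - s * c * (y i * y i) - K i i
        - μ / 2 * s * ((1 - (1 - μ) * a) * (q i * q i) + 2 * a * (y i * q i)) := by
      intro i; rw [hB]; simp only [if_true]; ring
    simp only [e, Finset.sum_sub_distrib, ← Finset.mul_sum, Finset.sum_add_distrib, hy, ha, hb,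
      ← h0, Finset.sum_const, Finset.card_univ, Fintype.card_fin]
    simp only [nsmul_eq_mul]
    push_cast
    ring
  have yB : ∑ i, ∑ j, B i j * (y i * y j) =
      -k1 - μ / 2 * s * (a ^ 2 * (1 - (1 - μ) * a) + 2 * a * a) := by
    simp only [hB]
    rw [form_hess_algebra, hy, ha', ← h1]
    ring
  have nn : ∑ i, n i * n i = c ^ 2 - 2 * c * a + b := by
    have e : ∀ i, n i * n i = c ^ 2 * (y i * y i) - 2 * c * (y i * q i) + q i * q i := by
      intro i; rw [hn]; ring
    simp only [e, Finset.sum_sub_distrib, ← Finset.mul_sum, Finset.sum_add_distrib, hy, ha, hb]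
    ring
  have yn : ∑ i, y i * n i = c - a := by
    have e : ∀ i, y i * n i = c * (y i * y i) - y i * q i := by intro i; rw [hn]; ring
    simp only [e, Finset.sum_sub_distrib, ← Finset.mul_sum, hy, ha]
    ring
  have qn : ∑ i, q i * n i = c * a - b := by
    have e : ∀ i, q i * n i = c * (q i * y i) - q i * q i := by intro i; rw [hn]; ring
    simp only [e, Finset.sum_sub_distrib, ← Finset.mul_sum, ha', hb]
  have Knn : ∑ i, ∑ j, K i j * (n i * n j) = c ^ 2 * k1 - 2 * c * k2 + k3 := by
    have e : ∀ i j, K i j * (n i * n j) = c ^ 2 * (K i j * (y i * y j)) - c * (K i j * (y i * q j))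
        - c * (K i j * (q i * y j)) + K i j * (q i * q j) := by
      intro i j; rw [hn, hn]; ring
    simp only [e, Finset.sum_sub_distrib, ← Finset.mul_sum, Finset.sum_add_distrib, ← h1, ← h2,
      h2', ← h3]
    ring
  have nB : ∑ i, ∑ j, B i j * (n i * n j) = (b - a ^ 2) * s * c - (c ^ 2 * k1 - 2 * c * k2 + k3)
      - μ / 2 * s * ((c * a - b) ^ 2 * (1 - (1 - μ) * a) + 2 * a * (c - a) * (c * a - b)) := by
    simp only [hB]
    rw [form_hess_algebra, nn, yn, qn, Knn]
    ring
  have nda : ∑ i, n i * da i = s * ((c * a - b) - a * (c - a)) + (c * k1 - k2) := by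
    have e : ∀ i, n i * da i = s * (q i * n i) - s * a * (y i * n i)
        + (c * (∑ k, K i k * (y i * y k)) - ∑ k, K i k * (q i * y k)) := by
      intro i
      rw [hda, mul_add, Finset.mul_sum, Finset.mul_sum, ← Finset.sum_sub_distrib]
      congr 1
      · ring
      · exact Finset.sum_congr rfl fun k _ => by rw [hn]; ring
    simp only [e, Finset.sum_sub_distrib, ← Finset.mul_sum, Finset.sum_add_distrib, ← h1, h2', yn,
      qn]
    ring
  have nqK : ∑ i, n i * ∑ k, q k * K i k = c * k2 - k3 := by
    have e : ∀ i, n i * ∑ k, q k * K i k = c * (∑ k, K i k * (y i * q k))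
        - ∑ k, K i k * (q i * q k) := by
      intro i
      rw [Finset.mul_sum, Finset.mul_sum, ← Finset.sum_sub_distrib]
      exact Finset.sum_congr rfl fun k _ => by rw [hn]; ring
    simp only [e, Finset.sum_sub_distrib, ← Finset.mul_sum, ← h2, ← h3]
  have ndL : ∑ i, n i * dL i = 2 * (1 + μ * a) * (s * ((c * a - b) - a * (c - a)) + (c * k1 - k2))
      - 2 * (c * k2 - k3) - μ * s * a ^ 2 * (c - a) := by
    have e : ∀ i, n i * dL i = 2 * (1 + μ * a) * (n i * da i) - 2 * (n i * ∑ k, q k * K i k)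
        - μ * s * a ^ 2 * (y i * n i) := by
      intro i; rw [hdL]; ring
    simp only [e, Finset.sum_sub_distrib, ← Finset.mul_sum, nda, nqK, yn]
  have yda : ∑ i, da i * y i = k1 := by
    have e : ∀ i, da i * y i = s * (q i * y i) - s * a * (y i * y i)
        + ∑ k, K i k * (y i * y k) := by
      intro i
      rw [hda, add_mul, Finset.sum_mul]
      congr 1
      · ring
      · exact Finset.sum_congr rfl fun k _ => by ring
    simp only [e, Finset.sum_sub_distrib, ← Finset.mul_sum, Finset.sum_add_distrib, ← h1, ha', hy]
    ring
  have dn : ∑ i, ((-(μ * s * y i * a) + μ * da i) * y i + c * ((1 - y i * y i) * s) - K i i) =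
      2 * s * c - μ * s * a + μ * k1 - k0 := by
    have e : ∀ i, (-(μ * s * y i * a) + μ * da i) * y i + c * ((1 - y i * y i) * s) - K i i =
        -(μ * s * a) * (y i * y i) + μ * (da i * y i) + (c * s - c * s * (y i * y i)) - K i i := by
      intro i; ring
    simp only [e, Finset.sum_sub_distrib, ← Finset.mul_sum, Finset.sum_add_distrib, hy, yda,
      ← h0, Finset.sum_const, Finset.card_univ, Fintype.card_fin]
    simp only [nsmul_eq_mul]
    push_cast
    ring
  rw [tB, yB, nB, dn, ndL, hL, hc]
  ring

end Algebra

/-! ### The mean curvature of the graph -/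

section Graph

variable {m : ℝ} {Q : E 3 → ℝ} {U : Set (E 3)} {x : E 3}

theorem normalV_eq (i : Fin 3) : normalV m Q i x =
    (1 + 2 * m * ‖x‖⁻¹ * radialD Q x) * unitv i x - partialD i Q x := by
  rw [normalV, gradW]; ring

theorem IsGraphDomain.contDiffAt_radialD (h : IsGraphDomain m Q U) (hx : x ∈ U) :
    ContDiffAt ℝ ∞ (radialD Q) x :=
  ContDiffAt.sum fun i _ => (contDiffAt_unitv (h.ne_zero hx) i).mul
    (contDiffAt_partialD (h.contDiffAt hx) i)

theorem IsGraphDomain.contDiffAt_gradW (h : IsGraphDomain m Q U) (hx : x ∈ U) (i : Fin 3) :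
    ContDiffAt ℝ ∞ (gradW Q i) x :=
  (contDiffAt_unitv (h.ne_zero hx) i).sub (contDiffAt_partialD (h.contDiffAt hx) i)

theorem IsGraphDomain.contDiffAt_gramL (h : IsGraphDomain m Q U) (hx : x ∈ U) :
    ContDiffAt ℝ ∞ (gramL m Q) x :=
  (contDiffAt_const.sub (ContDiffAt.sum fun i _ => (h.contDiffAt_gradW hx i).pow 2)).add
    ((contDiffAt_const.mul (contDiffAt_inv_norm (h.ne_zero hx))).mul
      ((h.contDiffAt_radialD hx).pow 2))

theorem IsGraphDomain.contDiffAt_normalV (h : IsGraphDomain m Q U) (hx : x ∈ U) (i : Fin 3) :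
    ContDiffAt ℝ ∞ (normalV m Q i) x :=
  (h.contDiffAt_gradW hx i).add
    (((contDiffAt_const.mul (contDiffAt_inv_norm (h.ne_zero hx))).mul
      (h.contDiffAt_radialD hx)).mul (contDiffAt_unitv (h.ne_zero hx) i))

theorem IsGraphDomain.partialD_radialD (h : IsGraphDomain m Q U) (hx : x ∈ U) (i : Fin 3) :
    partialD i (radialD Q) x = ‖x‖⁻¹ * (partialD i Q x - radialD Q x * unitv i x)
      + ∑ k, unitv k x * partialD i (partialD k Q) x := by
  have h0 := h.ne_zero hx
  have d1 := fun k => ContDiffAt.dAt (contDiffAt_unitv h0 k)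
  have d2 := fun k => ContDiffAt.dAt (contDiffAt_partialD (h.contDiffAt hx) k)
  have e : radialD Q = fun x => ∑ k, unitv k x * partialD k Q x := rfl
  rw [e, partialD_sum (fun k _ => (d1 k).fun_mul (d2 k))]
  simp only [partialD_mul (d1 _) (d2 _), partialD_unitv h0, Finset.sum_add_distrib]
  congr 1
  have : ∀ k, ((if i = k then 1 else 0) - unitv i x * unitv k x) * ‖x‖⁻¹ * partialD k Q x =
      (if i = k then ‖x‖⁻¹ * partialD k Q x else 0)
        - ‖x‖⁻¹ * unitv i x * (unitv k x * partialD k Q x) := by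
    intro k; split_ifs <;> ring
  simp only [this, Finset.sum_sub_distrib, ← Finset.mul_sum]
  simp
  ring

theorem IsGraphDomain.partialD_normalV (h : IsGraphDomain m Q U) (hx : x ∈ U) (i j : Fin 3) :
    partialD i (normalV m Q j) x =
      (-(2 * m * ‖x‖⁻¹ * ‖x‖⁻¹ * unitv i x * radialD Q x)
        + 2 * m * ‖x‖⁻¹ * partialD i (radialD Q) x) * unitv j x
      + (1 + 2 * m * ‖x‖⁻¹ * radialD Q x) *
        (((if i = j then 1 else 0) - unitv i x * unitv j x) * ‖x‖⁻¹)
      - partialD i (partialD j Q) x := by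
  have h0 := h.ne_zero hx
  have e : normalV m Q j = fun x => (1 + 2 * m * ‖x‖⁻¹ * radialD Q x) * unitv j x
    - partialD j Q x := by ext x; exact normalV_eq j
  have d1 := ContDiffAt.dAt (contDiffAt_unitv h0 j)
  have d2 := ContDiffAt.dAt (contDiffAt_partialD (h.contDiffAt hx) j)
  have d3 := ContDiffAt.dAt (h.contDiffAt_radialD hx)
  have d4 := ContDiffAt.dAt (contDiffAt_inv_norm h0)
  have d5 := d4.const_mul (2 * m)
  have d6 := (d5.fun_mul d3).const_add 1
  rw [e, partialD_sub (d6.fun_mul d1) d2, partialD_mul d6 d1,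
    partialD_add (f := fun _ => (1 : ℝ)) (by fun_prop) (d5.fun_mul d3), partialD_const,
    partialD_mul d5 d3, partialD_const_mul d4, partialD_inv_norm h0, partialD_unitv h0]
  ring

theorem IsGraphDomain.partialD_gramL (h : IsGraphDomain m Q U) (hx : x ∈ U) (i : Fin 3) :
    partialD i (gramL m Q) x = 2 * partialD i (radialD Q) x
      - 2 * ∑ k, partialD k Q x * partialD i (partialD k Q) x
      - 2 * m * ‖x‖⁻¹ * ‖x‖⁻¹ * unitv i x * radialD Q x ^ 2
      + 2 * (2 * m * ‖x‖⁻¹) * radialD Q x * partialD i (radialD Q) x := by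
  have h0 := h.ne_zero hx
  have d2 := fun j => ContDiffAt.dAt (contDiffAt_partialD (h.contDiffAt hx) j)
  have d3 := ContDiffAt.dAt (h.contDiffAt_radialD hx)
  have d4 := ContDiffAt.dAt (contDiffAt_inv_norm h0)
  have d5 := d4.const_mul (2 * m)
  have d6 : DifferentiableAt ℝ (fun x => ∑ i, partialD i Q x * partialD i Q x) x :=
    DifferentiableAt.fun_sum fun i _ => (d2 i).fun_mul (d2 i)
  have e : ∀ z ∈ U, gramL m Q z = 2 * radialD Q z - (∑ i, partialD i Q z * partialD i Q z)
      + 2 * m * ‖z‖⁻¹ * (radialD Q z * radialD Q z) := fun z hz => by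
    rw [h.gramL_eq hz]; ring
  rw [partialD_congr_of_mem h.isOpen e hx, partialD_add ((d3.const_mul 2).fun_sub d6)
    (d5.fun_mul (d3.fun_mul d3)), partialD_sub (d3.const_mul 2) d6, partialD_const_mul d3,
    partialD_mul d5 (d3.fun_mul d3), partialD_mul d3 d3, partialD_const_mul d4,
    partialD_inv_norm h0, partialD_sum (fun k _ => (d2 k).fun_mul (d2 k))]
  simp only [partialD_mul (d2 _) (d2 _)]
  have : ∑ k, (partialD i (partialD k Q) x * partialD k Q x
      + partialD k Q x * partialD i (partialD k Q) x) =
      2 * ∑ k, partialD k Q x * partialD i (partialD k Q) x := by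
    rw [Finset.mul_sum]; exact Finset.sum_congr rfl fun k _ => by ring
  rw [this]
  ring

/-- The induced metric is positive only where the graph is spacelike, that is `L > 0`. -/
theorem IsGraphDomain.gramL_pos (h : IsGraphDomain m Q U) (hx : x ∈ U)
    (hpos : (inducedMetric (schwarzschild m) (graphMap (heightOf m Q)) x).PosDef) :
    0 < gramL m Q x := by
  by_contra! hL
  have hx0 := h.norm_pos hx
  have hy := sum_unitv_sq (h.ne_zero hx)
  have hμ0 : 0 ≤ 2 * m * ‖x‖⁻¹ := by have := h.nonneg; positivity
  have hμ : 2 * m * ‖x‖⁻¹ < 1 := by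
    rw [← div_eq_mul_inv, div_lt_one hx0]; exact h.outer x hx
  have e := gram_normal_normal (q := fun i => partialD i Q x) hy
    (show _ = radialD Q x from rfl) rfl
    (show gramL m Q x = _ from h.gramL_eq hx)
  set v : Fin 3 → ℝ := fun i => normalV m Q i x with hv
  have e2 : star v ⬝ᵥ (inducedMetric (schwarzschild m) (graphMap (heightOf m Q)) x *ᵥ v) =
      gramL m Q x * (1 - (1 - 2 * m * ‖x‖⁻¹) * gramL m Q x) := by
    rw [← e]
    simp only [dotProduct, Matrix.mulVec, Finset.mul_sum, star_trivial, hv, normalV_eq,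
      h.inducedMetric_eq hx, gramG, gradW]
    refine Finset.sum_congr rfl fun i _ => Finset.sum_congr rfl fun j _ => ?_
    ring
  have hv0 : v ≠ 0 := by
    intro hv0
    -- if `n = 0` then `∇Q = c y` and `L = c > 0`
    have hq : ∀ i, partialD i Q x = (1 + 2 * m * ‖x‖⁻¹ * radialD Q x) * unitv i x := by
      intro i
      have := congrFun hv0 i
      simp only [hv, normalV_eq, Pi.zero_apply] at this
      linarith
    have ha : radialD Q x = 1 + 2 * m * ‖x‖⁻¹ * radialD Q x := by
      conv_lhs => rw [radialD]
      calc ∑ i, unitv i x * partialD i Q x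
          = ∑ i, (1 + 2 * m * ‖x‖⁻¹ * radialD Q x) * (unitv i x * unitv i x) :=
            Finset.sum_congr rfl fun i _ => by rw [hq]; ring
        _ = _ := by rw [← Finset.mul_sum, hy, mul_one]
    have hb : ∑ i, partialD i Q x * partialD i Q x = radialD Q x ^ 2 := by
      calc ∑ i, partialD i Q x * partialD i Q x
          = ∑ i, (1 + 2 * m * ‖x‖⁻¹ * radialD Q x) ^ 2 * (unitv i x * unitv i x) :=
            Finset.sum_congr rfl fun i _ => by rw [hq]; ring
        _ = _ := by rw [← Finset.mul_sum, hy, mul_one, ← ha]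
    rw [h.gramL_eq hx, hb] at hL
    have h3 : radialD Q x * (1 - 2 * m * ‖x‖⁻¹) = 1 := by linear_combination ha
    have h4 : 0 < radialD Q x := by
      by_contra! h4
      nlinarith
    nlinarith
  have h5 := hpos.dotProduct_mulVec_pos hv0
  rw [e2] at h5
  nlinarith [mul_nonneg (sub_nonneg.2 hμ.le) (neg_nonneg.2 hL)]

theorem IsGraphDomain.inv_inducedMetric (h : IsGraphDomain m Q U) (hx : x ∈ U)
    (hL : 0 < gramL m Q x) :
    (inducedMetric (schwarzschild m) (graphMap (heightOf m Q)) x)⁻¹ = Matrix.of fun i j =>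
      (if i = j then 1 else 0) - 2 * m * ‖x‖⁻¹ * (unitv i x * unitv j x)
        + normalV m Q i x * normalV m Q j x / gramL m Q x := by
  refine Matrix.inv_eq_right_inv ?_
  ext i k
  have e := gram_mul_inverse (q := fun i => partialD i Q x) (sum_unitv_sq (h.ne_zero hx)) rfl rfl
    (show gramL m Q x = _ from h.gramL_eq hx) hL.ne' i k
  rw [Matrix.mul_apply, Matrix.one_apply, ← e]
  refine Finset.sum_congr rfl fun j _ => ?_
  rw [h.inducedMetric_eq hx, Matrix.of_apply, normalV_eq, normalV_eq, gramG, gradW, gradW]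
  rfl

/-- The divergence of the vector field `n` with components `normalV`. -/
noncomputable def divNormal (m : ℝ) (Q : E 3 → ℝ) (x : E 3) : ℝ :=
  ∑ i, partialD i (normalV m Q i) x

/-- `L div n - (1/2) n·∇L`, equal to `3 L^{3/2} H` where `H` is the mean curvature. -/
noncomputable def meanR (m : ℝ) (Q : E 3 → ℝ) (x : E 3) : ℝ :=
  gramL m Q x * divNormal m Q x - 1 / 2 * ∑ i, normalV m Q i x * partialD i (gramL m Q) x

theorem hessB_eq (i j : Fin 3) : hessB m Q x i j =
    ((if i = j then 1 else 0) - unitv i x * unitv j x) * ‖x‖⁻¹ * (1 + 2 * m * ‖x‖⁻¹ * radialD Q x)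
    - partialD i (partialD j Q) x
    - 2 * m * ‖x‖⁻¹ / 2 * ‖x‖⁻¹ * (partialD i Q x * partialD j Q x
        * (1 - (1 - 2 * m * ‖x‖⁻¹) * radialD Q x)
      + radialD Q x * (unitv i x * partialD j Q x + unitv j x * partialD i Q x)) := by
  rw [hessB]; ring

theorem IsGraphDomain.meanR_eq (h : IsGraphDomain m Q U) (hx : x ∈ U) :
    gramL m Q x * (∑ i, hessB m Q x i i
      - 2 * m * ‖x‖⁻¹ * ∑ i, ∑ j, hessB m Q x i j * (unitv i x * unitv j x))
      + ∑ i, ∑ j, hessB m Q x i j * (normalV m Q i x * normalV m Q j x) = meanR m Q x := by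
  have h1 := mean_curvature_algebra (q := fun i => partialD i Q x) (sum_unitv_sq (h.ne_zero hx))
    (fun i j => partialD i (partialD j Q) x) (fun i j => partialD_comm (h.contDiffAt hx) i j)
    ‖x‖⁻¹ rfl rfl (show gramL m Q x = _ from h.gramL_eq hx) rfl
    (fun i j => hessB_eq (m := m) (Q := Q) (x := x) i j)
    (fun i => normalV_eq i) (fun i => h.partialD_radialD hx i) (fun i => h.partialD_gramL hx i)
  rw [h1, meanR, divNormal]
  congr 2
  refine Finset.sum_congr rfl fun i _ => ?_
  rw [h.partialD_normalV hx, if_pos rfl]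
  rfl

theorem IsGraphDomain.sum_inv_mul (h : IsGraphDomain m Q U) (hx : x ∈ U)
    (hL : 0 < gramL m Q x) :
    ∑ i, ∑ j, (inducedMetric (schwarzschild m) (graphMap (heightOf m Q)) x)⁻¹ i j *
      secondFundamentalForm (schwarzschild m) (graphMap (heightOf m Q))
      (futureUnitNormal (schwarzschild m) (heightOf m Q)) x i j =
      (Real.sqrt (gramL m Q x))⁻¹ * (gramL m Q x)⁻¹ * meanR m Q x := by
  rw [← h.meanR_eq hx, h.inv_inducedMetric hx hL]
  simp only [h.secondFundamentalForm_eq hx, Matrix.of_apply]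
  have e : ∀ i j, ((if i = j then (1 : ℝ) else 0) - 2 * m * ‖x‖⁻¹ * (unitv i x * unitv j x)
        + normalV m Q i x * normalV m Q j x / gramL m Q x) *
        ((Real.sqrt (gramL m Q x))⁻¹ * hessB m Q x i j) =
      (Real.sqrt (gramL m Q x))⁻¹ * ((if i = j then hessB m Q x i j else 0)
        - 2 * m * ‖x‖⁻¹ * (hessB m Q x i j * (unitv i x * unitv j x))
        + (gramL m Q x)⁻¹ * (hessB m Q x i j * (normalV m Q i x * normalV m Q j x))) := by
    intro i j
    split_ifs <;> ring
  simp only [e, Finset.sum_sub_distrib, ← Finset.mul_sum, Finset.sum_add_distrib,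
    Finset.sum_ite_eq, Finset.mem_univ, if_true]
  field_simp

theorem IsGraphDomain.meanR_of_cmc (h : IsGraphDomain m Q U) (hx : x ∈ U)
    (hL : 0 < gramL m Q x)
    (hH : meanCurvature (schwarzschild m) (graphMap (heightOf m Q))
      (futureUnitNormal (schwarzschild m) (heightOf m Q)) x = 1) :
    meanR m Q x = 3 * (Real.sqrt (gramL m Q x) * gramL m Q x) := by
  rw [meanCurvature, h.sum_inv_mul hx hL] at hH
  have hs := (Real.sqrt_pos.2 hL).ne'
  have := hL.ne'
  push_cast at hH
  field_simp at hH
  linarith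

end Graph

end SchwarzschildCMC

namespace SchwarzschildCMC

open Set Filter Topology

/-! ### The constant mean curvature equation and the scalar curvature -/

variable {m : ℝ} {Q : E 3 → ℝ} {U : Set (E 3)} {x : E 3}

/-- A graph domain on which the graph is spacelike with mean curvature one. -/
structure IsCMCGraph (m : ℝ) (Q : E 3 → ℝ) (U : Set (E 3)) : Prop extends IsGraphDomain m Q U where
  posDef : ∀ x ∈ U, (inducedMetric (schwarzschild m) (graphMap (heightOf m Q)) x).PosDef
  cmc : ∀ x ∈ U, meanCurvature (schwarzschild m) (graphMap (heightOf m Q))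
      (futureUnitNormal (schwarzschild m) (heightOf m Q)) x = 1

theorem IsCMCGraph.gramL_pos (h : IsCMCGraph m Q U) (hx : x ∈ U) : 0 < gramL m Q x :=
  h.toIsGraphDomain.gramL_pos hx (h.posDef x hx)

theorem IsCMCGraph.meanR_eq (h : IsCMCGraph m Q U) (hx : x ∈ U) :
    meanR m Q x = 3 * (Real.sqrt (gramL m Q x) * gramL m Q x) :=
  h.meanR_of_cmc hx (h.gramL_pos hx) (h.cmc x hx)

theorem IsCMCGraph.sq_meanR (h : IsCMCGraph m Q U) (hx : x ∈ U) :
    meanR m Q x ^ 2 = 9 * gramL m Q x ^ 3 := by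
  rw [h.meanR_eq hx]
  have := Real.sq_sqrt (h.gramL_pos hx).le
  linear_combination 9 * gramL m Q x ^ 2 * this

/-- The constant mean curvature equation in divergence form. -/
theorem IsCMCGraph.divergence_form (h : IsCMCGraph m Q U) (hx : x ∈ U) :
    ∑ i, partialD i (fun z => (Real.sqrt (gramL m Q z))⁻¹ * normalV m Q i z) x = 3 := by
  have hL := h.gramL_pos hx
  have hs := Real.sqrt_pos.2 hL
  have dn := fun i => ContDiffAt.dAt (h.contDiffAt_normalV hx i)
  have dL := ContDiffAt.dAt (h.contDiffAt_gramL hx)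
  have hu : HasDerivAt (fun t : ℝ => (Real.sqrt t)⁻¹)
      (-(1 / (2 * Real.sqrt (gramL m Q x))) / Real.sqrt (gramL m Q x) ^ 2) (gramL m Q x) :=
    (Real.hasDerivAt_sqrt hL.ne').inv hs.ne'
  have dS : DifferentiableAt ℝ (fun z => (Real.sqrt (gramL m Q z))⁻¹) x :=
    hu.differentiableAt.comp x dL
  have e : ∀ i, partialD i (fun z => (Real.sqrt (gramL m Q z))⁻¹ * normalV m Q i z) x =
      (Real.sqrt (gramL m Q x))⁻¹ * partialD i (normalV m Q i) x
      + -(1 / (2 * Real.sqrt (gramL m Q x))) / Real.sqrt (gramL m Q x) ^ 2 *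
        (normalV m Q i x * partialD i (gramL m Q) x) := by
    intro i
    rw [partialD_mul dS (dn i), partialD_comp (f := gramL m Q) hu dL]
    ring
  simp only [e, Finset.sum_add_distrib, ← Finset.mul_sum]
  have h1 := h.meanR_eq hx
  rw [meanR] at h1
  have h2 := Real.sq_sqrt hL.le
  have h3 : gramL m Q x * divNormal m Q x = 3 * (Real.sqrt (gramL m Q x) * gramL m Q x)
    + 1 / 2 * ∑ i, normalV m Q i x * partialD i (gramL m Q) x := by linarith
  change (Real.sqrt (gramL m Q x))⁻¹ * divNormal m Q x + _ = 3
  generalize ∑ i, normalV m Q i x * partialD i (gramL m Q) x = Z at *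
  have h4 : divNormal m Q x = (3 * (Real.sqrt (gramL m Q x) * gramL m Q x) + 1 / 2 * Z) /
      gramL m Q x := by rw [eq_div_iff hL.ne']; linarith
  rw [h4, h2]
  field_simp
  ring

/-- The tensor `T = √L A - κ γ`, where `γ` is the induced metric and `A` the second fundamental form.
It measures the deviation of `A` from being umbilic, when `κ` is close to `√L`. -/
noncomputable def umbilicT (m : ℝ) (Q κ : E 3 → ℝ) (x : E 3) (i j : Fin 3) : ℝ :=
  hessB m Q x i j - κ x * gramG m Q x i j

/-- The inverse of the induced metric without the term `n n / L`. -/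
noncomputable def gramP (m : ℝ) (x : E 3) (i j : Fin 3) : ℝ :=
  (if i = j then 1 else 0) - 2 * m * ‖x‖⁻¹ * (unitv i x * unitv j x)

theorem gramG_comm (x : E 3) (i j : Fin 3) : gramG m Q x i j = gramG m Q x j i := by
  simp only [gramG, eq_comm (a := i)]; ring

theorem IsGraphDomain.hessB_comm (h : IsGraphDomain m Q U) (hx : x ∈ U) (i j : Fin 3) :
    hessB m Q x i j = hessB m Q x j i := by
  simp only [hessB, eq_comm (a := i), SchwarzschildCMC.partialD_comm (h.contDiffAt hx) i j]; ring

/-- The square of the norm of `T` for an inverse metric `P + n n / L`. -/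
theorem sum_contract_rank_one (P T : Fin 3 → Fin 3 → ℝ) (hT : ∀ i j, T i j = T j i)
    (n : Fin 3 → ℝ) (l : ℝ) :
    ∑ i, ∑ j, ∑ k, ∑ p, (P i j + n i * n j * l) * (P k p + n k * n p * l) * T j p * T k i =
    (∑ i, ∑ j, ∑ k, ∑ p, P i j * P k p * T j p * T k i)
      + 2 * l * (∑ i, ∑ j, P i j * (∑ k, T i k * n k) * (∑ k, T j k * n k))
      + (l * ∑ i, ∑ j, T i j * (n i * n j)) ^ 2 := by
  have e : ∀ i j k p, (P i j + n i * n j * l) * (P k p + n k * n p * l) * T j p * T k i =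
      P i j * P k p * T j p * T k i + l * (P i j * (T i k * n k) * (T j p * n p))
      + l * (P k p * (T k i * n i) * (T p j * n j))
      + l ^ 2 * ((T k i * (n k * n i)) * (T p j * (n p * n j))) := by
    intro i j k p
    rw [hT p j, hT i k]
    ring
  have e0 : ∑ i, ∑ j, ∑ k, ∑ p,
      (P i j + n i * n j * l) * (P k p + n k * n p * l) * T j p * T k i =
      (∑ i, ∑ j, ∑ k, ∑ p, P i j * P k p * T j p * T k i)
      + l * (∑ i, ∑ j, ∑ k, ∑ p, P i j * (T i k * n k) * (T j p * n p))
      + l * (∑ i, ∑ j, ∑ k, ∑ p, P k p * (T k i * n i) * (T p j * n j))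
      + l ^ 2 * (∑ i, ∑ j, ∑ k, ∑ p, (T k i * (n k * n i)) * (T p j * (n p * n j))) := by
    simp only [e, Finset.sum_add_distrib, Finset.mul_sum]
  have e1 : ∑ i, ∑ j, ∑ k, ∑ p, P i j * (T i k * n k) * (T j p * n p) =
      ∑ i, ∑ j, P i j * (∑ k, T i k * n k) * (∑ k, T j k * n k) := by
    refine Finset.sum_congr rfl fun i _ => Finset.sum_congr rfl fun j _ => ?_
    simp only [Finset.mul_sum, Finset.sum_mul]
    rw [Finset.sum_comm]
  have e2 : ∑ i, ∑ j, ∑ k, ∑ p, P k p * (T k i * n i) * (T p j * n j) =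
      ∑ i, ∑ j, P i j * (∑ k, T i k * n k) * (∑ k, T j k * n k) := by
    rw [← e1]
    have s1 : ∀ F : Fin 3 → Fin 3 → Fin 3 → Fin 3 → ℝ,
        ∑ i, ∑ j, ∑ k, ∑ p, F i j k p = ∑ k, ∑ p, ∑ i, ∑ j, F i j k p := by
      intro F
      calc ∑ i, ∑ j, ∑ k, ∑ p, F i j k p = ∑ i, ∑ k, ∑ j, ∑ p, F i j k p :=
            Finset.sum_congr rfl fun i _ => Finset.sum_comm
        _ = ∑ k, ∑ i, ∑ j, ∑ p, F i j k p := Finset.sum_comm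
        _ = ∑ k, ∑ i, ∑ p, ∑ j, F i j k p := Finset.sum_congr rfl fun k _ =>
            Finset.sum_congr rfl fun i _ => Finset.sum_comm
        _ = _ := Finset.sum_congr rfl fun k _ => Finset.sum_comm
    rw [s1]
  have e3 : ∑ i, ∑ j, ∑ k, ∑ p, (T k i * (n k * n i)) * (T p j * (n p * n j)) =
      (∑ i, ∑ j, T i j * (n i * n j)) ^ 2 := by
    have : ∑ i, ∑ j, T i j * (n i * n j) = ∑ i, ∑ k, T k i * (n k * n i) := Finset.sum_comm
    rw [this, sq, Finset.sum_mul_sum]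
    refine Finset.sum_congr rfl fun i _ => Finset.sum_congr rfl fun j _ => ?_
    rw [Finset.sum_mul_sum]
  rw [e0, e1, e2, e3]
  ring

/-- The scalar curvature of a spacelike graph with mean curvature one, by the Gauss equation for
`A = L^{-1/2} (κ γ + T)`. The right hand side is quadratic in `T` and in `√L - κ`. -/
theorem IsCMCGraph.scalarCurvature_eq (h : IsCMCGraph m Q U) (hx : x ∈ U) (κ : E 3 → ℝ) :
    scalarCurvature (inducedMetric (schwarzschild m) (graphMap (heightOf m Q))) x + 6 =
      (gramL m Q x)⁻¹ * ((∑ i, ∑ j, ∑ k, ∑ p, gramP m x i j * gramP m x k p *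
          umbilicT m Q κ x j p * umbilicT m Q κ x k i)
      + 2 * (gramL m Q x)⁻¹ * (∑ i, ∑ j, gramP m x i j *
          (∑ k, umbilicT m Q κ x i k * normalV m Q k x) *
          (∑ k, umbilicT m Q κ x j k * normalV m Q k x))
      + ((gramL m Q x)⁻¹ * ∑ i, ∑ j, umbilicT m Q κ x i j *
          (normalV m Q i x * normalV m Q j x)) ^ 2
      - 3 * (Real.sqrt (gramL m Q x) - κ x) ^ 2) := by
  have hL := h.gramL_pos hx
  have hs := Real.sqrt_pos.2 hL
  have hs2 := Real.sq_sqrt hL.le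
  have hdet : ∀ x ∈ U,
      IsUnit (inducedMetric (schwarzschild m) (graphMap (heightOf m Q)) x).det :=
    fun x hx => (h.posDef x hx).det_pos.ne'.isUnit
  rw [h.isMapInto.scalarCurvature_eq (isMetricOn_schwarzschild m) hdet hx
    (fun i j => ricci_schwarzschild (h.isMapInto.mapsTo x hx) i j)
    (futureUnitNormal (schwarzschild m) (heightOf m Q)) (h.normal_orthogonal hx)
    (h.normal_unit hx hL)]
  have hH := h.cmc x hx
  rw [meanCurvature] at hH
  have hT : ∀ i j, umbilicT m Q κ x i j = umbilicT m Q κ x j i := fun i j => by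
    rw [umbilicT, umbilicT, h.hessB_comm hx, gramG_comm]
  rw [← sum_contract_rank_one (fun i j => gramP m x i j) (fun i j => umbilicT m Q κ x i j) hT
    (fun i => normalV m Q i x) (gramL m Q x)⁻¹]
  set γ := inducedMetric (schwarzschild m) (graphMap (heightOf m Q)) x with hγ
  set A := secondFundamentalForm (schwarzschild m) (graphMap (heightOf m Q))
    (futureUnitNormal (schwarzschild m) (heightOf m Q)) x with hA
  have hinv : ∀ i j, γ⁻¹ i j = gramP m x i j + normalV m Q i x * normalV m Q j x * (gramL m Q x)⁻¹ :=
    fun i j => by rw [hγ, h.inv_inducedMetric hx hL]; simp [gramP, div_eq_mul_inv]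
  simp only [← hinv]
  set T : Matrix (Fin 3) (Fin 3) ℝ := Matrix.of (umbilicT m Q κ x) with hTd
  have hAT : A = (Real.sqrt (gramL m Q x))⁻¹ • (κ x • γ + T) := by
    ext i j
    rw [hA, h.secondFundamentalForm_eq hx, Matrix.smul_apply, Matrix.add_apply, Matrix.smul_apply,
      hγ, h.inducedMetric_eq hx, hTd, Matrix.of_apply, umbilicT]
    simp only [smul_eq_mul]
    ring
  have hTs : Tᵀ = T := by ext i j; exact hT j i
  have hγs : γᵀ = γ := by
    ext i j; rw [Matrix.transpose_apply, hγ, h.inducedMetric_eq hx, h.inducedMetric_eq hx, gramG_comm]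
  have hAs : Aᵀ = A := by rw [hAT, Matrix.transpose_smul, Matrix.transpose_add,
    Matrix.transpose_smul, hγs, hTs]
  have hγγ : γ⁻¹ * γ = 1 := Matrix.nonsing_inv_mul _ (hdet x hx)
  have tr1 : ∀ M : Matrix (Fin 3) (Fin 3) ℝ, Mᵀ = M →
      ∑ i, ∑ j, γ⁻¹ i j * M i j = (γ⁻¹ * M).trace := by
    intro M hM
    simp only [Matrix.trace, Matrix.diag, Matrix.mul_apply]
    refine Finset.sum_congr rfl fun i _ => Finset.sum_congr rfl fun j _ => ?_
    rw [← congrFun (congrFun hM i) j, Matrix.transpose_apply]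
  have tr2 : ∀ M : Matrix (Fin 3) (Fin 3) ℝ, Mᵀ = M →
      ∑ i, ∑ j, ∑ k, ∑ p, γ⁻¹ i j * γ⁻¹ k p * M j p * M k i =
        (γ⁻¹ * M * (γ⁻¹ * M)).trace := by
    intro M hM
    have hM' : ∀ i j, M i j = M j i := fun i j => by
      conv_lhs => rw [← hM, Matrix.transpose_apply]
    have hγs' : ∀ i j, γ⁻¹ i j = γ⁻¹ j i := fun i j => by
      conv_lhs => rw [← hγs, ← Matrix.transpose_nonsing_inv, Matrix.transpose_apply]
    simp only [Matrix.trace, Matrix.diag, Matrix.mul_apply, Finset.sum_mul, Finset.mul_sum]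
    refine Finset.sum_congr rfl fun i _ => ?_
    have : ∀ F : Fin 3 → Fin 3 → Fin 3 → ℝ, ∑ j, ∑ k, ∑ p, F j k p = ∑ p, ∑ k, ∑ j, F j k p := by
      intro F
      calc ∑ j, ∑ k, ∑ p, F j k p = ∑ k, ∑ j, ∑ p, F j k p := Finset.sum_comm
        _ = ∑ k, ∑ p, ∑ j, F j k p := Finset.sum_congr rfl fun _ _ => Finset.sum_comm
        _ = _ := Finset.sum_comm
    rw [this]
    refine Finset.sum_congr rfl fun p _ => Finset.sum_congr rfl fun k _ =>
      Finset.sum_congr rfl fun j _ => ?_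
    rw [hγs' k p]
    ring
  rw [tr1 A hAs] at hH
  rw [tr1 A hAs, tr2 A hAs]
  have e2 := tr2 T hTs
  simp only [hTd, Matrix.of_apply] at e2
  rw [e2, ← hTd]
  -- mean curvature one prescribes the trace of `T`
  have hb : γ⁻¹ * A = (Real.sqrt (gramL m Q x))⁻¹ • (κ x • 1 + γ⁻¹ * T) := by
    rw [hAT, Matrix.mul_smul, Matrix.mul_add, Matrix.mul_smul, hγγ]
  rw [hb] at hH ⊢
  simp only [Matrix.smul_mul, Matrix.mul_smul, Matrix.add_mul, Matrix.mul_add, Matrix.one_mul,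
    Matrix.mul_one, Matrix.trace_smul, Matrix.trace_add, Matrix.trace_one, smul_eq_mul,
    Fintype.card_fin] at hH ⊢
  push_cast at hH ⊢
  set t := (γ⁻¹ * T).trace
  have ht : t = 3 * Real.sqrt (gramL m Q x) - 3 * κ x := by
    field_simp at hH
    linarith
  set z := Real.sqrt (gramL m Q x)
  rw [ht, ← hs2]
  field_simp
  ring

end SchwarzschildCMC

namespace SchwarzschildCMC

open Set Filter Topology

/-! ### The hyperboloids -/

/-- The height `√(1 + |x - ξ|²)` of a unit hyperboloid of Minkowski space. -/
noncomputable def refW (ξ x : E 3) : ℝ := √(1 + ‖x - ξ‖ ^ 2)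

theorem refW_pos (ξ x : E 3) : 0 < refW ξ x := Real.sqrt_pos.2 (by positivity)

theorem refW_sq (ξ x : E 3) : refW ξ x ^ 2 = 1 + ‖x - ξ‖ ^ 2 := Real.sq_sqrt (by positivity)

/-- `κ = 1 / √(1 + |x - ξ|²)`. -/
noncomputable def refκ (ξ x : E 3) : ℝ := (refW ξ x)⁻¹

theorem refκ_pos (ξ x : E 3) : 0 < refκ ξ x := inv_pos.2 (refW_pos ξ x)

theorem contDiff_refW (ξ : E 3) : ContDiff ℝ ∞ (refW ξ) :=
  ContDiff.sqrt (contDiff_const.add (ContDiff.norm_sq ℝ (by fun_prop))) fun x => by positivity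

theorem contDiff_refκ (ξ : E 3) : ContDiff ℝ ∞ (refκ ξ) :=
  (contDiff_refW ξ).inv fun x => (refW_pos ξ x).ne'

theorem norm_sub_sq_eq (ξ x : E 3) : ‖x - ξ‖ ^ 2 = ∑ i, (x i - ξ i) * (x i - ξ i) := by
  rw [← sum_sq_eq]; rfl

theorem partialD_refW (ξ x : E 3) (i : Fin 3) :
    partialD i (refW ξ) x = (x i - ξ i) * refκ ξ x := by
  have hp : (0 : ℝ) < 1 + ‖x - ξ‖ ^ 2 := by positivity
  have d : DifferentiableAt ℝ (fun x : E 3 => 1 + ‖x - ξ‖ ^ 2) x :=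
    (DifferentiableAt.norm_sq ℝ (by fun_prop)).const_add 1
  have e : refW ξ = fun x => √(1 + ‖x - ξ‖ ^ 2) := rfl
  rw [e, partialD_comp (f := fun x : E 3 => 1 + ‖x - ξ‖ ^ 2) (Real.hasDerivAt_sqrt hp.ne') d]
  have e2 : (fun x : E 3 => 1 + ‖x - ξ‖ ^ 2) =
      fun x => 1 + ∑ i, (x i - ξ i) * (x i - ξ i) := by ext x; rw [norm_sub_sq_eq]
  have d2 : ∀ j, DifferentiableAt ℝ (fun x : E 3 => x j - ξ j) x := fun j => by fun_prop
  rw [e2, partialD_add (f := fun _ => (1 : ℝ)) (by fun_prop) (by fun_prop), partialD_const,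
    partialD_sum (fun j _ => (d2 j).fun_mul (d2 j))]
  have e3 : ∀ j, partialD i (fun y : E 3 => (y j - ξ j) * (y j - ξ j)) x =
      if i = j then 2 * (x j - ξ j) else 0 := by
    intro j
    rw [partialD_mul (d2 j) (d2 j), partialD_sub (f := fun y : E 3 => y j) (by fun_prop)
      (by fun_prop), partialD_coord, partialD_const]
    split_ifs <;> ring
  simp only [e3, Finset.sum_ite_eq, Finset.mem_univ, if_true]
  have := (refW_pos ξ x).ne'
  rw [refκ, refW] at *
  field_simp
  ring

theorem sum_partialD_refW_sq (ξ x : E 3) :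
    ∑ i, partialD i (refW ξ) x * partialD i (refW ξ) x = 1 - refκ ξ x ^ 2 := by
  have e : ∀ i, partialD i (refW ξ) x * partialD i (refW ξ) x =
      refκ ξ x ^ 2 * ((x i - ξ i) * (x i - ξ i)) := fun i => by rw [partialD_refW]; ring
  simp only [e, ← Finset.mul_sum, ← norm_sub_sq_eq]
  have h1 := refW_sq ξ x
  have h2 := (refW_pos ξ x).ne'
  rw [refκ]
  field_simp
  linarith

theorem partialD_refκ (ξ x : E 3) (i : Fin 3) :
    partialD i (refκ ξ) x = -(refκ ξ x ^ 2 * partialD i (refW ξ) x) := by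
  have e : refκ ξ = fun x => (refW ξ x)⁻¹ := rfl
  rw [e, partialD_comp (f := refW ξ) (hasDerivAt_inv (refW_pos ξ x).ne')
    (ContDiffAt.dAt (contDiff_refW ξ).contDiffAt)]
  ring

theorem partialD_partialD_refW (ξ x : E 3) (i j : Fin 3) :
    partialD i (partialD j (refW ξ)) x =
      refκ ξ x * ((if i = j then 1 else 0) - partialD i (refW ξ) x * partialD j (refW ξ) x) := by
  have e : partialD j (refW ξ) = fun x => (x j - ξ j) * refκ ξ x := by
    ext x; exact partialD_refW ξ x j
  have d2 : DifferentiableAt ℝ (fun x : E 3 => x j - ξ j) x := by fun_prop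
  rw [e, partialD_mul d2 (ContDiffAt.dAt (contDiff_refκ ξ).contDiffAt),
    partialD_sub (f := fun y : E 3 => y j) (by fun_prop) (by fun_prop), partialD_coord,
    partialD_const, partialD_refκ]
  ring

/-- `1 + |x - ξ|²` rescaled by `|x|²`, in terms of the direction of `x` and `σ = |x| ^ (-1/2)`. -/
noncomputable def refA (ξ : E 3) (p : E 3 × ℝ) : ℝ := ‖p.1 - p.2 ^ 2 • ξ‖ ^ 2 + p.2 ^ 4

theorem refA_pos (ξ : E 3) {p : E 3 × ℝ} (hp : p.1 ≠ 0) : 0 < refA ξ p := by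
  rw [refA]
  by_cases h : p.2 = 0
  · have : 0 < ‖p.1‖ := norm_pos_iff.2 hp
    simp [h, this]
  · have : 0 < p.2 ^ 4 := by positivity
    positivity

theorem contDiff_refA (ξ : E 3) : ContDiff ℝ ∞ (refA ξ) := by
  unfold refA
  exact (ContDiff.norm_sq ℝ (by fun_prop)).add (by fun_prop)

theorem contDiffOn_sqrt_refA (ξ : E 3) : ContDiffOn ℝ ∞ (fun p => √(refA ξ p)) {p | p.1 ≠ 0} :=
  (contDiff_refA ξ).contDiffOn.sqrt fun _ hp => (refA_pos ξ hp).ne'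

theorem refW_eq (ξ : E 3) {x : E 3} (hx : x ≠ 0) :
    refW ξ x = ‖x‖ * √(refA ξ (‖x‖⁻¹ • x, √(‖x‖⁻¹))) := by
  have h0 : 0 < ‖x‖ := norm_pos_iff.2 hx
  have h1 : √(‖x‖⁻¹) ^ 2 = ‖x‖⁻¹ := Real.sq_sqrt (by positivity)
  have h2 : √(‖x‖⁻¹) ^ 4 = ‖x‖⁻¹ ^ 2 := by
    rw [show √(‖x‖⁻¹) ^ 4 = (√(‖x‖⁻¹) ^ 2) ^ 2 by ring, h1]
  rw [refW, refA, h1, h2, ← smul_sub, norm_smul, Real.norm_of_nonneg (by positivity),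
    ← Real.sqrt_sq h0.le, ← Real.sqrt_mul (by positivity), Real.sqrt_sq h0.le]
  congr 1
  field_simp
  ring

theorem isSymbol_refW {U : Set (E 3)} (hU : IsExterior U) (ξ : E 3) : IsSymbol U (-1) (refW ξ) := by
  have h := (isSymbol_norm hU).mul (isSymbol_of_smooth hU (contDiffOn_sqrt_refA ξ)
    (φ := fun x => √(refA ξ (‖x‖⁻¹ • x, √(‖x‖⁻¹)))) fun x _ => rfl) hU
  simpa using h.congr hU fun x hx => refW_eq ξ (hU.ne_zero hx)

theorem isSymbol_refκ {U : Set (E 3)} (hU : IsExterior U) (ξ : E 3) : IsSymbol U 1 (refκ ξ) := by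
  have h := (isSymbol_inv_norm hU).mul (isSymbol_of_smooth hU
    ((contDiffOn_sqrt_refA ξ).inv fun p hp => (Real.sqrt_pos.2 (refA_pos ξ hp)).ne')
    (φ := fun x => (√(refA ξ (‖x‖⁻¹ • x, √(‖x‖⁻¹))))⁻¹) fun x _ => rfl) hU
  simpa using h.congr hU fun x hx => by rw [refκ, refW_eq ξ (hU.ne_zero hx), mul_inv]

/-- The function `r - √(1 + |x - ξ|²)` in terms of the direction and `σ`. -/
noncomputable def refF (ξ : E 3) (p : E 3 × ℝ) : ℝ :=
  (2 * (∑ i, ξ i * p.1 i) - p.2 ^ 2 * (1 + ‖ξ‖ ^ 2)) / (1 + √(refA ξ p))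

theorem contDiffOn_refF (ξ : E 3) : ContDiffOn ℝ ∞ (refF ξ) {p | p.1 ≠ 0} :=
  ContDiffOn.div (by fun_prop) (contDiffOn_const.add (contDiffOn_sqrt_refA ξ))
    fun p _ => by positivity

theorem refF_neg (ξ x : E 3) (σ : ℝ) : refF ξ (x, -σ) = refF ξ (x, σ) := by
  simp [refF, refA, Even.neg_pow (show Even 4 by decide)]

theorem refF_zero (ξ : E 3) {y : E 3} (hy : ‖y‖ = 1) : refF ξ (y, 0) = ∑ i, ξ i * y i := by
  simp [refF, refA, hy]
  ring

theorem norm_sub_refW (ξ : E 3) {x : E 3} (hx : x ≠ 0) :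
    ‖x‖ - refW ξ x = refF ξ (‖x‖⁻¹ • x, √(‖x‖⁻¹)) := by
  have h0 : 0 < ‖x‖ := norm_pos_iff.2 hx
  have h1 : √(‖x‖⁻¹) ^ 2 = ‖x‖⁻¹ := Real.sq_sqrt (by positivity)
  have hA := refW_eq ξ hx
  rw [refF, eq_div_iff (by positivity), h1]
  set z := √(refA ξ (‖x‖⁻¹ • x, √(‖x‖⁻¹))) with hz
  have h2 := refW_sq ξ x
  have h3 : ‖x - ξ‖ ^ 2 = ‖x‖ ^ 2 - 2 * (∑ i, ξ i * x i) + ‖ξ‖ ^ 2 := by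
    rw [norm_sub_sq_eq, ← sum_sq_eq, ← sum_sq_eq]
    simp only [Fin.sum_univ_three]
    ring
  have h4 : ∑ i, ξ i * (‖x‖⁻¹ • x) i = ‖x‖⁻¹ * ∑ i, ξ i * x i := by
    rw [Finset.mul_sum]
    exact Finset.sum_congr rfl fun i _ => by simp; ring
  simp only [h4]
  rw [hA] at h2 ⊢
  field_simp
  linear_combination -h2 - h3

/-- The function defining the surface differs from that of a hyperboloid by a function which
vanishes at infinity, and is smooth in the direction and in `s`. -/
theorem exists_difference {P : S2 × ℝ → ℝ} {s₀ : ℝ} (hs₀ : 0 < s₀)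
    (hP : ContMDiffOn ((𝓡 2).prod 𝓘(ℝ, ℝ)) 𝓘(ℝ, ℝ) ∞ P (Set.univ ×ˢ Set.Ico 0 s₀))
    (hbdry : IsCombFirstFourEigenfunctions (fun y => P (y, 0))) :
    ∃ (c : ℝ) (ξ : E 3) (G F : E 3 × ℝ → ℝ) (R : ℝ), 1 ≤ R ∧
      ContDiffOn ℝ ∞ G {p | p.1 ≠ 0} ∧ (∀ x σ, x ≠ 0 → G (x, -σ) = G (x, σ)) ∧
      ContDiffOn ℝ ∞ F {p | p.1 ≠ 0} ∧ (∀ x σ, x ≠ 0 → F (x, -σ) = F (x, σ)) ∧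
      (∀ x ≠ 0, leading F x = 0) ∧
      ∀ x, R < ‖x‖ → P (direction x, ‖x‖⁻¹) = G (‖x‖⁻¹ • x, √(‖x‖⁻¹)) ∧
        P (direction x, ‖x‖⁻¹) = ‖x‖ - refW ξ x + c + F (‖x‖⁻¹ • x, √(‖x‖⁻¹)) := by
  obtain ⟨G, hG, hev, δ, hδ, hGP⟩ := exists_smooth_extension hs₀ hP
  obtain ⟨c, ξ, hc⟩ := exists_affine_of_isComb hbdry
  have key : ∀ x, max 1 (δ⁻¹ ^ 2) < ‖x‖ →
      P (direction x, ‖x‖⁻¹) = G (‖x‖⁻¹ • x, √(‖x‖⁻¹)) := by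
    intro x hx
    have h1 : 1 < ‖x‖ := (le_max_left _ _).trans_lt hx
    have h2 : δ⁻¹ ^ 2 < ‖x‖ := (le_max_right _ _).trans_lt hx
    have h0 : 0 < ‖x‖ := by linarith
    rw [hGP, Real.sq_sqrt (by positivity), direction_smul (by positivity)]
    rw [abs_of_nonneg (Real.sqrt_nonneg _), Real.sqrt_lt' hδ]
    rw [inv_lt_comm₀ h0 (by positivity)]
    simpa using h2
  refine ⟨c, ξ, G, fun p => G p - c - refF ξ p, max 1 (δ⁻¹ ^ 2), le_max_left _ _, hG,
    fun x σ _ => hev x σ, (hG.sub contDiffOn_const).sub (contDiffOn_refF ξ), ?_, ?_, ?_⟩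
  · intro x σ _
    simp only [hev, refF_neg]
  · intro x hx
    have h1 : ‖‖x‖⁻¹ • x‖ = 1 := by simp [norm_smul, hx]
    rw [leading, refF_zero ξ h1, hGP _ _ (by simpa using hδ), direction_smul (by positivity)]
    have := hc (direction x)
    simp only [direction_coe hx] at this
    rw [zero_pow two_ne_zero, this]
    simp
  · intro x hx
    refine ⟨key x hx, ?_⟩
    have h0 : x ≠ 0 := by
      rintro rfl
      simp at hx
      linarith [hx.1]
    rw [key x hx]
    linear_combination -norm_sub_refW ξ h0

end SchwarzschildCMC

namespace SchwarzschildCMC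

open Set Filter Topology

/-! ### Leading terms -/

/-- `φ₀` is a leading term of `φ`, of order `-k`: the remainder is a symbol of order `-k - 1`. -/
structure IsLead (U : Set (E 3)) (k : ℤ) (φ φ₀ : E 3 → ℝ) : Prop where
  lead : IsSymbol U k φ₀
  rem : IsSymbol U (k + 1) (fun x => φ x - φ₀ x)

section Lead

variable {U : Set (E 3)} {k l : ℤ} {φ ψ φ₀ ψ₀ : E 3 → ℝ}

theorem IsLead.symbol (h : IsLead U k φ φ₀) (hU : IsExterior U) : IsSymbol U k φ :=
  (h.lead.add (h.rem.of_le hU (by omega)) hU).congr hU fun x _ => by ring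

theorem isSymbol_zero (U : Set (E 3)) (k : ℤ) : IsSymbol U k (fun _ => 0) :=
  ⟨contDiffOn_const, fun n => ⟨0, fun x _ => by
    have : iteratedFDeriv ℝ n (fun _ : E 3 => (0 : ℝ)) x = 0 := by
      rw [iteratedFDeriv_fun_zero]; rfl
    simp [this]⟩⟩

theorem IsSymbol.isLead_self (h : IsSymbol U k φ) (hU : IsExterior U) : IsLead U k φ φ :=
  ⟨h, (isSymbol_zero U _).congr hU fun _ _ => sub_self _⟩

theorem IsSymbol.isLead_zero (h : IsSymbol U (k + 1) φ) (hU : IsExterior U) :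
    IsLead U k φ (fun _ => 0) :=
  ⟨isSymbol_zero U k, h.congr hU fun _ _ => sub_zero _⟩

theorem IsLead.add (hφ : IsLead U k φ φ₀) (hψ : IsLead U k ψ ψ₀) (hU : IsExterior U) :
    IsLead U k (fun x => φ x + ψ x) (fun x => φ₀ x + ψ₀ x) :=
  ⟨hφ.lead.add hψ.lead hU, (hφ.rem.add hψ.rem hU).congr hU fun x _ => by ring⟩

theorem IsLead.const_mul (hφ : IsLead U k φ φ₀) (hU : IsExterior U) (c : ℝ) :
    IsLead U k (fun x => c * φ x) (fun x => c * φ₀ x) :=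
  ⟨hφ.lead.const_mul hU c, (hφ.rem.const_mul hU c).congr hU fun x _ => by ring⟩

theorem IsLead.mul (hφ : IsLead U k φ φ₀) (hψ : IsLead U l ψ ψ₀) (hU : IsExterior U) :
    IsLead U (k + l) (fun x => φ x * ψ x) (fun x => φ₀ x * ψ₀ x) := by
  refine ⟨hφ.lead.mul hψ.lead hU, ?_⟩
  have h1 := (hφ.rem.mul (hψ.symbol hU) hU).of_le hU (show k + l + 1 ≤ _ by omega)
  have h2 := (hφ.lead.mul hψ.rem hU).of_le hU (show k + l + 1 ≤ _ by omega)
  exact (h1.add h2 hU).congr hU fun x _ => by ring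

theorem IsLead.congr (h : IsLead U k φ φ₀) (hU : IsExterior U) (h1 : ∀ x ∈ U, ψ x = φ x)
    (h2 : ∀ x ∈ U, ψ₀ x = φ₀ x) : IsLead U k ψ ψ₀ :=
  ⟨h.lead.congr hU h2, h.rem.congr hU fun x hx => by rw [h1 x hx, h2 x hx]⟩

theorem IsLead.cast (h : IsLead U k φ φ₀) (e : k = l) : IsLead U l φ φ₀ := e ▸ h

theorem IsLead.trans (h : IsLead U k φ φ₀) (h' : IsLead U k φ₀ ψ₀) (hU : IsExterior U) :
    IsLead U k φ ψ₀ :=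
  ⟨h'.lead, (h.rem.add h'.rem hU).congr hU fun x _ => by ring⟩

theorem isSymbol_unitv (hU : IsExterior U) (i : Fin 3) : IsSymbol U 0 (unitv i) :=
  ((isSymbol_coord hU i).mul (isSymbol_inv_norm hU) hU).congr hU fun _ _ => rfl

theorem IsSymbol.radialD (h : IsSymbol U k φ) (hU : IsExterior U) :
    IsSymbol U (k + 1) (radialD φ) :=
  IsSymbol.sum hU fun i _ => by
    simpa using (isSymbol_unitv hU i).mul (h.partialD hU i) hU

theorem radialD_congr (hU : IsOpen U) (h : ∀ x ∈ U, φ x = ψ x) {x : E 3} (hx : x ∈ U) :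
    SchwarzschildCMC.radialD φ x = SchwarzschildCMC.radialD ψ x :=
  Finset.sum_congr rfl fun i _ => by rw [partialD_congr_of_mem hU h hx]

theorem radialD_sub {x : E 3} (hφ : DifferentiableAt ℝ φ x) (hψ : DifferentiableAt ℝ ψ x) :
    SchwarzschildCMC.radialD (fun y => φ y - ψ y) x =
      SchwarzschildCMC.radialD φ x - SchwarzschildCMC.radialD ψ x := by
  simp only [SchwarzschildCMC.radialD, ← Finset.sum_sub_distrib, partialD_sub hφ hψ, mul_sub]

theorem radialD_add {x : E 3} (hφ : DifferentiableAt ℝ φ x) (hψ : DifferentiableAt ℝ ψ x) :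
    SchwarzschildCMC.radialD (fun y => φ y + ψ y) x =
      SchwarzschildCMC.radialD φ x + SchwarzschildCMC.radialD ψ x := by
  simp only [SchwarzschildCMC.radialD, ← Finset.sum_add_distrib, partialD_add hφ hψ, mul_add]

theorem radialD_const_mul {x : E 3} (hφ : DifferentiableAt ℝ φ x) (c : ℝ) :
    SchwarzschildCMC.radialD (fun y => c * φ y) x = c * SchwarzschildCMC.radialD φ x := by
  simp only [SchwarzschildCMC.radialD, Finset.mul_sum, partialD_const_mul hφ]
  exact Finset.sum_congr rfl fun i _ => by ring

theorem IsLead.radialD (h : IsLead U k φ φ₀) (hU : IsExterior U) :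
    IsLead U (k + 1) (radialD φ) (radialD φ₀) :=
  ⟨IsSymbol.radialD h.lead hU, (IsSymbol.radialD h.rem hU).congr hU fun x hx => by
    rw [radialD_sub ((h.symbol hU).differentiableAt hU hx) (h.lead.differentiableAt hU hx)]⟩

theorem IsSymbol.pow (h : IsSymbol U k φ) (hU : IsExterior U) (n : ℕ) :
    IsSymbol U (n * k) (fun x => φ x ^ n) := by
  induction n with
  | zero => simpa using IsSymbol.const U 1
  | succ n ih =>
    have := ih.mul h hU
    rw [show ((n + 1 : ℕ) : ℤ) * k = n * k + k by push_cast; ring]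
    exact this.congr hU fun x _ => pow_succ _ _

/-- The radial derivative of a homogeneous function. -/
theorem radialD_homogeneous {q : E 3 → ℝ} {x : E 3} (hx : x ≠ 0) (hq : DifferentiableAt ℝ q x)
    (hh : ∀ c : ℝ, 0 < c → ∀ y, q (c • y) = q y) (k : ℕ) :
    radialD (fun y => ‖y‖⁻¹ ^ k * q y) x = -(k * (‖x‖⁻¹ ^ (k + 1) * q x)) := by
  have h1 := euler_of_homogeneous 0 hx hq (fun c hc y _ => by simpa using hh c hc y)
  have d1 := ContDiffAt.dAt (contDiffAt_inv_norm hx)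
  have d2 : DifferentiableAt ℝ (fun y : E 3 => ‖y‖⁻¹ ^ k) x := d1.fun_pow k
  have e : ∀ i, unitv i x * partialD i (fun y : E 3 => ‖y‖⁻¹ ^ k * q y) x =
      -(k * (‖x‖⁻¹ ^ (k + 1) * q x)) * (unitv i x * unitv i x)
      + ‖x‖⁻¹ ^ (k + 1) * (x i * partialD i q x) := by
    intro i
    rw [partialD_mul d2 hq, partialD_comp (f := fun y : E 3 => ‖y‖⁻¹) (hasDerivAt_pow k _) d1,
      partialD_inv_norm hx]
    rcases k with _ | k
    · simp [unitv]; ring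
    · simp only [unitv, Nat.add_sub_cancel]; ring
  simp only [radialD, e, Finset.sum_add_distrib, ← Finset.mul_sum, sum_unitv_sq hx, h1]
  simp

/-- Terms of different homogeneity do not cancel. -/
theorem eq_zero_of_isSymbol {R : ℝ} {f : E 3 → ℝ}
    (hh : ∀ c : ℝ, 0 < c → ∀ y, f (c • y) = f y) (n : ℕ)
    (hf : IsSymbol {x : E 3 | R < ‖x‖} (n + 1) (fun x => ‖x‖⁻¹ ^ n * f x))
    (hR : 1 ≤ R) {x : E 3} (hx : x ≠ 0) : f x = 0 := by
  have hU := isExterior_norm_gt hR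
  obtain ⟨C, hC, hb⟩ := hf.bound hU
  have hx0 : 0 < ‖x‖ := norm_pos_iff.2 hx
  by_contra hne
  have hfx : 0 < |f x| := abs_pos.2 hne
  -- evaluate at a point far out on the ray through `x`
  set t := max R (C / |f x|) + 1 with ht
  have ht1 : R < t := by have := le_max_left R (C / |f x|); linarith
  have ht2 : C / |f x| < t := by have := le_max_right R (C / |f x|); linarith
  have ht0 : 0 < t := by linarith
  have hn : ‖(t * ‖x‖⁻¹) • x‖ = t := by
    rw [norm_smul, Real.norm_of_nonneg (by positivity)]
    field_simp
  have h1 := hb ((t * ‖x‖⁻¹) • x) (by change R < _; rw [hn]; exact ht1)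
  rw [hn, hh _ (by positivity), abs_mul, abs_of_pos (by positivity : 0 < t⁻¹ ^ n)] at h1
  have h2 : t ^ (-((n : ℤ) + 1)) = t⁻¹ ^ n * t⁻¹ := by
    rw [zpow_neg, ← inv_zpow, zpow_add_one₀ (by positivity), zpow_natCast]
  rw [h2] at h1
  have h3 : |f x| ≤ C * t⁻¹ := by
    have : 0 < t⁻¹ ^ n := by positivity
    nlinarith
  rw [← div_eq_mul_inv, le_div_iff₀ ht0] at h3
  rw [div_lt_iff₀ hfx] at ht2
  linarith

end Lead

end SchwarzschildCMC

namespace SchwarzschildCMC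

open Set Filter Topology

/-! ### Comparison of the surface with a hyperboloid -/

/-- A spacelike graph with mean curvature one which is compared with a hyperboloid centred at `ξ`:
the difference of the height functions is `D` up to a constant. -/
structure IsComparison (m : ℝ) (Q : E 3 → ℝ) (U : Set (E 3)) (ξ : E 3) (c : ℝ) (D : E 3 → ℝ) : Prop
    extends IsCMCGraph m Q U where
  exterior : IsExterior U
  eq : ∀ x ∈ U, Q x = ‖x‖ - refW ξ x + c + D x
  symbol : IsSymbol U 0 Q
  radial : IsSymbol U 2 (radialD Q)

variable {m : ℝ} {Q : E 3 → ℝ} {U : Set (E 3)} {ξ : E 3} {c : ℝ} {D : E 3 → ℝ} {k : ℤ}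

theorem isSymbol_norm_sub_refW (hU : IsExterior U) (ξ : E 3) :
    IsSymbol U 0 (fun x => ‖x‖ - refW ξ x) :=
  isSymbol_of_smooth hU (contDiffOn_refF ξ) fun _ hx => norm_sub_refW ξ (hU.ne_zero hx)

theorem isSymbol_partialD_refW (hU : IsExterior U) (ξ : E 3) (i : Fin 3) :
    IsSymbol U 0 (partialD i (refW ξ)) := by
  simpa using (isSymbol_refW hU ξ).partialD hU i

/-- The gradient of the hyperboloid is radial to leading order. -/
theorem isLead_partialD_refW (hU : IsExterior U) (ξ : E 3) (i : Fin 3) :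
    IsLead U 0 (partialD i (refW ξ)) (unitv i) := by
  refine ⟨isSymbol_unitv hU i, (((isSymbol_norm_sub_refW hU ξ).partialD hU i).neg hU).congr hU
    fun x hx => ?_⟩
  rw [partialD_sub (differentiableAt_norm (hU.ne_zero hx))
    (ContDiffAt.dAt (contDiff_refW ξ).contDiffAt), partialD_norm (hU.ne_zero hx), unitv]
  ring

theorem isLead_refκ (hU : IsExterior U) (ξ : E 3) : IsLead U 1 (refκ ξ) (fun x => ‖x‖⁻¹) := by
  refine ⟨isSymbol_inv_norm hU, ((((isSymbol_norm_sub_refW hU ξ).mul (isSymbol_refκ hU ξ) hU).mul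
    (isSymbol_inv_norm hU) hU).congr hU fun x hx => ?_)⟩
  have h1 := (hU.norm_pos hx).ne'
  have h2 := (refW_pos ξ x).ne'
  rw [refκ]
  field_simp

namespace IsComparison

theorem differentiableAt_D (hD : IsSymbol U k D) (h : IsComparison m Q U ξ c D) {x : E 3}
    (hx : x ∈ U) : DifferentiableAt ℝ D x := hD.differentiableAt h.exterior hx

theorem gradW_eq (h : IsComparison m Q U ξ c D) (hD : IsSymbol U k D) {x : E 3} (hx : x ∈ U)
    (i : Fin 3) : gradW Q i x = partialD i (refW ξ) x - partialD i D x := by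
  have d1 := differentiableAt_norm (h.ne_zero hx)
  have d2 := ContDiffAt.dAt (contDiff_refW ξ).contDiffAt (x := x)
  rw [gradW, partialD_congr_of_mem h.isOpen h.eq hx, partialD_add ((d1.fun_sub d2).add_const c)
    (differentiableAt_D hD h hx), partialD_add (d1.fun_sub d2) (differentiableAt_const c),
    partialD_const, partialD_sub d1 d2, partialD_norm (h.ne_zero hx), unitv]
  ring

theorem isSymbol_mass (hU : IsExterior U) (m : ℝ) : IsSymbol U 1 (fun x => 2 * m * ‖x‖⁻¹) :=
  (isSymbol_inv_norm hU).const_mul hU _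

theorem gramL_sub_eq (h : IsComparison m Q U ξ c D) (hD : IsSymbol U k D) {x : E 3} (hx : x ∈ U) :
    gramL m Q x - refκ ξ x ^ 2 = 2 * (∑ i, partialD i (refW ξ) x * partialD i D x)
      - (∑ i, partialD i D x * partialD i D x) + 2 * m * ‖x‖⁻¹ * radialD Q x ^ 2 := by
  have h1 := sum_partialD_refW_sq ξ x
  simp only [gramL, h.gradW_eq hD hx, Fin.sum_univ_three] at h1 ⊢
  linear_combination -h1

/-- The term of `L` which contains the mass is of order five. -/
theorem isSymbol_mass_sq (h : IsComparison m Q U ξ c D) :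
    IsSymbol U 5 (fun x => 2 * m * ‖x‖⁻¹ * radialD Q x ^ 2) := by
  simpa using (isSymbol_mass h.exterior m).mul (IsSymbol.pow h.radial h.exterior 2) h.exterior

theorem isLead_sum_refW_D (hU : IsExterior U) (hD : IsSymbol U k D) :
    IsLead U (k + 1) (fun x => ∑ i, partialD i (refW ξ) x * partialD i D x) (radialD D) := by
  refine ⟨IsSymbol.radialD hD hU, ?_⟩
  refine (IsSymbol.sum (s := Finset.univ) hU fun i _ => ((isLead_partialD_refW hU ξ i).rem.mul
    (hD.partialD hU i) hU).of_le hU (show k + 1 + 1 ≤ _ by omega)).congr hU fun x _ => ?_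
  simp only [radialD, ← Finset.sum_sub_distrib]
  exact Finset.sum_congr rfl fun i _ => by ring

/-- To leading order `L` depends on `D` through its radial derivative only. -/
theorem isLead_gramL_sub (h : IsComparison m Q U ξ c D) (hD : IsSymbol U k D) (hk : 1 ≤ k)
    (hk' : k ≤ 3) :
    IsLead U (k + 1) (fun x => gramL m Q x - refκ ξ x ^ 2) (fun x => 2 * radialD D x) := by
  have hU := h.exterior
  have h1 := (isLead_sum_refW_D (ξ := ξ) hU hD).const_mul hU 2
  have h2 : IsSymbol U (k + 1 + 1) (fun x => ∑ i, partialD i D x * partialD i D x) :=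
    IsSymbol.sum hU fun i _ => ((hD.partialD hU i).mul (hD.partialD hU i) hU).of_le hU (by omega)
  have h3 := h.isSymbol_mass_sq.of_le hU (show k + 1 + 1 ≤ 5 by omega)
  have h4 := h1.add ((h3.sub h2 hU).isLead_zero hU) hU
  exact h4.congr hU (fun x hx => by rw [h.gramL_sub_eq hD hx]; ring) fun x _ => by ring

/-- The difference of the normals. -/
theorem normalV_sub_eq (h : IsComparison m Q U ξ c D) (hD : IsSymbol U k D) {x : E 3}
    (hx : x ∈ U) (i : Fin 3) : normalV m Q i x - partialD i (refW ξ) x =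
      2 * m * ‖x‖⁻¹ * radialD Q x * unitv i x - partialD i D x := by
  rw [normalV, h.gradW_eq hD hx]; ring

theorem isSymbol_normal_mass (h : IsComparison m Q U ξ c D) (i : Fin 3) :
    IsSymbol U 3 (fun x => 2 * m * ‖x‖⁻¹ * radialD Q x * unitv i x) := by
  simpa using ((isSymbol_mass h.exterior m).mul h.radial h.exterior).mul
    (isSymbol_unitv h.exterior i) h.exterior

theorem isSymbol_normalV_sub (h : IsComparison m Q U ξ c D) (hD : IsSymbol U k D)
    {l : ℤ} (hl : l ≤ k + 1) (hl' : l ≤ 3) (i : Fin 3) :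
    IsSymbol U l (fun x => normalV m Q i x - partialD i (refW ξ) x) :=
  (((h.isSymbol_normal_mass i).of_le h.exterior hl').sub
    ((hD.partialD h.exterior i).of_le h.exterior hl) h.exterior).congr h.exterior
    fun x hx => by rw [h.normalV_sub_eq hD hx]

theorem isLead_normalV (h : IsComparison m Q U ξ c D) (hD : IsSymbol U k D) (hk : 1 ≤ k)
    (i : Fin 3) : IsLead U 0 (normalV m Q i) (unitv i) := by
  have hU := h.exterior
  refine IsLead.trans (φ₀ := partialD i (refW ξ)) ⟨isSymbol_partialD_refW hU ξ i,
    h.isSymbol_normalV_sub hD (by omega) (by omega) i⟩ (isLead_partialD_refW hU ξ i) hU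

theorem sum_partialD_partialD_refW (ξ x : E 3) :
    ∑ i, partialD i (partialD i (refW ξ)) x = refκ ξ x * (2 + refκ ξ x ^ 2) := by
  simp only [partialD_partialD_refW, if_true, ← Finset.mul_sum, Finset.sum_sub_distrib,
    sum_partialD_refW_sq]
  simp only [Finset.sum_const, Finset.card_univ, Fintype.card_fin, nsmul_eq_mul]
  push_cast
  ring

theorem isSymbol_divNormal_sub (h : IsComparison m Q U ξ c D) (hD : IsSymbol U k D)
    {l : ℤ} (hl : l ≤ k + 2) (hl' : l ≤ 4) :
    IsSymbol U l (fun x => divNormal m Q x - refκ ξ x * (2 + refκ ξ x ^ 2)) := by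
  have hU := h.exterior
  refine (IsSymbol.sum (s := Finset.univ) hU fun i _ =>
    ((h.isSymbol_normalV_sub (l := l - 1) hD (by omega) (by omega) i).partialD hU i).of_le hU
      (show l ≤ _ by omega)).congr hU fun x hx => ?_
  rw [← sum_partialD_partialD_refW, divNormal, ← Finset.sum_sub_distrib]
  refine Finset.sum_congr rfl fun i _ => ?_
  rw [partialD_sub (ContDiffAt.dAt (h.contDiffAt_normalV hx i))
    (ContDiffAt.dAt (contDiffAt_partialD (contDiff_refW ξ).contDiffAt i))]

theorem isLead_divNormal (h : IsComparison m Q U ξ c D) (hD : IsSymbol U k D) (hk : 1 ≤ k) :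
    IsLead U 1 (divNormal m Q) (fun x => 2 * ‖x‖⁻¹) := by
  have hU := h.exterior
  have h1 := (isLead_refκ hU ξ).const_mul hU 2
  have h2 := (IsSymbol.pow (isSymbol_refκ hU ξ) hU 3).of_le hU (show (1 : ℤ) + 1 ≤ _ by norm_num)
  have h3 := h.isSymbol_divNormal_sub hD (show (1 : ℤ) + 1 ≤ k + 2 by omega) (by norm_num)
  exact (h1.add ((h2.add h3 hU).isLead_zero hU) hU).congr hU (fun x _ => by ring) fun x _ => by ring

theorem isLead_sum_normal_partialD (h : IsComparison m Q U ξ c D) (hD : IsSymbol U k D) (hk : 1 ≤ k)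
    {l : ℤ} {φ : E 3 → ℝ} (hφ : IsSymbol U l φ) :
    IsLead U (l + 1) (fun x => ∑ i, normalV m Q i x * partialD i φ x) (radialD φ) := by
  have hU := h.exterior
  refine ⟨IsSymbol.radialD hφ hU, ?_⟩
  refine (IsSymbol.sum (s := Finset.univ) hU fun i _ => ((h.isLead_normalV hD hk i).rem.mul
    (hφ.partialD hU i) hU).of_le hU (show l + 1 + 1 ≤ _ by omega)).congr hU fun x _ => ?_
  simp only [radialD, ← Finset.sum_sub_distrib]
  exact Finset.sum_congr rfl fun i _ => by ring

theorem meanR_sub_eq (h : IsComparison m Q U ξ c D) {x : E 3} (hx : x ∈ U) :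
    meanR m Q x - 3 * refκ ξ x ^ 3 =
      (gramL m Q x - refκ ξ x ^ 2) * divNormal m Q x
      - 1 / 2 * (∑ i, normalV m Q i x * partialD i (fun z => gramL m Q z - refκ ξ z ^ 2) x)
      + (refκ ξ x ^ 2 * (divNormal m Q x - refκ ξ x * (2 + refκ ξ x ^ 2))
      + refκ ξ x ^ 3 * ∑ i, (normalV m Q i x - partialD i (refW ξ) x) * partialD i (refW ξ) x) := by
  have d1 := ContDiffAt.dAt (h.contDiffAt_gramL hx)
  have d2 := ContDiffAt.dAt (contDiff_refκ ξ).contDiffAt (x := x)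
  have e : ∀ i, partialD i (fun z => gramL m Q z - refκ ξ z ^ 2) x =
      partialD i (gramL m Q) x + 2 * refκ ξ x ^ 3 * partialD i (refW ξ) x := by
    intro i
    rw [partialD_sub d1 (d2.fun_pow 2), partialD_comp (f := refκ ξ) (hasDerivAt_pow 2 _) d2,
      partialD_refκ]
    push_cast
    ring
  have h1 := sum_partialD_refW_sq ξ x
  simp only [meanR, e, Fin.sum_univ_three] at h1 ⊢
  linear_combination (refκ ξ x ^ 3) * h1

/-- To leading order the mean curvature operator acts on `D` as an ordinary differential operator in
the radial direction. -/
theorem isLead_meanR_sub (h : IsComparison m Q U ξ c D) (hD : IsSymbol U k D) (hk : 1 ≤ k)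
    (hk' : k ≤ 3) :
    IsLead U (k + 2) (fun x => meanR m Q x - 3 * refκ ξ x ^ 3)
      (fun x => 4 * (‖x‖⁻¹ * radialD D x) - radialD (radialD D) x) := by
  have hU := h.exterior
  have hL := h.isLead_gramL_sub hD hk hk'
  have h1 := (hL.mul (h.isLead_divNormal hD hk) hU).cast (show _ = k + 2 by omega)
  have h2 : IsLead U (k + 2)
      (fun x => ∑ i, normalV m Q i x * partialD i (fun z => gramL m Q z - refκ ξ z ^ 2) x)
      (radialD (fun x => 2 * radialD D x)) :=
    ((h.isLead_sum_normal_partialD hD hk (hL.symbol hU)).trans (hL.radialD hU) hU).cast (by omega)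
  have h3 := ((IsSymbol.pow (isSymbol_refκ hU ξ) hU 2).mul
    (h.isSymbol_divNormal_sub (l := k + 1) hD (by omega) (by omega)) hU).of_le hU
    (show k + 2 + 1 ≤ _ by push_cast; omega)
  have h4 : IsSymbol U (k + 2 + 1) (fun x => refκ ξ x ^ 3 *
      ∑ i, (normalV m Q i x - partialD i (refW ξ) x) * partialD i (refW ξ) x) :=
    ((IsSymbol.pow (isSymbol_refκ hU ξ) hU 3).mul (IsSymbol.sum (s := Finset.univ) hU fun i _ =>
      (h.isSymbol_normalV_sub (l := k) hD (by omega) (by omega) i).mul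
        (isSymbol_partialD_refW hU ξ i) hU) hU).of_le hU (by push_cast; omega)
  have h5 := (h1.add (h2.const_mul hU (-1 / 2)) hU).add ((h3.add h4 hU).isLead_zero hU) hU
  refine h5.congr hU (fun x hx => ?_) fun x hx => ?_
  · rw [h.meanR_sub_eq hx]; ring
  · rw [radialD_const_mul ((IsSymbol.radialD hD hU).differentiableAt hU hx)]
    ring

/-- The constant mean curvature equation, squared to remove the root, in terms of the differences
from the hyperboloid, for which `L = κ²` and `meanR = 3 κ³`. -/
theorem cmc_identity (h : IsComparison m Q U ξ c D) {x : E 3} (hx : x ∈ U) {κ δ η : ℝ}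
    (hκ : κ = refκ ξ x) (hδ : δ = gramL m Q x - refκ ξ x ^ 2)
    (hη : η = meanR m Q x - 3 * refκ ξ x ^ 3) :
    27 * (κ ^ 4 * δ) + 27 * (κ ^ 2 * δ ^ 2) + 9 * δ ^ 3 - 6 * (κ ^ 3 * η) - η ^ 2 = 0 := by
  have h1 := h.sq_meanR hx
  have e1 : gramL m Q x = δ + κ ^ 2 := by rw [hδ, hκ]; ring
  have e2 : meanR m Q x = η + 3 * κ ^ 3 := by rw [hη, hκ]; ring
  rw [e1, e2] at h1
  linear_combination -h1

end IsComparison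

end SchwarzschildCMC

namespace SchwarzschildCMC

open Set Filter Topology

/-! ### A vector field of vanishing divergence has bounded flux -/

theorem hasDerivAt_max_zero_sq (t : ℝ) :
    HasDerivAt (fun t : ℝ => max 0 t ^ 2) (2 * max 0 t) t := by
  rcases lt_trichotomy t 0 with ht | rfl | ht
  · have : (fun t : ℝ => max 0 t ^ 2) =ᶠ[𝓝 t] fun _ => 0 := by
      filter_upwards [gt_mem_nhds ht] with s hs
      simp [max_eq_left hs.le]
    rw [max_eq_left ht.le, mul_zero]
    exact (hasDerivAt_const t (0 : ℝ)).congr_of_eventuallyEq this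
  · rw [hasDerivAt_iff_isLittleO_nhds_zero]
    simp only [zero_add, max_self, mul_zero, smul_zero, sub_zero]
    have h1 : (fun h : ℝ => h ^ 2) =o[𝓝 0] fun h => h := by
      simpa using Asymptotics.isLittleO_pow_pow (𝕜 := ℝ) (show 1 < 2 by norm_num)
    refine Asymptotics.IsBigO.trans_isLittleO (Asymptotics.IsBigO.of_bound 1 ?_) h1
    refine Filter.Eventually.of_forall fun h => ?_
    rcases le_total 0 h with h0 | h0
    · simp [max_eq_right h0]
    · simp [max_eq_left h0]; positivity
  · have : (fun t : ℝ => max 0 t ^ 2) =ᶠ[𝓝 t] fun t => t ^ 2 := by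
      filter_upwards [lt_mem_nhds ht] with s hs
      rw [max_eq_right hs.le]
    rw [max_eq_right ht.le]
    simpa using (hasDerivAt_pow 2 t).congr_of_eventuallyEq this

theorem contDiff_max_zero_sq : ContDiff ℝ 1 (fun t : ℝ => max 0 t ^ 2) := by
  rw [contDiff_one_iff_deriv]
  refine ⟨fun t => (hasDerivAt_max_zero_sq t).differentiableAt, ?_⟩
  have : deriv (fun t : ℝ => max 0 t ^ 2) = fun t => 2 * max 0 t :=
    funext fun t => (hasDerivAt_max_zero_sq t).deriv
  rw [this]
  fun_prop

/-- The cutoff function `((1 - |x|² / λ²)₊)²`. -/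
noncomputable def ballCutoff (l : ℝ) (x : E 3) : ℝ := max 0 (1 - l⁻¹ ^ 2 * ‖x‖ ^ 2) ^ 2

theorem contDiff_ballCutoff (l : ℝ) : ContDiff ℝ 1 (ballCutoff l) :=
  contDiff_max_zero_sq.comp (contDiff_const.sub (contDiff_const.mul (contDiff_id.norm_sq ℝ)))

theorem partialD_ballCutoff (l : ℝ) (x : E 3) (i : Fin 3) :
    partialD i (ballCutoff l) x =
      -(4 * l⁻¹ ^ 2 * max 0 (1 - l⁻¹ ^ 2 * ‖x‖ ^ 2)) * x i := by
  have d2 : ∀ j, DifferentiableAt ℝ (fun x : E 3 => x j) x := fun j => by fun_prop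
  have e2 : (fun x : E 3 => 1 - l⁻¹ ^ 2 * ‖x‖ ^ 2) =
      fun x => 1 - l⁻¹ ^ 2 * ∑ i, x i * x i := by ext x; rw [sum_sq_eq]
  have d : DifferentiableAt ℝ (fun x : E 3 => 1 - l⁻¹ ^ 2 * ‖x‖ ^ 2) x := by
    rw [e2]; fun_prop
  have e3 : partialD i (fun x : E 3 => 1 - l⁻¹ ^ 2 * ‖x‖ ^ 2) x = -(2 * l⁻¹ ^ 2) * x i := by
    rw [e2, partialD_sub (by fun_prop) (by fun_prop), partialD_const,
      partialD_const_mul (f := fun x : E 3 => ∑ i, x i * x i) (by fun_prop),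
      partialD_sum (fun j _ => (d2 j).fun_mul (d2 j))]
    have e4 : ∀ j, partialD i (fun y : E 3 => y j * y j) x = if i = j then 2 * x j else 0 := by
      intro j
      rw [partialD_mul (d2 j) (d2 j), partialD_coord]
      split_ifs <;> ring
    simp only [e4, Finset.sum_ite_eq, Finset.mem_univ, if_true]
    ring
  have e : ballCutoff l = fun x => max 0 (1 - l⁻¹ ^ 2 * ‖x‖ ^ 2) ^ 2 := rfl
  rw [e, partialD_comp (f := fun x : E 3 => 1 - l⁻¹ ^ 2 * ‖x‖ ^ 2) (hasDerivAt_max_zero_sq _) d, e3]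
  ring

theorem ballCutoff_nonneg (l : ℝ) (x : E 3) : 0 ≤ ballCutoff l x := sq_nonneg _

theorem ballCutoff_le_one (l : ℝ) (x : E 3) : ballCutoff l x ≤ 1 :=
  pow_le_one₀ (le_max_left _ _) (max_le zero_le_one (by
    have : 0 ≤ l⁻¹ ^ 2 * ‖x‖ ^ 2 := by positivity
    linarith))

theorem ballCutoff_eq_zero {l : ℝ} (hl : 0 < l) {x : E 3} (hx : l ≤ ‖x‖) : ballCutoff l x = 0 := by
  have : 1 ≤ l⁻¹ ^ 2 * ‖x‖ ^ 2 := by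
    rw [← mul_pow, inv_mul_eq_div]
    exact one_le_pow₀ ((one_le_div hl).2 hx)
  rw [ballCutoff, max_eq_left (by linarith)]
  norm_num

theorem hasCompactSupport_ballCutoff {l : ℝ} (hl : 0 < l) : HasCompactSupport (ballCutoff l) :=
  HasCompactSupport.intro (isCompact_closedBall 0 l) fun x hx => ballCutoff_eq_zero hl (by
    simp at hx; exact hx.le)

theorem continuous_partialD {f : E 3 → ℝ} (hf : ContDiff ℝ 1 f) (i : Fin 3) :
    Continuous (partialD i f) :=
  (hf.continuous_fderiv one_ne_zero).clm_apply continuous_const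

/-- A vector field on space whose divergence has compact support does not point outward with a
flux density growing faster than linearly. -/
theorem false_of_superlinear_flux {M : Fin 3 → E 3 → ℝ} (hM : ∀ i, ContDiff ℝ 1 (M i)) {R : ℝ}
    (hdiv : ∀ x : E 3, R < ‖x‖ → ∑ i, partialD i (M i) x = 0)
    (hnonneg : ∀ x : E 3, 0 ≤ ∑ i, x i * M i x)
    (hgrow : ∀ K : ℝ, ∃ RK : ℝ, ∀ x : E 3, RK ≤ ‖x‖ → K * ‖x‖ ^ 2 ≤ ∑ i, x i * M i x) : False := by
  set ρ : E 3 → ℝ := fun x => ∑ i, partialD i (M i) x with hρ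
  have hρc : Continuous ρ := continuous_finsetSum _ fun i _ => continuous_partialD (hM i) i
  have hρs : HasCompactSupport ρ := HasCompactSupport.intro (isCompact_closedBall 0 R)
    fun x hx => hdiv x (by simpa using hx)
  have hρi : MeasureTheory.Integrable ρ := hρc.integrable_of_hasCompactSupport hρs
  set A := ∫ x, |ρ x| with hA
  set v := MeasureTheory.volume.real (Metric.ball (0 : E 3) 1) with hv
  have hv0 : 0 < v := 
    ENNReal.toReal_pos (Metric.measure_ball_pos _ _ one_pos).ne' MeasureTheory.measure_ball_lt_top.ne
  set K := 16 * (A + 1) / (3 * v) with hK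
  have hA0 : 0 ≤ A := MeasureTheory.integral_nonneg fun x => abs_nonneg _
  have hK0 : 0 < K := by positivity
  obtain ⟨RK, hRK⟩ := hgrow K
  set l := max 16 (4 * RK) with hl
  have hl16 : 16 ≤ l := le_max_left _ _
  have hlR : RK ≤ l / 4 := by have := le_max_right 16 (4 * RK); linarith
  have hl0 : 0 < l := by linarith
  set g : E 3 → ℝ := fun x => 4 * l⁻¹ ^ 2 * max 0 (1 - l⁻¹ ^ 2 * ‖x‖ ^ 2) * ∑ i, x i * M i x with hg
  have hg0 : ∀ x, 0 ≤ g x := fun x => by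
    have := hnonneg x
    have h2 : 0 ≤ max 0 (1 - l⁻¹ ^ 2 * ‖x‖ ^ 2) := le_max_left _ _
    positivity
  have hgc : Continuous g := by
    have := fun i => (hM i).continuous
    fun_prop
  have hgs : HasCompactSupport g := by
    refine HasCompactSupport.intro (isCompact_closedBall 0 l) fun x hx => ?_
    have hx' : l ≤ ‖x‖ := by simp at hx; exact hx.le
    have h1 : 1 ≤ l⁻¹ ^ 2 * ‖x‖ ^ 2 := by
      rw [← mul_pow, inv_mul_eq_div]
      exact one_le_pow₀ ((one_le_div hl0).2 hx')
    simp only [hg]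
    rw [max_eq_left (by linarith)]
    ring
  have hgi : MeasureTheory.Integrable g := hgc.integrable_of_hasCompactSupport hgs
  have hbρi : MeasureTheory.Integrable (fun x => ballCutoff l x * ρ x) :=
    ((contDiff_ballCutoff l).continuous.mul hρc).integrable_of_hasCompactSupport hρs.mul_left
  -- the divergence theorem
  have hbal : ∫ x, g x = ∫ x, ballCutoff l x * ρ x := by
    have h1 : ∀ i, ∫ x, partialD i (fun y => ballCutoff l y * M i y) x = 0 := fun i =>
      integral_partialD_eq_zero ((contDiff_ballCutoff l).mul (hM i))
        (hasCompactSupport_ballCutoff hl0).mul_right i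
    have hint : ∀ i, MeasureTheory.Integrable (partialD i (fun y => ballCutoff l y * M i y)) :=
      fun i => (continuous_partialD ((contDiff_ballCutoff l).mul (hM i)) i).integrable_of_hasCompactSupport
        (((hasCompactSupport_ballCutoff hl0).mul_right).fderiv_apply (𝕜 := ℝ) _)
    have h2 : ∫ x, ∑ i, partialD i (fun y => ballCutoff l y * M i y) x = 0 := by
      rw [MeasureTheory.integral_finsetSum _ fun i _ => hint i]
      simp [h1]
    have h3 : ∀ x, ∑ i, partialD i (fun y => ballCutoff l y * M i y) x =
        ballCutoff l x * ρ x - g x := by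
      intro x
      simp only [partialD_mul ((contDiff_ballCutoff l).differentiable one_ne_zero x)
        ((hM _).differentiable one_ne_zero x), partialD_ballCutoff, Finset.sum_add_distrib, hρ, hg,
        Finset.mul_sum]
      rw [← Finset.sum_add_distrib, ← Finset.sum_sub_distrib]
      exact Finset.sum_congr rfl fun i _ => by ring
    simp only [h3] at h2
    rw [MeasureTheory.integral_sub hbρi hgi] at h2
    linarith
  have hup : ∫ x, ballCutoff l x * ρ x ≤ A := by
    refine MeasureTheory.integral_mono hbρi hρi.abs fun x => ?_
    calc ballCutoff l x * ρ x ≤ ballCutoff l x * |ρ x| :=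
          mul_le_mul_of_nonneg_left (le_abs_self _) (ballCutoff_nonneg l x)
      _ ≤ 1 * |ρ x| := mul_le_mul_of_nonneg_right (ballCutoff_le_one l x) (abs_nonneg _)
      _ = |ρ x| := one_mul _
  -- the flux through a unit ball at distance `3 l / 8`
  set p : E 3 := EuclideanSpace.single 0 (3 * l / 8) with hp
  have hpn : ‖p‖ = 3 * l / 8 := by
    rw [hp, PiLp.norm_single, Real.norm_of_nonneg (by positivity)]
  have hlow : 3 * K / 16 * v ≤ ∫ x, g x := by
    have h1 : ∫ x in Metric.ball p 1, g x ≤ ∫ x, g x :=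
      MeasureTheory.setIntegral_le_integral hgi (Filter.Eventually.of_forall hg0)
    have h2 : ∫ x in Metric.ball p 1, (3 * K / 16 : ℝ) ≤ ∫ x in Metric.ball p 1, g x := by
      refine MeasureTheory.setIntegral_mono_on ?_ hgi.integrableOn measurableSet_ball ?_
      · exact MeasureTheory.integrableOn_const (MeasureTheory.measure_ball_lt_top).ne
      · intro x hx
        rw [mem_ball_iff_norm] at hx
        have hx1 : l / 4 ≤ ‖x‖ := by
          have := norm_sub_norm_le p x
          rw [norm_sub_rev, hpn] at this
          linarith
        have hx2 : ‖x‖ ≤ l / 2 := by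
          have := norm_sub_norm_le x p
          rw [hpn] at this
          linarith
        have h3 := hRK x (by linarith)
        have h4 : 3 / 4 ≤ max 0 (1 - l⁻¹ ^ 2 * ‖x‖ ^ 2) := by
          refine le_max_of_le_right ?_
          have : l⁻¹ * ‖x‖ ≤ 1 / 2 := by
            rw [inv_mul_le_iff₀ hl0]; linarith
          have h5 : 0 ≤ l⁻¹ * ‖x‖ := by positivity
          nlinarith [mul_pow l⁻¹ ‖x‖ 2]
        have h6 : 1 / 16 ≤ l⁻¹ ^ 2 * ‖x‖ ^ 2 := by
          have : 1 / 4 ≤ l⁻¹ * ‖x‖ := by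
            rw [inv_mul_eq_div, le_div_iff₀ hl0]; linarith
          rw [← mul_pow]
          nlinarith
        calc 3 * K / 16 = 4 * (3 / 4) * (K * (1 / 16)) := by ring
          _ ≤ 4 * max 0 (1 - l⁻¹ ^ 2 * ‖x‖ ^ 2) * (K * (l⁻¹ ^ 2 * ‖x‖ ^ 2)) := by gcongr
          _ = 4 * l⁻¹ ^ 2 * max 0 (1 - l⁻¹ ^ 2 * ‖x‖ ^ 2) * (K * ‖x‖ ^ 2) := by ring
          _ ≤ g x := mul_le_mul_of_nonneg_left h3 (by positivity)
    rw [MeasureTheory.setIntegral_const, smul_eq_mul] at h2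
    have h3 : MeasureTheory.volume.real (Metric.ball p 1) = v := by
      rw [hv, MeasureTheory.measureReal_def, MeasureTheory.measureReal_def,
        MeasureTheory.Measure.addHaar_ball_center]
    rw [h3] at h2
    linarith
  have : 3 * K / 16 * v = A + 1 := by rw [hK]; field_simp
  linarith

end SchwarzschildCMC

namespace SchwarzschildCMC

open Set Filter Topology

/-! ### The surface is asymptotic to a hyperboloid to third order -/

variable {m : ℝ} {Q : E 3 → ℝ} {R : ℝ} {ξ : E 3} {c : ℝ} {D : E 3 → ℝ} {k : ℕ} {q : E 3 → ℝ}

section Homogeneous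

variable {U : Set (E 3)}

theorem radialD_homogeneous_mul (hU : IsExterior U) (hq : IsSymbol U 0 q)
    (hh : ∀ c : ℝ, 0 < c → ∀ y, q (c • y) = q y) {x : E 3} (hx : x ∈ U) (k : ℕ) :
    radialD (fun y => ‖y‖⁻¹ ^ k * q y) x = -(k * (‖x‖⁻¹ ^ (k + 1) * q x)) :=
  radialD_homogeneous (hU.ne_zero hx) (hq.differentiableAt hU hx) hh k

theorem IsComparison.isLead_gramL_sub_homogeneous (h : IsComparison m Q U ξ c D)
    (hD : IsLead U k D (fun x => ‖x‖⁻¹ ^ k * q x)) (hq : IsSymbol U 0 q)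
    (hh : ∀ c : ℝ, 0 < c → ∀ y, q (c • y) = q y) (hk : 1 ≤ k) (hk' : k ≤ 3) :
    IsLead U (k + 1) (fun x => gramL m Q x - refκ ξ x ^ 2)
      (fun x => -(2 * k) * (‖x‖⁻¹ ^ (k + 1) * q x)) := by
  have hU := h.exterior
  refine ((h.isLead_gramL_sub (hD.symbol hU) (by exact_mod_cast hk) (by exact_mod_cast hk')).trans
    ((hD.radialD hU).const_mul hU 2) hU).congr hU (fun _ _ => rfl) fun x hx => ?_
  rw [radialD_homogeneous_mul hU hq hh hx]
  ring

theorem IsComparison.isLead_meanR_sub_homogeneous (h : IsComparison m Q U ξ c D)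
    (hD : IsLead U k D (fun x => ‖x‖⁻¹ ^ k * q x)) (hq : IsSymbol U 0 q)
    (hh : ∀ c : ℝ, 0 < c → ∀ y, q (c • y) = q y) (hk : 1 ≤ k) (hk' : k ≤ 3) :
    IsLead U (k + 2) (fun x => meanR m Q x - 3 * refκ ξ x ^ 3)
      (fun x => -(k * (k + 5)) * (‖x‖⁻¹ ^ (k + 2) * q x)) := by
  have hU := h.exterior
  have h1 := (h.isLead_meanR_sub (hD.symbol hU) (by exact_mod_cast hk) (by exact_mod_cast hk'))
  have h2 := hD.radialD hU
  have h3 : IsLead U (k + 2) (fun x => 4 * (‖x‖⁻¹ * radialD D x) + -1 * radialD (radialD D) x)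
      (fun x => 4 * (‖x‖⁻¹ * radialD (fun x => ‖x‖⁻¹ ^ k * q x) x)
        + -1 * radialD (radialD (fun x => ‖x‖⁻¹ ^ k * q x)) x) :=
    ((((isSymbol_inv_norm hU).isLead_self hU).mul h2 hU).cast (by ring) |>.const_mul hU 4).add
      (((h2.radialD hU).cast (by ring)).const_mul hU (-1)) hU
  refine (h1.trans (h3.congr hU (fun x _ => by ring) fun _ _ => rfl) hU).congr hU
    (fun _ _ => rfl) fun x hx => ?_
  have e1 := fun x hx => radialD_homogeneous_mul hU hq hh (x := x) hx k
  have e2 : radialD (radialD (fun x => ‖x‖⁻¹ ^ k * q x)) x =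
      k * ((k + 1) * (‖x‖⁻¹ ^ (k + 2) * q x)) := by
    rw [radialD_congr hU.1 (ψ := fun x => -(k : ℝ) * (‖x‖⁻¹ ^ (k + 1) * q x))
      (fun x hx => by rw [e1 x hx]; ring) hx, radialD_const_mul, radialD_homogeneous_mul hU hq hh hx]
    · push_cast; ring
    · have := (IsSymbol.pow (isSymbol_inv_norm hU) hU (k + 1)).mul hq hU
      exact this.differentiableAt hU hx
  rw [e1 x hx, e2]
  ring

end Homogeneous

/-- The leading coefficient of `D` takes the values `0` and `1 / 2` only, as one sees from the terms
of order `|x| ^ (-6)` of the constant mean curvature equation. All terms of `cmc_identity`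
contribute, so that the equation is nonlinear. -/
theorem IsComparison.first_coefficient (h : IsComparison m Q {x | R < ‖x‖} ξ c D) (hR : 1 ≤ R)
    (hD : IsLead {x | R < ‖x‖} 1 D (fun x => ‖x‖⁻¹ ^ 1 * q x)) (hq : IsSymbol {x | R < ‖x‖} 0 q)
    (hh : ∀ c : ℝ, 0 < c → ∀ y, q (c • y) = q y) {x : E 3} (hx : x ≠ 0) :
    q x * (1 - 2 * q x) ^ 2 = 0 := by
  have hU := h.exterior
  have hδ := h.isLead_gramL_sub_homogeneous (k := 1) hD hq hh le_rfl (by norm_num)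
  have hη := h.isLead_meanR_sub_homogeneous (k := 1) hD hq hh le_rfl (by norm_num)
  have hκ := isLead_refκ hU ξ
  set δ := fun x => gramL m Q x - refκ ξ x ^ 2
  set η := fun x => meanR m Q x - 3 * refκ ξ x ^ 3
  have hκ2 := hκ.mul hκ hU
  have hκ3 := hκ2.mul hκ hU
  have hκ4 := hκ2.mul hκ2 hU
  have hδ2 := hδ.mul hδ hU
  have t1 := ((hκ4.mul hδ hU).cast (show _ = (6 : ℤ) by norm_num)).const_mul hU 27
  have t2 := ((hκ2.mul hδ2 hU).cast (show _ = (6 : ℤ) by norm_num)).const_mul hU 27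
  have t3 := ((hδ2.mul hδ hU).cast (show _ = (6 : ℤ) by norm_num)).const_mul hU 9
  have t4 := ((hκ3.mul hη hU).cast (show _ = (6 : ℤ) by norm_num)).const_mul hU (-6)
  have t5 := ((hη.mul hη hU).cast (show _ = (6 : ℤ) by norm_num)).const_mul hU (-1)
  have t := ((((t1.add t2 hU).add t3 hU).add t4 hU).add t5 hU).rem
  have key := eq_zero_of_isSymbol (R := R) (f := fun x => q x * (1 - 2 * q x) ^ 2)
    (fun c hc y => by simp only [hh c hc]) 6 ?_ hR hx
  · exact key
  · refine (t.const_mul hU (1 / 18)).congr hU fun x hx => ?_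
    have := h.cmc_identity (x := x) hx (κ := refκ ξ x) (δ := δ x) (η := η x) rfl rfl rfl
    push_cast
    linear_combination (-1 / 18) * this

/-- The second coefficient of `D` vanishes if the first does. The terms of order `|x| ^ (-7)` of
`cmc_identity` are linear in it. -/
theorem IsComparison.second_coefficient (h : IsComparison m Q {x | R < ‖x‖} ξ c D) (hR : 1 ≤ R)
    (hD : IsLead {x | R < ‖x‖} 2 D (fun x => ‖x‖⁻¹ ^ 2 * q x)) (hq : IsSymbol {x | R < ‖x‖} 0 q)
    (hh : ∀ c : ℝ, 0 < c → ∀ y, q (c • y) = q y) {x : E 3} (hx : x ≠ 0) : q x = 0 := by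
  have hU := h.exterior
  have hδ := h.isLead_gramL_sub_homogeneous (k := 2) hD hq hh (by norm_num) (by norm_num)
  have hη := h.isLead_meanR_sub_homogeneous (k := 2) hD hq hh (by norm_num) (by norm_num)
  have hκ := isLead_refκ hU ξ
  set δ := fun x => gramL m Q x - refκ ξ x ^ 2
  set η := fun x => meanR m Q x - 3 * refκ ξ x ^ 3
  have hκ2 := hκ.mul hκ hU
  have hκ3 := hκ2.mul hκ hU
  have hκ4 := hκ2.mul hκ2 hU
  have hδ2 := hδ.mul hδ hU
  have t1 := ((hκ4.mul hδ hU).cast (show _ = (7 : ℤ) by norm_num)).const_mul hU 27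
  have t2 := (((hκ2.mul hδ2 hU).symbol hU).of_le hU (show (7 : ℤ) + 1 ≤ _ by norm_num)).const_mul
    hU 27
  have t3 := (((hδ2.mul hδ hU).symbol hU).of_le hU (show (7 : ℤ) + 1 ≤ _ by norm_num)).const_mul
    hU 9
  have t4 := ((hκ3.mul hη hU).cast (show _ = (7 : ℤ) by norm_num)).const_mul hU (-6)
  have t5 := (((hη.mul hη hU).symbol hU).of_le hU (show (7 : ℤ) + 1 ≤ _ by norm_num)).const_mul
    hU (-1)
  have t := ((t1.add t4 hU).add (((t2.add t3 hU).add t5 hU).isLead_zero hU) hU).rem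
  refine eq_zero_of_isSymbol (R := R) hh 7 ?_ hR hx
  refine (t.const_mul hU (1 / 24)).congr hU fun x hx => ?_
  have := h.cmc_identity (x := x) hx (κ := refκ ξ x) (δ := δ x) (η := η x) rfl rfl rfl
  push_cast
  linear_combination (-1 / 24) * this

/-- The function `L`, which is of order `|x| ^ (-2)` for a hyperboloid, is not of order `|x| ^ (-3)`:
the vector field `L^{-1/2} n - x` is free of divergence, but its flux would not be bounded. -/
theorem IsComparison.not_isSymbol_three_gramL (h : IsComparison m Q {x | R < ‖x‖} ξ c D) (hR : 1 ≤ R)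
    (hD : IsSymbol {x | R < ‖x‖} 1 D) (hL : IsSymbol {x | R < ‖x‖} 3 (gramL m Q)) : False := by
  have hU := h.exterior
  set N : Fin 3 → E 3 → ℝ := fun i x => (√(gramL m Q x))⁻¹ * normalV m Q i x - x i with hN
  have hNs : ∀ i, ∀ x, R < ‖x‖ → ContDiffAt ℝ ∞ (N i) x := fun i x hx =>
    (((h.contDiffAt_gramL hx).sqrt (h.gramL_pos hx).ne').inv
      (Real.sqrt_pos.2 (h.gramL_pos hx)).ne' |>.mul (h.contDiffAt_normalV hx i)).sub (by fun_prop)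
  have hNdiv : ∀ x, R < ‖x‖ → ∑ i, partialD i (N i) x = 0 := by
    intro x hx
    have h1 := h.divergence_form hx
    have d1 : ∀ i, DifferentiableAt ℝ (fun z => (√(gramL m Q z))⁻¹ * normalV m Q i z) x :=
      fun i => ContDiffAt.dAt ((((h.contDiffAt_gramL hx).sqrt (h.gramL_pos hx).ne').inv
      (Real.sqrt_pos.2 (h.gramL_pos hx)).ne').mul (h.contDiffAt_normalV hx i))
    have d2 : ∀ i : Fin 3, DifferentiableAt ℝ (fun x : E 3 => x i) x := fun i => by fun_prop
    simp only [hN, partialD_sub (d1 _) (d2 _), Finset.sum_sub_distrib, h1, partialD_coord, if_true]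
    simp
  obtain ⟨C, hC, hLC⟩ := hL.bound hU
  -- the normal is nearly radial
  have hny : IsSymbol {x : E 3 | R < ‖x‖} 1 (fun x => ∑ i, normalV m Q i x * unitv i x - 1) := by
    refine (IsSymbol.sum (s := Finset.univ) hU fun i _ => ((h.isLead_normalV hD le_rfl i).rem.mul
      (isSymbol_unitv hU i) hU).of_le hU (show (1 : ℤ) ≤ _ by norm_num)).congr hU fun x hx => ?_
    rw [← sum_unitv_sq (hU.ne_zero hx), ← Finset.sum_sub_distrib]
    exact Finset.sum_congr rfl fun i _ => by ring
  obtain ⟨C', hC', hnC⟩ := hny.bound hU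
  -- if `L = O(|x| ^ (-3))` then `L^{-1/2} n` grows at least like `|x| ^ (3/2)`
  have hgrow : ∀ K : ℝ, 0 ≤ K → ∃ RK, R + 1 ≤ RK ∧ ∀ x : E 3, RK ≤ ‖x‖ →
      K * ‖x‖ ^ 2 ≤ ∑ i, x i * N i x := by
    intro K hK
    refine ⟨max (R + 1) (max (2 * C') (4 * C * (K + 1) ^ 2)), le_max_left _ _, fun x hx => ?_⟩
    have hx1 : R < ‖x‖ := by linarith [(le_max_left _ _).trans hx]
    have hx2 : 2 * C' ≤ ‖x‖ := ((le_max_left _ _).trans (le_max_right _ _)).trans hx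
    have hx3 : 4 * C * (K + 1) ^ 2 ≤ ‖x‖ := ((le_max_right _ _).trans (le_max_right _ _)).trans hx
    have hx0 : 0 < ‖x‖ := by linarith
    have h1 : 1 / 2 ≤ ∑ i, normalV m Q i x * unitv i x := by
      have h2 := hnC x hx1
      rw [zpow_neg_one, ← div_eq_mul_inv] at h2
      have h3 : C' / ‖x‖ ≤ 1 / 2 := by rw [div_le_iff₀ hx0]; linarith
      have h4 := (abs_le.1 (h2.trans h3)).1
      linarith
    have hLp := h.gramL_pos hx1
    have h2 : √(gramL m Q x) ≤ (2 * (K + 1) * ‖x‖)⁻¹ := by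
      rw [Real.sqrt_le_left (by positivity)]
      refine ((le_abs_self _).trans (hLC x hx1)).trans ?_
      rw [show (-3 : ℤ) = -((3 : ℕ) : ℤ) by norm_num, zpow_neg, zpow_natCast, inv_pow,
        ← div_eq_mul_inv, div_le_iff₀ (by positivity), inv_mul_eq_div, le_div_iff₀ (by positivity)]
      calc C * (2 * (K + 1) * ‖x‖) ^ 2 = 4 * C * (K + 1) ^ 2 * ‖x‖ ^ 2 := by ring
        _ ≤ ‖x‖ * ‖x‖ ^ 2 := by gcongr
        _ = ‖x‖ ^ 3 := by ring
    have h3 : 2 * (K + 1) * ‖x‖ ≤ (√(gramL m Q x))⁻¹ := by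
      rw [le_inv_comm₀ (by positivity) (Real.sqrt_pos.2 hLp)]
      exact h2
    have h4 : ∑ i, x i * N i x = (√(gramL m Q x))⁻¹ * ‖x‖ *
        (∑ i, normalV m Q i x * unitv i x) - ‖x‖ ^ 2 := by
      rw [← sum_sq_eq x, Finset.mul_sum, ← Finset.sum_sub_distrib]
      refine Finset.sum_congr rfl fun i _ => ?_
      simp only [hN, unitv]
      field_simp
    rw [h4]
    have h5 : 2 * (K + 1) * ‖x‖ * ‖x‖ * (1 / 2) ≤ (√(gramL m Q x))⁻¹ * ‖x‖ *
        (∑ i, normalV m Q i x * unitv i x) := by gcongr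
    linarith
  obtain ⟨R₂, hR₂, hpos⟩ := hgrow 0 le_rfl
  have hR₂0 : 0 < R₂ := by linarith
  -- extend the vector field by zero to the interior
  let χ : ContDiffBump (0 : E 3) := ⟨R₂, R₂ + 1, hR₂0, by linarith⟩
  have hχ1 : ∀ x : E 3, ‖x‖ ≤ R₂ → χ x = 1 := fun x hx =>
    χ.one_of_mem_closedBall (by simpa using hx)
  have hχ0 : ∀ x : E 3, R₂ + 1 ≤ ‖x‖ → χ x = 0 := fun x hx =>
    χ.zero_of_le_dist (by simpa using hx)
  refine false_of_superlinear_flux (M := fun i x => (1 - χ x) * N i x) (R := R₂ + 1) ?_ ?_ ?_ ?_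
  · intro i
    rw [contDiff_iff_contDiffAt]
    intro x
    rcases lt_or_ge R ‖x‖ with hx | hx
    · exact (((contDiffAt_const.sub χ.contDiffAt).mul (hNs i x hx))).of_le (by simp)
    · have : (fun x => (1 - χ x) * N i x) =ᶠ[𝓝 x] fun _ => 0 := by
        filter_upwards [(isOpen_lt continuous_norm continuous_const).mem_nhds
          (show x ∈ {y : E 3 | ‖y‖ < R₂} by change ‖x‖ < R₂; linarith)] with y (hy : ‖y‖ < R₂)
        rw [hχ1 y hy.le]; ring
      exact contDiffAt_const.congr_of_eventuallyEq this
  · intro x hx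
    rw [← hNdiv x (by linarith)]
    refine Finset.sum_congr rfl fun i _ => ?_
    exact partialD_congr_of_mem (isOpen_lt continuous_const continuous_norm)
      (fun y (hy : R₂ + 1 < ‖y‖) => by rw [hχ0 y hy.le]; ring) hx i
  · intro x
    rcases le_or_gt ‖x‖ R₂ with hx | hx
    · simp [hχ1 x hx]
    · have e : ∑ i, x i * ((1 - χ x) * N i x) = (1 - χ x) * ∑ i, x i * N i x := by
        rw [Finset.mul_sum]; exact Finset.sum_congr rfl fun i _ => by ring
      rw [e]
      have := hpos x hx.le
      have h1 := χ.le_one (x := x)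
      exact mul_nonneg (by linarith) (by linarith)
  · intro K
    obtain ⟨RK, _, hRK⟩ := hgrow |K| (abs_nonneg K)
    refine ⟨max RK (R₂ + 1), fun x hx => ?_⟩
    have h1 := hRK x ((le_max_left _ _).trans hx)
    simp only [hχ0 x ((le_max_right _ _).trans hx), sub_zero, one_mul]
    exact (mul_le_mul_of_nonneg_right (le_abs_self K) (sq_nonneg _)).trans h1

theorem isPreconnected_ne_zero : IsPreconnected {x : E 3 | x ≠ 0} := by
  have : 1 < Module.rank ℝ (E 3) := by
    rw [← Module.finrank_eq_rank, finrank_euclideanSpace_fin]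
    norm_num
  exact (isConnected_compl_singleton_of_one_lt_rank this (0 : E 3)).isPreconnected

/-- The height functions of the surface and of the hyperboloid agree to third order. -/
theorem IsComparison.isSymbol_three (h : IsComparison m Q {x | R < ‖x‖} ξ c D) (hR : 1 ≤ R)
    {F : E 3 × ℝ → ℝ} (hF : ContDiffOn ℝ ∞ F {p | p.1 ≠ 0})
    (hev : ∀ x σ, x ≠ 0 → F (x, -σ) = F (x, σ)) (hF0 : ∀ x ≠ 0, leading F x = 0)
    (hDF : ∀ x : E 3, x ≠ 0 → D x = F (‖x‖⁻¹ • x, √(‖x‖⁻¹))) : IsSymbol {x | R < ‖x‖} 3 D := by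
  have hU := h.exterior
  obtain ⟨F₁, hF₁, hev₁, e₁⟩ := exists_expansion hF hev
  obtain ⟨F₂, hF₂, hev₂, e₂⟩ := exists_expansion hF₁ hev₁
  obtain ⟨F₃, hF₃, -, e₃⟩ := exists_expansion hF₂ hev₂
  have hs := isSymbol_inv_norm hU
  have s₂ : IsSymbol {x : E 3 | R < ‖x‖} 2 (fun x => ‖x‖⁻¹ ^ 2 * F₂ (‖x‖⁻¹ • x, √(‖x‖⁻¹))) := by
    simpa using (IsSymbol.pow hs hU 2).mul (isSymbol_of_smooth hU hF₂
      (φ := fun x => F₂ (‖x‖⁻¹ • x, √(‖x‖⁻¹))) fun _ _ => rfl) hU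
  have s₃ : IsSymbol {x : E 3 | R < ‖x‖} 3 (fun x => ‖x‖⁻¹ ^ 3 * F₃ (‖x‖⁻¹ • x, √(‖x‖⁻¹))) := by
    simpa using (IsSymbol.pow hs hU 3).mul (isSymbol_of_smooth hU hF₃
      (φ := fun x => F₃ (‖x‖⁻¹ • x, √(‖x‖⁻¹))) fun _ _ => rfl) hU
  have l₁ : IsLead {x : E 3 | R < ‖x‖} 1 D (fun x => ‖x‖⁻¹ ^ 1 * leading F₁ x) := by
    refine ⟨by simpa using (IsSymbol.pow hs hU 1).mul (isSymbol_leading hU hF₁) hU,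
      s₂.congr hU fun x hx => ?_⟩
    have hx0 := hU.ne_zero hx
    rw [hDF x hx0, e₁ x hx0, hF0 x hx0, e₂ x hx0]
    ring
  have hq₁ := isSymbol_leading hU hF₁
  have hh₁ := fun c (hc : 0 < c) y => leading_smul F₁ hc y
  have hval : ∀ x : E 3, x ≠ 0 → leading F₁ x * (1 - 2 * leading F₁ x) ^ 2 = 0 :=
    fun x hx => h.first_coefficient hR l₁ hq₁ hh₁ hx
  have hval' : ∀ x : E 3, x ≠ 0 → leading F₁ x = 0 ∨ leading F₁ x = 1 / 2 := by
    intro x hx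
    rcases mul_eq_zero.1 (hval x hx) with h1 | h1
    · exact Or.inl h1
    · right
      have := pow_eq_zero_iff (two_ne_zero) |>.1 h1
      linarith
  have hzero : ∀ x : E 3, x ≠ 0 → leading F₁ x = 0 := by
    -- by continuity the coefficient is constant, and if it is `1 / 2` then `L = O(|x| ^ (-3))`
    by_contra! hne
    obtain ⟨x₁, hx₁, hne⟩ := hne
    have hhalf : ∀ x : E 3, x ≠ 0 → leading F₁ x = 1 / 2 := by
      intro x hx
      refine (hval' x hx).resolve_left fun h0 => ?_
      have h1 := (hval' x₁ hx₁).resolve_left hne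
      have hmem : (1 / 4 : ℝ) ∈ leading F₁ '' {x | x ≠ 0} :=
        isPreconnected_ne_zero.intermediate_value hx hx₁ (contDiffOn_leading hF₁).continuousOn
          ⟨by rw [h0]; norm_num, by rw [h1]; norm_num⟩
      obtain ⟨z, hz, hz'⟩ := hmem
      rcases hval' z hz with h2 | h2 <;> rw [h2] at hz' <;> norm_num at hz'
    refine h.not_isSymbol_three_gramL hR (l₁.symbol hU) ?_
    have hδ := h.isLead_gramL_sub_homogeneous (k := 1) l₁ hq₁ hh₁ le_rfl (by norm_num)
    have hκ := (isLead_refκ hU ξ).mul (isLead_refκ hU ξ) hU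
    refine (((hδ.cast (by norm_num)).add hκ hU).rem.of_le hU (show (3 : ℤ) ≤ _ by norm_num)).congr
      hU fun x hx => ?_
    rw [hhalf x (hU.ne_zero hx)]
    push_cast
    ring
  have l₂ : IsLead {x : E 3 | R < ‖x‖} 2 D (fun x => ‖x‖⁻¹ ^ 2 * leading F₂ x) := by
    refine ⟨by simpa using (IsSymbol.pow hs hU 2).mul (isSymbol_leading hU hF₂) hU,
      s₃.congr hU fun x hx => ?_⟩
    have hx0 := hU.ne_zero hx
    rw [hDF x hx0, e₁ x hx0, hF0 x hx0, e₂ x hx0, hzero x hx0, e₃ x hx0]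
    ring
  refine s₃.congr hU fun x hx => ?_
  have hx0 := hU.ne_zero hx
  rw [hDF x hx0, e₁ x hx0, hF0 x hx0, e₂ x hx0, hzero x hx0, e₃ x hx0,
    h.second_coefficient hR l₂ (isSymbol_leading hU hF₂) (fun c hc y => leading_smul F₂ hc y) hx0]
  ring

end SchwarzschildCMC

namespace SchwarzschildCMC

open Set Filter Topology

/-! ### Decay of the scalar curvature -/

variable {m : ℝ} {Q : E 3 → ℝ} {U : Set (E 3)} {ξ : E 3} {c : ℝ} {D : E 3 → ℝ} {k : ℤ}

namespace IsComparison

theorem partialD_eq (h : IsComparison m Q U ξ c D) (hD : IsSymbol U k D) {x : E 3} (hx : x ∈ U)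
    (i : Fin 3) : partialD i Q x = unitv i x - partialD i (refW ξ) x + partialD i D x := by
  have := h.gradW_eq hD hx i
  rw [gradW] at this
  linarith

theorem hessian_eq (h : IsComparison m Q U ξ c D) (hD : IsSymbol U k D) {x : E 3} (hx : x ∈ U)
    (i j : Fin 3) : partialD i (partialD j Q) x =
      ((if i = j then 1 else 0) - unitv i x * unitv j x) * ‖x‖⁻¹
      - refκ ξ x * ((if i = j then 1 else 0) - partialD i (refW ξ) x * partialD j (refW ξ) x)
      + partialD i (partialD j D) x := by
  have hx0 := h.ne_zero hx
  have d1 := ContDiffAt.dAt (contDiffAt_unitv hx0 j)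
  have d2 := ContDiffAt.dAt (contDiffAt_partialD (contDiff_refW ξ).contDiffAt (x := x) j)
  have d3 := (hD.partialD h.exterior j).differentiableAt h.exterior hx
  rw [partialD_congr_of_mem h.isOpen (fun y hy => h.partialD_eq hD hy j) hx,
    partialD_add (d1.fun_sub d2) d3, partialD_sub d1 d2, partialD_unitv hx0,
    partialD_partialD_refW]

/-- The part of `T` of order five. -/
noncomputable def remT (ξ : E 3) (D : E 3 → ℝ) (i j : Fin 3) (x : E 3) : ℝ :=
  refκ ξ x * (partialD i D x * partialD j D x - partialD i (refW ξ) x * partialD j D x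
    - partialD i D x * partialD j (refW ξ) x) - partialD i (partialD j D) x

/-- The coefficient of `∂_i Q ∂_j Q` in `T`. -/
noncomputable def coeffT (m : ℝ) (Q : E 3 → ℝ) (ξ x : E 3) : ℝ :=
  m * ‖x‖⁻¹ ^ 2 * (1 - (1 - 2 * m * ‖x‖⁻¹) * radialD Q x) + refκ ξ x * (2 * m * ‖x‖⁻¹)

theorem umbilicT_eq (h : IsComparison m Q U ξ c D) (hD : IsSymbol U k D) {x : E 3} (hx : x ∈ U)
    (i j : Fin 3) : umbilicT m Q (refκ ξ) x i j = remT ξ D i j x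
      + ((if i = j then 1 else 0) - unitv i x * unitv j x) *
        (‖x‖⁻¹ * (2 * m * ‖x‖⁻¹ * radialD Q x))
      - coeffT m Q ξ x * (partialD i Q x * partialD j Q x)
      - m * ‖x‖⁻¹ ^ 2 * radialD Q x * (unitv i x * partialD j Q x + unitv j x * partialD i Q x) := by
  rw [umbilicT, hessB, gramG, h.hessian_eq hD hx, h.gradW_eq hD hx, h.gradW_eq hD hx, coeffT, remT]
  ring

theorem isSymbol_remT (hU : IsExterior U) (hD : IsSymbol U 3 D) (i j : Fin 3) :
    IsSymbol U 5 (remT ξ D i j) := by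
  have d := fun i => hD.partialD hU i
  have w := fun i => isSymbol_partialD_refW hU ξ i
  have h1 := ((d i).mul (d j) hU).of_le hU (show (4 : ℤ) ≤ _ by norm_num)
  have h2 := ((w i).mul (d j) hU).of_le hU (show (4 : ℤ) ≤ _ by norm_num)
  have h3 := ((d i).mul (w j) hU).of_le hU (show (4 : ℤ) ≤ _ by norm_num)
  have h4 := ((isSymbol_refκ hU ξ).mul ((h1.sub h2 hU).sub h3 hU) hU).of_le hU
    (show (5 : ℤ) ≤ _ by norm_num)
  exact (h4.sub (((d j).partialD hU i).of_le hU (by norm_num)) hU).congr hU fun x _ => rfl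

theorem isSymbol_coeffT (h : IsComparison m Q U ξ c D) : IsSymbol U 2 (coeffT m Q ξ) := by
  have hU := h.exterior
  have μ := isSymbol_mass hU m
  have one := IsSymbol.const U 1
  have h1 := (one.sub (μ.of_le hU (show (0 : ℤ) ≤ 1 by norm_num)) hU).mul
    (h.radial.of_le hU (show (0 : ℤ) ≤ 2 by norm_num)) hU
  have h2 := ((IsSymbol.pow (isSymbol_inv_norm hU) hU 2).const_mul hU m).mul (one.sub h1 hU) hU
  have h3 := (isSymbol_refκ hU ξ).mul μ hU
  exact ((h2.of_le hU (by norm_num)).add (h3.of_le hU (by norm_num)) hU).congr hU fun x _ => rfl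

theorem isSymbol_partialD_Q (h : IsComparison m Q U ξ c D) (i : Fin 3) :
    IsSymbol U 1 (partialD i Q) := by simpa using h.symbol.partialD h.exterior i

theorem isSymbol_umbilicT (h : IsComparison m Q U ξ c D) (hD : IsSymbol U 3 D) (i j : Fin 3) :
    IsSymbol U 4 (fun x => umbilicT m Q (refκ ξ) x i j) := by
  have hU := h.exterior
  have μ := isSymbol_mass hU m
  have y := fun i => isSymbol_unitv hU i
  have q := h.isSymbol_partialD_Q
  have s := isSymbol_inv_norm hU
  have t1 := (isSymbol_remT (ξ := ξ) hU hD i j).of_le hU (show (4 : ℤ) ≤ _ by norm_num)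
  have t2 := (((IsSymbol.const U (if i = j then 1 else 0)).sub
    (((y i).mul (y j) hU).of_le hU (show (0 : ℤ) ≤ _ by norm_num)) hU).mul
    (s.mul (μ.mul h.radial hU) hU) hU).of_le hU (show (4 : ℤ) ≤ _ by norm_num)
  have t3 := (h.isSymbol_coeffT.mul ((q i).mul (q j) hU) hU).of_le hU
    (show (4 : ℤ) ≤ _ by norm_num)
  have t4 := ((((IsSymbol.pow s hU 2).const_mul hU m).mul h.radial hU).mul
    (((y i).mul (q j) hU).add ((y j).mul (q i) hU) hU) hU).of_le hU (show (4 : ℤ) ≤ _ by norm_num)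
  exact (((t1.add t2 hU).sub t3 hU).sub t4 hU).congr hU fun x hx => h.umbilicT_eq hD hx i j

/-- In the radial direction `T` reduces to its part of order five and to a multiple of `(∂_r Q)²`. -/
theorem sum_umbilicT_unitv (h : IsComparison m Q U ξ c D) (hD : IsSymbol U k D) {x : E 3}
    (hx : x ∈ U) : ∑ i, ∑ j, umbilicT m Q (refκ ξ) x i j * (unitv i x * unitv j x) =
      (∑ i, ∑ j, remT ξ D i j x * (unitv i x * unitv j x))
      - (coeffT m Q ξ x + 2 * (m * ‖x‖⁻¹ ^ 2)) * radialD Q x ^ 2 := by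
  have hy := sum_unitv_sq (h.ne_zero hx)
  have e : ∀ i j, umbilicT m Q (refκ ξ) x i j * (unitv i x * unitv j x) =
      remT ξ D i j x * (unitv i x * unitv j x)
      + (‖x‖⁻¹ * (2 * m * ‖x‖⁻¹ * radialD Q x)) * (if i = j then unitv i x * unitv j x else 0)
      - (‖x‖⁻¹ * (2 * m * ‖x‖⁻¹ * radialD Q x)) * ((unitv i x * unitv i x) * (unitv j x * unitv j x))
      - coeffT m Q ξ x * ((unitv i x * partialD i Q x) * (unitv j x * partialD j Q x))
      - m * ‖x‖⁻¹ ^ 2 * radialD Q x * ((unitv i x * unitv i x) * (unitv j x * partialD j Q x))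
      - m * ‖x‖⁻¹ ^ 2 * radialD Q x * ((unitv i x * partialD i Q x) * (unitv j x * unitv j x)) := by
    intro i j
    rw [h.umbilicT_eq hD hx]
    split_ifs <;> ring
  have ha : ∑ i, unitv i x * partialD i Q x = radialD Q x := rfl
  simp only [e, Finset.sum_add_distrib, Finset.sum_sub_distrib, ← Finset.mul_sum,
    ← Finset.sum_mul, hy, ha, Finset.sum_ite_eq, Finset.mem_univ, if_true]
  ring

theorem isSymbol_sum_umbilicT (h : IsComparison m Q U ξ c D) (hD : IsSymbol U 3 D) :
    IsSymbol U 5 (fun x => ∑ i, ∑ j, umbilicT m Q (refκ ξ) x i j *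
      (normalV m Q i x * normalV m Q j x)) := by
  have hU := h.exterior
  have y := fun i => isSymbol_unitv hU i
  have t1 : IsSymbol U 5 (fun x => ∑ i, ∑ j, umbilicT m Q (refκ ξ) x i j *
      (normalV m Q i x * normalV m Q j x - unitv i x * unitv j x)) :=
    IsSymbol.sum hU fun i _ => IsSymbol.sum hU fun j _ => ((h.isSymbol_umbilicT hD i j).mul
      ((h.isLead_normalV hD (by norm_num) i).mul (h.isLead_normalV hD (by norm_num) j) hU).rem
      hU).of_le hU (by norm_num)
  have t2 : IsSymbol U 5 (fun x => ∑ i, ∑ j, remT ξ D i j x * (unitv i x * unitv j x)) :=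
    IsSymbol.sum hU fun i _ => IsSymbol.sum hU fun j _ => ((isSymbol_remT hU hD i j).mul
      ((y i).mul (y j) hU) hU).of_le hU (by norm_num)
  have t3 := ((h.isSymbol_coeffT.add ((((IsSymbol.pow (isSymbol_inv_norm hU) hU 2).const_mul hU
    m).const_mul hU 2).of_le hU (show (2 : ℤ) ≤ _ by norm_num)) hU).mul
    (IsSymbol.pow h.radial hU 2) hU).of_le hU (show (5 : ℤ) ≤ _ by norm_num)
  refine (t1.add (t2.sub t3 hU) hU).congr hU fun x hx => ?_
  rw [← h.sum_umbilicT_unitv hD hx]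
  simp only [← Finset.sum_add_distrib]
  exact Finset.sum_congr rfl fun i _ => Finset.sum_congr rfl fun j _ => by ring

theorem isSymbol_gramP (hU : IsExterior U) (m : ℝ) (i j : Fin 3) :
    IsSymbol U 0 (fun x => gramP m x i j) :=
  (IsSymbol.const U _).sub (((isSymbol_mass hU m).mul ((isSymbol_unitv hU i).mul
    (isSymbol_unitv hU j) hU) hU).of_le hU (by norm_num)) hU

/-- Far out, `L` is at least half as large as its leading term. -/
theorem exists_inv_gramL_le (h : IsComparison m Q U ξ c D) (hD : IsSymbol U 3 D) :
    ∃ R : ℝ, ∀ x ∈ U, R < ‖x‖ → (gramL m Q x)⁻¹ ≤ 2 * ‖x‖ ^ 2 := by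
  have hU := h.exterior
  have hδ := (h.isLead_gramL_sub hD (by norm_num) (by norm_num)).symbol hU
  have hκ := ((isLead_refκ hU ξ).mul (isLead_refκ hU ξ) hU).rem
  have h1 : IsSymbol U 3 (fun x => gramL m Q x - ‖x‖⁻¹ * ‖x‖⁻¹) :=
    ((hδ.of_le hU (by norm_num)).add (hκ.of_le hU (by norm_num)) hU).congr hU fun x _ => by ring
  obtain ⟨C, hC, hb⟩ := h1.bound hU
  refine ⟨2 * C, fun x hx hR => ?_⟩
  have hx0 := hU.norm_pos hx
  have h2 := (abs_le.1 (hb x hx)).1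
  have h3 : C * ‖x‖ ^ (-3 : ℤ) ≤ 1 / 2 * (‖x‖⁻¹ * ‖x‖⁻¹) := by
    rw [show (-3 : ℤ) = -((3 : ℕ) : ℤ) by norm_num, zpow_neg, zpow_natCast]
    rw [show 1 / 2 * (‖x‖⁻¹ * ‖x‖⁻¹) = ‖x‖ / 2 * (‖x‖ ^ 3)⁻¹ by field_simp]
    gcongr
    linarith
  rw [inv_le_comm₀ (h.gramL_pos hx) (by positivity)]
  rw [show (2 * ‖x‖ ^ 2)⁻¹ = 1 / 2 * (‖x‖⁻¹ * ‖x‖⁻¹) by field_simp]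
  linarith

/-- The scalar curvature of the surface tends to `-6` with fourth order decay. -/
theorem exists_scalarCurvature_bound (h : IsComparison m Q U ξ c D) (hD : IsSymbol U 3 D) :
    ∃ C R : ℝ, 0 < C ∧ ∀ x ∈ U, R < ‖x‖ →
      |scalarCurvature (inducedMetric (schwarzschild m) (graphMap (heightOf m Q))) x + 6| ≤
        C * ‖x‖⁻¹ ^ 4 := by
  have hU := h.exterior
  have P := fun i j => isSymbol_gramP hU m i j
  have T := fun i j => h.isSymbol_umbilicT hD i j
  have n := fun i => (h.isLead_normalV hD (by norm_num) i).symbol hU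
  have t1 : IsSymbol U 8 (fun x => ∑ i, ∑ j, ∑ k, ∑ p, gramP m x i j * gramP m x k p *
      umbilicT m Q (refκ ξ) x j p * umbilicT m Q (refκ ξ) x k i) :=
    IsSymbol.sum hU fun i _ => IsSymbol.sum hU fun j _ => IsSymbol.sum hU fun k _ =>
      IsSymbol.sum hU fun p _ => (((((P i j).mul (P k p) hU).mul (T j p) hU)).mul (T k i) hU).of_le
        hU (by norm_num)
  have Tn : ∀ i, IsSymbol U 4 (fun x => ∑ k, umbilicT m Q (refκ ξ) x i k * normalV m Q k x) :=
    fun i => IsSymbol.sum hU fun k _ => ((T i k).mul (n k) hU).of_le hU (by norm_num)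
  have t2 : IsSymbol U 8 (fun x => ∑ i, ∑ j, gramP m x i j *
          (∑ k, umbilicT m Q (refκ ξ) x i k * normalV m Q k x) *
          (∑ k, umbilicT m Q (refκ ξ) x j k * normalV m Q k x)) :=
    IsSymbol.sum hU fun i _ => IsSymbol.sum hU fun j _ => (((P i j).mul (Tn i) hU).mul (Tn j)
      hU).of_le hU (by norm_num)
  have t3 := h.isSymbol_sum_umbilicT hD
  have t4 := (h.isLead_gramL_sub hD (by norm_num) (by norm_num)).symbol hU
  obtain ⟨C₁, hC₁, b₁⟩ := t1.bound hU
  obtain ⟨C₂, hC₂, b₂⟩ := t2.bound hU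
  obtain ⟨C₃, hC₃, b₃⟩ := t3.bound hU
  obtain ⟨C₄, hC₄, b₄⟩ := t4.bound hU
  obtain ⟨R, hR⟩ := h.exists_inv_gramL_le hD
  refine ⟨2 * C₁ + 8 * C₂ + 8 * C₃ ^ 2 + 12 * C₄ ^ 2, R, by positivity, fun x hx hxR => ?_⟩
  rw [h.scalarCurvature_eq hx (refκ ξ)]
  have hL := h.gramL_pos hx
  have hr := hU.norm_pos hx
  have hr1 := hU.2 x hx
  have hLi := hR x hx hxR
  have b₁ := b₁ x hx
  have b₂ := b₂ x hx
  have b₃ := b₃ x hx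
  have b₄ := b₄ x hx
  set Y₁ := ∑ i, ∑ j, ∑ k, ∑ p, gramP m x i j * gramP m x k p *
      umbilicT m Q (refκ ξ) x j p * umbilicT m Q (refκ ξ) x k i
  set Y₂ := ∑ i, ∑ j, gramP m x i j *
          (∑ k, umbilicT m Q (refκ ξ) x i k * normalV m Q k x) *
          (∑ k, umbilicT m Q (refκ ξ) x j k * normalV m Q k x)
  set Y₃ := ∑ i, ∑ j, umbilicT m Q (refκ ξ) x i j * (normalV m Q i x * normalV m Q j x)
  set Y₄ := gramL m Q x - refκ ξ x ^ 2 with hY₄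
  have hs := Real.sq_sqrt hL.le
  have hsp := Real.sqrt_pos.2 hL
  have hκ := refκ_pos ξ x
  set z := √(gramL m Q x)
  set l := (gramL m Q x)⁻¹ with hl
  have hl0 : 0 < l := inv_pos.2 hL
  have hzκ : (z - refκ ξ x) ^ 2 ≤ l * Y₄ ^ 2 := by
    rw [hl, inv_mul_eq_div, le_div_iff₀ hL, hY₄, ← hs]
    nlinarith [mul_nonneg (sq_nonneg (z - refκ ξ x)) (mul_nonneg hsp.le hκ.le),
      mul_nonneg (sq_nonneg (z - refκ ξ x)) (sq_nonneg (refκ ξ x))]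
  have e1 : |l * (Y₁ + 2 * l * Y₂ + (l * Y₃) ^ 2 - 3 * (z - refκ ξ x) ^ 2)| ≤
      l * |Y₁| + 2 * l ^ 2 * |Y₂| + l ^ 3 * |Y₃| ^ 2 + 3 * l ^ 2 * |Y₄| ^ 2 := by
    rw [abs_mul, abs_of_pos hl0]
    calc l * |Y₁ + 2 * l * Y₂ + (l * Y₃) ^ 2 - 3 * (z - refκ ξ x) ^ 2|
        ≤ l * (|Y₁| + 2 * l * |Y₂| + l ^ 2 * |Y₃| ^ 2 + 3 * (l * |Y₄| ^ 2)) := by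
          gcongr
          have a1 := abs_sub (Y₁ + 2 * l * Y₂ + (l * Y₃) ^ 2) (3 * (z - refκ ξ x) ^ 2)
          have a2 := abs_add_le (Y₁ + 2 * l * Y₂) ((l * Y₃) ^ 2)
          have a3 := abs_add_le Y₁ (2 * l * Y₂)
          rw [abs_mul (2 * l), abs_of_pos (by positivity : 0 < 2 * l)] at a3
          rw [abs_of_nonneg (sq_nonneg (l * Y₃)), mul_pow] at a2
          rw [abs_of_nonneg (by positivity : 0 ≤ 3 * (z - refκ ξ x) ^ 2)] at a1
          simp only [sq_abs]
          rw [mul_pow] at a1 ⊢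
          linarith
      _ = _ := by ring
  refine e1.trans ?_
  have p8 : ‖x‖ ^ (-8 : ℤ) = ‖x‖⁻¹ ^ 8 := by
    rw [show (-8 : ℤ) = -((8 : ℕ) : ℤ) by norm_num, zpow_neg, zpow_natCast, inv_pow]
  have p5 : ‖x‖ ^ (-5 : ℤ) = ‖x‖⁻¹ ^ 5 := by
    rw [show (-5 : ℤ) = -((5 : ℕ) : ℤ) by norm_num, zpow_neg, zpow_natCast, inv_pow]
  have p4 : ‖x‖ ^ (-(3 + 1) : ℤ) = ‖x‖⁻¹ ^ 4 := by
    rw [show (-(3 + 1) : ℤ) = -((4 : ℕ) : ℤ) by norm_num, zpow_neg, zpow_natCast, inv_pow]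
  rw [p8] at b₁ b₂
  rw [p5] at b₃
  rw [p4] at b₄
  have hsr : ‖x‖⁻¹ ≤ 1 := inv_le_one_of_one_le₀ hr1
  have q1 : l * |Y₁| ≤ 2 * C₁ * ‖x‖⁻¹ ^ 4 := by
    calc l * |Y₁| ≤ (2 * ‖x‖ ^ 2) * (C₁ * ‖x‖⁻¹ ^ 8) := by gcongr
      _ = 2 * C₁ * (‖x‖⁻¹ ^ 4 * ‖x‖⁻¹ ^ 2) := by field_simp
      _ ≤ 2 * C₁ * (‖x‖⁻¹ ^ 4 * 1) := by gcongr; exact pow_le_one₀ (by positivity) hsr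
      _ = _ := by ring
  have q2 : 2 * l ^ 2 * |Y₂| ≤ 8 * C₂ * ‖x‖⁻¹ ^ 4 := by
    calc 2 * l ^ 2 * |Y₂| ≤ 2 * (2 * ‖x‖ ^ 2) ^ 2 * (C₂ * ‖x‖⁻¹ ^ 8) := by gcongr
      _ = _ := by field_simp; norm_num
  have q3 : l ^ 3 * |Y₃| ^ 2 ≤ 8 * C₃ ^ 2 * ‖x‖⁻¹ ^ 4 := by
    calc l ^ 3 * |Y₃| ^ 2 ≤ (2 * ‖x‖ ^ 2) ^ 3 * (C₃ * ‖x‖⁻¹ ^ 5) ^ 2 := by gcongr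
      _ = _ := by field_simp; norm_num
  have q4 : 3 * l ^ 2 * |Y₄| ^ 2 ≤ 12 * C₄ ^ 2 * ‖x‖⁻¹ ^ 4 := by
    calc 3 * l ^ 2 * |Y₄| ^ 2 ≤ 3 * (2 * ‖x‖ ^ 2) ^ 2 * (C₄ * ‖x‖⁻¹ ^ 4) ^ 2 := by gcongr
      _ = _ := by field_simp; norm_num
  linarith

end IsComparison

end SchwarzschildCMC

namespace SchwarzschildCMC

open Set Filter Topology

/-! ### Polar coordinates of the hyperboloid -/

/-- The map `ρ y ↦ sinh ρ y`. -/
noncomputable def sinhMap (z : E 3) : E 3 := (Real.sinh ‖z‖ * ‖z‖⁻¹) • z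

/-- The map `r y ↦ arsinh r y`, the inverse of `sinhMap`. -/
noncomputable def arsinhMap (x : E 3) : E 3 := (Real.arsinh ‖x‖ * ‖x‖⁻¹) • x

theorem norm_sinhMap (z : E 3) : ‖sinhMap z‖ = Real.sinh ‖z‖ := by
  have h : 0 ≤ Real.sinh ‖z‖ := Real.sinh_nonneg_iff.2 (norm_nonneg z)
  rw [sinhMap, norm_smul, Real.norm_of_nonneg (by positivity)]
  by_cases hz : z = 0
  · simp [hz]
  · have := norm_ne_zero_iff.2 hz
    field_simp

theorem norm_arsinhMap (x : E 3) : ‖arsinhMap x‖ = Real.arsinh ‖x‖ := by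
  have h : 0 ≤ Real.arsinh ‖x‖ := Real.arsinh_nonneg_iff.2 (norm_nonneg x)
  rw [arsinhMap, norm_smul, Real.norm_of_nonneg (by positivity)]
  by_cases hx : x = 0
  · simp [hx]
  · have := norm_ne_zero_iff.2 hx
    field_simp

theorem arsinhMap_sinhMap {z : E 3} (hz : z ≠ 0) : arsinhMap (sinhMap z) = z := by
  have h0 := norm_pos_iff.2 hz
  have h1 : 0 < Real.sinh ‖z‖ := Real.sinh_pos_iff.2 h0
  rw [arsinhMap, norm_sinhMap, Real.arsinh_sinh, sinhMap, smul_smul]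
  convert one_smul ℝ z using 2
  field_simp

theorem sinhMap_arsinhMap {x : E 3} (hx : x ≠ 0) : sinhMap (arsinhMap x) = x := by
  have h0 := norm_pos_iff.2 hx
  have h1 : 0 < Real.arsinh ‖x‖ := Real.arsinh_pos_iff.2 h0
  rw [sinhMap, norm_arsinhMap, Real.sinh_arsinh, arsinhMap, smul_smul]
  convert one_smul ℝ x using 2
  field_simp

theorem direction_sinhMap {z : E 3} (hz : z ≠ 0) : direction (sinhMap z) = direction z :=
  direction_smul (mul_pos (Real.sinh_pos_iff.2 (norm_pos_iff.2 hz))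
    (inv_pos.2 (norm_pos_iff.2 hz))) z

theorem contDiffAt_sinhMap {z : E 3} (hz : z ≠ 0) : ContDiffAt ℝ ∞ sinhMap z :=
  ((Real.contDiff_sinh.contDiffAt.comp z (contDiffAt_norm ℝ hz)).mul (contDiffAt_inv_norm hz)).smul
    contDiffAt_id

theorem contDiffAt_arsinhMap {x : E 3} (hx : x ≠ 0) : ContDiffAt ℝ ∞ arsinhMap x :=
  ((Real.contDiff_arsinh.contDiffAt.comp x (contDiffAt_norm ℝ hx)).mul
    (contDiffAt_inv_norm hx)).smul contDiffAt_id

/-- The polar coordinates `z ↦ ξ + sinh ρ y` of a hyperboloid centred at `ξ`, on `ρ > R`. -/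
noncomputable def hyperboloidChart (ξ : E 3) {R : ℝ} (hR : 0 < R) :
    OpenPartialHomeomorph (E 3) (E 3) where
  toFun z := sinhMap z + ξ
  invFun x := arsinhMap (x - ξ)
  source := {z | R < ‖z‖}
  target := {x | Real.sinh R < ‖x - ξ‖}
  map_source' z hz := by
    change _ < ‖sinhMap z + ξ - ξ‖
    rw [add_sub_cancel_right, norm_sinhMap]
    exact Real.sinh_lt_sinh.2 hz
  map_target' x hx := by
    change R < _
    rw [norm_arsinhMap, ← Real.sinh_lt_sinh, Real.sinh_arsinh]
    exact hx
  left_inv' z hz := by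
    rw [add_sub_cancel_right, arsinhMap_sinhMap (norm_pos_iff.1 (hR.trans hz))]
  right_inv' x hx := by
    rw [sinhMap_arsinhMap (norm_pos_iff.1 ((Real.sinh_pos_iff.2 hR).trans hx)), sub_add_cancel]
  open_source := isOpen_lt continuous_const continuous_norm
  open_target := isOpen_lt continuous_const (by fun_prop)
  continuousOn_toFun z hz := ((contDiffAt_sinhMap
    (norm_pos_iff.1 (hR.trans hz))).continuousAt.add continuousAt_const).continuousWithinAt
  continuousOn_invFun x hx := by
    have h1 := (contDiffAt_arsinhMap
      (norm_pos_iff.1 ((Real.sinh_pos_iff.2 hR).trans hx))).continuousAt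
    exact (ContinuousAt.comp (f := fun x => x - ξ) h1 (by fun_prop)).continuousWithinAt

theorem contDiffOn_hyperboloidChart (ξ : E 3) {R : ℝ} (hR : 0 < R) :
    ContDiffOn ℝ ∞ (hyperboloidChart ξ hR) {z | R < ‖z‖} := fun _ hz =>
  ((contDiffAt_sinhMap (norm_pos_iff.1 (hR.trans hz))).add contDiffAt_const).contDiffWithinAt

theorem contDiffOn_hyperboloidChart_symm (ξ : E 3) {R : ℝ} (hR : 0 < R) :
    ContDiffOn ℝ ∞ (hyperboloidChart ξ hR).symm {x | Real.sinh R < ‖x - ξ‖} := fun x hx =>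
  (ContDiffAt.comp (f := fun x => x - ξ) x (contDiffAt_arsinhMap
    (norm_pos_iff.1 ((Real.sinh_pos_iff.2 hR).trans hx))) (by fun_prop)).contDiffWithinAt

theorem tendsto_hyperboloidChart (ξ : E 3) {R : ℝ} (hR : 0 < R) :
    Tendsto (hyperboloidChart ξ hR) (Bornology.cobounded (E 3)) (Bornology.cobounded (E 3)) := by
  rw [← tendsto_norm_atTop_iff_cobounded]
  have h1 : ∀ z : E 3, ‖z‖ - ‖ξ‖ ≤ ‖hyperboloidChart ξ hR z‖ := by
    intro z
    have h2 := norm_sub_norm_le (sinhMap z) (-ξ)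
    rw [sub_neg_eq_add, norm_neg, norm_sinhMap] at h2
    have h3 := Real.self_le_sinh_iff.2 (norm_nonneg z)
    change _ ≤ ‖sinhMap z + ξ‖
    linarith
  exact tendsto_atTop_mono h1 (tendsto_atTop_add_const_right _ _ tendsto_norm_cobounded_atTop)

theorem fderiv_norm_apply {z : E 3} (hz : z ≠ 0) (v : E 3) :
    fderiv ℝ (fun z : E 3 => ‖z‖) z v = ⟪(direction z : E 3), v⟫_ℝ := by
  rw [fderiv_apply_eq_sum, direction_coe hz]
  simp only [partialD_norm hz, PiLp.inner_apply]
  refine Finset.sum_congr rfl fun i _ => ?_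
  simp only [PiLp.smul_apply, smul_eq_mul, RCLike.inner_apply, conj_trivial]
  ring

theorem fderiv_sinhMap {z : E 3} (hz : z ≠ 0) (v : E 3) :
    fderiv ℝ sinhMap z v = ((Real.cosh ‖z‖ - Real.sinh ‖z‖ * ‖z‖⁻¹) *
      ⟪(direction z : E 3), v⟫_ℝ) • (direction z : E 3) + (Real.sinh ‖z‖ * ‖z‖⁻¹) • v := by
  have h0 := norm_ne_zero_iff.2 hz
  have hn : HasFDerivAt (fun z : E 3 => ‖z‖) (fderiv ℝ (fun z : E 3 => ‖z‖) z) z :=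
    (differentiableAt_norm hz).hasFDerivAt
  have hg : HasDerivAt (fun r => Real.sinh r * r⁻¹)
      (Real.cosh ‖z‖ * ‖z‖⁻¹ + Real.sinh ‖z‖ * (-(‖z‖ ^ 2)⁻¹)) ‖z‖ :=
    (Real.hasDerivAt_sinh _).mul (hasDerivAt_inv h0)
  have h1 := (hg.comp_hasFDerivAt z hn).smul (hasFDerivAt_id z)
  have h2 : HasFDerivAt sinhMap _ z := h1
  rw [h2.fderiv]
  simp only [add_apply, smul_apply,
    ContinuousLinearMap.smulRight_apply, Function.comp, ContinuousLinearMap.id_apply, id, fderiv_norm_apply hz, smul_eq_mul]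
  rw [add_comm]
  congr 1
  rw [direction_coe hz, smul_smul]
  congr 1
  field_simp
  ring

/-- The orthonormal frame of the hyperboloid `t = √(1 + |x|²)`, projected to space. -/
noncomputable def spatialFrame (f : Fin 2 → S2 → E 3) : Fin 3 → E 3 → E 3 :=
  Fin.cons (fun x => refW 0 x • (direction x : E 3)) (fun α x => f α (direction x))

theorem refW_sinhMap (z : E 3) : refW 0 (sinhMap z) = Real.cosh ‖z‖ := by
  rw [refW, sub_zero, norm_sinhMap, add_comm, ← Real.cosh_sq, Real.sqrt_sq (Real.cosh_pos _).le]

theorem inner_direction_self (z : E 3) : ⟪(direction z : E 3), (direction z : E 3)⟫_ℝ = 1 := by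
  rw [real_inner_self_eq_norm_sq]
  simp

/-- The hyperbolic frame is mapped to the frame of the hyperboloid. -/
theorem fderiv_sinhMap_hyperbolicFrame {f : Fin 2 → S2 → E 3} {U : Set S2}
    (hf : IsOrthonormalFrameOn f U) {z : E 3} (hz : z ≠ 0) (hzU : direction z ∈ U) (i : Fin 3) :
    fderiv ℝ sinhMap z (hyperbolicFrame f i z) = spatialFrame f i (sinhMap z) := by
  have h0 := norm_ne_zero_iff.2 hz
  have h1 : Real.sinh ‖z‖ ≠ 0 := (Real.sinh_pos_iff.2 (norm_pos_iff.2 hz)).ne'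
  rw [fderiv_sinhMap hz]
  refine Fin.cases ?_ (fun α => ?_) i
  · simp only [hyperbolicFrame, spatialFrame, Fin.cons_zero, inner_direction_self, refW_sinhMap,
      direction_sinhMap hz]
    rw [← add_smul]
    congr 1
    ring
  · simp only [hyperbolicFrame, spatialFrame, Fin.cons_succ, direction_sinhMap hz]
    rw [inner_smul_right, real_inner_comm, hf.tangent α _ hzU]
    simp only [mul_zero, zero_smul, zero_add, smul_smul]
    convert one_smul ℝ _ using 2
    field_simp

theorem alongField_congr {V : Set (E 3)} (hV : IsOpen V) {g h : E 3 → ℝ} (e : ∀ z ∈ V, g z = h z)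
    (X : E 3 → E 3) {z : E 3} (hz : z ∈ V) : alongField X g z = alongField X h z := by
  rw [alongField, alongField, (eventuallyEq_of_mem (hV.mem_nhds hz) e).fderiv_eq]

/-- Differentiation along the hyperbolic frame is differentiation along the frame of the
hyperboloid. -/
theorem alongField_comp_sinhMap {f : Fin 2 → S2 → E 3} {U : Set S2}
    (hf : IsOrthonormalFrameOn f U) {z : E 3} (hz : z ≠ 0) (hzU : direction z ∈ U) (k : Fin 3)
    {φ : E 3 → ℝ} (hφ : DifferentiableAt ℝ φ (sinhMap z)) :
    alongField (hyperbolicFrame f k) (fun w => φ (sinhMap w)) z =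
      alongField (spatialFrame f k) φ (sinhMap z) := by
  rw [alongField, alongField, ← fderiv_sinhMap_hyperbolicFrame hf hz hzU]
  have := (hφ.hasFDerivAt.comp z (ContDiffAt.dAt (contDiffAt_sinhMap hz)).hasFDerivAt).fderiv
  rw [show (fun w => φ (sinhMap w)) = φ ∘ sinhMap from rfl, this]
  rfl

end SchwarzschildCMC

namespace SchwarzschildCMC

open Set Filter Topology

/-! ### The induced metric in the hyperbolic frame -/

theorem continuous_angle (p : S2) :
    Continuous fun y : S2 => InnerProductGeometry.angle (y : E 3) (p : E 3) := by
  rw [continuous_iff_continuousAt]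
  intro y
  have h : ∀ y : S2, (y : E 3) ≠ 0 := fun y h0 => by
    have : ‖(y : E 3)‖ = 1 := by simp
    simp [h0] at this
  exact ContinuousAt.comp (f := fun y : S2 => ((y : E 3), (p : E 3)))
    (InnerProductGeometry.continuousAt_angle (h y) (h p)) (by fun_prop)

theorem isOpen_geodesicBall (p : S2) (a : ℝ) : IsOpen (geodesicBall p a) :=
  isOpen_lt (continuous_angle p) continuous_const

/-- The part outside of a ball of the cone over a geodesic ball of radius one. -/
def coneOver (p : S2) (R : ℝ) : Set (E 3) := {x | R < ‖x‖} ∩ direction ⁻¹' geodesicBall p 1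

theorem isOpen_cone {p : S2} {a : ℝ} : IsOpen ({x | x ≠ 0} ∩ direction ⁻¹' geodesicBall p a) :=
  contMDiffOn_direction.continuousOn.isOpen_inter_preimage isOpen_ne_zero (isOpen_geodesicBall p a)

theorem isOpen_coneOver {p : S2} {R : ℝ} (hR : 0 ≤ R) : IsOpen (coneOver p R) := by
  have : coneOver p R = {x | R < ‖x‖} ∩ ({x | x ≠ 0} ∩ direction ⁻¹' geodesicBall p 1) := by
    ext x
    simp only [coneOver, mem_inter_iff, mem_preimage]
    refine ⟨fun h => ⟨h.1, norm_pos_iff.1 (hR.trans_lt h.1), h.2⟩, fun h => ⟨h.1, h.2.2⟩⟩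
  rw [this]
  exact (isOpen_lt continuous_const continuous_norm).inter isOpen_cone

theorem isExterior_coneOver {p : S2} {R : ℝ} (hR : 1 ≤ R) : IsExterior (coneOver p R) :=
  ⟨isOpen_coneOver (by linarith), fun _ hx => hR.trans (le_of_lt hx.1)⟩

theorem geodesicBall_subset (p : S2) : geodesicBall p 1 ⊆ geodesicBall p 2 := fun _ hy =>
  lt_trans (show _ < (1 : ℝ) from hy) one_lt_two

section Frame

variable {p : S2} {R : ℝ} {f : Fin 2 → S2 → E 3}

theorem isSymbol_frame (hf : IsOrthonormalFrameOn f (geodesicBall p 2)) (hR : 1 ≤ R) (α : Fin 2)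
    (a : Fin 3) : IsSymbol (coneOver p R) 0 (fun x => f α (direction x) a) := by
  have hK : IsCompact {y : S2 | InnerProductGeometry.angle (y : E 3) (p : E 3) ≤ 1} :=
    (isClosed_le (continuous_angle p) continuous_const).isCompact
  refine isSymbol_of_scaling (isExterior_coneOver hR) (k := 0)
    (G := fun q => f α (direction q.1) a)
    (O := Prod.fst ⁻¹' ({x | x ≠ 0} ∩ direction ⁻¹' geodesicBall p 2))
    (K := (Subtype.val '' {y : S2 | InnerProductGeometry.angle (y : E 3) (p : E 3) ≤ 1}) ×ˢ
      Icc (0 : ℝ) 1) (isOpen_cone.preimage continuous_fst) ?_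
    ((hK.image continuous_subtype_val).prod isCompact_Icc) ?_ ?_ ?_
  · have h1 : ContDiffOn ℝ ∞ (fun q : E 3 × ℝ => f α (direction q.1))
        (Prod.fst ⁻¹' ({x | x ≠ 0} ∩ direction ⁻¹' geodesicBall p 2)) :=
      (contDiffOn_comp_direction (hf.smooth α)).comp contDiffOn_fst fun _ hq => hq
    exact (contDiffOn_euclidean.1 h1) a
  · rintro ⟨x, σ⟩ ⟨⟨y, hy, rfl⟩, -⟩
    refine ⟨fun h0 => ?_, ?_⟩
    · have h1 : ‖(y : E 3)‖ = 1 := by simp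
      simp [show (y : E 3) = 0 from h0] at h1
    · change direction (y : E 3) ∈ geodesicBall p 2
      rw [direction_coe_sphere]
      have h1 : InnerProductGeometry.angle (y : E 3) (p : E 3) ≤ 1 := hy
      exact lt_of_le_of_lt h1 one_lt_two
  · intro X hX
    have h1 : InnerProductGeometry.angle (direction X : E 3) (p : E 3) < 1 := hX.2
    refine ⟨⟨direction X, h1.le, ?_⟩, ((isExterior_coneOver hR).rescaled_mem hX).2⟩
    rw [direction_coe ((isExterior_coneOver hR).ne_zero hX)]
  · intro X hX
    refine Filter.Eventually.of_forall fun X' => ?_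
    simp [direction_smul (inv_pos.2 ((isExterior_coneOver hR).norm_pos hX))]

theorem direction_apply {x : E 3} (hx : x ≠ 0) (a : Fin 3) : (direction x : E 3) a = unitv a x := by
  rw [direction_coe hx, unitv]
  simp [mul_comm]

theorem isSymbol_spatialFrame (hf : IsOrthonormalFrameOn f (geodesicBall p 2)) (hR : 1 ≤ R)
    (i a : Fin 3) : IsSymbol (coneOver p R) (-1) (fun x => spatialFrame f i x a) := by
  have hV := isExterior_coneOver (p := p) hR
  refine Fin.cases ?_ (fun α => ?_) i
  · refine (((isSymbol_refW hV 0).mul (isSymbol_unitv hV a) hV).of_le hV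
      (by norm_num : (-1 : ℤ) ≤ _)).congr hV fun x hx => ?_
    rw [← direction_apply (hV.ne_zero hx)]
    simp [spatialFrame]
  · exact (isSymbol_frame hf hR α a).of_le hV (by norm_num)

theorem alongField_eq_sum (X : E 3 → E 3) (φ : E 3 → ℝ) (x : E 3) :
    alongField X φ x = ∑ a, X x a * partialD a φ x := fderiv_apply_eq_sum φ x (X x)

/-- Differentiation along the frame of the hyperboloid preserves the order of symbols. -/
theorem IsSymbol.alongField_spatialFrame {k : ℤ} {φ : E 3 → ℝ}
    (hf : IsOrthonormalFrameOn f (geodesicBall p 2)) (hR : 1 ≤ R) (hφ : IsSymbol (coneOver p R) k φ)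
    (i : Fin 3) : IsSymbol (coneOver p R) k (alongField (spatialFrame f i) φ) := by
  have hV := isExterior_coneOver (p := p) hR
  exact (IsSymbol.sum (s := Finset.univ) hV fun a _ => ((isSymbol_spatialFrame hf hR i a).mul
    (hφ.partialD hV a) hV).of_le hV (show k ≤ _ by omega)).congr hV fun x _ =>
      alongField_eq_sum _ _ _

/-- The inner products of the spatial parts of the frame of the hyperboloid. -/
theorem sum_spatialFrame (hf : IsOrthonormalFrameOn f (geodesicBall p 2)) {x : E 3}
    (hx : x ∈ coneOver p R) (i j : Fin 3) :
    ∑ a, spatialFrame f i x a * spatialFrame f j x a =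
      (if i = j then 1 else 0) + (if i = 0 then ‖x‖ else 0) * (if j = 0 then ‖x‖ else 0) := by
  have hb := geodesicBall_subset p hx.2
  have e : ∀ v w : E 3, ∑ a, v a * w a = ⟪v, w⟫_ℝ := fun v w => by
    rw [PiLp.inner_apply]
    exact Finset.sum_congr rfl fun a _ => by simp [mul_comm]
  have hsq : refW 0 x * refW 0 x = 1 + ‖x‖ * ‖x‖ := by
    have := refW_sq 0 x
    rw [sub_zero] at this
    linarith [sq (refW 0 x), sq ‖x‖]
  rw [e]
  refine Fin.cases ?_ (fun α => ?_) i <;> refine Fin.cases ?_ (fun β => ?_) j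
  · simp only [spatialFrame, Fin.cons_zero, inner_smul_left, inner_smul_right,
      inner_direction_self, if_true, mul_one]
    exact hsq
  · simp only [spatialFrame, Fin.cons_zero, Fin.cons_succ, inner_smul_left]
    rw [real_inner_comm, hf.tangent β _ hb]
    simp [Fin.succ_ne_zero, (Fin.succ_ne_zero β).symm]
  · simp only [spatialFrame, Fin.cons_zero, Fin.cons_succ, inner_smul_right]
    rw [hf.tangent α _ hb]
    simp [Fin.succ_ne_zero]
  · simp only [spatialFrame, Fin.cons_succ, Fin.succ_inj, Fin.succ_ne_zero, if_false, mul_zero,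
      add_zero]
    exact orthonormal_iff_ite.1 (hf.orthonormal _ hb) α β

theorem refκ_add (ξ x : E 3) : refκ ξ (x + ξ) = refκ 0 x := by
  simp [refκ, refW]

/-- The frame derivatives of the height of the hyperboloid. -/
theorem sum_refW_spatialFrame (ξ : E 3) (hf : IsOrthonormalFrameOn f (geodesicBall p 2)) {x : E 3}
    (hx : x ∈ coneOver p R) (hx0 : x ≠ 0) (i : Fin 3) :
    ∑ a, partialD a (refW ξ) (x + ξ) * spatialFrame f i x a = if i = 0 then ‖x‖ else 0 := by
  have hb := geodesicBall_subset p hx.2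
  have h0 := norm_ne_zero_iff.2 hx0
  have e : ∑ a, partialD a (refW ξ) (x + ξ) * spatialFrame f i x a =
      refκ 0 x * ‖x‖ * ⟪(direction x : E 3), spatialFrame f i x⟫_ℝ := by
    rw [PiLp.inner_apply, Finset.mul_sum]
    refine Finset.sum_congr rfl fun a _ => ?_
    rw [partialD_refW, refκ_add, direction_apply hx0, unitv]
    simp only [PiLp.add_apply, RCLike.inner_apply, conj_trivial]
    field_simp
    ring
  rw [e]
  refine Fin.cases ?_ (fun α => ?_) i
  · simp only [spatialFrame, Fin.cons_zero, inner_smul_right, inner_direction_self, if_true,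
      mul_one]
    have := (refW_pos 0 x).ne'
    rw [refκ]
    field_simp
  · simp only [spatialFrame, Fin.cons_succ, Fin.succ_ne_zero, if_false]
    rw [real_inner_comm, hf.tangent α _ hb, mul_zero]

/-- The components in the frame of the hyperboloid of the metric `G`, moved by `ξ`. -/
noncomputable def frameMetric (G : E 3 → Matrix (Fin 3) (Fin 3) ℝ) (ξ : E 3)
    (f : Fin 2 → S2 → E 3) (i j : Fin 3) (x : E 3) : ℝ :=
  ∑ a, ∑ b, G (x + ξ) a b * spatialFrame f i x a * spatialFrame f j x b

variable {m : ℝ} {Q : E 3 → ℝ} {R₀ : ℝ} {ξ : E 3} {c : ℝ} {D : E 3 → ℝ}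

/-- In the frame of the hyperboloid, the deviation of the induced metric from the hyperbolic metric
and its frame derivatives are of second order. -/
theorem IsComparison.isSymbol_frameMetric (h : IsComparison m Q {x | R₀ < ‖x‖} ξ c D)
    (hD : IsSymbol {x | R₀ < ‖x‖} 3 D) (hf : IsOrthonormalFrameOn f (geodesicBall p 2))
    (hR : 1 ≤ R) (hR₀ : R₀ + ‖ξ‖ ≤ R) (hξ : 2 * ‖ξ‖ ≤ R)
    {G : E 3 → Matrix (Fin 3) (Fin 3) ℝ} (hG : ∀ x, R₀ < ‖x‖ → ∀ i j, G x i j = gramG m Q x i j)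
    (i j : Fin 3) : IsSymbol (coneOver p R) 2
      (fun x => frameMetric G ξ f i j x - if i = j then 1 else 0) := by
  have hV := isExterior_coneOver (p := p) hR
  have hU := h.exterior
  have hmem : ∀ x ∈ coneOver p R, x + ξ ∈ {x : E 3 | R₀ < ‖x‖} := by
    intro x hx
    have h1 : R < ‖x‖ := hx.1
    have h2 := norm_sub_norm_le x (-ξ)
    rw [sub_neg_eq_add, norm_neg] at h2
    change R₀ < ‖x + ξ‖
    linarith
  have hξ' : ∀ x ∈ coneOver p R, 2 * ‖ξ‖ ≤ ‖x‖ := fun x hx => hξ.trans (le_of_lt hx.1)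
  have tr : ∀ {k : ℤ} {φ : E 3 → ℝ}, IsSymbol {x : E 3 | R₀ < ‖x‖} k φ →
      IsSymbol (coneOver p R) k (fun x => φ (x + ξ)) := fun hφ => hφ.translate hU hV ξ hmem hξ'
  have e := isSymbol_spatialFrame (p := p) hf hR
  -- the frame derivatives of `D` and of `Q`
  have d : ∀ i, IsSymbol (coneOver p R) 3
      (fun x => ∑ a, partialD a D (x + ξ) * spatialFrame f i x a) := fun i =>
    IsSymbol.sum hV fun a _ => ((tr (hD.partialD hU a)).mul (e i a) hV).of_le hV (by norm_num)
  have q := h.isSymbol_partialD_Q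
  have y0 : ∀ a, IsSymbol (coneOver p R) 1 (fun x => unitv a x - unitv a (x + ξ)) := by
    intro a
    refine ((tr (isLead_partialD_refW hU ξ a).rem).sub (isLead_partialD_refW hV 0 a).rem hV).congr
      hV fun x hx => ?_
    rw [partialD_refW, partialD_refW, refκ_add]
    simp
  have qr : IsSymbol (coneOver p R) 2 (fun x => ∑ a, partialD a Q (x + ξ) * unitv a x) := by
    have t1 : IsSymbol (coneOver p R) 2
        (fun x => ∑ a, partialD a Q (x + ξ) * (unitv a x - unitv a (x + ξ))) :=
      IsSymbol.sum hV fun a _ => ((tr (q a)).mul (y0 a) hV).of_le hV (by norm_num)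
    refine (t1.add (tr h.radial) hV).congr hV fun x _ => ?_
    rw [radialD, ← Finset.sum_add_distrib]
    exact Finset.sum_congr rfl fun a _ => by ring
  have pq : ∀ i, IsSymbol (coneOver p R) 1
      (fun x => ∑ a, partialD a Q (x + ξ) * spatialFrame f i x a) := by
    intro i
    refine Fin.cases ?_ (fun α => ?_) i
    · refine (((isSymbol_refW hV 0).mul qr hV).of_le hV (show (1 : ℤ) ≤ _ by norm_num)).congr hV
        fun x hx => ?_
      rw [Finset.mul_sum]
      refine Finset.sum_congr rfl fun a _ => ?_
      rw [← direction_apply (hV.ne_zero hx)]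
      simp [spatialFrame]
      ring
    · exact IsSymbol.sum hV fun a _ => ((tr (q a)).mul (isSymbol_frame hf hR α a) hV).of_le hV
        (by norm_num)
  have w : ∀ i : Fin 3, IsSymbol (coneOver p R) (-1) (fun x => if i = 0 then ‖x‖ else 0) := by
    intro i
    by_cases hi : i = 0
    · simpa [hi] using isSymbol_norm hV
    · simpa [hi] using isSymbol_zero (coneOver p R) (-1)
  have μ := tr (isSymbol_mass hU m)
  have s1 := ((w i).mul (d j) hV).of_le hV (show (2 : ℤ) ≤ _ by norm_num)
  have s2 := ((d i).mul (w j) hV).of_le hV (show (2 : ℤ) ≤ _ by norm_num)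
  have s3 := ((d i).mul (d j) hV).of_le hV (show (2 : ℤ) ≤ _ by norm_num)
  have s4 := (μ.mul ((pq i).mul (pq j) hV) hV).of_le hV (show (2 : ℤ) ≤ _ by norm_num)
  refine ((((s1.add s2 hV).sub s3 hV).add s4 hV)).congr hV fun x hx => ?_
  have hx0 := hV.ne_zero hx
  have hxU := hmem x hx
  have g1 := sum_spatialFrame hf hx i j
  have g2 := sum_refW_spatialFrame ξ hf hx hx0 i
  have g3 := sum_refW_spatialFrame ξ hf hx hx0 j
  have g4 : frameMetric G ξ f i j x = (∑ a, spatialFrame f i x a * spatialFrame f j x a)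
      - (∑ a, gradW Q a (x + ξ) * spatialFrame f i x a) *
        (∑ b, gradW Q b (x + ξ) * spatialFrame f j x b)
      + 2 * m * ‖x + ξ‖⁻¹ * ((∑ a, partialD a Q (x + ξ) * spatialFrame f i x a) *
        (∑ b, partialD b Q (x + ξ) * spatialFrame f j x b)) := by
    rw [Finset.sum_mul_sum, Finset.sum_mul_sum, Finset.mul_sum, ← Finset.sum_sub_distrib,
      ← Finset.sum_add_distrib, frameMetric]
    refine Finset.sum_congr rfl fun a _ => ?_
    rw [Finset.mul_sum]
    have : spatialFrame f i x a * spatialFrame f j x a =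
        ∑ b, if a = b then spatialFrame f i x a * spatialFrame f j x b else 0 := by simp
    rw [this, ← Finset.sum_sub_distrib, ← Finset.sum_add_distrib]
    refine Finset.sum_congr rfl fun b _ => ?_
    rw [hG _ hxU, gramG]
    split_ifs <;> ring
  have g5 : ∀ i, ∑ a, gradW Q a (x + ξ) * spatialFrame f i x a =
      (∑ a, partialD a (refW ξ) (x + ξ) * spatialFrame f i x a)
      - ∑ a, partialD a D (x + ξ) * spatialFrame f i x a := by
    intro i
    rw [← Finset.sum_sub_distrib]
    exact Finset.sum_congr rfl fun a _ => by rw [h.gradW_eq hD hxU]; ring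
  rw [g4, g5, g5, g1, g2, g3]
  ring

end Frame

end SchwarzschildCMC

namespace SchwarzschildCMC

open Set Filter Topology

/-! ### The surface as a perturbation of a hyperboloid -/

section Surface

variable {m s₀ : ℝ} {P : S2 × ℝ → ℝ}

theorem contDiffOn_comp_direction_inv_norm (hs₀ : 0 < s₀)
    (hP : ContMDiffOn ((𝓡 2).prod 𝓘(ℝ, ℝ)) 𝓘(ℝ, ℝ) ∞ P (Set.univ ×ˢ Set.Ico 0 s₀)) :
    ContDiffOn ℝ ∞ (fun x : E 3 => P (direction x, ‖x‖⁻¹)) {x | s₀⁻¹ < ‖x‖} := by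
  have h0 : ∀ x ∈ {x : E 3 | s₀⁻¹ < ‖x‖}, x ≠ 0 := fun x hx =>
    norm_pos_iff.1 ((inv_pos.2 hs₀).trans hx)
  have h1 : ContMDiffOn 𝓘(ℝ, E 3) 𝓘(ℝ, ℝ) ∞ (fun x : E 3 => ‖x‖⁻¹) {x | s₀⁻¹ < ‖x‖} :=
    contMDiffOn_iff_contDiffOn.2 fun x hx => (contDiffAt_inv_norm (h0 x hx)).contDiffWithinAt
  have h2 := hP.comp ((contMDiffOn_direction.mono h0).prodMk h1) fun x hx =>
    ⟨mem_univ _, by positivity, inv_lt_of_inv_lt₀ hs₀ hx⟩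
  exact contMDiffOn_iff_contDiffOn.1 h2

theorem isCMCGraph_surface (hm : 0 ≤ m) (hs₀ : 0 < s₀) (hms : 2 * m * s₀ ≤ 1)
    (hP : ContMDiffOn ((𝓡 2).prod 𝓘(ℝ, ℝ)) 𝓘(ℝ, ℝ) ∞ P (Set.univ ×ˢ Set.Ico 0 s₀))
    (hspacelike : ∀ x : E 3, s₀⁻¹ < ‖x‖ → (surfaceMetric m P x).PosDef)
    (hcmc : ∀ x : E 3, s₀⁻¹ < ‖x‖ → surfaceMeanCurvature m P x = 1) :
    IsCMCGraph m (fun x => P (direction x, ‖x‖⁻¹)) {x | s₀⁻¹ < ‖x‖} where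
  nonneg := hm
  isOpen := isOpen_lt continuous_const continuous_norm
  outer _ hx := lt_of_le_of_lt ((le_div_iff₀ hs₀).2 hms |>.trans (one_div s₀).le) hx
  smooth := contDiffOn_comp_direction_inv_norm hs₀ hP
  posDef := hspacelike
  cmc := hcmc

theorem IsCMCGraph.mono {Q : E 3 → ℝ} {U V : Set (E 3)} (h : IsCMCGraph m Q U) (hV : IsOpen V)
    (hVU : V ⊆ U) : IsCMCGraph m Q V where
  nonneg := h.nonneg
  isOpen := hV
  outer x hx := h.outer x (hVU hx)
  smooth := h.smooth.mono hVU
  posDef x hx := h.posDef x (hVU hx)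
  cmc x hx := h.cmc x (hVU hx)

/-- The constant mean curvature surface approaches a hyperboloid to third order. -/
theorem exists_isComparison (hs₀ : 0 < s₀)
    (hP : ContMDiffOn ((𝓡 2).prod 𝓘(ℝ, ℝ)) 𝓘(ℝ, ℝ) ∞ P (Set.univ ×ˢ Set.Ico 0 s₀))
    (hbdry : IsCombFirstFourEigenfunctions (fun y => P (y, 0)))
    (h : IsCMCGraph m (fun x => P (direction x, ‖x‖⁻¹)) {x | s₀⁻¹ < ‖x‖}) :
    ∃ (c : ℝ) (ξ : E 3) (D : E 3 → ℝ) (R : ℝ), s₀⁻¹ ≤ R ∧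
      IsComparison m (fun x => P (direction x, ‖x‖⁻¹)) {x | R < ‖x‖} ξ c D ∧
      IsSymbol {x | R < ‖x‖} 3 D := by
  obtain ⟨c, ξ, G, F, R₁, hR₁, hG, hGe, hF, hFe, hF0, hPGF⟩ := exists_difference hs₀ hP hbdry
  have hR : 1 ≤ max R₁ s₀⁻¹ := hR₁.trans (le_max_left _ _)
  have hU := isExterior_norm_gt hR
  have hPU : ∀ x ∈ {x : E 3 | max R₁ s₀⁻¹ < ‖x‖}, R₁ < ‖x‖ := fun x hx =>
    (le_max_left _ _).trans_lt hx
  have hQ : IsSymbol {x : E 3 | max R₁ s₀⁻¹ < ‖x‖} 0 (fun x => P (direction x, ‖x‖⁻¹)) :=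
    isSymbol_of_smooth hU hG fun x hx => (hPGF x (hPU x hx)).1
  obtain ⟨G₂, hG₂, -, eG⟩ := exists_expansion hG hGe
  -- the leading part of `Q` is homogeneous of degree zero, hence has no radial derivative
  have hrad : IsSymbol {x : E 3 | max R₁ s₀⁻¹ < ‖x‖} 2
      (radialD (fun x => P (direction x, ‖x‖⁻¹))) := by
    have hl := isSymbol_leading hU hG
    have hr : IsSymbol {x : E 3 | max R₁ s₀⁻¹ < ‖x‖} 1
        (fun x => ‖x‖⁻¹ * G₂ (‖x‖⁻¹ • x, √(‖x‖⁻¹))) := by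
      simpa using (isSymbol_inv_norm hU).mul (isSymbol_of_smooth hU hG₂ fun x _ => rfl) hU
    refine (hr.radialD hU).congr hU fun x hx => ?_
    have e1 : radialD (fun x => P (direction x, ‖x‖⁻¹)) x =
        radialD (fun x => leading G x + ‖x‖⁻¹ * G₂ (‖x‖⁻¹ • x, √(‖x‖⁻¹))) x :=
      radialD_congr hU.1 (fun y hy => by
        rw [(hPGF y (hPU y hy)).1, eG y (hU.ne_zero hy)]) hx
    have e2 : radialD (leading G) x = 0 := by
      have := radialD_homogeneous (hU.ne_zero hx) (hl.differentiableAt hU hx)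
        (fun c hc y => leading_smul G hc y) 0
      simpa using this
    rw [e1, radialD_add (hl.differentiableAt hU hx) (hr.differentiableAt hU hx), e2, zero_add]
  have hc : IsComparison m (fun x => P (direction x, ‖x‖⁻¹)) {x : E 3 | max R₁ s₀⁻¹ < ‖x‖} ξ c
      (fun x => F (‖x‖⁻¹ • x, √(‖x‖⁻¹))) :=
    { h.mono hU.1 fun x hx => lt_of_le_of_lt (le_max_right R₁ s₀⁻¹) hx with
      exterior := hU
      eq := fun x hx => (hPGF x (hPU x hx)).2
      symbol := hQ
      radial := hrad }
  exact ⟨c, ξ, _, _, le_max_right _ _, hc, hc.isSymbol_three hR hF hFe hF0 fun _ _ => rfl⟩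

end Surface

/-! ### Asymptotics in polar coordinates -/

theorem exp_le_sinh {ρ : ℝ} (hρ : 1 ≤ ρ) : Real.exp ρ / 4 ≤ Real.sinh ρ := by
  have h1 : Real.exp (-ρ) ≤ 1 := Real.exp_le_one_iff.2 (by linarith)
  have h2 := Real.add_one_le_exp ρ
  rw [Real.sinh_eq]
  linarith

section Frame

variable {p : S2} {R : ℝ} {f : Fin 2 → S2 → E 3} {φ : E 3 → ℝ}

theorem sinhMap_mem_coneOver (hR : 1 ≤ R) {z : E 3} (hz : z ∈ coneOver p R) :
    sinhMap z ∈ coneOver p R := by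
  have hz0 := (isExterior_coneOver hR).ne_zero hz
  refine ⟨?_, ?_⟩
  · change R < _
    rw [norm_sinhMap]
    exact lt_of_lt_of_le hz.1 (Real.self_le_sinh_iff.2 (norm_nonneg z))
  · rw [mem_preimage, direction_sinhMap hz0]
    exact hz.2

/-- A symbol of order `-2` decays like `exp (-2 ρ)` in polar coordinates. -/
theorem IsSymbol.exists_exp_bound (hφ : IsSymbol (coneOver p R) 2 φ) (hR : 1 ≤ R) :
    ∃ C, ∀ z ∈ coneOver p R, |φ (sinhMap z)| ≤ C * Real.exp (-2 * ‖z‖) := by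
  obtain ⟨C, hC, hb⟩ := hφ.bound (isExterior_coneOver hR)
  refine ⟨C * 16, fun z hz => (hb _ (sinhMap_mem_coneOver hR hz)).trans ?_⟩
  rw [norm_sinhMap, mul_assoc]
  refine mul_le_mul_of_nonneg_left ?_ hC.le
  have h1 := exp_le_sinh (hR.trans (le_of_lt hz.1))
  have h2 : 0 < Real.exp ‖z‖ := Real.exp_pos _
  have h3 : Real.exp (-2 * ‖z‖) = (Real.exp ‖z‖ ^ 2)⁻¹ := by
    rw [← Real.exp_nat_mul, ← Real.exp_neg]
    congr 1
    push_cast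
    ring
  have h4 : (Real.exp ‖z‖ / 4) ^ 2 ≤ Real.sinh ‖z‖ ^ 2 := by gcongr
  rw [h3, zpow_neg, show (16 : ℝ) * (Real.exp ‖z‖ ^ 2)⁻¹ = ((Real.exp ‖z‖ / 4) ^ 2)⁻¹ by
    field_simp; norm_num]
  exact inv_anti₀ (by positivity) (by exact_mod_cast h4)

theorem alongField_add_const (X : E 3 → E 3) (φ : E 3 → ℝ) (c : ℝ) (z : E 3) :
    alongField X (fun w => φ w + c) z = alongField X φ z := by
  rw [alongField, alongField, fderiv_add_const]

/-- A function which in polar coordinates is a constant plus a symbol of order `-2` has frame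
derivatives of order `exp (-2 ρ)`. -/
theorem IsSymbol.exists_frame_bound (hf : IsOrthonormalFrameOn f (geodesicBall p 2))
    (hφ : IsSymbol (coneOver p R) 2 φ) (hR : 1 ≤ R) {g : E 3 → ℝ} {c : ℝ}
    (hg : ∀ z ∈ coneOver p R, g z = φ (sinhMap z) + c) (k l : Fin 3) :
    ∃ C, ∀ z ∈ coneOver p R, |g z - c| ≤ C * Real.exp (-2 * ‖z‖) ∧
      |alongField (hyperbolicFrame f k) g z| ≤ C * Real.exp (-2 * ‖z‖) ∧
      |alongField (hyperbolicFrame f k) (alongField (hyperbolicFrame f l) g) z| ≤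
        C * Real.exp (-2 * ‖z‖) := by
  have hV := isExterior_coneOver (p := p) hR
  have key : ∀ (k : Fin 3) {ψ g : E 3 → ℝ} {c : ℝ}, IsSymbol (coneOver p R) 2 ψ →
      (∀ z ∈ coneOver p R, g z = ψ (sinhMap z) + c) → ∀ z ∈ coneOver p R,
        alongField (hyperbolicFrame f k) g z =
          alongField (spatialFrame f k) ψ (sinhMap z) + 0 := by
    intro k ψ g c hψ hg z hz
    rw [alongField_congr hV.1 hg _ hz, alongField_add_const, add_zero,
      alongField_comp_sinhMap hf (hV.ne_zero hz) (geodesicBall_subset p hz.2) k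
        (hψ.differentiableAt hV (sinhMap_mem_coneOver hR hz))]
  have φ₁ := hφ.alongField_spatialFrame hf hR k
  have φ₂ := (hφ.alongField_spatialFrame hf hR l).alongField_spatialFrame hf hR k
  have h₁ := key k hφ hg
  have h₂ := key k (hφ.alongField_spatialFrame hf hR l) (key l hφ hg)
  obtain ⟨C₀, b₀⟩ := hφ.exists_exp_bound hR
  obtain ⟨C₁, b₁⟩ := φ₁.exists_exp_bound hR
  obtain ⟨C₂, b₂⟩ := φ₂.exists_exp_bound hR
  refine ⟨max C₀ (max C₁ C₂), fun z hz => ⟨?_, ?_, ?_⟩⟩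
  · rw [hg z hz, add_sub_cancel_right]
    exact (b₀ z hz).trans (mul_le_mul_of_nonneg_right (le_max_left _ _) (Real.exp_pos _).le)
  · rw [h₁ z hz, add_zero]
    exact (b₁ z hz).trans (mul_le_mul_of_nonneg_right
      ((le_max_left _ _).trans (le_max_right _ _)) (Real.exp_pos _).le)
  · rw [h₂ z hz, add_zero]
    exact (b₂ z hz).trans (mul_le_mul_of_nonneg_right
      ((le_max_right _ _).trans (le_max_right _ _)) (Real.exp_pos _).le)

end Frame

/-- The pulled back metric in the hyperbolic frame. -/
theorem pullbackForm_hyperboloidChart (G : E 3 → Matrix (Fin 3) (Fin 3) ℝ) (ξ : E 3) {R : ℝ}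
    (hR : 0 < R) {f : Fin 2 → S2 → E 3} {U : Set S2} (hf : IsOrthonormalFrameOn f U) {z : E 3}
    (hz : z ≠ 0) (hzU : direction z ∈ U) (i j : Fin 3) :
    pullbackForm G (hyperboloidChart ξ hR) z (hyperbolicFrame f i z) (hyperbolicFrame f j z) =
      frameMetric G ξ f i j (sinhMap z) := by
  have h1 : fderiv ℝ (hyperboloidChart ξ hR) z = fderiv ℝ sinhMap z :=
    fderiv_add_const ξ
  simp only [pullbackForm, h1, fderiv_sinhMap_hyperbolicFrame hf hz hzU]
  rfl

/-- The metric is asymptotic to the hyperbolic metric, with rate `τ = 2`. -/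
theorem IsComparison.exists_frame_bound {m : ℝ} {Q : E 3 → ℝ} {R₀ : ℝ} {ξ : E 3} {c : ℝ}
    {D : E 3 → ℝ} (h : IsComparison m Q {x | R₀ < ‖x‖} ξ c D) (hD : IsSymbol {x | R₀ < ‖x‖} 3 D)
    {R : ℝ} (hR0 : 0 < R) (hR : 1 ≤ R) (hR₀ : R₀ + ‖ξ‖ ≤ R) (hξ : 2 * ‖ξ‖ ≤ R)
    {p : S2} {f : Fin 2 → S2 → E 3} (hf : IsOrthonormalFrameOn f (geodesicBall p 2)) :
    ∃ C R₁ : ℝ, ∀ z : E 3, R₁ < ‖z‖ → direction z ∈ geodesicBall p 1 → ∀ i j k l : Fin 3,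
      let ε := hyperbolicFrame f
      let gij : E 3 → ℝ := fun w => pullbackForm
        (inducedMetric (schwarzschild m) (graphMap (heightOf m Q))) (hyperboloidChart ξ hR0) w
        (ε i w) (ε j w)
      |gij z - (if i = j then 1 else 0)| ≤ C * Real.exp (-2 * ‖z‖) ∧
      |alongField (ε k) gij z| ≤ C * Real.exp (-2 * ‖z‖) ∧
      |alongField (ε k) (alongField (ε l) gij) z| ≤ C * Real.exp (-2 * ‖z‖) := by
  have hV := isExterior_coneOver (p := p) hR
  have key := fun q : Fin 3 × Fin 3 × Fin 3 × Fin 3 =>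
    (h.isSymbol_frameMetric hD hf hR hR₀ hξ (fun x hx => h.toIsGraphDomain.inducedMetric_eq hx)
      q.1 q.2.1).exists_frame_bound hf hR (g := fun w => pullbackForm
        (inducedMetric (schwarzschild m) (graphMap (heightOf m Q))) (hyperboloidChart ξ hR0) w
        (hyperbolicFrame f q.1 w) (hyperbolicFrame f q.2.1 w)) (c := if q.1 = q.2.1 then 1 else 0)
      (fun z hz => by
        rw [pullbackForm_hyperboloidChart _ ξ hR0 hf (hV.ne_zero hz)
          (geodesicBall_subset p hz.2), sub_add_cancel]) q.2.2.1 q.2.2.2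
  choose C hC using key
  obtain ⟨M, hM⟩ := (Set.finite_range C).bddAbove
  refine ⟨M, R, fun z hz hzp i j k l => ?_⟩
  have hle : C (i, j, k, l) * Real.exp (-2 * ‖z‖) ≤ M * Real.exp (-2 * ‖z‖) :=
    mul_le_mul_of_nonneg_right (hM (mem_range_self _)) (Real.exp_pos _).le
  obtain ⟨h1, h2, h3⟩ := hC (i, j, k, l) z ⟨hz, hzp⟩
  exact ⟨h1.trans hle, h2.trans hle, h3.trans hle⟩

/-! ### Integrability of the scalar curvature -/

theorem IsMetricOn.continuousOn_scalarCurvature {n : ℕ} {g : E n → Matrix (Fin n) (Fin n) ℝ}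
    {O : Set (E n)} (h : IsMetricOn g O) : ContinuousOn (scalarCurvature g) O := by
  intro x hx
  have hi := (h.smooth x hx).inv (h.det x hx)
  have hΓ : ∀ k i j, ContDiffAt ℝ ∞ (christoffel g k i j) x := fun k i j => h.smooth_conn hx i k j
  have hr : ∀ i j, ContinuousAt (ricci g i j) x := fun i j =>
    (ContDiffAt.sum fun k _ => ((contDiffAt_partialD (hΓ k i j) k).sub
      (contDiffAt_partialD (hΓ k i k) j)).add (ContDiffAt.sum fun l _ =>
        ((hΓ k k l).mul (hΓ l i j)).sub ((hΓ k j l).mul (hΓ l i k)))).continuousAt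
  refine ContinuousAt.continuousWithinAt ?_
  unfold scalarCurvature
  exact tendsto_finsetSum _ fun i _ => tendsto_finsetSum _ fun j _ =>
    (hi i j).continuousAt.mul (hr i j)

/-- A continuous function which is `O(|x| ^ (-4))` on a hyperboloid is integrable with respect to
`exp ρ` times the hyperbolic volume. -/
theorem integrableOn_of_bound {S : E 3 → ℝ} {ξ : E 3} {R C : ℝ} (hR0 : 0 < R) (hR : 1 ≤ R)
    (hξ : 2 * ‖ξ‖ ≤ R) (hC : 0 < C)
    (hS : ContinuousOn (fun z => S (hyperboloidChart ξ hR0 z)) {z : E 3 | R < ‖z‖})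
    (hb : ∀ z : E 3, R < ‖z‖ →
      |S (hyperboloidChart ξ hR0 z)| ≤ C * ‖hyperboloidChart ξ hR0 z‖⁻¹ ^ 4) :
    MeasureTheory.IntegrableOn
      (fun z => S (hyperboloidChart ξ hR0 z) * Real.exp ‖z‖ * hyperbolicDensity z)
      {z | R < ‖z‖} MeasureTheory.volume := by
  have hmeas : MeasurableSet {z : E 3 | R < ‖z‖} :=
    (isOpen_lt continuous_const continuous_norm).measurableSet
  have hint : MeasureTheory.Integrable (fun z : E 3 => (1 + ‖z‖) ^ (-(4 : ℝ)))
      MeasureTheory.volume := integrable_one_add_norm (by simp; norm_num)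
  refine MeasureTheory.Integrable.mono' ((hint.const_mul (C * 256 * 24 * Real.exp 1)).integrableOn)
    ?_ ?_
  · refine ContinuousOn.aestronglyMeasurable ?_ hmeas
    refine (hS.mul (by fun_prop)).mul (ContinuousOn.pow (ContinuousOn.div ?_ (by fun_prop) ?_) 2)
    · exact (Real.continuous_sinh.comp continuous_norm).continuousOn
    · exact fun z hz => (hR0.trans hz).ne'
  · refine (MeasureTheory.ae_restrict_iff' hmeas).2 (Eventually.of_forall fun z hz => ?_)
    have hz1 : 1 ≤ ‖z‖ := hR.trans (le_of_lt hz)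
    have hs := exp_le_sinh hz1
    have he : 0 < Real.exp ‖z‖ := Real.exp_pos _
    have hs0 : 0 < Real.sinh ‖z‖ := by linarith
    have hn : Real.sinh ‖z‖ / 2 ≤ ‖hyperboloidChart ξ hR0 z‖ := by
      have h2 := norm_sub_norm_le (sinhMap z) (-ξ)
      rw [sub_neg_eq_add, norm_neg, norm_sinhMap] at h2
      have h3 := Real.self_le_sinh_iff.2 (norm_nonneg z)
      have h4 : R < ‖z‖ := hz
      change _ ≤ ‖sinhMap z + ξ‖
      linarith
    have hd : hyperbolicDensity z ≤ Real.sinh ‖z‖ ^ 2 := by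
      rw [hyperbolicDensity]
      exact pow_le_pow_left₀ (by positivity) (div_le_self hs0.le hz1) 2
    have hd0 : 0 ≤ hyperbolicDensity z := by rw [hyperbolicDensity]; positivity
    rw [norm_mul, norm_mul, Real.norm_eq_abs, Real.norm_of_nonneg he.le, Real.norm_of_nonneg hd0]
    have h5 : |S (hyperboloidChart ξ hR0 z)| ≤ C * (Real.sinh ‖z‖ / 2)⁻¹ ^ 4 :=
      (hb z hz).trans (by gcongr)
    have h6 : (1 + ‖z‖) ^ 4 / 24 ≤ Real.exp (1 + ‖z‖) := by
      simpa [Nat.factorial] using Real.pow_div_factorial_le_exp (1 + ‖z‖) (by positivity) 4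
    -- the integrand is bounded by a multiple of `exp (-ρ)`
    have h7 : C * (Real.sinh ‖z‖ / 2)⁻¹ ^ 4 * Real.exp ‖z‖ * Real.sinh ‖z‖ ^ 2 ≤
        C * 256 * (Real.exp ‖z‖)⁻¹ := by
      have e1 : C * (Real.sinh ‖z‖ / 2)⁻¹ ^ 4 * Real.exp ‖z‖ * Real.sinh ‖z‖ ^ 2 =
          C * (16 * Real.exp ‖z‖ * (Real.sinh ‖z‖)⁻¹ ^ 2) := by
        field_simp
        norm_num
      have e2 : (Real.sinh ‖z‖)⁻¹ ^ 2 ≤ (Real.exp ‖z‖ / 4)⁻¹ ^ 2 := by gcongr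
      rw [e1, mul_assoc C]
      refine mul_le_mul_of_nonneg_left ?_ hC.le
      calc 16 * Real.exp ‖z‖ * (Real.sinh ‖z‖)⁻¹ ^ 2
          ≤ 16 * Real.exp ‖z‖ * (Real.exp ‖z‖ / 4)⁻¹ ^ 2 := by gcongr
        _ = 256 * (Real.exp ‖z‖)⁻¹ := by field_simp; norm_num
    have h8 : (Real.exp ‖z‖)⁻¹ ≤ 24 * Real.exp 1 * (1 + ‖z‖) ^ (-(4 : ℝ)) := by
      rw [Real.exp_add] at h6
      rw [Real.rpow_neg (by positivity), show (4 : ℝ) = ((4 : ℕ) : ℝ) by norm_num,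
        Real.rpow_natCast, inv_le_iff_one_le_mul₀ he]
      rw [show 24 * Real.exp 1 * ((1 + ‖z‖) ^ 4)⁻¹ * Real.exp ‖z‖ =
        24 * (Real.exp 1 * Real.exp ‖z‖) / (1 + ‖z‖) ^ 4 by ring, one_le_div (by positivity)]
      linarith
    calc |S (hyperboloidChart ξ hR0 z)| * Real.exp ‖z‖ * hyperbolicDensity z
        ≤ C * (Real.sinh ‖z‖ / 2)⁻¹ ^ 4 * Real.exp ‖z‖ * Real.sinh ‖z‖ ^ 2 := by gcongr
      _ ≤ C * 256 * (Real.exp ‖z‖)⁻¹ := h7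
      _ ≤ C * 256 * (24 * Real.exp 1 * (1 + ‖z‖) ^ (-(4 : ℝ))) := by gcongr
      _ = _ := by ring

end SchwarzschildCMC

theorem theorem3p6 (m s₀ : ℝ) (hm : 0 ≤ m) (hs₀ : 0 < s₀) (hms : 2 * m * s₀ ≤ 1)
    (P : S2 × ℝ → ℝ)
    (hP : ContMDiffOn ((𝓡 2).prod 𝓘(ℝ, ℝ)) 𝓘(ℝ, ℝ) ∞ P (Set.univ ×ˢ Set.Ico 0 s₀))
    (hspacelike : ∀ x : E 3, s₀⁻¹ < ‖x‖ → (surfaceMetric m P x).PosDef)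
    (hcmc : ∀ x : E 3, s₀⁻¹ < ‖x‖ → surfaceMeanCurvature m P x = 1)
    (hbdry : IsCombFirstFourEigenfunctions (fun y => P (y, 0))) :
    IsAsymptoticallyHyperbolic {x : E 3 | s₀⁻¹ < ‖x‖} (surfaceMetric m P) := by
  have hΩ := isCMCGraph_surface hm hs₀ hms hP hspacelike hcmc
  have hg : IsMetricOn (surfaceMetric m P) {x | s₀⁻¹ < ‖x‖} :=
    hΩ.isMapInto.isMetricOn (isMetricOn_schwarzschild m) fun x hx =>
      (hspacelike x hx).det_pos.ne'.isUnit
  obtain ⟨c, ξ, D, R₀, hR₀, hc, hD⟩ := exists_isComparison hs₀ hP hbdry hΩ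
  obtain ⟨C, R₁, hC, hS⟩ := hc.exists_scalarCurvature_bound hD
  set R := max 1 (max (R₀ + ‖ξ‖) (max (R₁ + ‖ξ‖) (2 * ‖ξ‖))) with hRdef
  have hR : 1 ≤ R := le_max_left _ _
  have hR0 : 0 < R := one_pos.trans_le hR
  have hRR₀ : R₀ + ‖ξ‖ ≤ R := (le_max_left _ _).trans (le_max_right _ _)
  have hRR₁ : R₁ + ‖ξ‖ ≤ R :=
    ((le_max_left _ _).trans (le_max_right _ _)).trans (le_max_right _ _)
  have hξ : 2 * ‖ξ‖ ≤ R := ((le_max_right _ _).trans (le_max_right _ _)).trans (le_max_right _ _)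
  have htarget : ∀ x : E 3, Real.sinh R < ‖x - ξ‖ → R₀ < ‖x‖ ∧ R₁ < ‖x‖ := by
    intro x hx
    have h1 := Real.self_le_sinh_iff.2 hR0.le
    have h2 := norm_sub_le x ξ
    constructor <;> linarith
  have hsource : ∀ z : E 3, R < ‖z‖ → Real.sinh R < ‖hyperboloidChart ξ hR0 z - ξ‖ :=
    fun z hz => (hyperboloidChart ξ hR0).map_source hz
  refine ⟨fun i j x hx => (hg.smooth x hx i j).contDiffWithinAt, hspacelike, R,
    hyperboloidChart ξ hR0, hR0, rfl, fun x hx => hR₀.trans_lt (htarget x hx).1,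
    contDiffOn_hyperboloidChart ξ hR0, contDiffOn_hyperboloidChart_symm ξ hR0,
    tendsto_hyperboloidChart ξ hR0, ?_, ⟨2, by norm_num, fun p f hf =>
      hc.exists_frame_bound hD hR0 hR hRR₀ hξ hf⟩, ?_⟩
  · filter_upwards [tendsto_norm_cobounded_atTop.eventually_gt_atTop (Real.sinh R + ‖ξ‖)] with x hx
    change Real.sinh R < ‖x - ξ‖
    linarith [norm_sub_norm_le x ξ]
  · refine integrableOn_of_bound (S := fun x => scalarCurvature (surfaceMetric m P) x + 6) hR0 hR hξ
      hC ?_ fun z hz => hS _ (htarget _ (hsource z hz)).1 (htarget _ (hsource z hz)).2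
    refine (ContinuousOn.comp hg.continuousOn_scalarCurvature
      (contDiffOn_hyperboloidChart ξ hR0).continuousOn fun z hz => ?_).add continuousOn_const
    exact hR₀.trans_lt (htarget _ (hsource z hz)).1
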